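/- **Theorem (The Index Formula).** Let $M$ be a smooth $3$-dimensional Riemannian manifold, let $r\ge 1$, and let $(U,X,Y)$ be a $C^r$-prepared triple. This means the following. * $U\subset M$ is a relatively compact open set, $X,Y$ are commuting vector fields of class $C^r$ on $M$, $Y$ has no zero in $U$ and $X$ has no zero on $\partial U$. Write $X=N+\mu Y$ with $N\perp Y$ ($N$ is the normal component, $\mu$ the quotient function), and $K_c=\{p\in\overline U: X(p)=cY(p)\}$. * There are $\varepsilon>0$, a compact connected surface $S$, possibly with boundary, and a $C^r$-diffeomorphism $S\times[-\varepsilon,\varepsilon]\to\overline U$ sending each $S\times\{c\}$ into the level set $\mu=c$. We write points of $\overline U$ as $(x,c)$. * $Y$ is nowhere orthogonal to the level sets of $\mu$ in $\overline U$ (in particular $Y\neq0$ on $\overline U$). * $0$ is a continuity point of $c\mapsto K_c$ in the Hausdorff topology. * $K_c\cap(\partial S\times\{c\})=\emptyset$ for all $c\in[-\varepsilon,\varepsilon]$. Assume that $Y$ is transversally oriented, that is, the plane field $Y^\perp$ is continuously oriented over $\overline U$. Orient $\overline U$ so that $(u,v,Y)$ is positive whenever $(u,v)$ is a positive basis of $Y^\perp$,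 and orient $S\simeq S\times\{0\}$ so that a basis $(u,v)$ of its tangent plane is positive iff $(u,v,w)$ is positive for the vectors $w$ with $d\mu(w)>0$. Orient $\partial S$ as the boundary of $S$ (outward vector first). Then there are continuous vector fields $e_1,e_2$ on $\overline U$ such that $e_2$ is nowhere zero, tangent to the level sets of $\mu$ and orthogonal to $Y$, and $e_1=e_2\wedge Y$ (cross product). For any such $e_1,e_2$ write $N=\alpha_1e_1+\alpha_2e_2$ and, for each boundary component $\gamma$ of $S\simeq S\times\{0\}$, let the linking number $l(\gamma)\in\mathbb Z$ be the topological degree of $$\gamma\to\mathbf S^1,\qquad \mathbf x\mapsto\frac{(\alpha_1(\mathbf x),\alpha_2(\mathbf x))}{\sqrt{\alpha_1(\mathbf x)^2+\alpha_2(\mathbf x)^2}} .$$ Then $$\mathrm{Ind}(X,U)=\sum_\gamma l(\gamma),$$ the sum being over all boundary components $\gamma$ of $S$. In particular $\mathrm{Ind}(X,U)=0$ if $S$ has no boundary. Here $\mathrm{Ind}(X,U)$ is the Poincaré–Hopf index: the sum $\sum_{x\in\mathrm{Zero}(X')\cap U}\mathrm{Ind}(X',x)$ for any $C^1$ vector field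 $X'$ sufficiently $C^0$-close to $X$ on $\overline U$ with finitely many zeros in $U$, where $\mathrm{Ind}(X',x)$ is the degree of the Gauss map $X'/\|X'\|$ on the boundary of a small ball around $x$ in local coordinates. -/

import Mathlib

open Set Filter Topology Manifold Bundle
open scoped ContDiff

noncomputable section

/-! ### Topological degree -/

/-- The unit sphere of `ℝᵈ`. -/
abbrev UnitSphere (d : ℕ) : Type := Metric.sphere (0 : EuclideanSpace ℝ (Fin d)) 1

/-- `n` is the topological degree of the continuous self-map `f` of the unit sphere of `ℝᵈ`:
`f` is homotopic to a `C¹` map `g` having a regular value `q` with `n` preimages counted with sign.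

The map `g` is handled through its homogeneous extension `G (t u) = t g(u)` to `ℝᵈ`, which is `C¹`
away from the origin exactly when `g` is `C¹`. At a unit vector `u` the linear map `DG(u)` sends `u`
to `g u` and restricts on `u^⊥` to the differential of `g`; hence `u` is a regular point of `g` iff
`det DG(u) ≠ 0`, and the sign of `det DG(u)` tells whether `g` preserves at `u` the standard
orientation of the sphere. -/
def HasSphereDegree {d : ℕ} (f : C(UnitSphere d, UnitSphere d)) (n : ℤ) : Prop :=
  ∃ (g : C(UnitSphere d, UnitSphere d))
    (G : EuclideanSpace ℝ (Fin d) → EuclideanSpace ℝ (Fin d)) (q : UnitSphere d),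
    f.Homotopic g ∧
    (∀ (u : UnitSphere d) (t : ℝ), 0 < t →
      G (t • (u : EuclideanSpace ℝ (Fin d))) = t • (g u : EuclideanSpace ℝ (Fin d))) ∧
    ContDiffOn ℝ 1 G {0}ᶜ ∧
    (∀ u : UnitSphere d, g u = q → (fderiv ℝ G u).det ≠ 0) ∧
    ∃ hfin : (g ⁻¹' {q}).Finite,
      ∑ u ∈ hfin.toFinset, ((SignType.sign (fderiv ℝ G u).det : SignType) : ℤ) = n

/-- `n` is the degree of the map `ℝ / ℤ → S¹ ⊆ ℂ` induced by the `1`-periodic function `f`: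
`f` has a continuous determination of the angle which increases by `2 π n` over a period. -/
def HasCircleDegree (f : ℝ → ℂ) (n : ℤ) : Prop :=
  ∃ θ : ℝ → ℝ, Continuous θ ∧ (∀ t, f t = Complex.exp ((θ t : ℂ) * Complex.I)) ∧
    ∀ t, θ (t + 1) = θ t + 2 * Real.pi * n

/-! ### The Poincaré-Hopf index -/

section Index

variable {d : ℕ} {M : Type*} [TopologicalSpace M] [ChartedSpace (EuclideanSpace ℝ (Fin d)) M]

/-- A vector field of class `C^r` on `M`. -/
def IsVectorFieldOfClass (r : ℕ∞) (X : ∀ p : M, TangentSpace (𝓡 d) p)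
    [IsManifold (𝓡 d) 1 M] : Prop :=
  ContMDiff (𝓡 d) (𝓡 d).tangent r (fun p => (⟨p, X p⟩ : TangentBundle (𝓡 d) M))

/-- The expression of the vector field `X` in the chart around `p`. -/
def coordField (X : ∀ p : M, TangentSpace (𝓡 d) p) (p : M) (y : EuclideanSpace ℝ (Fin d)) :
    EuclideanSpace ℝ (Fin d) :=
  mfderiv (𝓡 d) 𝓘(ℝ, EuclideanSpace ℝ (Fin d)) (extChartAt (𝓡 d) p)
    ((extChartAt (𝓡 d) p).symm y) (X ((extChartAt (𝓡 d) p).symm y))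

/-- `n` is the Poincaré-Hopf index of `X` at its isolated zero `p`: the degree of the Gauss map
`X / ‖X‖` on the boundary of a ball, in coordinates centred at `p`, whose closure contains no
other zero. -/
def HasIndexAt (X : ∀ p : M, TangentSpace (𝓡 d) p) (p : M) (n : ℤ) : Prop :=
  ∃ ρ : ℝ, 0 < ρ ∧
    Metric.closedBall (extChartAt (𝓡 d) p p) ρ ⊆ (extChartAt (𝓡 d) p).target ∧
    (∀ y ∈ Metric.closedBall (extChartAt (𝓡 d) p p) ρ,
      X ((extChartAt (𝓡 d) p).symm y) = 0 ↔ y = extChartAt (𝓡 d) p p) ∧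
    ∃ f : C(UnitSphere d, UnitSphere d),
      (∀ u : UnitSphere d, (f u : EuclideanSpace ℝ (Fin d)) =
        ‖coordField X p (extChartAt (𝓡 d) p p + ρ • (u : EuclideanSpace ℝ (Fin d)))‖⁻¹ •
          coordField X p (extChartAt (𝓡 d) p p + ρ • (u : EuclideanSpace ℝ (Fin d)))) ∧
      HasSphereDegree f n

variable [IsManifold (𝓡 d) 1 M] [RiemannianBundle (fun p : M => TangentSpace (𝓡 d) p)]

/-- `X'` is a `C¹` vector field at `C⁰`-distance less than `δ` from `X` on the closure of `U`, with
finitely many zeros inside `U`. -/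
structure IsIndexPerturbation (X : ∀ p : M, TangentSpace (𝓡 d) p) (U : Set M) (δ : ℝ)
    (X' : ∀ p : M, TangentSpace (𝓡 d) p) : Prop where
  contMDiff : IsVectorFieldOfClass 1 X'
  close : ∀ p ∈ closure U, ‖X' p - X p‖ < δ
  finite_zeros : {p ∈ U | X' p = 0}.Finite

/-- `n` is the Poincaré-Hopf index `Ind(X, U)` of a vector field `X` without zeros on the boundary
of the relatively compact open set `U`: the sum of the indices at its zeros in `U` of every vector
field which is `C⁰`-close enough to `X` and has finitely many zeros in `U`. Such vector fields are
required to exist arbitrarily close to `X`. -/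
def IsPoincareHopfIndex (X : ∀ p : M, TangentSpace (𝓡 d) p) (U : Set M) (n : ℤ) : Prop :=
  (∃ δ > 0, ∀ X' : ∀ p : M, TangentSpace (𝓡 d) p, ∀ h : IsIndexPerturbation X U δ X',
    ∃ ind : M → ℤ, (∀ p ∈ U, X' p = 0 → HasIndexAt X' p (ind p)) ∧
      ∑ p ∈ h.finite_zeros.toFinset, ind p = n) ∧
  ∀ δ > 0, ∃ X' : ∀ p : M, TangentSpace (𝓡 d) p, IsIndexPerturbation X U δ X'

end Index

/-! ### Prepared triples -/

section Triples

variable {M : Type*} [TopologicalSpace M] [ChartedSpace (EuclideanSpace ℝ (Fin 3)) M]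
  [IsManifold (𝓡 3) ∞ M] [RiemannianBundle (fun p : M => TangentSpace (𝓡 3) p)]

/-- `(U, X, Y)` is a triple of class `C^r`. -/
structure IsTriple (r : ℕ∞) (U : Set M) (X Y : ∀ p : M, TangentSpace (𝓡 3) p) : Prop where
  isOpen : IsOpen U
  isCompact_closure : IsCompact (closure U)
  contMDiff_left : IsVectorFieldOfClass r X
  contMDiff_right : IsVectorFieldOfClass r Y
  commute : ∀ p, VectorField.mlieBracket (𝓡 3) X Y p = 0
  right_ne_zero : ∀ p ∈ U, Y p ≠ 0
  left_ne_zero : ∀ p ∈ frontier U, X p ≠ 0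

/-- The quotient function `μ` of `X`: the component of `X` along `Y`, in the orthogonal
decomposition `X = N + μ Y`. -/
def quotientFunction (X Y : ∀ p : M, TangentSpace (𝓡 3) p) (p : M) : ℝ :=
  inner ℝ (X p) (Y p) / inner ℝ (Y p) (Y p)

/-- The normal component `N = X - μ Y` of `X`. -/
def normalComponent (X Y : ∀ p : M, TangentSpace (𝓡 3) p) (p : M) : TangentSpace (𝓡 3) p :=
  X p - quotientFunction X Y p • Y p

/-- The differential at `p` of the quotient function. Its kernel is the tangent space at `p` to the
level set of `μ` through `p`. -/
def dQuotient (X Y : ∀ p : M, TangentSpace (𝓡 3) p) (p : M) (v : TangentSpace (𝓡 3) p) : ℝ :=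
  mfderiv (𝓡 3) 𝓘(ℝ, ℝ) (quotientFunction X Y) p v

/-- `K_c`, the set of zeros of `X - c Y` in the closure of `U`. -/
def collinearitySet (U : Set M) (X Y : ∀ p : M, TangentSpace (𝓡 3) p) (c : ℝ) : Set M :=
  {p ∈ closure U | X p - c • Y p = 0}

variable {S : Type*} [TopologicalSpace S] [ChartedSpace (EuclideanHalfSpace 2) S]

/-- `(U, X, Y)` is a prepared triple of class `C^r`, with trivialisation
`Φ : S × [-ε, ε] → closure U` of the foliation by level sets of the quotient function. -/
structure IsPreparedTriple (r : ℕ∞) (U : Set M) (X Y : ∀ p : M, TangentSpace (𝓡 3) p)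
    (ε : ℝ) (Φ : S × ℝ → M) : Prop extends IsTriple r U X Y where
  eps_pos : 0 < ε
  /-- `Φ` is a diffeomorphism of class `C^r` of `S × [-ε, ε]` onto the closure of `U`. -/
  contMDiffOn : ContMDiffOn ((𝓡∂ 2).prod 𝓘(ℝ, ℝ)) (𝓡 3) r Φ (univ ×ˢ Icc (-ε) ε)
  injOn : InjOn Φ (univ ×ˢ Icc (-ε) ε)
  injective_mfderiv : ∀ z ∈ (univ : Set S) ×ˢ Icc (-ε) ε, Function.Injective
    (mfderivWithin ((𝓡∂ 2).prod 𝓘(ℝ, ℝ)) (𝓡 3) Φ (univ ×ˢ Icc (-ε) ε) z)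
  image_eq : Φ '' (univ ×ˢ Icc (-ε) ε) = closure U
  /-- `Φ (S × {c})` is the level set `μ = c`. -/
  quotientFunction_eq : ∀ x : S, ∀ c ∈ Icc (-ε) ε, quotientFunction X Y (Φ (x, c)) = c
  /-- `Y` is nowhere orthogonal to the level sets of `μ`. -/
  not_orthogonal : ∀ p ∈ closure U, ∃ v : TangentSpace (𝓡 3) p,
    dQuotient X Y p v = 0 ∧ inner ℝ (Y p) v ≠ 0
  /-- `0` is a continuity point of `c ↦ K_c` in the Hausdorff topology: for compact sets this means
  lower and upper semicontinuity. -/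
  lower : LowerHemicontinuousAt (collinearitySet U X Y) 0
  upper : UpperHemicontinuousAt (collinearitySet U X Y) 0
  /-- `K_c` is disjoint from the boundary of the level set `μ = c`. -/
  boundary_disjoint : ∀ c ∈ Icc (-ε) ε, ∀ x ∈ (𝓡∂ 2).boundary S,
    Φ (x, c) ∉ collinearitySet U X Y c

/-! ### Orientations -/

/-- `(u, v, w)` is a positively oriented basis of `T_p M`. -/
def IsPositive (o : ∀ p : M, Orientation ℝ (TangentSpace (𝓡 3) p) (Fin 3)) (p : M)
    (u v w : TangentSpace (𝓡 3) p) : Prop :=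
  ∃ b : Module.Basis (Fin 3) ℝ (TangentSpace (𝓡 3) p), ⇑b = ![u, v, w] ∧ b.orientation = o p

/-- `o` is a continuous orientation of the tangent spaces of `M` at the points of `A`: locally, it
is given by a continuous frame. -/
def IsContinuousOrientationOn (o : ∀ p : M, Orientation ℝ (TangentSpace (𝓡 3) p) (Fin 3))
    (A : Set M) : Prop :=
  ∀ p₀ ∈ A, ∃ V ∈ 𝓝[A] p₀, ∃ e : Fin 3 → ∀ p : M, TangentSpace (𝓡 3) p,
    (∀ i, ContinuousOn (fun p => (⟨p, e i p⟩ : TangentBundle (𝓡 3) M)) V) ∧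
    ∀ p ∈ V, IsPositive o p (e 0 p) (e 1 p) (e 2 p)

/-- A transverse orientation of the non-vanishing vector field `Y` over `A`, i.e. a continuous
orientation of the plane field `Y^⊥`, given as the continuous orientation `o` of `TM` over `A` for
which a basis `(u, v)` of `Y^⊥` is positive iff `(u, v, Y)` is `o`-positive. -/
structure IsTransverseOrientation (o : ∀ p : M, Orientation ℝ (TangentSpace (𝓡 3) p) (Fin 3))
    (Y : ∀ p : M, TangentSpace (𝓡 3) p) (A : Set M) : Prop where
  ne_zero : ∀ p ∈ A, Y p ≠ 0
  continuousOn : IsContinuousOrientationOn o A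

/-- `(u, v)` is a positive basis of the tangent plane of the level set of `μ` through `p`, this
plane being oriented in such a way that `(u, v, w)` is `o`-positive whenever `dμ(w) > 0`. -/
def IsLevelPositive (o : ∀ p : M, Orientation ℝ (TangentSpace (𝓡 3) p) (Fin 3))
    (X Y : ∀ p : M, TangentSpace (𝓡 3) p) (p : M) (u v : TangentSpace (𝓡 3) p) : Prop :=
  dQuotient X Y p u = 0 ∧ dQuotient X Y p v = 0 ∧
    ∀ w : TangentSpace (𝓡 3) p, 0 < dQuotient X Y p w → IsPositive o p u v w

/-- `n` is a tangent vector of `S` at a boundary point `x` which points outwards. Vectors of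
`T_x S` are given by their coordinates in the chart at `x`, which maps `S` to the half space of
points with first coordinate `≥ 0`. -/
def IsOutward (x : S) (n : TangentSpace (𝓡∂ 2) x) : Prop :=
  (show EuclideanSpace ℝ (Fin 2) from n) 0 < 0

/-- `γ 0, …, γ (k - 1)` are parametrisations of class `C¹`, of period `1`, of the boundary
components of `S ≃ S × {0}`, with the boundary orientation: (outward vector, velocity) is a
positive basis of the tangent plane of the level set. -/
structure IsBoundaryParametrization (o : ∀ p : M, Orientation ℝ (TangentSpace (𝓡 3) p) (Fin 3))
    (X Y : ∀ p : M, TangentSpace (𝓡 3) p) (Φ : S × ℝ → M) {k : ℕ} (γ : Fin k → ℝ → S) : Prop where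
  contMDiff : ∀ i, ContMDiff 𝓘(ℝ, ℝ) (𝓡∂ 2) 1 (γ i)
  velocity_ne_zero : ∀ i t, mfderiv 𝓘(ℝ, ℝ) (𝓡∂ 2) (γ i) t (1 : ℝ) ≠ 0
  periodic : ∀ i, Function.Periodic (γ i) 1
  injOn : ∀ i, InjOn (γ i) (Ico 0 1)
  disjoint : Pairwise fun i j => Disjoint (range (γ i)) (range (γ j))
  iUnion_range : ⋃ i, range (γ i) = (𝓡∂ 2).boundary S
  positive : ∀ i t, ∀ n : TangentSpace (𝓡∂ 2) (γ i t), IsOutward (γ i t) n →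
    IsLevelPositive o X Y (Φ (γ i t, 0))
      (mfderiv (𝓡∂ 2) (𝓡 3) (fun x => Φ (x, 0)) (γ i t) n)
      (mfderiv (𝓡∂ 2) (𝓡 3) (fun x => Φ (x, 0)) (γ i t)
        (mfderiv 𝓘(ℝ, ℝ) (𝓡∂ 2) (γ i) t (1 : ℝ)))

/-! ### Linking numbers -/

/-- `(e₁, e₂, Y)` is a continuous frame over the closure of `U` such that `e₂` is tangent to the
level sets of `μ` and orthogonal to `Y`, and `e₁` is the cross product `e₂ ∧ Y`. -/
structure IsAdaptedFrame (o : ∀ p : M, Orientation ℝ (TangentSpace (𝓡 3) p) (Fin 3)) (U : Set M)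
    (X Y e₁ e₂ : ∀ p : M, TangentSpace (𝓡 3) p) : Prop where
  continuousOn_fst : ContinuousOn (fun p => (⟨p, e₁ p⟩ : TangentBundle (𝓡 3) M)) (closure U)
  continuousOn_snd : ContinuousOn (fun p => (⟨p, e₂ p⟩ : TangentBundle (𝓡 3) M)) (closure U)
  tangent_snd : ∀ p ∈ closure U, dQuotient X Y p (e₂ p) = 0
  inner_snd : ∀ p ∈ closure U, inner ℝ (e₂ p) (Y p) = 0
  inner_fst_snd : ∀ p ∈ closure U, inner ℝ (e₁ p) (e₂ p) = 0
  inner_fst : ∀ p ∈ closure U, inner ℝ (e₁ p) (Y p) = 0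
  norm_fst : ∀ p ∈ closure U, ‖e₁ p‖ = ‖e₂ p‖ * ‖Y p‖
  positive : ∀ p ∈ closure U, IsPositive o p (e₁ p) (e₂ p) (Y p)

/-- The Gauss map of the normal component: `N = α₁ e₁ + α₂ e₂` is sent to
`(α₁, α₂) / √(α₁² + α₂²)`, seen as a complex number. Here `(e₁, e₂)` is an orthogonal frame
of `Y^⊥`. -/
def normalGaussMap (X Y e₁ e₂ : ∀ p : M, TangentSpace (𝓡 3) p) (p : M) : ℂ :=
  let α₁ : ℝ := inner ℝ (normalComponent X Y p) (e₁ p) / inner ℝ (e₁ p) (e₁ p)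
  let α₂ : ℝ := inner ℝ (normalComponent X Y p) (e₂ p) / inner ℝ (e₂ p) (e₂ p)
  ⟨α₁ / Real.sqrt (α₁ ^ 2 + α₂ ^ 2), α₂ / Real.sqrt (α₁ ^ 2 + α₂ ^ 2)⟩

/-- `l` is the linking number of the normal component along the closed curve `γ` of
`S ≃ S × {0}`. -/
def IsLinkingNumber (X Y e₁ e₂ : ∀ p : M, TangentSpace (𝓡 3) p) (Φ : S × ℝ → M) (γ : ℝ → S)
    (l : ℤ) : Prop :=
  HasCircleDegree (fun t => normalGaussMap X Y e₁ e₂ (Φ (γ t, 0))) l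

end Triples

end

/-! The index is read off as a signed number of points in a fibre. Over the closure of `U` the
tangent bundle is trivialised by `frameCoord`, which sends `v` to `(⟨v, E₁⟩, ⟨v, E₂⟩, ⟨v, Y⟩ / ⟨Y,
Y⟩)`. Here `E₁`, `E₂` are global `C¹` fields approximating `eᵢ / ‖eᵢ‖²`, since the adapted frame
itself is only continuous. In these coordinates `X` becomes a `C¹` map `F` to `ℝ³` without zeros on
the frontier of `U`. Its first two components are close to `α₁`, `α₂`, and its third component is
exactly `μ`.

On the one hand, the signed number of points of `U` over a suitable generic small value of `F` is
the index (`isPoincareHopfIndex_of_degCount`). This is degree theory: the count is invariant under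
homotopies that stay away from zero off a compact set (`ae_degCount_eq`), so it is the same for `X`
and for a perturbation `X'`; near an isolated zero of `X'` it is the degree of the Gauss map
(`exists_forall_ae_hasIndexAt`, resting on `exists_forall_ae_hasSphereDegree`).

On the other hand, since the third component of `F` is `μ`, the fibre over `(a, c)` lies in the
single level surface `S × {c}`. The differential is block triangular there, so the points count with
the same signs for the planar map `(F₁, F₂)` on that surface (`degCount_sheet`). For a map from a
compact oriented surface to the plane an argument principle holds: `2π` times the signed count over
`a` is the boundary integral of the angular form around `a` (`ae_degCount_eq_boundaryWinding`).
Along the boundary the normal component does not vanish, so for small `a` and `c` the planar map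
stays at an acute angle with `(α₁, α₂)`, and each boundary integral is `2π` times a linking number
(`exists_isLinkingNumber`).

Both invariance statements are obtained for `C¹` maps by integration. A map is deformed in one chart
at a time by bump functions. Change of variables turns a signed count into an integral of `η(V) det
DV` (`exists_setIntegral_comp_mul_det_eq`), whose integrand is exact. Hence in dimension three a
compactly supported modification does not change it (`sum_sign_det_eq_of_eqOn_compl`, from
`integral_jac3`), and in the half plane it changes by a boundary term
(`sum_sign_det_sub_eq_boundary`, from `integral_halfPlane`). Regular values come from Sard's theorem
in equal dimensions (`ae_regular`), so the statements hold for almost every value; Fubini reconciles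
generic points of `ℝ³` with generic points of horizontal planes (`exists_small_of_ae_joinEquiv`).
Orientations are carried by functions recording at each point the sign of its preferred chart. -/

noncomputable section

open MeasureTheory

/-! ### The Jacobian in dimension three as a null Lagrangian. -/

/-- The standard basis vectors of `ℝᵈ`. -/
abbrev stdVec {d : ℕ} (i : Fin d) : EuclideanSpace ℝ (Fin d) := EuclideanSpace.single i 1

theorem clm_det_eq_matrix_det {d : ℕ}
    (A : EuclideanSpace ℝ (Fin d) →L[ℝ] EuclideanSpace ℝ (Fin d)) :
    A.det = (Matrix.of fun i j => A (stdVec j) i).det := by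
  rw [ContinuousLinearMap.det, ← LinearMap.det_toMatrix (EuclideanSpace.basisFun (Fin d) ℝ).toBasis]
  rfl

/-- Mollification by shrinking bumps. The gradients converge pointwise because `fderiv ℝ v` is
continuous, and they stay bounded. This is what dominated convergence needs in order to pass from
smooth to `C¹` functions, for which second derivatives are not available. -/
theorem exists_smooth_approx {E : Type*} [NormedAddCommGroup E] [NormedSpace ℝ E]
    [FiniteDimensional ℝ E] {v : E → ℝ} (hv : ContDiff ℝ 1 v) (hc : HasCompactSupport v) :
    ∃ w : ℕ → E → ℝ, (∀ n, ContDiff ℝ ∞ (w n)) ∧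
      (∀ x, Tendsto (fun n => fderiv ℝ (w n) x) atTop (𝓝 (fderiv ℝ v x))) ∧
      ∃ C, ∀ n x, ‖fderiv ℝ (w n) x‖ ≤ C := by
  let _ : MeasurableSpace E := borel E
  have : BorelSpace E := ⟨rfl⟩
  let μ : Measure E := MeasureTheory.Measure.addHaar
  let φ : ℕ → ContDiffBump (0 : E) := fun n =>
    ⟨1 / (n + 2), 1 / (n + 1), by positivity, by
      apply one_div_lt_one_div_of_lt <;> linarith [(Nat.cast_nonneg n : (0:ℝ) ≤ n)]⟩
  have hφ : Tendsto (fun n => (φ n).rOut) atTop (𝓝 0) := tendsto_one_div_add_atTop_nhds_zero_nat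
  let w : ℕ → E → ℝ := fun n => MeasureTheory.convolution ((φ n).normed μ) v (ContinuousLinearMap.lsmul ℝ ℝ) μ
  have hvl : LocallyIntegrable v μ := hv.continuous.locallyIntegrable
  have hdc : Continuous (fderiv ℝ v) := hv.continuous_fderiv (by norm_num)
  have hder : ∀ n x, fderiv ℝ (w n) x =
      MeasureTheory.convolution ((φ n).normed μ) (fderiv ℝ v) (ContinuousLinearMap.lsmul ℝ ℝ) μ x := by
    intro n x
    have := hc.hasFDerivAt_convolution_right (ContinuousLinearMap.lsmul ℝ ℝ)
      ((φ n).continuous_normed (μ := μ)).locallyIntegrable hv (x₀ := x) (μ := μ)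
    rw [this.fderiv]
    rfl
  obtain ⟨C, hC⟩ := (hc.fderiv ℝ).exists_bound_of_continuous hdc
  refine ⟨w, fun n => ?_, fun x => ?_, 3 * C, fun n x => ?_⟩
  · exact HasCompactSupport.contDiff_convolution_left _ ((φ n).hasCompactSupport_normed)
      ((φ n).contDiff_normed) hvl
  · simp_rw [hder]
    exact ContDiffBump.convolution_tendsto_right_of_continuous hφ hdc x
  · rw [hder]
    have h1 := ContDiffBump.dist_normed_convolution_le (φ := φ n) (μ := μ) (g := fderiv ℝ v) (x₀ := x)
      (ε := 2 * C) hdc.aestronglyMeasurable (fun y _ => by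
        rw [dist_eq_norm]
        calc _ ≤ ‖fderiv ℝ v y‖ + ‖fderiv ℝ v x‖ := norm_sub_le _ _
          _ ≤ 2 * C := by linarith [hC x, hC y])
    rw [dist_eq_norm] at h1
    calc _ = ‖(MeasureTheory.convolution ((φ n).normed μ) (fderiv ℝ v) (ContinuousLinearMap.lsmul ℝ ℝ) μ x
          - fderiv ℝ v x) + fderiv ℝ v x‖ := by rw [sub_add_cancel]
      _ ≤ _ := norm_add_le _ _
      _ ≤ 3 * C := by linarith [hC x]

/-- The Jacobian determinant of three functions on `ℝ³`. -/
def jac3 (p v w : EuclideanSpace ℝ (Fin 3) → ℝ) (x : EuclideanSpace ℝ (Fin 3)) : ℝ :=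
  (Matrix.of ![fun j => fderiv ℝ p x (stdVec j), fun j => fderiv ℝ v x (stdVec j),
    fun j => fderiv ℝ w x (stdVec j)]).det

theorem jac3_eq (p v w : EuclideanSpace ℝ (Fin 3) → ℝ) (x : EuclideanSpace ℝ (Fin 3)) :
    jac3 p v w x =
      fderiv ℝ p x (stdVec 0) * (fderiv ℝ v x (stdVec 1) * fderiv ℝ w x (stdVec 2) -
        fderiv ℝ v x (stdVec 2) * fderiv ℝ w x (stdVec 1)) +
      fderiv ℝ p x (stdVec 1) * (fderiv ℝ v x (stdVec 2) * fderiv ℝ w x (stdVec 0) -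
        fderiv ℝ v x (stdVec 0) * fderiv ℝ w x (stdVec 2)) +
      fderiv ℝ p x (stdVec 2) * (fderiv ℝ v x (stdVec 0) * fderiv ℝ w x (stdVec 1) -
        fderiv ℝ v x (stdVec 1) * fderiv ℝ w x (stdVec 0)) := by
  rw [jac3, Matrix.det_fin_three]
  simp
  ring

theorem fderiv_minor {v w : EuclideanSpace ℝ (Fin 3) → ℝ} (hv : ContDiff ℝ ∞ v)
    (hw : ContDiff ℝ ∞ w) (a b c x : EuclideanSpace ℝ (Fin 3)) :
    fderiv ℝ (fun y => fderiv ℝ v y a * fderiv ℝ w y b - fderiv ℝ v y b * fderiv ℝ w y a) x c =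
      fderiv ℝ (fderiv ℝ v) x c a * fderiv ℝ w x b + fderiv ℝ v x a * fderiv ℝ (fderiv ℝ w) x c b -
      (fderiv ℝ (fderiv ℝ v) x c b * fderiv ℝ w x a
        + fderiv ℝ v x b * fderiv ℝ (fderiv ℝ w) x c a) := by
  have dv : ∀ e, HasFDerivAt (fun y => fderiv ℝ v y e) ((fderiv ℝ (fderiv ℝ v) x).flip e) x := by
    intro e
    have h : DifferentiableAt ℝ (fderiv ℝ v) x :=
      ((hv.fderiv_right (m := ∞) (by simp)).differentiable (by simp)) x
    exact (h.hasFDerivAt.clm_apply (hasFDerivAt_const e x)).congr_fderiv (by ext; simp)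
  have dw : ∀ e, HasFDerivAt (fun y => fderiv ℝ w y e) ((fderiv ℝ (fderiv ℝ w) x).flip e) x := by
    intro e
    have h : DifferentiableAt ℝ (fderiv ℝ w) x :=
      ((hw.fderiv_right (m := ∞) (by simp)).differentiable (by simp)) x
    exact (h.hasFDerivAt.clm_apply (hasFDerivAt_const e x)).congr_fderiv (by ext; simp)
  have := ((dv a).mul (dw b)).sub ((dv b).mul (dw a))
  have h2 := this.fderiv
  simp only [Pi.mul_apply, Pi.sub_def] at h2
  erw [h2]
  simp
  ring

/-- Expand the determinant along the gradient of `p` and integrate by parts. The derivatives fall on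
the 2 × 2 minors of `v` and `w`, whose divergence vanishes by symmetry of second derivatives.
Compact support is needed for `p` only. -/
theorem integral_jac3_of_smooth {p v w : EuclideanSpace ℝ (Fin 3) → ℝ} (hp : ContDiff ℝ 1 p)
    (hpc : HasCompactSupport p) (hv : ContDiff ℝ ∞ v) (hw : ContDiff ℝ ∞ w) :
    ∫ x, jac3 p v w x = 0 := by
  have cv : ∀ a, Continuous fun y => fderiv ℝ v y a := fun a =>
    (hv.continuous_fderiv (by simp)).clm_apply continuous_const
  have cw : ∀ a, Continuous fun y => fderiv ℝ w y a := fun a =>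
    (hw.continuous_fderiv (by simp)).clm_apply continuous_const
  have cp : ∀ a, Continuous fun y => fderiv ℝ p y a := fun a =>
    (hp.continuous_fderiv (by simp)).clm_apply continuous_const
  have hpc' : ∀ a, HasCompactSupport fun y => fderiv ℝ p y a := fun a => by
    exact (hpc.fderiv ℝ).comp_left (g := fun A : EuclideanSpace ℝ (Fin 3) →L[ℝ] ℝ => A a) (by simp)
  have minor_smooth : ∀ a b, ContDiff ℝ ∞
      (fun y => fderiv ℝ v y a * fderiv ℝ w y b - fderiv ℝ v y b * fderiv ℝ w y a) := fun a b => by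
    have h1 : ContDiff ℝ ∞ (fderiv ℝ v) := hv.fderiv_right (by simp)
    have h2 : ContDiff ℝ ∞ (fderiv ℝ w) := hw.fderiv_right (by simp)
    fun_prop
  have key : ∀ a b c : EuclideanSpace ℝ (Fin 3),
      ∫ x, fderiv ℝ p x c * (fderiv ℝ v x a * fderiv ℝ w x b - fderiv ℝ v x b * fderiv ℝ w x a) =
      - ∫ x, p x * (fderiv ℝ (fderiv ℝ v) x c a * fderiv ℝ w x b
        + fderiv ℝ v x a * fderiv ℝ (fderiv ℝ w) x c b -
      (fderiv ℝ (fderiv ℝ v) x c b * fderiv ℝ w x a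
        + fderiv ℝ v x b * fderiv ℝ (fderiv ℝ w) x c a)) := by
    intro a b c
    have hm := minor_smooth a b
    have := integral_mul_fderiv_eq_neg_fderiv_mul_of_integrable (μ := volume) (f := p)
      (g := fun y => fderiv ℝ v y a * fderiv ℝ w y b - fderiv ℝ v y b * fderiv ℝ w y a) (v := c)
      (((cp c).mul hm.continuous).integrable_of_hasCompactSupport ((hpc' c).mul_right))
      ((hp.continuous.mul ((hm.continuous_fderiv (by simp)).clm_apply
        continuous_const)).integrable_of_hasCompactSupport hpc.mul_right)
      ((hp.continuous.mul hm.continuous).integrable_of_hasCompactSupport hpc.mul_right)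
      (fun x _ => hp.differentiable (by simp) x) (fun x _ => hm.differentiable (by simp) x)
    simp_rw [fderiv_minor hv hw] at this
    rw [this, neg_neg]
  have int1 : ∀ a b c : EuclideanSpace ℝ (Fin 3), Integrable fun x =>
      fderiv ℝ p x c * (fderiv ℝ v x a * fderiv ℝ w x b - fderiv ℝ v x b * fderiv ℝ w x a) :=
    fun a b c => ((cp c).mul (minor_smooth a b).continuous).integrable_of_hasCompactSupport
      ((hpc' c).mul_right)
  have int2 : ∀ a b c : EuclideanSpace ℝ (Fin 3), Integrable fun x =>
      p x * (fderiv ℝ (fderiv ℝ v) x c a * fderiv ℝ w x b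
        + fderiv ℝ v x a * fderiv ℝ (fderiv ℝ w) x c b -
      (fderiv ℝ (fderiv ℝ v) x c b * fderiv ℝ w x a
        + fderiv ℝ v x b * fderiv ℝ (fderiv ℝ w) x c a)) := by
    intro a b c
    have : Integrable (fun x => p x * fderiv ℝ (fun y => fderiv ℝ v y a * fderiv ℝ w y b
        - fderiv ℝ v y b * fderiv ℝ w y a) x c) :=
      (hp.continuous.mul (((minor_smooth a b).continuous_fderiv (by simp)).clm_apply
        (continuous_const (y := c)))).integrable_of_hasCompactSupport (μ := volume) hpc.mul_right
    simpa only [fderiv_minor hv hw] using this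
  simp_rw [jac3_eq]
  have three : ∀ f g h : EuclideanSpace ℝ (Fin 3) → ℝ, Integrable f → Integrable g →
      Integrable h → ∫ x, (f x + g x + h x) = (∫ x, f x) + (∫ x, g x) + ∫ x, h x := by
    intro f g h hf hg hh
    rw [integral_add (f := fun x => f x + g x) (hf.add hg) hh, integral_add hf hg]
  rw [three _ _ _ (int1 _ _ _) (int1 _ _ _) (int1 _ _ _), key, key, key, ← neg_add, ← neg_add,
    ← three _ _ _ (int2 _ _ _) (int2 _ _ _) (int2 _ _ _), neg_eq_zero]
  apply integral_eq_zero_of_ae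
  filter_upwards with x
  have sv : ∀ a b, fderiv ℝ (fderiv ℝ v) x a b = fderiv ℝ (fderiv ℝ v) x b a := fun a b =>
    ((hv.contDiffAt (x := x)).isSymmSndFDerivAt (by simp; exact ENat.LEInfty.out)) a b
  have sw : ∀ a b, fderiv ℝ (fderiv ℝ w) x a b = fderiv ℝ (fderiv ℝ w) x b a := fun a b =>
    ((hw.contDiffAt (x := x)).isSymmSndFDerivAt (by simp; exact ENat.LEInfty.out)) a b
  rw [sv (stdVec 1) (stdVec 0), sv (stdVec 2) (stdVec 0), sv (stdVec 2) (stdVec 1),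
    sw (stdVec 1) (stdVec 0), sw (stdVec 2) (stdVec 0), sw (stdVec 2) (stdVec 1)]
  simp only [Pi.zero_apply]
  ring

/-- The Jacobian is a null Lagrangian. -/
theorem integral_jac3 {p v w : EuclideanSpace ℝ (Fin 3) → ℝ} (hp : ContDiff ℝ 1 p)
    (hpc : HasCompactSupport p) (hv : ContDiff ℝ 1 v) (hvc : HasCompactSupport v)
    (hw : ContDiff ℝ 1 w) (hwc : HasCompactSupport w) :
    ∫ x, jac3 p v w x = 0 := by
  obtain ⟨V, hV, hVt, CV, hCV⟩ := exists_smooth_approx hv hvc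
  obtain ⟨W, hW, hWt, CW, hCW⟩ := exists_smooth_approx hw hwc
  have key : ∀ n, ∫ x, jac3 p (V n) (W n) x = 0 := fun n =>
    integral_jac3_of_smooth hp hpc (hV n) (hW n)
  have nrm : ∀ i : Fin 3, ‖(stdVec i : EuclideanSpace ℝ (Fin 3))‖ = 1 := fun i => by simp
  have cp : ∀ a, Continuous fun y => fderiv ℝ p y a := fun a =>
    (hp.continuous_fderiv (by simp)).clm_apply continuous_const
  have hb : ∀ (A : EuclideanSpace ℝ (Fin 3) →L[ℝ] ℝ) (C : ℝ) (i : Fin 3), ‖A‖ ≤ C →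
      |A (stdVec i)| ≤ C := fun A C i h => by
    have := A.le_opNorm (stdVec i)
    rw [nrm, mul_one] at this
    exact this.trans h
  have lim : Tendsto (fun n => ∫ x, jac3 p (V n) (W n) x) atTop (𝓝 (∫ x, jac3 p v w x)) := by
    -- The determinant has six terms, each at most `CV * CW * ‖fderiv ℝ p x‖`; the support of `p`
    -- makes the bound integrable.
    apply tendsto_integral_of_dominated_convergence
      (fun x => 6 * (CV * CW) * ‖fderiv ℝ p x‖)
    · intro n
      apply Continuous.aestronglyMeasurable
      have h1 : ∀ a, Continuous fun y => fderiv ℝ (V n) y a := fun a =>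
        ((hV n).continuous_fderiv (by simp)).clm_apply continuous_const
      have h2 : ∀ a, Continuous fun y => fderiv ℝ (W n) y a := fun a =>
        ((hW n).continuous_fderiv (by simp)).clm_apply continuous_const
      unfold jac3
      simp_rw [Matrix.det_fin_three]
      simp
      fun_prop
    · exact (((hp.continuous_fderiv (by simp)).norm.const_smul (6 * (CV * CW))).integrable_of_hasCompactSupport
        (((hpc.fderiv ℝ).norm).comp_left (g := fun t => (6 * (CV * CW)) • t) (by simp)))
    · intro n
      filter_upwards with x
      rw [jac3_eq]
      have CV0 : 0 ≤ CV := (norm_nonneg _).trans (hCV n x)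
      have CW0 : 0 ≤ CW := (norm_nonneg _).trans (hCW n x)
      have m : ∀ i j k l m : Fin 3, |fderiv ℝ p x (stdVec i) * (fderiv ℝ (V n) x (stdVec j)
          * fderiv ℝ (W n) x (stdVec k) - fderiv ℝ (V n) x (stdVec l) * fderiv ℝ (W n) x (stdVec m))|
          ≤ ‖fderiv ℝ p x‖ * (2 * (CV * CW)) := by
        intro i j k l m
        rw [abs_mul]
        apply mul_le_mul (hb _ _ _ le_rfl) _ (abs_nonneg _) (norm_nonneg _)
        have h1 : |fderiv ℝ (V n) x (stdVec j) * fderiv ℝ (W n) x (stdVec k)| ≤ CV * CW := by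
          rw [abs_mul]
          exact mul_le_mul (hb _ _ _ (hCV n x)) (hb _ _ _ (hCW n x)) (abs_nonneg _) CV0
        have h2 : |fderiv ℝ (V n) x (stdVec l) * fderiv ℝ (W n) x (stdVec m)| ≤ CV * CW := by
          rw [abs_mul]
          exact mul_le_mul (hb _ _ _ (hCV n x)) (hb _ _ _ (hCW n x)) (abs_nonneg _) CV0
        have := abs_sub (fderiv ℝ (V n) x (stdVec j) * fderiv ℝ (W n) x (stdVec k))
          (fderiv ℝ (V n) x (stdVec l) * fderiv ℝ (W n) x (stdVec m))
        linarith
      rw [Real.norm_eq_abs]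
      refine (abs_add_three _ _ _).trans ?_
      linarith [m 0 1 2 2 1, m 1 2 0 0 2, m 2 0 1 1 0]
    · filter_upwards with x
      have h1 : ∀ a, Tendsto (fun n => fderiv ℝ (V n) x a) atTop (𝓝 (fderiv ℝ v x a)) := fun a =>
        ((ContinuousLinearMap.apply ℝ ℝ a).continuous.tendsto _).comp (hVt x)
      have h2 : ∀ a, Tendsto (fun n => fderiv ℝ (W n) x a) atTop (𝓝 (fderiv ℝ w x a)) := fun a =>
        ((ContinuousLinearMap.apply ℝ ℝ a).continuous.tendsto _).comp (hWt x)
      simp_rw [jac3_eq]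
      exact ((((h1 _).mul (h2 _)).sub ((h1 _).mul (h2 _))).const_mul _).add
        ((((h1 _).mul (h2 _)).sub ((h1 _).mul (h2 _))).const_mul _) |>.add
        ((((h1 _).mul (h2 _)).sub ((h1 _).mul (h2 _))).const_mul _)
  simp_rw [key] at lim
  exact (tendsto_nhds_unique lim tendsto_const_nhds)

end

/-! ### Signed counts as integrals, and their invariance in `ℝ³`. -/

noncomputable section

open MeasureTheory

theorem eventually_ball_subset_of_mem_nhds {E : Type*} [PseudoMetricSpace E] {a : E} {s : Set E}
    (h : s ∈ 𝓝 a) : ∀ᶠ δ : ℝ in 𝓝[>] 0, Metric.ball a δ ⊆ s := by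
  obtain ⟨r, hr, hrs⟩ := Metric.mem_nhds_iff.1 h
  filter_upwards [Ioo_mem_nhdsGT hr] with δ hδ
  exact (Metric.ball_subset_ball hδ.2.le).trans hrs

section Count

variable {E : Type*} [NormedAddCommGroup E] [NormedSpace ℝ E] [FiniteDimensional ℝ E]

theorem continuous_clm_det : Continuous fun A : E →L[ℝ] E => A.det :=
  ContinuousLinearMap.continuous_det

/-- The inverse function theorem, combined with the continuity of the determinant, whose sign is
locally constant where it does not vanish. -/
theorem exists_nhds_injOn_sign_det_eq {V : E → E} {y : E} (hV : ContDiffAt ℝ 1 V y)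
    (hd : (fderiv ℝ V y).det ≠ 0) {W : Set E} (hW : W ∈ 𝓝 y) :
    ∃ N ⊆ W, IsOpen N ∧ y ∈ N ∧ InjOn V N ∧ V '' N ∈ 𝓝 (V y) ∧
      ∀ x ∈ N, DifferentiableAt ℝ V x ∧
        SignType.sign (fderiv ℝ V x).det = SignType.sign (fderiv ℝ V y).det := by
  let A : E ≃L[ℝ] E := ContinuousLinearEquiv.ofBijective (fderiv ℝ V y)
    (LinearMap.ker_eq_bot.2 (LinearMap.equivOfDetNeZero _ hd).injective)
    (LinearMap.range_eq_top.2 (LinearMap.equivOfDetNeZero _ hd).surjective)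
  have hA : (A : E →L[ℝ] E) = fderiv ℝ V y := by ext; rfl
  have hs : HasStrictFDerivAt V (A : E →L[ℝ] E) y := by
    rw [hA]; exact hV.hasStrictFDerivAt (by simp)
  let φ := hs.toOpenPartialHomeomorph V
  have hc : ContinuousAt (fun x => (fderiv ℝ V x).det) y :=
    continuous_clm_det.continuousAt.comp (hV.continuousAt_fderiv (by simp))
  have h1 : ∀ᶠ x in 𝓝 y, SignType.sign (fderiv ℝ V x).det = SignType.sign (fderiv ℝ V y).det :=
    (ContinuousAt.comp (f := fun x => (fderiv ℝ V x).det) (g := SignType.sign)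
      (continuousAt_sign_of_ne_zero hd) hc).eventually (by
      have : ({SignType.sign (fderiv ℝ V y).det} : Set SignType) ∈
        𝓝 (SignType.sign (fderiv ℝ V y).det) := by simp
      exact this)
  have h2 : ∀ᶠ x in 𝓝 y, DifferentiableAt ℝ V x := by
    filter_upwards [hV.eventually (by simp)] with x hx
    exact hx.differentiableAt (by simp)
  have h3 : φ.source ∈ 𝓝 y := φ.open_source.mem_nhds hs.mem_toOpenPartialHomeomorph_source
  obtain ⟨N, hN, hNo, hy⟩ := mem_nhds_iff.1 (inter_mem (inter_mem hW h3) (inter_mem h1 h2))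
  refine ⟨N, fun x hx => (hN hx).1.1, hNo, hy, ?_, ?_, fun x hx => ⟨(hN hx).2.2, (hN hx).2.1⟩⟩
  · exact φ.injOn.mono fun x hx => (hN hx).1.2
  · have := φ.isOpen_image_of_subset_source hNo (fun x hx => (hN hx).1.2)
    exact this.mem_nhds ⟨y, hy, rfl⟩

variable [MeasurableSpace E] [BorelSpace E] (μ : Measure E) [μ.IsAddHaarMeasure]

/-- Integration against a density concentrated near a regular value counts its preimages with
sign. -/
theorem exists_setIntegral_comp_mul_det_eq {V : E → E} {a : E} {P : Finset E} {Q : Set E}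
    (hQ : IsCompact Q) (hV : ContinuousOn V Q) (hP : ∀ y ∈ P, ContDiffAt ℝ 1 V y)
    (hPa : ∀ y ∈ P, V y = a) (hdet : ∀ y ∈ P, (fderiv ℝ V y).det ≠ 0)
    (hPQ : ∀ y ∈ P, y ∈ interior Q) (hQP : ∀ y ∈ Q, V y = a → y ∈ P) :
    ∀ᶠ δ : ℝ in 𝓝[>] 0, ∀ η : E → ℝ, Integrable η μ → (∀ z, η z ≠ 0 → z ∈ Metric.ball a δ) →
      ∫ x in Q, η (V x) * (fderiv ℝ V x).det ∂μ =
        (∑ y ∈ P, ((SignType.sign (fderiv ℝ V y).det : SignType) : ℝ)) * ∫ z, η z ∂μ := by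
  -- Around the preimages choose disjoint neighbourhoods where `V` is injective with a determinant
  -- of constant sign. The rest of `Q` is compact and its image misses `a`, so for small `δ` only
  -- these neighbourhoods contribute.
  obtain ⟨D, hD, hDd⟩ := P.finite_toSet.t2_separation
  have hloc : ∀ y, ∃ N : Set E, y ∈ P → N ⊆ interior Q ∩ D y ∧ IsOpen N ∧ y ∈ N ∧ InjOn V N ∧
      V '' N ∈ 𝓝 a ∧ ∀ x ∈ N, DifferentiableAt ℝ V x ∧
        SignType.sign (fderiv ℝ V x).det = SignType.sign (fderiv ℝ V y).det := by
    intro y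
    by_cases hy : y ∈ P
    · obtain ⟨N, hN⟩ := exists_nhds_injOn_sign_det_eq (hP y hy) (hdet y hy)
        (inter_mem (isOpen_interior.mem_nhds (hPQ y hy)) ((hD y).2.mem_nhds (hD y).1))
      rw [hPa y hy] at hN
      exact ⟨N, fun _ => hN⟩
    · exact ⟨∅, fun h => absurd h hy⟩
  choose N hN using hloc
  have hNo : IsOpen (⋃ y ∈ P, N y) := isOpen_biUnion fun y hy => (hN y hy).2.1
  have hNQ : (⋃ y ∈ P, N y) ⊆ Q := iUnion₂_subset fun y hy =>
    ((hN y hy).1.trans inter_subset_left).trans interior_subset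
  have hc : (V '' (Q \ ⋃ y ∈ P, N y))ᶜ ∈ 𝓝 a := by
    apply IsOpen.mem_nhds
    · exact ((hQ.diff hNo).image_of_continuousOn (hV.mono sdiff_subset)).isClosed.isOpen_compl
    · rintro ⟨y, ⟨hyQ, hyN⟩, hya⟩
      exact hyN (mem_biUnion (hQP y hyQ hya) (hN y (hQP y hyQ hya)).2.2.1)
  have e2 : ∀ᶠ δ : ℝ in 𝓝[>] 0, ∀ y ∈ P, Metric.ball a δ ⊆ V '' N y :=
    (Finset.eventually_all P).2 fun y hy =>
      eventually_ball_subset_of_mem_nhds (hN y hy).2.2.2.2.1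
  filter_upwards [eventually_ball_subset_of_mem_nhds hc, e2] with δ h1 h2 η hηi hη
  have s1 : ∫ x in Q, η (V x) * (fderiv ℝ V x).det ∂μ =
      ∫ x in ⋃ y ∈ P, N y, η (V x) * (fderiv ℝ V x).det ∂μ := by
    apply setIntegral_eq_of_subset_of_forall_sdiff_eq_zero hQ.isClosed.measurableSet hNQ
    intro x hx
    have : η (V x) = 0 := by
      by_contra h
      exact h1 (hη _ h) ⟨x, hx, rfl⟩
    rw [this, zero_mul]
  have s2 : ∀ y ∈ P, ∫ x in N y, η (V x) * (fderiv ℝ V x).det ∂μ =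
      ((SignType.sign (fderiv ℝ V y).det : SignType) : ℝ) * ∫ z, η z ∂μ := by
    intro y hy
    obtain ⟨-, hNo, -, hinj, -, hx⟩ := hN y hy
    have : ∫ z, η z ∂μ = ∫ z in V '' N y, η z ∂μ := by
      symm
      apply setIntegral_eq_integral_of_forall_compl_eq_zero
      intro z hz
      by_contra h
      exact hz (h2 y hy (hη z h))
    rw [this, integral_image_eq_integral_abs_det_fderiv_smul μ hNo.measurableSet
      (fun x h => (hx x h).1.hasFDerivAt.hasFDerivWithinAt) hinj, ← integral_const_mul]
    apply setIntegral_congr_fun hNo.measurableSet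
    intro x h
    -- The change of variables formula produces `|det|`; the sign, constant on `N y`, converts it
    -- into `det`.
    have := sign_mul_abs (fderiv ℝ V x).det
    rw [(hx x h).2] at this
    simp only [smul_eq_mul]
    rw [← mul_assoc, this, mul_comm]
  rw [s1, integral_biUnion_finset P (fun y hy => (hN y hy).2.1.measurableSet), Finset.sum_mul]
  · exact Finset.sum_congr rfl s2
  · intro y hy z hz hyz
    exact (hDd hy hz hyz).mono ((hN y hy).1.trans inter_subset_right)
      ((hN z hz).1.trans inter_subset_right)
  · intro y hy
    obtain ⟨-, hNo, -, hinj, -, hx⟩ := hN y hy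
    have h := (integrableOn_image_iff_integrableOn_abs_det_fderiv_smul μ hNo.measurableSet
      (fun x h => (hx x h).1.hasFDerivAt.hasFDerivWithinAt) hinj η).1 hηi.integrableOn
    refine Integrable.congr (h.const_mul ((SignType.sign (fderiv ℝ V y).det : SignType) : ℝ)) ?_
    filter_upwards [ae_restrict_mem hNo.measurableSet] with x h
    have := sign_mul_abs (fderiv ℝ V x).det
    rw [(hx x h).2] at this
    simp only [smul_eq_mul]
    rw [← mul_assoc, this, mul_comm]

end Count

/-- A product of one-dimensional bumps is a partial derivative of a `C¹` function. -/
theorem exists_bump_eq_fderiv (a : EuclideanSpace ℝ (Fin 3)) {δ : ℝ} (hδ : 0 < δ) :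
    ∃ f η : EuclideanSpace ℝ (Fin 3) → ℝ, ContDiff ℝ 1 f ∧ Integrable η ∧ ∫ z, η z ≠ 0 ∧
      (∀ z, η z ≠ 0 → z ∈ Metric.ball a δ) ∧ ∀ z, fderiv ℝ f z (stdVec 0) = η z := by
  let b : ∀ i : Fin 3, ContDiffBump (a i) := fun i => ⟨δ / 4, δ / 2, by linarith, by linarith⟩
  -- The primitive is taken in the first variable only. The resulting `f` need not have compact
  -- support: it will be cut off after composition with the map under study.
  let B : ℝ → ℝ := fun t => ∫ s in (0:ℝ)..t, b 0 s
  have hB : ∀ t, HasDerivAt B (b 0 t) t := fun t =>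
    intervalIntegral.integral_hasDerivAt_right ((b 0).continuous.intervalIntegrable _ _)
      (b 0).continuous.stronglyMeasurable.stronglyMeasurableAtFilter (b 0).continuous.continuousAt
  have hBc : ContDiff ℝ 1 B := by
    rw [contDiff_one_iff_deriv]
    refine ⟨fun t => (hB t).differentiableAt, ?_⟩
    rw [show deriv B = b 0 from funext fun t => (hB t).deriv]
    exact (b 0).continuous
  have hb : ∀ i, ContDiff ℝ 1 (b i) := fun i => (b i).contDiff
  let η : EuclideanSpace ℝ (Fin 3) → ℝ := fun z => b 0 (z 0) * b 1 (z 1) * b 2 (z 2)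
  have hηc : Continuous η := by
    have := fun i => (b i).continuous
    fun_prop
  have hη0 : ∀ z, 0 ≤ η z := fun z => mul_nonneg (mul_nonneg (b 0).nonneg (b 1).nonneg) (b 2).nonneg
  have hηs : ∀ z, η z ≠ 0 → z ∈ Metric.ball a δ := by
    intro z hz
    have hi : ∀ i, |z i - a i| < δ / 2 := by
      intro i
      by_contra h
      apply hz
      have : b i (z i) = 0 := (b i).zero_of_le_dist (by rw [Real.dist_eq]; exact not_lt.1 h)
      fin_cases i <;> simp only [η] <;> simp_all
    rw [Metric.mem_ball, dist_eq_norm, EuclideanSpace.norm_eq, Fin.sum_univ_three]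
    rw [Real.sqrt_lt' hδ]
    have h2 : ∀ i, ‖(z - a) i‖ ^ 2 ≤ (δ / 2) ^ 2 := fun i => by
      rw [Real.norm_eq_abs]
      exact pow_le_pow_left₀ (abs_nonneg _) (hi i).le 2
    nlinarith [h2 0, h2 1, h2 2]
  have hηcs : HasCompactSupport η := by
    apply HasCompactSupport.intro (isCompact_closedBall a δ)
    intro z hz
    by_contra h
    exact hz (Metric.ball_subset_closedBall (hηs z h))
  refine ⟨fun z => B (z 0) * b 1 (z 1) * b 2 (z 2), η, ?_, hηc.integrable_of_hasCompactSupport hηcs,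
    ?_, hηs, ?_⟩
  · have p : ∀ i : Fin 3, ContDiff ℝ 1 fun z : EuclideanSpace ℝ (Fin 3) => z i := fun i => by fun_prop
    exact ((hBc.comp (p 0)).mul ((hb 1).comp (p 1))).mul ((hb 2).comp (p 2))
  · apply ne_of_gt
    apply hηc.integral_pos_of_hasCompactSupport_nonneg_nonzero hηcs hη0 (x := a)
    have : ∀ i, b i (a i) = 1 := fun i => (b i).one_of_mem_closedBall
      (Metric.mem_closedBall_self (b i).rIn_pos.le)
    simp [η, this]
  · intro z
    have h : HasDerivAt (fun t : ℝ => B ((z + t • (stdVec 0 : EuclideanSpace ℝ (Fin 3))) 0) * b 1 ((z + t • (stdVec 0 : EuclideanSpace ℝ (Fin 3))) 1)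
        * b 2 ((z + t • (stdVec 0 : EuclideanSpace ℝ (Fin 3))) 2)) (η z) 0 := by
      have h1 : HasDerivAt (fun t : ℝ => B (z 0 + t)) (b 0 (z 0 + 0)) 0 := by
        simpa using (hB (z 0 + 0)).comp_const_add (z 0) 0
      have := (h1.mul_const (b 1 (z 1))).mul_const (b 2 (z 2))
      simpa [η] using this
    have hd : DifferentiableAt ℝ (fun z : EuclideanSpace ℝ (Fin 3) => B (z 0) * b 1 (z 1) * b 2 (z 2)) z := by
      have p : ∀ i : Fin 3, ContDiff ℝ 1 fun z : EuclideanSpace ℝ (Fin 3) => z i := fun i => by fun_prop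
      exact ((((hBc.comp (p 0)).mul ((hb 1).comp (p 1))).mul ((hb 2).comp (p 2))).differentiable
        (by simp)) z
    have h2 := hd.hasFDerivAt.hasLineDerivAt (stdVec 0)
    exact h2.unique h

/-- By the chain rule the first row is a combination of the three rows of the Jacobian matrix of
`V`, and its parts along the last two rows drop out of the determinant. When `η` is the first
partial derivative of `f`, this exhibits `η (V x) * det` as a null Lagrangian. -/
theorem jac3_comp {f : EuclideanSpace ℝ (Fin 3) → ℝ} {V : EuclideanSpace ℝ (Fin 3) → EuclideanSpace ℝ (Fin 3)}
    {x : EuclideanSpace ℝ (Fin 3)} (hf : DifferentiableAt ℝ f (V x)) (hV : DifferentiableAt ℝ V x) :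
    jac3 (fun y => f (V y)) (fun y => V y 1) (fun y => V y 2) x =
      fderiv ℝ f (V x) (stdVec 0) * (fderiv ℝ V x).det := by
  have hi : ∀ i : Fin 3, fderiv ℝ (fun y => V y i) x = (EuclideanSpace.proj i).comp (fderiv ℝ V x) :=
    fun i => ((EuclideanSpace.proj i : EuclideanSpace ℝ (Fin 3) →L[ℝ] ℝ).hasFDerivAt.comp x hV.hasFDerivAt).fderiv
  have hp : ∀ (i : Fin 3) (w : EuclideanSpace ℝ (Fin 3)),
      (EuclideanSpace.proj i : EuclideanSpace ℝ (Fin 3) →L[ℝ] ℝ) w = w i := fun _ _ => rfl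
  have hfV : fderiv ℝ (fun y => f (V y)) x = (fderiv ℝ f (V x)).comp (fderiv ℝ V x) :=
    (hf.hasFDerivAt.comp x hV.hasFDerivAt).fderiv
  have hsum : ∀ w : EuclideanSpace ℝ (Fin 3), fderiv ℝ f (V x) w = w 0 * fderiv ℝ f (V x) (stdVec 0)
      + w 1 * fderiv ℝ f (V x) (stdVec 1) + w 2 * fderiv ℝ f (V x) (stdVec 2) := by
    intro w
    conv_lhs => rw [← (EuclideanSpace.basisFun (Fin 3) ℝ).sum_repr w]
    simp [Fin.sum_univ_three]
  rw [clm_det_eq_matrix_det, jac3_eq, Matrix.det_fin_three, hi, hi, hfV]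
  simp only [ContinuousLinearMap.comp_apply, Matrix.of_apply, hp]
  rw [hsum (fderiv ℝ V x (stdVec 0)), hsum (fderiv ℝ V x (stdVec 1)), hsum (fderiv ℝ V x (stdVec 2))]
  ring

/-- A `C¹` function on an open set coincides near a given compact subset with a globally defined
compactly supported one. -/
theorem exists_cutoff {d : ℕ} {O Q : Set (EuclideanSpace ℝ (Fin d))} (hO : IsOpen O)
    (hQ : IsCompact Q) (hQO : Q ⊆ O) :
    ∃ ψ : EuclideanSpace ℝ (Fin d) → ℝ, ContDiff ℝ ∞ ψ ∧ HasCompactSupport ψ ∧ tsupport ψ ⊆ O ∧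
      ∀ᶠ x in 𝓝ˢ Q, ψ x = 1 := by
  obtain ⟨R, hR, hQR, hRO⟩ := exists_compact_between hQ hO hQO
  obtain ⟨ψ, h1, h0, -⟩ := exists_contMDiffMap_one_nhds_of_subset_interior
    (I := 𝓘(ℝ, EuclideanSpace ℝ (Fin d))) (n := ⊤) hQ.isClosed hQR
  refine ⟨ψ, ψ.contMDiff.contDiff, HasCompactSupport.intro hR h0, ?_, h1⟩
  refine (closure_minimal ?_ hR.isClosed).trans hRO
  intro x hx
  by_contra h
  exact hx (h0 x h)

theorem contDiff_cutoff_mul {d : ℕ} {O : Set (EuclideanSpace ℝ (Fin d))} (hO : IsOpen O)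
    {ψ u : EuclideanSpace ℝ (Fin d) → ℝ} (hψ : ContDiff ℝ ∞ ψ) (hψO : tsupport ψ ⊆ O)
    (hu : ContDiffOn ℝ 1 u O) : ContDiff ℝ 1 fun x => ψ x * u x := by
  rw [contDiff_iff_contDiffAt]
  intro x
  by_cases hx : x ∈ O
  · exact (hψ.of_le (by simp)).contDiffAt.mul (hu.contDiffAt (hO.mem_nhds hx))
  · have : (fun y => ψ y * u y) =ᶠ[𝓝 x] fun _ => 0 := by
      filter_upwards [(isClosed_tsupport ψ).isOpen_compl.mem_nhds fun h => hx (hψO h)] with y hy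
      rw [image_eq_zero_of_notMem_tsupport hy, zero_mul]
    exact contDiffAt_const.congr_of_eventuallyEq this

/-- The signed number of preimages of a regular value does not change under a modification of the
map on a compact subset. -/
theorem sum_sign_det_eq_of_eqOn_compl {O T : Set (EuclideanSpace ℝ (Fin 3))} (hO : IsOpen O)
    (hT : IsCompact T) (hTO : T ⊆ O)
    {V₀ V₁ : EuclideanSpace ℝ (Fin 3) → EuclideanSpace ℝ (Fin 3)} (h₀ : ContDiffOn ℝ 1 V₀ O)
    (h₁ : ContDiffOn ℝ 1 V₁ O) (heq : ∀ x ∈ O \ T, V₀ x = V₁ x) {a : EuclideanSpace ℝ (Fin 3)}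
    {P₀ P₁ : Finset (EuclideanSpace ℝ (Fin 3))} (hP₀ : ∀ x, x ∈ P₀ ↔ x ∈ O ∧ V₀ x = a)
    (hP₁ : ∀ x, x ∈ P₁ ↔ x ∈ O ∧ V₁ x = a) (d₀ : ∀ x ∈ P₀, (fderiv ℝ V₀ x).det ≠ 0)
    (d₁ : ∀ x ∈ P₁, (fderiv ℝ V₁ x).det ≠ 0) :
    ∑ x ∈ P₀, ((SignType.sign (fderiv ℝ V₀ x).det : SignType) : ℤ) =
      ∑ x ∈ P₁, ((SignType.sign (fderiv ℝ V₁ x).det : SignType) : ℤ) := by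
  classical
  -- `Q` is a compact set with `T` and both fibres in its interior, and the cutoff `ψ` is `1` near
  -- `Q`. The two cut off Jacobians integrate to zero over the whole space and coincide off `Q`.
  -- Hence their integrals over `Q`, which are the signed counts times the integral of `η`, are
  -- equal.
  have hK : IsCompact (T ∪ (P₀ ∪ P₁ : Set (EuclideanSpace ℝ (Fin 3)))) :=
    hT.union (P₀.finite_toSet.isCompact.union P₁.finite_toSet.isCompact)
  obtain ⟨Q, hQ, hKQ, hQO⟩ := exists_compact_between hK hO (by
    rintro x (h | h | h)
    exacts [hTO h, ((hP₀ x).1 h).1, ((hP₁ x).1 h).1])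
  have c₀ := exists_setIntegral_comp_mul_det_eq volume hQ (h₀.continuousOn.mono hQO) (P := P₀) (a := a)
    (fun y hy => h₀.contDiffAt (hO.mem_nhds ((hP₀ y).1 hy).1)) (fun y hy => ((hP₀ y).1 hy).2) d₀
    (fun y hy => hKQ (Or.inr (Or.inl hy))) (fun y hy hya => (hP₀ y).2 ⟨hQO hy, hya⟩)
  have c₁ := exists_setIntegral_comp_mul_det_eq volume hQ (h₁.continuousOn.mono hQO) (P := P₁) (a := a)
    (fun y hy => h₁.contDiffAt (hO.mem_nhds ((hP₁ y).1 hy).1)) (fun y hy => ((hP₁ y).1 hy).2) d₁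
    (fun y hy => hKQ (Or.inr (Or.inr hy))) (fun y hy hya => (hP₁ y).2 ⟨hQO hy, hya⟩)
  obtain ⟨δ, ⟨e₀, e₁⟩, hδ⟩ := ((c₀.and c₁).and self_mem_nhdsWithin).exists
  obtain ⟨f, η, hf, hηi, hη0, hηs, hfη⟩ := exists_bump_eq_fderiv a hδ
  obtain ⟨ψ, hψ, hψc, hψO, hψ1⟩ := exists_cutoff hO hQ hQO
  have proj : ∀ {V : EuclideanSpace ℝ (Fin 3) → EuclideanSpace ℝ (Fin 3)}, ContDiffOn ℝ 1 V O → ∀ i : Fin 3,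
      ContDiffOn ℝ 1 (fun x => V x i) O := fun hV i =>
    (EuclideanSpace.proj i : EuclideanSpace ℝ (Fin 3) →L[ℝ] ℝ).contDiff.comp_contDiffOn hV
  have tot : ∀ {V : EuclideanSpace ℝ (Fin 3) → EuclideanSpace ℝ (Fin 3)}, ContDiffOn ℝ 1 V O →
      ∫ x, jac3 (fun y => ψ y * f (V y)) (fun y => ψ y * V y 1) (fun y => ψ y * V y 2) x = 0 :=
    fun hV => integral_jac3 (contDiff_cutoff_mul hO hψ hψO (hf.comp_contDiffOn hV)) hψc.mul_right
      (contDiff_cutoff_mul hO hψ hψO (proj hV 1)) hψc.mul_right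
      (contDiff_cutoff_mul hO hψ hψO (proj hV 2)) hψc.mul_right
  have onQ : ∀ {V : EuclideanSpace ℝ (Fin 3) → EuclideanSpace ℝ (Fin 3)}, ContDiffOn ℝ 1 V O →
      ∫ x in Q, jac3 (fun y => ψ y * f (V y)) (fun y => ψ y * V y 1) (fun y => ψ y * V y 2) x =
      ∫ x in Q, η (V x) * (fderiv ℝ V x).det := by
    intro V hV
    apply setIntegral_congr_fun hQ.isClosed.measurableSet
    intro x hx
    have hx1 : ∀ᶠ y in 𝓝 x, ψ y = 1 := hψ1.filter_mono (nhds_le_nhdsSet hx)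
    have hl : ∀ u : EuclideanSpace ℝ (Fin 3) → ℝ, fderiv ℝ (fun y => ψ y * u y) x = fderiv ℝ u x := fun u =>
      Filter.EventuallyEq.fderiv_eq (hx1.mono fun y hy => by simp [hy])
    change _ = η (V x) * _
    rw [← hfη (V x), ← jac3_comp (hf.differentiable (by simp) _)
      ((hV.contDiffAt (hO.mem_nhds (hQO hx))).differentiableAt (by simp))]
    simp only [jac3, hl]
  have int : ∀ {V : EuclideanSpace ℝ (Fin 3) → EuclideanSpace ℝ (Fin 3)}, ContDiffOn ℝ 1 V O →
      Integrable (jac3 (fun y => ψ y * f (V y)) (fun y => ψ y * V y 1) (fun y => ψ y * V y 2)) := by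
    intro V hV
    have q0 := contDiff_cutoff_mul hO hψ hψO (hf.comp_contDiffOn hV)
    have q1 := contDiff_cutoff_mul hO hψ hψO (proj hV 1)
    have q2 := contDiff_cutoff_mul hO hψ hψO (proj hV 2)
    have cc : ∀ {u : EuclideanSpace ℝ (Fin 3) → ℝ}, ContDiff ℝ 1 u → ∀ b, Continuous fun x => fderiv ℝ u x b :=
      fun hu b => (hu.continuous_fderiv (by simp)).clm_apply continuous_const
    have d0 := cc q0
    have d1 := cc q1
    have d2 := cc q2
    apply Continuous.integrable_of_hasCompactSupport
    · have : jac3 (fun y => ψ y * f (V y)) (fun y => ψ y * V y 1) (fun y => ψ y * V y 2) = _ :=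
        funext fun x => jac3_eq _ _ _ x
      rw [this]
      simp only [Function.comp_def] at d0
      fun_prop
    · apply HasCompactSupport.intro hψc
      intro x hx
      have : fderiv ℝ (fun y => ψ y * f (V y)) x = 0 := by
        have h0 : (fun y => ψ y * f (V y)) =ᶠ[𝓝 x] fun _ => 0 := by
          filter_upwards [(isClosed_tsupport ψ).isOpen_compl.mem_nhds hx] with y hy
          rw [image_eq_zero_of_notMem_tsupport hy, zero_mul]
        rw [h0.fderiv_eq]; simp
      rw [jac3_eq, this]
      simp
  have off : ∫ x in Qᶜ, jac3 (fun y => ψ y * f (V₀ y)) (fun y => ψ y * V₀ y 1) (fun y => ψ y * V₀ y 2) x =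
      ∫ x in Qᶜ, jac3 (fun y => ψ y * f (V₁ y)) (fun y => ψ y * V₁ y 1) (fun y => ψ y * V₁ y 2) x := by
    apply setIntegral_congr_fun hQ.isClosed.measurableSet.compl
    intro x hx
    have hx1 : ∀ᶠ y in 𝓝 x, ∀ g : EuclideanSpace ℝ (Fin 3) → ℝ, ψ y * g (V₀ y) = ψ y * g (V₁ y) := by
      have hxT : x ∉ T := fun h => hx (interior_subset (hKQ (Or.inl h)))
      filter_upwards [hT.isClosed.isOpen_compl.mem_nhds hxT] with y hy g
      by_cases hyO : y ∈ O
      · rw [heq y ⟨hyO, hy⟩]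
      · rw [image_eq_zero_of_notMem_tsupport fun h => hyO (hψO h), zero_mul, zero_mul]
    have hl : ∀ g : EuclideanSpace ℝ (Fin 3) → ℝ, fderiv ℝ (fun y => ψ y * g (V₀ y)) x
        = fderiv ℝ (fun y => ψ y * g (V₁ y)) x := fun g =>
      Filter.EventuallyEq.fderiv_eq (hx1.mono fun y hy => hy g)
    simp only [jac3, hl f, hl (fun z => z 1), hl (fun z => z 2)]
  have key : ∫ x in Q, η (V₀ x) * (fderiv ℝ V₀ x).det = ∫ x in Q, η (V₁ x) * (fderiv ℝ V₁ x).det := by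
    rw [← onQ h₀, ← onQ h₁]
    have t₀ := integral_add_compl hQ.isClosed.measurableSet (int h₀)
    have t₁ := integral_add_compl hQ.isClosed.measurableSet (int h₁)
    rw [tot h₀] at t₀
    rw [tot h₁] at t₁
    linarith
  rw [e₀ η hηi hηs, e₁ η hηi hηs] at key
  have := mul_right_cancel₀ hη0 key
  have cast : ∀ s : SignType, (s : ℝ) = ((s : ℤ) : ℝ) := fun s => by cases s <;> simp
  simp_rw [cast] at this
  exact_mod_cast this

end

/-! ### Stokes' formula on the half plane for `C¹` functions. -/

noncomputable section

open MeasureTheory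

/-- `p` is of class `C¹` on the closed half plane, with partial derivatives `ps` and `pt`. -/
structure HalfPlaneC1 (p ps pt : ℝ → ℝ → ℝ) : Prop where
  cont : ContinuousOn (Function.uncurry p) (Ici 0 ×ˢ univ)
  cont_fst : ContinuousOn (Function.uncurry ps) (Ici 0 ×ˢ univ)
  cont_snd : ContinuousOn (Function.uncurry pt) (Ici 0 ×ˢ univ)
  deriv_fst : ∀ s t, 0 < s → HasDerivAt (fun s => p s t) (ps s t) s
  deriv_snd : ∀ s t, 0 ≤ s → HasDerivAt (p s) (pt s t) t

theorem continuous_slice {f : ℝ → ℝ → ℝ}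
    (h : ContinuousOn (Function.uncurry f) (Ici 0 ×ˢ univ)) {s : ℝ} (hs : 0 ≤ s) :
    Continuous (f s) :=
  h.comp_continuous (f := fun t : ℝ => (s, t)) (by fun_prop) fun t => ⟨hs, mem_univ _⟩

theorem continuous_clamp {f : ℝ → ℝ → ℝ}
    (h : ContinuousOn (Function.uncurry f) (Ici 0 ×ˢ univ)) :
    Continuous (Function.uncurry fun s t => f (max s 0) t) :=
  h.comp_continuous (f := fun z : ℝ × ℝ => (max z.1 0, z.2)) (by fun_prop)
    fun z => ⟨le_max_right z.1 0, mem_univ _⟩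

/-- For `C²` functions this is differentiation under the integral sign followed by an integration by
parts in `t`. Since `v` is only `C¹`, the integration by parts is carried out on the difference
quotients, before passing to the limit, so that no mixed derivative appears. -/
theorem hasDerivAt_integral_mul {p ps pt v vs vt : ℝ → ℝ → ℝ} (hp : HalfPlaneC1 p ps pt)
    (hv : HalfPlaneC1 v vs vt) {R : ℝ} (hR : 0 < R)
    (hsupp : ∀ s t, 0 ≤ s → R ≤ |t| → p s t = 0) {s : ℝ} (hs : 0 < s) :
    HasDerivAt (fun s => ∫ t in -R..R, p s t * vt s t)
      (∫ t in -R..R, (ps s t * vt s t - pt s t * vs s t)) s := by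
  have hI : ∀ᶠ s' in 𝓝 s, s' ∈ Ioo (s / 2) (s + 1) := Ioo_mem_nhds (by linarith) (by linarith)
  have hcomp : IsCompact (Icc (s / 2) (s + 1) ×ˢ Icc (-R) R) := isCompact_Icc.prod isCompact_Icc
  have hsub : Icc (s / 2) (s + 1) ×ˢ Icc (-R) R ⊆ Ici 0 ×ˢ univ := fun z hz =>
    ⟨le_trans (by linarith) hz.1.1, mem_univ _⟩
  have bdd : ∀ {f : ℝ → ℝ → ℝ}, ContinuousOn (Function.uncurry f) (Ici 0 ×ˢ univ) →
      ∃ C, ∀ s' ∈ Icc (s / 2) (s + 1), ∀ t ∈ Icc (-R) R, ‖f s' t‖ ≤ C := by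
    intro f hf
    obtain ⟨C, hC⟩ := hcomp.exists_bound_of_continuousOn (hf.mono hsub)
    exact ⟨C, fun s' hs' t ht => hC (s', t) ⟨hs', ht⟩⟩
  obtain ⟨C1, hC1⟩ := bdd hp.cont_fst
  obtain ⟨C2, hC2⟩ := bdd hv.cont_fst
  obtain ⟨C3, hC3⟩ := bdd hv.cont_snd
  obtain ⟨C4, hC4⟩ := bdd hp.cont_snd
  have hss : s ∈ Icc (s / 2) (s + 1) := ⟨by linarith, by linarith⟩
  have mv : ∀ {f fs ft : ℝ → ℝ → ℝ}, HalfPlaneC1 f fs ft → ∀ C,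
      (∀ s' ∈ Icc (s / 2) (s + 1), ∀ t ∈ Icc (-R) R, ‖fs s' t‖ ≤ C) →
      ∀ s' ∈ Icc (s / 2) (s + 1), ∀ t ∈ Icc (-R) R, ‖(s' - s)⁻¹ * (f s' t - f s t)‖ ≤ C := by
    intro f fs ft hf C hC s' hs' t ht
    have h := Convex.norm_image_sub_le_of_norm_hasDerivWithin_le (f := fun s => f s t)
      (f' := fun s => fs s t) (s := Icc (s / 2) (s + 1)) (C := C) (x := s) (y := s')
      (fun x hx => (hf.deriv_fst x t (lt_of_lt_of_le (by linarith) hx.1)).hasDerivWithinAt)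
      (fun x hx => hC x hx t ht) (convex_Icc _ _) hss hs'
    rw [norm_mul, norm_inv]
    rcases eq_or_ne s' s with rfl | hne
    · simpa using (norm_nonneg _).trans (hC s' hs' t ht)
    · rw [inv_mul_le_iff₀ (norm_pos_iff.2 (sub_ne_zero.2 hne)), mul_comm]
      exact h
  have cs : ∀ {f : ℝ → ℝ → ℝ}, ContinuousOn (Function.uncurry f) (Ici 0 ×ˢ univ) →
      ∀ {s' : ℝ}, 0 ≤ s' → Continuous (f s') := fun hf => fun h => continuous_slice hf h
  rw [hasDerivAt_iff_tendsto_slope]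
  have heq : (fun s' => ∫ t in -R..R, ((s' - s)⁻¹ * (p s' t - p s t) * vt s' t -
      pt s t * ((s' - s)⁻¹ * (v s' t - v s t)))) =ᶠ[𝓝[≠] s]
      slope (fun s => ∫ t in -R..R, p s t * vt s t) s := by
    filter_upwards [mem_nhdsWithin_of_mem_nhds hI] with s' hs'
    have hs'0 : 0 ≤ s' := by linarith [hs'.1]
    -- There are no boundary terms because `p s` vanishes at `R` and at `-R`.
    have parts : ∫ t in -R..R, p s t * (vt s' t - vt s t) =
        - ∫ t in -R..R, pt s t * (v s' t - v s t) := by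
      have := intervalIntegral.integral_mul_deriv_eq_deriv_mul (a := -R) (b := R)
        (u := p s) (u' := pt s) (v := fun t => v s' t - v s t) (v' := fun t => vt s' t - vt s t)
        (fun t _ => hp.deriv_snd s t hs.le)
        (fun t _ => (hv.deriv_snd s' t hs'0).sub (hv.deriv_snd s t hs.le))
        ((cs hp.cont_snd hs.le).intervalIntegrable _ _)
        (((cs hv.cont_snd hs'0).sub (cs hv.cont_snd hs.le)).intervalIntegrable _ _)
      rw [this, hsupp s R hs.le (le_abs_self _), hsupp s (-R) hs.le (by rw [abs_neg]; exact le_abs_self _)]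
      ring
    have i1 : IntervalIntegrable (fun t => (p s' t - p s t) * vt s' t) volume (-R) R :=
      (((cs hp.cont hs'0).sub (cs hp.cont hs.le)).mul (cs hv.cont_snd hs'0)).intervalIntegrable _ _
    have i2 : IntervalIntegrable (fun t => pt s t * (v s' t - v s t)) volume (-R) R :=
      ((cs hp.cont_snd hs.le).mul ((cs hv.cont hs'0).sub (cs hv.cont hs.le))).intervalIntegrable _ _
    have i3 : IntervalIntegrable (fun t => p s t * (vt s' t - vt s t)) volume (-R) R :=
      ((cs hp.cont hs.le).mul ((cs hv.cont_snd hs'0).sub (cs hv.cont_snd hs.le))).intervalIntegrable _ _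
    have i4 : IntervalIntegrable (fun t => p s' t * vt s' t) volume (-R) R :=
      ((cs hp.cont hs'0).mul (cs hv.cont_snd hs'0)).intervalIntegrable _ _
    have i5 : IntervalIntegrable (fun t => p s t * vt s t) volume (-R) R :=
      ((cs hp.cont hs.le).mul (cs hv.cont_snd hs.le)).intervalIntegrable _ _
    rw [slope_def_field, ← intervalIntegral.integral_sub i4 i5]
    have e1 : ∫ t in -R..R, (p s' t * vt s' t - p s t * vt s t) =
        (∫ t in -R..R, (p s' t - p s t) * vt s' t) - ∫ t in -R..R, pt s t * (v s' t - v s t) := by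
      rw [sub_eq_add_neg, ← parts, ← intervalIntegral.integral_add i1 i3]
      congr 1; ext t; ring
    rw [e1, ← intervalIntegral.integral_sub i1 i2, div_eq_inv_mul,
      ← intervalIntegral.integral_const_mul]
    congr 1; ext t; ring
  refine Tendsto.congr' heq ?_
  apply intervalIntegral.tendsto_integral_filter_of_dominated_convergence
    (fun _ => C1 * C3 + C4 * C2)
  · filter_upwards [mem_nhdsWithin_of_mem_nhds hI] with s' hs'
    have hs'0 : 0 ≤ s' := by linarith [hs'.1]
    have := cs hp.cont hs'0
    have := cs hp.cont hs.le
    have := cs hv.cont hs'0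
    have := cs hv.cont hs.le
    have := cs hv.cont_snd hs'0
    have := cs hp.cont_snd hs.le
    exact Continuous.aestronglyMeasurable (by fun_prop)
  · filter_upwards [mem_nhdsWithin_of_mem_nhds hI] with s' hs'
    filter_upwards with t ht
    have hs'I : s' ∈ Icc (s / 2) (s + 1) := ⟨hs'.1.le, hs'.2.le⟩
    have htI : t ∈ Icc (-R) R := by
      rw [uIoc_of_le (by linarith)] at ht
      exact ⟨ht.1.le, ht.2⟩
    refine (norm_sub_le _ _).trans ?_
    rw [norm_mul _ (vt s' t), norm_mul (pt s t)]
    have a1 := mv hp C1 hC1 s' hs'I t htI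
    have a2 := mv hv C2 hC2 s' hs'I t htI
    have n1 := (norm_nonneg _).trans a1
    have n4 := (norm_nonneg _).trans (hC4 s hss t htI)
    exact add_le_add (mul_le_mul a1 (hC3 s' hs'I t htI) (norm_nonneg _) n1)
      (mul_le_mul (hC4 s hss t htI) a2 (norm_nonneg _) n4)
  · exact intervalIntegrable_const
  · filter_upwards with t ht
    have d1 := (hasDerivAt_iff_tendsto_slope.1 (hp.deriv_fst s t hs))
    have d2 := (hasDerivAt_iff_tendsto_slope.1 (hv.deriv_fst s t hs))
    have d3 : Tendsto (fun s' => vt s' t) (𝓝[≠] s) (𝓝 (vt s t)) := by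
      have : ContinuousAt (Function.uncurry vt) (s, t) :=
        hv.cont_snd.continuousAt (prod_mem_nhds (Ici_mem_nhds hs) univ_mem)
      have h2 : ContinuousAt (fun s' : ℝ => ((s', t) : ℝ × ℝ)) s := by fun_prop
      exact (ContinuousAt.comp (f := fun s' : ℝ => ((s', t) : ℝ × ℝ)) this h2).tendsto.mono_left nhdsWithin_le_nhds
    refine (((d1.mul d3).sub (tendsto_const_nhds.mul d2))).congr fun s' => ?_
    simp only [slope_def_field]
    ring

/-- The fundamental theorem of calculus in `s` for the function differentiated in
`hasDerivAt_integral_mul`; the side `s = R` contributes nothing. -/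
theorem integral_halfPlane_aux {p ps pt v vs vt : ℝ → ℝ → ℝ} (hp : HalfPlaneC1 p ps pt)
    (hv : HalfPlaneC1 v vs vt) {R : ℝ} (hR : 0 < R)
    (hsupp : ∀ s t, 0 ≤ s → R ≤ s ∨ R ≤ |t| → p s t = 0) :
    ∫ s in (0:ℝ)..R, ∫ t in -R..R, (ps s t * vt s t - pt s t * vs s t) =
      - ∫ t in -R..R, p 0 t * vt 0 t := by
  have key := intervalIntegral.integral_eq_sub_of_hasDerivAt_of_le (a := 0) (b := R)
    (f := fun s => ∫ t in -R..R, p s t * vt s t)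
    (f' := fun s => ∫ t in -R..R, (ps s t * vt s t - pt s t * vs s t)) hR.le ?_
    (fun s hs => hasDerivAt_integral_mul hp hv hR (fun s t h1 h2 => hsupp s t h1 (Or.inr h2)) hs.1) ?_
  · rw [key]
    have : ∀ t, p R t = 0 := fun t => hsupp R t hR.le (Or.inl le_rfl)
    simp [this]
  -- Replacing `s` by `max s 0` extends the integrand continuously to the whole plane, where
  -- continuity of parametric integrals applies.
  · have : Continuous fun s => ∫ t in -R..R, p (max s 0) t * vt (max s 0) t :=
      intervalIntegral.continuous_parametric_intervalIntegral_of_continuous'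
        ((continuous_clamp hp.cont).mul (continuous_clamp hv.cont_snd)) _ _
    refine this.continuousOn.congr fun s hs => ?_
    simp only [max_eq_left hs.1]
  · have : Continuous fun s => ∫ t in -R..R, (ps (max s 0) t * vt (max s 0) t -
        pt (max s 0) t * vs (max s 0) t) :=
      intervalIntegral.continuous_parametric_intervalIntegral_of_continuous'
        (((continuous_clamp hp.cont_fst).mul (continuous_clamp hv.cont_snd)).sub
          ((continuous_clamp hp.cont_snd).mul (continuous_clamp hv.cont_fst))) _ _
    refine ContinuousOn.intervalIntegrable ?_
    refine this.continuousOn.congr fun s hs => ?_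
    rw [uIcc_of_le hR.le] at hs
    simp only [max_eq_left hs.1]

/-- The closed half plane. -/
def halfPlane : Set (EuclideanSpace ℝ (Fin 2)) := {y | 0 ≤ y 0}

/-- The point of the plane with given coordinates. -/
def planePt (s t : ℝ) : EuclideanSpace ℝ (Fin 2) := s • stdVec 0 + t • stdVec 1

@[simp] theorem planePt_zero (s t : ℝ) : planePt s t 0 = s := by simp [planePt]

@[simp] theorem planePt_one (s t : ℝ) : planePt s t 1 = t := by simp [planePt]

theorem planePt_eta (y : EuclideanSpace ℝ (Fin 2)) : planePt (y 0) (y 1) = y := by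
  ext i; fin_cases i <;> simp

theorem continuous_planePt : Continuous fun z : ℝ × ℝ => planePt z.1 z.2 := by
  unfold planePt; fun_prop

theorem isClosed_halfPlane : IsClosed halfPlane :=
  isClosed_le continuous_const (by fun_prop)

theorem planePt_mem {s t : ℝ} : planePt s t ∈ halfPlane ↔ 0 ≤ s := by simp [halfPlane]

theorem convex_halfPlane : Convex ℝ halfPlane := by
  intro x hx y hy a b ha hb _
  simp only [halfPlane, mem_ofPred_eq] at *
  simp only [PiLp.add_apply, PiLp.smul_apply, smul_eq_mul]
  positivity

theorem mem_interior_halfPlane {y : EuclideanSpace ℝ (Fin 2)} (h : 0 < y 0) :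
    halfPlane ∈ 𝓝 y := by
  have : {y : EuclideanSpace ℝ (Fin 2) | 0 < y 0} ∈ 𝓝 y :=
    (isOpen_lt continuous_const (by fun_prop)).mem_nhds h
  exact mem_of_superset this fun z (hz : 0 < z 0) => hz.le

theorem uniqueDiffOn_halfPlane : UniqueDiffOn ℝ halfPlane := by
  apply uniqueDiffOn_convex convex_halfPlane
  exact ⟨planePt 1 0, mem_interior_iff_mem_nhds.2 (mem_interior_halfPlane (by simp))⟩

theorem halfPlaneC1_of_contDiffOn {p : EuclideanSpace ℝ (Fin 2) → ℝ}
    (hp : ContDiffOn ℝ 1 p halfPlane) :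
    HalfPlaneC1 (fun s t => p (planePt s t))
      (fun s t => fderivWithin ℝ p halfPlane (planePt s t) (stdVec 0))
      (fun s t => fderivWithin ℝ p halfPlane (planePt s t) (stdVec 1)) := by
  have hmap : MapsTo (fun z : ℝ × ℝ => planePt z.1 z.2) (Ici 0 ×ˢ univ) halfPlane :=
    fun z hz => planePt_mem.2 hz.1
  have hdc := hp.continuousOn_fderivWithin uniqueDiffOn_halfPlane (by simp)
  have hd : ∀ y ∈ halfPlane, HasFDerivWithinAt p (fderivWithin ℝ p halfPlane y) halfPlane y :=
    fun y hy => (hp.differentiableOn (by simp) y hy).hasFDerivWithinAt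
  refine ⟨hp.continuousOn.comp continuous_planePt.continuousOn hmap, ?_, ?_, ?_, ?_⟩
  · exact (hdc.comp continuous_planePt.continuousOn hmap).clm_apply continuousOn_const
  · exact (hdc.comp continuous_planePt.continuousOn hmap).clm_apply continuousOn_const
  · intro s t hs
    have h1 := (hd (planePt s t) (planePt_mem.2 hs.le)).hasFDerivAt
      (mem_interior_halfPlane (by simpa using hs))
    have h2 : HasDerivAt (fun s => planePt s t) (stdVec 0) s := by
      unfold planePt
      simpa using ((hasDerivAt_id s).smul_const (stdVec 0 : EuclideanSpace ℝ (Fin 2))).add_const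
        (t • stdVec 1)
    exact h1.comp_hasDerivAt s h2
  · intro s t hs
    have h2 : HasDerivAt (fun t => planePt s t) (stdVec 1) t := by
      unfold planePt
      simpa using ((hasDerivAt_id t).smul_const (stdVec 1 : EuclideanSpace ℝ (Fin 2))).const_add
        (s • stdVec 0)
    exact (hd (planePt s t) (planePt_mem.2 hs)).comp_hasDerivAt t h2
      (Eventually.of_forall fun t => planePt_mem.2 hs)

theorem setIntegral_halfPlane_eq {F : EuclideanSpace ℝ (Fin 2) → ℝ} (hF : ContinuousOn F halfPlane)
    {R : ℝ} (hR : 0 < R) (hsupp : ∀ s t, 0 ≤ s → R ≤ s ∨ R ≤ |t| → F (planePt s t) = 0) :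
    ∫ y in halfPlane, F y = ∫ s in (0:ℝ)..R, ∫ t in -R..R, F (planePt s t) := by
  have hmp : MeasurePreserving (fun z : ℝ × ℝ => planePt z.1 z.2) volume volume := by
    have h := (PiLp.volume_preserving_toLp (Fin 2)).comp (volume_preserving_finTwoArrow ℝ).symm
    have hfun : (fun z : ℝ × ℝ => planePt z.1 z.2) =
        (WithLp.toLp 2 : (Fin 2 → ℝ) → EuclideanSpace ℝ (Fin 2)) ∘ MeasurableEquiv.finTwoArrow.symm := by
      refine funext fun z => ?_
      ext i
      fin_cases i <;> simp [MeasurableEquiv.finTwoArrow]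
    rw [hfun]
    exact h
  have hemb : MeasurableEmbedding (fun z : ℝ × ℝ => planePt z.1 z.2) := by
    apply continuous_planePt.measurableEmbedding
    intro z w h
    have h0 := congrArg (fun y : EuclideanSpace ℝ (Fin 2) => y 0) h
    have h1 := congrArg (fun y : EuclideanSpace ℝ (Fin 2) => y 1) h
    simp at h0 h1
    exact Prod.ext h0 h1
  rw [← hmp.setIntegral_preimage_emb hemb]
  have hpre : (fun z : ℝ × ℝ => planePt z.1 z.2) ⁻¹' halfPlane = Ici 0 ×ˢ univ := by
    ext z; simp [halfPlane]
  rw [hpre]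
  have hsub : Icc (0:ℝ) R ×ˢ Icc (-R) R ⊆ Ici 0 ×ˢ univ := fun z hz => ⟨hz.1.1, mem_univ _⟩
  rw [setIntegral_eq_of_subset_of_forall_sdiff_eq_zero (s := Icc (0:ℝ) R ×ˢ Icc (-R) R)
    (measurableSet_Ici.prod MeasurableSet.univ) hsub]
  · have hc : ContinuousOn (fun z : ℝ × ℝ => F (planePt z.1 z.2)) (Icc (0:ℝ) R ×ˢ Icc (-R) R) :=
      hF.comp continuous_planePt.continuousOn fun z hz => planePt_mem.2 hz.1.1
    rw [Measure.volume_eq_prod, setIntegral_prod]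
    · rw [intervalIntegral.integral_of_le hR.le, integral_Icc_eq_integral_Ioc]
      congr 1; ext s
      rw [intervalIntegral.integral_of_le (by linarith), integral_Icc_eq_integral_Ioc]
    · exact hc.integrableOn_compact (isCompact_Icc.prod isCompact_Icc)
  · rintro ⟨s, t⟩ ⟨⟨hs, -⟩, h⟩
    apply hsupp s t hs
    by_contra hc
    push Not at hc
    exact h ⟨⟨hs, hc.1.le⟩, abs_le.1 hc.2.le⟩

/-- Stokes' formula for the form `p dv` on the half plane. -/
theorem integral_halfPlane {p v : EuclideanSpace ℝ (Fin 2) → ℝ}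
    (hp : ContDiffOn ℝ 1 p halfPlane) (hv : ContDiffOn ℝ 1 v halfPlane) {K : Set (EuclideanSpace ℝ (Fin 2))}
    (hK : IsCompact K) (hpK : ∀ y ∈ halfPlane, y ∉ K → p y = 0) :
    ∫ y in halfPlane, (fderivWithin ℝ p halfPlane y (stdVec 0) * fderivWithin ℝ v halfPlane y (stdVec 1) -
      fderivWithin ℝ p halfPlane y (stdVec 1) * fderivWithin ℝ v halfPlane y (stdVec 0)) =
      - ∫ t : ℝ, p (planePt 0 t) * fderivWithin ℝ v halfPlane (planePt 0 t) (stdVec 1) := by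
  obtain ⟨R₀, hR₀⟩ := hK.isBounded.subset_closedBall 0
  obtain ⟨R, hR, hRR⟩ : ∃ R, 0 < R ∧ R₀ < R := ⟨max R₀ 0 + 1, by positivity, by
    linarith [le_max_left R₀ 0]⟩
  have hn : ∀ s t, R ≤ |s| ∨ R ≤ |t| → planePt s t ∉ K := by
    intro s t h hK
    have h1 := mem_closedBall_zero_iff.1 (hR₀ hK)
    have h2 : |s| ≤ ‖planePt s t‖ := by simpa using PiLp.norm_apply_le (planePt s t) 0
    have h3 : |t| ≤ ‖planePt s t‖ := by simpa using PiLp.norm_apply_le (planePt s t) 1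
    rcases h with h | h <;> linarith
  have hd : ∀ y ∈ halfPlane, y ∉ K → fderivWithin ℝ p halfPlane y = 0 := by
    intro y hy hyK
    have : p =ᶠ[𝓝[halfPlane] y] fun _ => 0 := by
      filter_upwards [self_mem_nhdsWithin, mem_nhdsWithin_of_mem_nhds
        (hK.isClosed.isOpen_compl.mem_nhds hyK)] with z hz hzK
      exact hpK z hz hzK
    rw [this.fderivWithin_eq (hpK y hy hyK)]
    simp
  have hdcp := hp.continuousOn_fderivWithin uniqueDiffOn_halfPlane (by simp)
  have hdcv := hv.continuousOn_fderivWithin uniqueDiffOn_halfPlane (by simp)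
  rw [setIntegral_halfPlane_eq _ hR, integral_halfPlane_aux (halfPlaneC1_of_contDiffOn hp)
    (halfPlaneC1_of_contDiffOn hv) hR]
  · rw [intervalIntegral.integral_of_le (by linarith), setIntegral_eq_integral_of_forall_compl_eq_zero]
    intro t ht
    rw [hpK _ (planePt_mem.2 le_rfl), zero_mul]
    apply hn
    right
    by_contra h
    push Not at h
    exact ht ⟨(abs_lt.1 h).1, (abs_lt.1 h).2.le⟩
  · intro s t hs h
    exact hpK _ (planePt_mem.2 hs) (hn s t (h.imp_left fun h => h.trans (le_abs_self s)))
  · intro s t hs h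
    have := hd _ (planePt_mem.2 hs) (hn s t (h.imp_left fun h => h.trans (le_abs_self s)))
    simp [this]
  · exact ((hdcp.clm_apply continuousOn_const).mul (hdcv.clm_apply continuousOn_const)).sub
      ((hdcp.clm_apply continuousOn_const).mul (hdcv.clm_apply continuousOn_const))

end

/-! ### A planar density of mass `2π` that is the divergence of a cut off radial field. -/

noncomputable section

open MeasureTheory

/-- A smooth function equal to `1 / s` for `s ≥ δ ^ 2` and to `0` near `s ≤ 0`. -/
def invCutoff (δ s : ℝ) : ℝ := Real.smoothTransition (2 * (s / δ ^ 2) - 1) / s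

theorem invCutoff_of_le {δ s : ℝ} (hδ : 0 < δ) (hs : δ ^ 2 ≤ s) : invCutoff δ s = 1 / s := by
  have : 1 ≤ s / δ ^ 2 := (one_le_div (by positivity)).2 hs
  rw [invCutoff, Real.smoothTransition.one_of_one_le (by linarith)]

theorem contDiff_invCutoff {δ : ℝ} (hδ : 0 < δ) : ContDiff ℝ 1 (invCutoff δ) := by
  have hl : ContDiff ℝ 1 fun s => Real.smoothTransition (2 * (s / δ ^ 2) - 1) :=
    Real.smoothTransition.contDiff.comp (by fun_prop)
  rw [contDiff_iff_contDiffAt]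
  intro s
  by_cases hs : s < δ ^ 2 / 2
  · have : invCutoff δ =ᶠ[𝓝 s] fun _ => 0 := by
      filter_upwards [Iio_mem_nhds hs] with x hx
      rw [invCutoff, Real.smoothTransition.zero_of_nonpos, zero_div]
      have : x / δ ^ 2 < 1 / 2 := by
        rw [div_lt_iff₀ (by positivity)]; linarith [mem_Iio.1 hx]
      linarith
    exact contDiffAt_const.congr_of_eventuallyEq this
  · have : s ≠ 0 := by
      have : 0 < δ ^ 2 := by positivity
      intro h; apply hs; rw [h]; linarith
    exact hl.contDiffAt.div contDiffAt_id this

/-- The components of the radial field `(z - a) / ‖z - a‖ ^ 2`, cut off near `a`. -/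
def radialField (a : EuclideanSpace ℝ (Fin 2)) (δ : ℝ) (i : Fin 2) (z : EuclideanSpace ℝ (Fin 2)) : ℝ :=
  (z i - a i) * invCutoff δ (‖z - a‖ ^ 2)

/-- The divergence of the cut off radial field. -/
def radialBump (a : EuclideanSpace ℝ (Fin 2)) (δ : ℝ) (z : EuclideanSpace ℝ (Fin 2)) : ℝ :=
  2 * deriv (fun s => s * invCutoff δ s) (‖z - a‖ ^ 2)

theorem contDiff_radialField (a : EuclideanSpace ℝ (Fin 2)) {δ : ℝ} (hδ : 0 < δ) (i : Fin 2) :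
    ContDiff ℝ 1 (radialField a δ i) := by
  have h1 : ContDiff ℝ 1 fun z : EuclideanSpace ℝ (Fin 2) => ‖z - a‖ ^ 2 :=
    (contDiff_id.sub contDiff_const).norm_sq ℝ
  have h2 : ContDiff ℝ 1 fun z : EuclideanSpace ℝ (Fin 2) => z i - a i := by fun_prop
  exact h2.mul ((contDiff_invCutoff hδ).comp h1)

theorem fderiv_radialField (a : EuclideanSpace ℝ (Fin 2)) {δ : ℝ} (hδ : 0 < δ) (i : Fin 2)
    (z w : EuclideanSpace ℝ (Fin 2)) :
    fderiv ℝ (radialField a δ i) z w = w i * invCutoff δ (‖z - a‖ ^ 2) +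
      (z i - a i) * (deriv (invCutoff δ) (‖z - a‖ ^ 2) * (2 * inner ℝ (z - a) w)) := by
  have h1 : HasFDerivAt (fun z : EuclideanSpace ℝ (Fin 2) => ‖z - a‖ ^ 2)
      (2 • innerSL ℝ (z - a)) z := by
    have := ((hasFDerivAt_id z).sub_const a).norm_sq
    simpa using this
  have h2 : HasFDerivAt (fun z : EuclideanSpace ℝ (Fin 2) => z i - a i)
      (EuclideanSpace.proj i : EuclideanSpace ℝ (Fin 2) →L[ℝ] ℝ) z :=
    (EuclideanSpace.proj i : EuclideanSpace ℝ (Fin 2) →L[ℝ] ℝ).hasFDerivAt.sub_const _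
  have h3 : HasDerivAt (invCutoff δ) (deriv (invCutoff δ) (‖z - a‖ ^ 2)) (‖z - a‖ ^ 2) :=
    (((contDiff_invCutoff hδ).differentiable (by simp)) _).hasDerivAt
  have h4 := h2.mul (h3.comp_hasFDerivAt z h1)
  have : fderiv ℝ (radialField a δ i) z = _ := h4.fderiv
  rw [this]
  simp [inner_sub_left]
  ring

/-- In the plane the divergence of `g(‖z - a‖²) (z - a)` is `2 g + 2 ‖z - a‖² g'`, that is, twice
the derivative of `s g(s)` at `s = ‖z - a‖²`. -/
theorem radialBump_eq_divergence (a : EuclideanSpace ℝ (Fin 2)) {δ : ℝ} (hδ : 0 < δ)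
    (z : EuclideanSpace ℝ (Fin 2)) :
    radialBump a δ z = fderiv ℝ (radialField a δ 0) z (stdVec 0) +
      fderiv ℝ (radialField a δ 1) z (stdVec 1) := by
  have h3 := (((contDiff_invCutoff hδ).differentiable (by simp)) (‖z - a‖ ^ 2)).hasDerivAt
  have h4 : deriv (fun s => s * invCutoff δ s) (‖z - a‖ ^ 2) = _ :=
    ((hasDerivAt_id (‖z - a‖ ^ 2)).mul h3).deriv
  have hn : ‖z - a‖ ^ 2 = (z 0 - a 0) ^ 2 + (z 1 - a 1) ^ 2 := by
    rw [EuclideanSpace.norm_sq_eq, Fin.sum_univ_two]; simp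
  rw [radialBump, h4, fderiv_radialField a hδ, fderiv_radialField a hδ]
  simp only [EuclideanSpace.inner_single_right, id]
  simp
  rw [hn]
  ring

theorem radialBump_eq_zero (a : EuclideanSpace ℝ (Fin 2)) {δ : ℝ} (hδ : 0 < δ)
    {z : EuclideanSpace ℝ (Fin 2)} (hz : δ < ‖z - a‖) : radialBump a δ z = 0 := by
  have : (fun s => s * invCutoff δ s) =ᶠ[𝓝 (‖z - a‖ ^ 2)] fun _ => 1 := by
    have h : δ ^ 2 < ‖z - a‖ ^ 2 := pow_lt_pow_left₀ hz hδ.le (by norm_num)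
    filter_upwards [Ioi_mem_nhds h] with s hs
    have hs' : δ ^ 2 < s := hs
    have : 0 < s := lt_trans (by positivity) hs'
    rw [invCutoff_of_le hδ hs'.le, mul_one_div_cancel this.ne']
  rw [radialBump, this.deriv_eq]
  simp

theorem continuous_radialBump (a : EuclideanSpace ℝ (Fin 2)) {δ : ℝ} (hδ : 0 < δ) :
    Continuous (radialBump a δ) := by
  have : ContDiff ℝ 1 fun s => s * invCutoff δ s := contDiff_id.mul (contDiff_invCutoff hδ)
  have h := this.continuous_deriv (by simp)
  unfold radialBump
  fun_prop

theorem hasCompactSupport_radialBump (a : EuclideanSpace ℝ (Fin 2)) {δ : ℝ} (hδ : 0 < δ) :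
    HasCompactSupport (radialBump a δ) := by
  apply HasCompactSupport.intro (isCompact_closedBall a δ)
  intro z hz
  apply radialBump_eq_zero a hδ
  rwa [← dist_eq_norm, ← not_le]

/-- In polar coordinates the integrand is `2π` times the derivative of `r² * invCutoff δ (r²)`,
which goes from `0` at the origin to `1` for large `r`. This is the flux of the radial field through
a large circle. -/
theorem integral_radialBump (a : EuclideanSpace ℝ (Fin 2)) {δ : ℝ} (hδ : 0 < δ) :
    ∫ z, radialBump a δ z = 2 * Real.pi := by
  have h1 : ∫ z, radialBump a δ z = ∫ z, radialBump 0 δ z := by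
    rw [← integral_sub_right_eq_self (fun z => radialBump 0 δ z) a]
    congr 1; ext z; simp [radialBump]
  let g : ℝ → ℝ := fun r => 2 * deriv (fun s => s * invCutoff δ s) (r ^ 2)
  have h2 : ∀ z, radialBump 0 δ z = g ‖z‖ := fun z => by simp [radialBump, g]
  simp_rw [h1, h2]
  rw [integral_fun_norm_addHaar]
  have hfd : Module.finrank ℝ (EuclideanSpace ℝ (Fin 2)) = 2 := by simp
  rw [hfd, measureReal_def, EuclideanSpace.volume_ball_fin_two]
  have hc : ContDiff ℝ 1 fun s => s * invCutoff δ s := contDiff_id.mul (contDiff_invCutoff hδ)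
  have hder : ∀ r : ℝ, HasDerivAt (fun r => r ^ 2 * invCutoff δ (r ^ 2)) (r * g r) r := by
    intro r
    have := ((hc.differentiable (by simp) (r ^ 2)).hasDerivAt).comp r (hasDerivAt_pow 2 r)
    refine (this.congr_deriv ?_)
    simp [g]; ring
  have h3 : ∫ y in Ioi (0:ℝ), y ^ (2 - 1) • g y = 1 := by
    have h0 := integral_Ioi_of_hasDerivAt_of_tendsto (a := 0) (m := 1)
      (f := fun r => r ^ 2 * invCutoff δ (r ^ 2)) (f' := fun r => r * g r)
      (hder 0).continuousAt.continuousWithinAt (fun r _ => hder r) ?_ ?_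
    · simpa using h0
    · have hcont : Continuous fun r => r * g r := by
        have := hc.continuous_deriv (by simp)
        simp only [g]
        fun_prop
      apply (hcont.integrable_of_hasCompactSupport ?_).integrableOn
      apply HasCompactSupport.intro (isCompact_Icc (a := -δ) (b := δ))
      intro r hr
      have h5 : δ < |r| := by
        by_contra h
        exact hr (abs_le.1 (not_lt.1 h))
      have h6 := h2 (planePt r 0)
      have hn : ‖planePt r 0‖ = |r| := by
        rw [EuclideanSpace.norm_eq, Fin.sum_univ_two]
        simp [Real.sqrt_sq_eq_abs]
      have h7 := radialBump_eq_zero 0 hδ (z := planePt r 0) (by rwa [sub_zero, hn])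
      have h8 : g |r| = g r := by simp [g]
      rw [← h8, ← hn, ← h6, h7, mul_zero]
    · refine tendsto_const_nhds.congr' ?_
      filter_upwards [eventually_ge_atTop δ] with r hr
      have : 0 < r ^ 2 := by have : 0 < r := lt_of_lt_of_le hδ hr
                             positivity
      rw [invCutoff_of_le hδ (pow_le_pow_left₀ hδ.le hr 2), mul_one_div_cancel this.ne']
  rw [h3]
  simp [ENNReal.toReal_ofReal Real.pi_pos.le]

end

/-! ### Signed counts in the half plane and the angular form on its boundary. -/

noncomputable section

open MeasureTheory

/-- Twice the area form `p₀ dp₁ - p₁ dp₀` divided by `‖p‖ ^ 2`: the angular form at the point `p`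
evaluated at the vector `w`. -/
def angularForm (p w : EuclideanSpace ℝ (Fin 2)) : ℝ := (p 0 * w 1 - p 1 * w 0) / ‖p‖ ^ 2

/-- The Jacobian of two functions on the half plane. -/
def jac2 (p v : EuclideanSpace ℝ (Fin 2) → ℝ) (y : EuclideanSpace ℝ (Fin 2)) : ℝ :=
  fderivWithin ℝ p halfPlane y (stdVec 0) * fderivWithin ℝ v halfPlane y (stdVec 1) -
    fderivWithin ℝ p halfPlane y (stdVec 1) * fderivWithin ℝ v halfPlane y (stdVec 0)

theorem contDiffOn_cutoff_mul {O : Set (EuclideanSpace ℝ (Fin 2))} (hO : IsOpen O)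
    {ψ u : EuclideanSpace ℝ (Fin 2) → ℝ} (hψ : ContDiff ℝ ∞ ψ) (hψO : tsupport ψ ⊆ O)
    (hu : ContDiffOn ℝ 1 u (O ∩ halfPlane)) : ContDiffOn ℝ 1 (fun x => ψ x * u x) halfPlane := by
  intro x hxH
  by_cases hx : x ∈ O
  · have h := hu x ⟨hx, hxH⟩
    rw [inter_comm, contDiffWithinAt_inter (hO.mem_nhds hx)] at h
    exact ((hψ.of_le (by simp)).contDiffAt.contDiffWithinAt).mul h
  · have : (fun y => ψ y * u y) =ᶠ[𝓝 x] fun _ => 0 := by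
      filter_upwards [(isClosed_tsupport ψ).isOpen_compl.mem_nhds fun h => hx (hψO h)] with y hy
      rw [image_eq_zero_of_notMem_tsupport hy, zero_mul]
    exact (contDiffAt_const.congr_of_eventuallyEq this).contDiffWithinAt

/-- This is the identity `d(A₀ dv₁ - A₁ dv₀) = div A dv₀ ∧ dv₁` for the cut off radial field `A`,
pulled back by `V`. It makes the counting density exact, with a primitive that is the angular form
wherever `V` is at distance at least `δ` from `a`. -/
theorem jac2_radial {a : EuclideanSpace ℝ (Fin 2)} {δ : ℝ} (hδ : 0 < δ)
    {V : EuclideanSpace ℝ (Fin 2) → EuclideanSpace ℝ (Fin 2)} {y : EuclideanSpace ℝ (Fin 2)}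
    (hy : y ∈ halfPlane) (hV : DifferentiableWithinAt ℝ V halfPlane y) :
    jac2 (fun x => radialField a δ 0 (V x)) (fun x => V x 1) y -
      jac2 (fun x => radialField a δ 1 (V x)) (fun x => V x 0) y =
      radialBump a δ (V y) * (fderivWithin ℝ V halfPlane y).det := by
  have hu := uniqueDiffOn_halfPlane y hy
  have hi : ∀ i : Fin 2, fderivWithin ℝ (fun y => V y i) halfPlane y =
      (EuclideanSpace.proj i : EuclideanSpace ℝ (Fin 2) →L[ℝ] ℝ).comp (fderivWithin ℝ V halfPlane y) :=
    fun i => ((EuclideanSpace.proj i : EuclideanSpace ℝ (Fin 2) →L[ℝ] ℝ).hasFDerivAt.comp_hasFDerivWithinAt y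
      hV.hasFDerivWithinAt).fderivWithin hu
  have hr : ∀ i : Fin 2, fderivWithin ℝ (fun y => radialField a δ i (V y)) halfPlane y =
      (fderiv ℝ (radialField a δ i) (V y)).comp (fderivWithin ℝ V halfPlane y) :=
    fun i => ((((contDiff_radialField a hδ i).differentiable (by simp)) (V y)).hasFDerivAt.comp_hasFDerivWithinAt y
      hV.hasFDerivWithinAt).fderivWithin hu
  have hp : ∀ (i : Fin 2) (w : EuclideanSpace ℝ (Fin 2)),
      (EuclideanSpace.proj i : EuclideanSpace ℝ (Fin 2) →L[ℝ] ℝ) w = w i := fun _ _ => rfl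
  have hsum : ∀ (A : EuclideanSpace ℝ (Fin 2) →L[ℝ] ℝ) (w : EuclideanSpace ℝ (Fin 2)),
      A w = w 0 * A (stdVec 0) + w 1 * A (stdVec 1) := by
    intro A w
    conv_lhs => rw [← planePt_eta w]
    simp [planePt]
  rw [radialBump_eq_divergence a hδ, clm_det_eq_matrix_det, Matrix.det_fin_two, jac2, jac2, hi, hi, hr, hr]
  simp only [ContinuousLinearMap.comp_apply, Matrix.of_apply, hp]
  generalize fderivWithin ℝ V halfPlane y = D
  rw [hsum (fderiv ℝ (radialField a δ 0) (V y)) (D (stdVec 0)),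
    hsum (fderiv ℝ (radialField a δ 0) (V y)) (D (stdVec 1)),
    hsum (fderiv ℝ (radialField a δ 1) (V y)) (D (stdVec 0)),
    hsum (fderiv ℝ (radialField a δ 1) (V y)) (D (stdVec 1))]
  ring

theorem ae_pos_of_halfPlane : ∀ᵐ y : EuclideanSpace ℝ (Fin 2), y ∈ halfPlane → 0 < y 0 := by
  have h : volume ((EuclideanSpace.proj 0 : EuclideanSpace ℝ (Fin 2) →L[ℝ] ℝ).ker :
      Set (EuclideanSpace ℝ (Fin 2))) = 0 := by
    apply Measure.addHaar_submodule
    intro h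
    have : stdVec 0 ∈ (EuclideanSpace.proj 0 : EuclideanSpace ℝ (Fin 2) →L[ℝ] ℝ).ker := by
      rw [h]; trivial
    simp at this
  filter_upwards [compl_mem_ae_iff.2 h] with y hy hyH
  refine lt_of_le_of_ne hyH fun h0 => hy ?_
  change y 0 = 0
  exact h0.symm

/-- Under a modification of a map on a compact part of the half plane, the signed number of
preimages of a regular value and the variation of the angle along the boundary change in the same
way. -/
theorem sum_sign_det_sub_eq_boundary {O T : Set (EuclideanSpace ℝ (Fin 2))} (hO : IsOpen O)
    (hT : IsCompact T) (hTO : T ⊆ O)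
    {V₀ V₁ : EuclideanSpace ℝ (Fin 2) → EuclideanSpace ℝ (Fin 2)}
    (h₀ : ContDiffOn ℝ 1 V₀ (O ∩ halfPlane)) (h₁ : ContDiffOn ℝ 1 V₁ (O ∩ halfPlane))
    (heq : ∀ x ∈ O ∩ halfPlane, x ∉ T → V₀ x = V₁ x) {a : EuclideanSpace ℝ (Fin 2)}
    {P₀ P₁ : Finset (EuclideanSpace ℝ (Fin 2))}
    (hP₀ : ∀ x, x ∈ P₀ ↔ x ∈ O ∩ halfPlane ∧ V₀ x = a)
    (hP₁ : ∀ x, x ∈ P₁ ↔ x ∈ O ∩ halfPlane ∧ V₁ x = a)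
    (i₀ : ∀ x ∈ P₀, 0 < x 0) (i₁ : ∀ x ∈ P₁, 0 < x 0)
    (d₀ : ∀ x ∈ P₀, (fderiv ℝ V₀ x).det ≠ 0) (d₁ : ∀ x ∈ P₁, (fderiv ℝ V₁ x).det ≠ 0) :
    2 * Real.pi * ((∑ x ∈ P₁, ((SignType.sign (fderiv ℝ V₁ x).det : SignType) : ℝ)) -
      ∑ x ∈ P₀, ((SignType.sign (fderiv ℝ V₀ x).det : SignType) : ℝ)) =
    - ∫ t in {t : ℝ | planePt 0 t ∈ T},
      (angularForm (V₁ (planePt 0 t) - a) (fderivWithin ℝ V₁ halfPlane (planePt 0 t) (stdVec 1)) -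
        angularForm (V₀ (planePt 0 t) - a) (fderivWithin ℝ V₀ halfPlane (planePt 0 t) (stdVec 1))) := by
  classical
  -- The argument is that of dimension three, with `radialBump` as density. Its primitive now
  -- contributes along the boundary line, but on the part of that line lying in `Q` both maps are
  -- farther from `a` than the cutoff radius, so the primitive is the angular form on the part lying
  -- in `T`.
  have hK : IsCompact (T ∪ (P₀ ∪ P₁ : Set (EuclideanSpace ℝ (Fin 2)))) :=
    hT.union (P₀.finite_toSet.isCompact.union P₁.finite_toSet.isCompact)
  obtain ⟨Q, hQ, hKQ, hQO⟩ := exists_compact_between hK hO (by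
    rintro x (h | h | h)
    exacts [hTO h, ((hP₀ x).1 h).1.1, ((hP₁ x).1 h).1.1])
  obtain ⟨ψ, hψ, hψc, hψO, hψ1⟩ := exists_cutoff hO hQ hQO
  have hQH : IsCompact (Q ∩ halfPlane) := hQ.inter_right isClosed_halfPlane
  -- the statements for one map
  have main : ∀ {V : EuclideanSpace ℝ (Fin 2) → EuclideanSpace ℝ (Fin 2)}
      {P : Finset (EuclideanSpace ℝ (Fin 2))}, ContDiffOn ℝ 1 V (O ∩ halfPlane) →
      (∀ x, x ∈ P ↔ x ∈ O ∩ halfPlane ∧ V x = a) → (∀ x ∈ P, 0 < x 0) →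
      (∀ x ∈ P, (fderiv ℝ V x).det ≠ 0) → (∀ x ∈ P, x ∈ interior Q) →
      ∀ᶠ δ : ℝ in 𝓝[>] 0,
        (∫ x in Q ∩ halfPlane, radialBump a (δ / 2) (V x) * (fderivWithin ℝ V halfPlane x).det =
          (∑ x ∈ P, ((SignType.sign (fderiv ℝ V x).det : SignType) : ℝ)) * (2 * Real.pi)) ∧
        ∀ t, planePt 0 t ∈ Q → δ / 2 < ‖V (planePt 0 t) - a‖ := by
    intro V P hV hP hi hd hPQ
    have hcd : ∀ x ∈ O ∩ halfPlane, 0 < x 0 → ContDiffAt ℝ 1 V x := fun x hx hx0 =>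
      hV.contDiffAt (inter_mem (hO.mem_nhds hx.1) (mem_interior_halfPlane hx0))
    have c := exists_setIntegral_comp_mul_det_eq volume hQH (P := P) (a := a)
      (hV.continuousOn.mono (inter_subset_inter_left _ hQO))
      (fun y hy => hcd y ((hP y).1 hy).1 (hi y hy)) (fun y hy => ((hP y).1 hy).2) hd
      (fun y hy => by
        rw [interior_inter]
        exact ⟨hPQ y hy, mem_interior_iff_mem_nhds.2 (mem_interior_halfPlane (hi y hy))⟩)
      (fun y hy hya => (hP y).2 ⟨⟨hQO hy.1, hy.2⟩, hya⟩)
    -- The fibre lies in the open half plane, so the image of the boundary part of `Q` is a compact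
    -- set missing `a`.
    have hB : IsCompact {x : EuclideanSpace ℝ (Fin 2) | x ∈ Q ∧ x 0 = 0} :=
      hQ.inter_right (isClosed_eq (by fun_prop) continuous_const)
    have hBc : (V '' {x : EuclideanSpace ℝ (Fin 2) | x ∈ Q ∧ x 0 = 0})ᶜ ∈ 𝓝 a := by
      apply IsOpen.mem_nhds
      · exact (hB.image_of_continuousOn (hV.continuousOn.mono fun x hx =>
          ⟨hQO hx.1, hx.2.symm.le⟩)).isClosed.isOpen_compl
      · rintro ⟨x, ⟨hxQ, hx0⟩, hxa⟩
        exact (hi x ((hP x).2 ⟨⟨hQO hxQ, hx0.symm.le⟩, hxa⟩)).ne' hx0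
    filter_upwards [c, eventually_ball_subset_of_mem_nhds hBc, self_mem_nhdsWithin] with δ hδ1 hδ2 hδ0
    have hδ0' : (0:ℝ) < δ := hδ0
    -- The bump of radius `δ / 2` may be nonzero on the bounding circle; halving puts its support in
    -- the open ball of radius `δ` required by the counting lemma.
    have hδ2' : 0 < δ / 2 := by linarith
    constructor
    · rw [← integral_radialBump a hδ2', ← hδ1 (radialBump a (δ / 2))
        ((continuous_radialBump a hδ2').integrable_of_hasCompactSupport
          (hasCompactSupport_radialBump a hδ2')) fun z hz => by
            by_contra h
            apply hz (radialBump_eq_zero a hδ2' _)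
            rw [Metric.mem_ball, dist_eq_norm, not_lt] at h
            linarith]
      -- Derivatives within the half plane are ordinary ones off the boundary line, which is
      -- negligible.
      apply setIntegral_congr_ae hQH.isClosed.measurableSet
      filter_upwards [ae_pos_of_halfPlane] with x hx hxQ
      rw [fderivWithin_of_mem_nhds (mem_interior_halfPlane (hx hxQ.2))]
    · intro t ht
      have h := mt (@hδ2 (V (planePt 0 t))) (fun h => h ⟨planePt 0 t, ⟨ht, by simp⟩, rfl⟩)
      rw [Metric.mem_ball, dist_eq_norm, not_lt] at h
      linarith
  obtain ⟨δ, ⟨⟨e₀, b₀⟩, e₁, b₁⟩, hδ⟩ := (((main h₀ hP₀ i₀ d₀ fun y hy => hKQ (Or.inr (Or.inl hy))).and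
    (main h₁ hP₁ i₁ d₁ fun y hy => hKQ (Or.inr (Or.inr hy)))).and self_mem_nhdsWithin).exists
  have hδ' : 0 < δ / 2 := by have : (0:ℝ) < δ := hδ
                             linarith
  set η := δ / 2 with hη
  have comp : ∀ {V : EuclideanSpace ℝ (Fin 2) → EuclideanSpace ℝ (Fin 2)}, ContDiffOn ℝ 1 V (O ∩ halfPlane) →
      ∀ {g : EuclideanSpace ℝ (Fin 2) → ℝ}, ContDiff ℝ 1 g →
      ContDiffOn ℝ 1 (fun x => ψ x * g (V x)) halfPlane := fun hV g hg =>
    contDiffOn_cutoff_mul hO hψ hψO (hg.comp_contDiffOn hV)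
  have hproj : ∀ i : Fin 2, ContDiff ℝ 1 fun z : EuclideanSpace ℝ (Fin 2) => z i := fun i => by fun_prop
  have hrad := contDiff_radialField a hδ'
  let J : (EuclideanSpace ℝ (Fin 2) → EuclideanSpace ℝ (Fin 2)) → EuclideanSpace ℝ (Fin 2) → ℝ :=
    fun V y => jac2 (fun x => ψ x * radialField a η 0 (V x)) (fun x => ψ x * V x 1) y -
      jac2 (fun x => ψ x * radialField a η 1 (V x)) (fun x => ψ x * V x 0) y
  let B : (EuclideanSpace ℝ (Fin 2) → EuclideanSpace ℝ (Fin 2)) → ℝ → ℝ := fun V t =>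
    ψ (planePt 0 t) * radialField a η 0 (V (planePt 0 t)) *
        fderivWithin ℝ (fun x => ψ x * V x 1) halfPlane (planePt 0 t) (stdVec 1) -
      ψ (planePt 0 t) * radialField a η 1 (V (planePt 0 t)) *
        fderivWithin ℝ (fun x => ψ x * V x 0) halfPlane (planePt 0 t) (stdVec 1)
  have hz : ∀ y, y ∉ tsupport ψ → ψ y = 0 := fun y hy => image_eq_zero_of_notMem_tsupport hy
  have hzd : ∀ y ∈ halfPlane, y ∉ tsupport ψ → ∀ u : EuclideanSpace ℝ (Fin 2) → ℝ,
      fderivWithin ℝ (fun x => ψ x * u x) halfPlane y = 0 := by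
    intro y hyH hy u
    have h0 : (fun x => ψ x * u x) =ᶠ[𝓝[halfPlane] y] fun _ => 0 := by
      filter_upwards [mem_nhdsWithin_of_mem_nhds ((isClosed_tsupport ψ).isOpen_compl.mem_nhds hy)] with x hx
      rw [hz x hx, zero_mul]
    rw [h0.fderivWithin_eq (by rw [hz y hy, zero_mul])]
    simp
  have cdf : ∀ {u : EuclideanSpace ℝ (Fin 2) → ℝ}, ContDiffOn ℝ 1 u halfPlane → ∀ w,
      ContinuousOn (fun y => fderivWithin ℝ u halfPlane y w) halfPlane := fun hu w =>
    (hu.continuousOn_fderivWithin uniqueDiffOn_halfPlane (by simp)).clm_apply continuousOn_const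
  have cj : ∀ {p v : EuclideanSpace ℝ (Fin 2) → ℝ}, ContDiffOn ℝ 1 p halfPlane →
      ContDiffOn ℝ 1 v halfPlane → ContinuousOn (jac2 p v) halfPlane := fun hp hv =>
    ((cdf hp _).mul (cdf hv _)).sub ((cdf hp _).mul (cdf hv _))
  have supp_int : ∀ {f : EuclideanSpace ℝ (Fin 2) → ℝ}, ContinuousOn f halfPlane →
      (∀ y ∈ halfPlane, y ∉ tsupport ψ → f y = 0) → IntegrableOn f halfPlane := by
    intro f hf h0
    have hc : IsCompact (tsupport ψ ∩ halfPlane) := IsCompact.inter_right hψc isClosed_halfPlane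
    refine IntegrableOn.of_forall_sdiff_eq_zero
      ((hf.mono inter_subset_right).integrableOn_compact hc) isClosed_halfPlane.measurableSet ?_
    rintro y ⟨hyH, hy⟩
    exact h0 y hyH fun h => hy ⟨h, hyH⟩
  have cline : Continuous fun t : ℝ => planePt 0 t := by unfold planePt; fun_prop
  have mline : MapsTo (fun t : ℝ => planePt 0 t) univ halfPlane := fun t _ => planePt_mem.2 le_rfl
  have hcs : IsCompact {t : ℝ | planePt 0 t ∈ tsupport ψ} := by
    have : Isometry fun t : ℝ => planePt 0 t := by
      refine Isometry.of_dist_eq fun s t => ?_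
      rw [dist_eq_norm, EuclideanSpace.norm_eq, Fin.sum_univ_two]
      simp [Real.sqrt_sq_eq_abs, Real.dist_eq]
    exact this.isClosedEmbedding.isCompact_preimage hψc
  have lint : ∀ {f : ℝ → ℝ}, Continuous f → (∀ t, planePt 0 t ∉ tsupport ψ → f t = 0) →
      Integrable f := fun hf h0 =>
    hf.integrable_of_hasCompactSupport (HasCompactSupport.intro hcs fun t ht => h0 t ht)
  -- The minus sign is one of orientation: the boundary of `y 0 ≥ 0`, positively oriented, runs in
  -- the direction of decreasing `y 1`.
  have stokes : ∀ {V : EuclideanSpace ℝ (Fin 2) → EuclideanSpace ℝ (Fin 2)},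
      ContDiffOn ℝ 1 V (O ∩ halfPlane) →
      IntegrableOn (J V) halfPlane ∧ Integrable (B V) ∧
      ∫ y in halfPlane, J V y = - ∫ t : ℝ, B V t := by
    intro V hV
    have ij : ∀ k l, IntegrableOn (jac2 (fun x => ψ x * radialField a η k (V x)) (fun x => ψ x * V x l)) halfPlane := by
      intro k l
      refine supp_int (cj (comp hV (hrad k)) (comp hV (hproj l))) fun y hyH hy => ?_
      rw [jac2, hzd y hyH hy fun x => radialField a η k (V x)]
      simp
    have ib : ∀ k l, Integrable fun t : ℝ => ψ (planePt 0 t) * radialField a η k (V (planePt 0 t)) *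
        fderivWithin ℝ (fun x => ψ x * V x l) halfPlane (planePt 0 t) (stdVec 1) := by
      intro k l
      refine lint ?_ fun t ht => by rw [hz _ ht]; simp
      rw [← continuousOn_univ]
      exact ((comp hV (hrad k)).continuousOn.comp cline.continuousOn mline).mul
        ((cdf (comp hV (hproj l)) _).comp cline.continuousOn mline)
    have st : ∀ k l, ∫ y in halfPlane, jac2 (fun x => ψ x * radialField a η k (V x)) (fun x => ψ x * V x l) y =
        - ∫ t : ℝ, ψ (planePt 0 t) * radialField a η k (V (planePt 0 t)) *
        fderivWithin ℝ (fun x => ψ x * V x l) halfPlane (planePt 0 t) (stdVec 1) := fun k l =>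
      integral_halfPlane (comp hV (hrad k)) (comp hV (hproj l)) (K := tsupport ψ) hψc
        fun y _ hy => by rw [hz y hy, zero_mul]
    refine ⟨(ij 0 1).sub (ij 1 0), (ib 0 1).sub (ib 1 0), ?_⟩
    rw [integral_sub (ij 0 1) (ij 1 0), integral_sub (ib 0 1) (ib 1 0), st, st]
    ring
  -- the integrands on `Q`
  have loc : ∀ y ∈ Q, ∀ u : EuclideanSpace ℝ (Fin 2) → ℝ,
      fderivWithin ℝ (fun x => ψ x * u x) halfPlane y = fderivWithin ℝ u halfPlane y := by
    intro y hy u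
    have hy1 : ∀ᶠ x in 𝓝 y, ψ x = 1 := hψ1.filter_mono (nhds_le_nhdsSet hy)
    have : (fun x => ψ x * u x) =ᶠ[𝓝 y] u := hy1.mono fun x hx => by simp [hx]
    exact Filter.EventuallyEq.fderivWithin_eq (this.filter_mono nhdsWithin_le_nhds) this.eq_of_nhds
  have hdw : ∀ {V : EuclideanSpace ℝ (Fin 2) → EuclideanSpace ℝ (Fin 2)},
      ContDiffOn ℝ 1 V (O ∩ halfPlane) → ∀ y ∈ O ∩ halfPlane, DifferentiableWithinAt ℝ V halfPlane y := by
    intro V hV y hy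
    have h := hV.differentiableOn (by simp) y hy
    rwa [inter_comm, differentiableWithinAt_inter (hO.mem_nhds hy.1)] at h
  have onQ : ∀ {V : EuclideanSpace ℝ (Fin 2) → EuclideanSpace ℝ (Fin 2)}, ContDiffOn ℝ 1 V (O ∩ halfPlane) →
      ∫ y in Q ∩ halfPlane, J V y =
        ∫ y in Q ∩ halfPlane, radialBump a η (V y) * (fderivWithin ℝ V halfPlane y).det := by
    intro V hV
    apply setIntegral_congr_fun hQH.isClosed.measurableSet
    intro y hy
    simp only [J, jac2, loc y hy.1]
    exact jac2_radial hδ' hy.2 (hdw hV y ⟨hQO hy.1, hy.2⟩)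
  have onT : ∀ {V : EuclideanSpace ℝ (Fin 2) → EuclideanSpace ℝ (Fin 2)}, ContDiffOn ℝ 1 V (O ∩ halfPlane) →
      (∀ t, planePt 0 t ∈ Q → η < ‖V (planePt 0 t) - a‖) → ∀ t, planePt 0 t ∈ T → B V t =
        angularForm (V (planePt 0 t) - a) (fderivWithin ℝ V halfPlane (planePt 0 t) (stdVec 1)) := by
    intro V hV hb t ht
    have htQ : planePt 0 t ∈ Q := interior_subset (hKQ (Or.inl ht))
    have hH : planePt 0 t ∈ halfPlane := planePt_mem.2 le_rfl
    have hψt : ψ (planePt 0 t) = 1 := (hψ1.filter_mono (nhds_le_nhdsSet htQ)).self_of_nhds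
    have hi : ∀ i : Fin 2, fderivWithin ℝ (fun y => V y i) halfPlane (planePt 0 t) (stdVec 1) =
        (fderivWithin ℝ V halfPlane (planePt 0 t) (stdVec 1)) i := by
      intro i
      have := ((EuclideanSpace.proj i : EuclideanSpace ℝ (Fin 2) →L[ℝ] ℝ).hasFDerivAt.comp_hasFDerivWithinAt _
        (hdw hV _ ⟨hQO htQ, hH⟩).hasFDerivWithinAt).fderivWithin (uniqueDiffOn_halfPlane _ hH)
      exact congrArg (fun A : EuclideanSpace ℝ (Fin 2) →L[ℝ] ℝ => A (stdVec 1)) this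
    have hinv : invCutoff η (‖V (planePt 0 t) - a‖ ^ 2) = 1 / ‖V (planePt 0 t) - a‖ ^ 2 :=
      invCutoff_of_le hδ' (pow_le_pow_left₀ hδ'.le (hb t htQ).le 2)
    simp only [B, loc _ htQ, hψt, hi, radialField, hinv, angularForm, PiLp.sub_apply]
    ring
  have neg : ∀ y ∈ halfPlane, y ∉ T → ∀ g : EuclideanSpace ℝ (Fin 2) → ℝ,
      ψ y * g (V₀ y) = ψ y * g (V₁ y) ∧
      fderivWithin ℝ (fun y => ψ y * g (V₀ y)) halfPlane y =
        fderivWithin ℝ (fun y => ψ y * g (V₁ y)) halfPlane y := by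
    intro y hyH hyT g
    have pt : ∀ x ∈ halfPlane, x ∉ T → ψ x * g (V₀ x) = ψ x * g (V₁ x) := by
      intro x hxH hxT
      by_cases hxO : x ∈ O
      · rw [heq x ⟨hxO, hxH⟩ hxT]
      · rw [hz x fun h => hxO (hψO h), zero_mul, zero_mul]
    refine ⟨pt y hyH hyT, Filter.EventuallyEq.fderivWithin_eq ?_ (pt y hyH hyT)⟩
    filter_upwards [self_mem_nhdsWithin, mem_nhdsWithin_of_mem_nhds
      (hT.isClosed.isOpen_compl.mem_nhds hyT)] with x hx hxT
    exact pt x hx hxT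
  obtain ⟨jI₀, bI₀, s₀⟩ := stokes h₀
  obtain ⟨jI₁, bI₁, s₁⟩ := stokes h₁
  have offJ : ∫ y in halfPlane \ (Q ∩ halfPlane), J V₀ y = ∫ y in halfPlane \ (Q ∩ halfPlane), J V₁ y := by
    apply setIntegral_congr_fun (isClosed_halfPlane.measurableSet.diff hQH.isClosed.measurableSet)
    rintro y ⟨hyH, hy⟩
    have hyT : y ∉ T := fun h => hy ⟨interior_subset (hKQ (Or.inl h)), hyH⟩
    simp only [J, jac2, (neg y hyH hyT (radialField a η 0)).2, (neg y hyH hyT (radialField a η 1)).2,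
      (neg y hyH hyT fun z => z 0).2, (neg y hyH hyT fun z => z 1).2]
  have hTm : MeasurableSet {t : ℝ | planePt 0 t ∈ T} := (hT.isClosed.preimage cline).measurableSet
  have offB : ∫ t in {t : ℝ | planePt 0 t ∈ T}ᶜ, B V₀ t = ∫ t in {t : ℝ | planePt 0 t ∈ T}ᶜ, B V₁ t := by
    apply setIntegral_congr_fun hTm.compl
    intro t ht
    have hH : planePt 0 t ∈ halfPlane := planePt_mem.2 le_rfl
    simp only [B, (neg _ hH ht (radialField a η 0)).1, (neg _ hH ht (radialField a η 1)).1,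
      (neg _ hH ht fun z => z 0).2, (neg _ hH ht fun z => z 1).2]
  have sJ₀ := setIntegral_sdiff hQH.isClosed.measurableSet jI₀ inter_subset_right
  have sJ₁ := setIntegral_sdiff hQH.isClosed.measurableSet jI₁ inter_subset_right
  have sB₀ := integral_add_compl hTm bI₀
  have sB₁ := integral_add_compl hTm bI₁
  have tB : ∫ t in {t : ℝ | planePt 0 t ∈ T},
      (angularForm (V₁ (planePt 0 t) - a) (fderivWithin ℝ V₁ halfPlane (planePt 0 t) (stdVec 1)) -
        angularForm (V₀ (planePt 0 t) - a) (fderivWithin ℝ V₀ halfPlane (planePt 0 t) (stdVec 1))) =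
      (∫ t in {t : ℝ | planePt 0 t ∈ T}, B V₁ t) - ∫ t in {t : ℝ | planePt 0 t ∈ T}, B V₀ t := by
    rw [← integral_sub bI₁.integrableOn bI₀.integrableOn]
    apply setIntegral_congr_fun hTm
    intro t ht
    simp only [onT h₁ b₁ t ht, onT h₀ b₀ t ht]
  have q₀ := onQ h₀
  have q₁ := onQ h₁
  rw [e₀] at q₀
  rw [e₁] at q₁
  rw [tB]
  linarith

end

/-! ### Signed counts on manifolds, finiteness of regular fibres, Sard's theorem. -/

noncomputable section

open MeasureTheory

section Count

variable {d : ℕ} {H : Type*} [TopologicalSpace H]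
  (I : ModelWithCorners ℝ (EuclideanSpace ℝ (Fin d)) H)
  {N : Type*} [TopologicalSpace N] [ChartedSpace H N]

/-- The Jacobian determinant of `F : N → ℝᵈ` at `x`, with respect to the preferred chart at `x`. -/
def mdet (F : N → EuclideanSpace ℝ (Fin d)) (x : N) : ℝ :=
  ContinuousLinearMap.det (show EuclideanSpace ℝ (Fin d) →L[ℝ] EuclideanSpace ℝ (Fin d) from
    mfderiv I 𝓘(ℝ, EuclideanSpace ℝ (Fin d)) F x)

/-- `σ x` tells whether the preferred chart at `x` preserves a continuous orientation over `A`. -/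
structure IsOrientationSign (σ : N → SignType) (A : Set N) : Prop where
  ne_zero : ∀ x ∈ A, σ x ≠ 0
  eventually_eq : ∀ x₀ ∈ A, ∀ᶠ x in 𝓝 x₀, x ∈ A →
    SignType.sign (mdet I (extChartAt I x₀) x) = σ x₀ * σ x

/-- The sign with which a point counts in its fibre. -/
def localSign (σ : N → SignType) (F : N → EuclideanSpace ℝ (Fin d)) (x : N) : ℤ :=
  ((σ x * SignType.sign (mdet I F x) : SignType) : ℤ)

/-- The signed number of points of `A` in the fibre of `F` over `a`. -/
def degCount (σ : N → SignType) (A : Set N) (F : N → EuclideanSpace ℝ (Fin d))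
    (a : EuclideanSpace ℝ (Fin d)) : ℤ :=
  ∑ᶠ x ∈ {x ∈ A | F x = a}, localSign I σ F x

variable {I}

theorem mdet_congr {F G : N → EuclideanSpace ℝ (Fin d)} {x : N} (h : F =ᶠ[𝓝 x] G) :
    mdet I F x = mdet I G x := by
  unfold mdet
  have : mfderiv I 𝓘(ℝ, EuclideanSpace ℝ (Fin d)) F x = mfderiv I 𝓘(ℝ, EuclideanSpace ℝ (Fin d)) G x :=
    h.mfderiv_eq
  simp only [this]

variable [IsManifold I 1 N]

/-- The chain rule through the chart at `x₀`, at a point that need not be its centre and may lie on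
the boundary, whence the derivative within `range I`. -/
theorem hasFDerivWithinAt_chart {F : N → EuclideanSpace ℝ (Fin d)} {x₀ x : N}
    (hx : x ∈ (extChartAt I x₀).source) (hF : MDifferentiableAt I 𝓘(ℝ, EuclideanSpace ℝ (Fin d)) F x) :
    ∃ D : EuclideanSpace ℝ (Fin d) →L[ℝ] EuclideanSpace ℝ (Fin d),
      HasFDerivWithinAt (F ∘ (extChartAt I x₀).symm) D (range I) (extChartAt I x₀ x) ∧
      (mfderiv I 𝓘(ℝ, EuclideanSpace ℝ (Fin d)) F x :
        EuclideanSpace ℝ (Fin d) →L[ℝ] EuclideanSpace ℝ (Fin d)) =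
        D.comp (mfderiv I 𝓘(ℝ, EuclideanSpace ℝ (Fin d)) (extChartAt I x₀) x :
          EuclideanSpace ℝ (Fin d) →L[ℝ] EuclideanSpace ℝ (Fin d)) := by
  have hy : extChartAt I x₀ x ∈ (extChartAt I x₀).target := (extChartAt I x₀).map_source hx
  have hxx : (extChartAt I x₀).symm (extChartAt I x₀ x) = x := (extChartAt I x₀).left_inv hx
  have h1 : HasMFDerivWithinAt 𝓘(ℝ, EuclideanSpace ℝ (Fin d)) I (extChartAt I x₀).symm (range I)
      (extChartAt I x₀ x) _ := (mdifferentiableWithinAt_extChartAt_symm hy).hasMFDerivWithinAt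
  have hF' : MDifferentiableAt I 𝓘(ℝ, EuclideanSpace ℝ (Fin d)) F
      ((extChartAt I x₀).symm (extChartAt I x₀ x)) := by rwa [hxx]
  have h2 := hF'.hasMFDerivAt.comp_hasMFDerivWithinAt (extChartAt I x₀ x) h1
  refine ⟨_, h2.hasFDerivWithinAt, ?_⟩
  have h3 := mfderivWithin_extChartAt_symm_comp_mfderiv_extChartAt' (I := I) (x := x₀) hx
  ext1 v
  have h4 := congrArg (fun A : TangentSpace I x →L[ℝ] TangentSpace I x => A v) h3
  simp only [ContinuousLinearMap.comp_apply] at h4 ⊢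
  have h5 : ∀ x', x' = x → ∀ v : EuclideanSpace ℝ (Fin d),
    (mfderiv I 𝓘(ℝ, EuclideanSpace ℝ (Fin d)) F x' : EuclideanSpace ℝ (Fin d) →L[ℝ] EuclideanSpace ℝ (Fin d)) v =
    (mfderiv I 𝓘(ℝ, EuclideanSpace ℝ (Fin d)) F x : EuclideanSpace ℝ (Fin d) →L[ℝ] EuclideanSpace ℝ (Fin d)) v := by
    rintro _ rfl v; rfl
  erw [h5 _ hxx, h4]
  rfl

theorem mdet_eq_mul {F : N → EuclideanSpace ℝ (Fin d)} {x₀ x : N}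
    (hx : x ∈ (extChartAt I x₀).source) (hF : MDifferentiableAt I 𝓘(ℝ, EuclideanSpace ℝ (Fin d)) F x) :
    mdet I F x = (fderivWithin ℝ (F ∘ (extChartAt I x₀).symm) (range I) (extChartAt I x₀ x)).det *
      mdet I (extChartAt I x₀) x := by
  obtain ⟨D, h1, h2⟩ := hasFDerivWithinAt_chart hx hF
  have hu : UniqueDiffWithinAt ℝ (range I) (extChartAt I x₀ x) :=
    I.uniqueDiffOn _ (extChartAt_target_subset_range x₀ ((extChartAt I x₀).map_source hx))
  rw [h1.fderivWithin hu]
  unfold mdet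
  change ContinuousLinearMap.det (mfderiv I 𝓘(ℝ, EuclideanSpace ℝ (Fin d)) F x :
        EuclideanSpace ℝ (Fin d) →L[ℝ] EuclideanSpace ℝ (Fin d)) = _
  rw [h2]
  exact LinearMap.det_comp _ _

theorem mdet_extChartAt_ne_zero {x₀ x : N} (hx : x ∈ (extChartAt I x₀).source) :
    mdet I (extChartAt I x₀) x ≠ 0 := by
  obtain ⟨e, he⟩ := isInvertible_mfderiv_extChartAt (I := I) hx
  unfold mdet
  rw [← he]
  exact (LinearEquiv.isUnit_det' (e.toLinearEquiv : EuclideanSpace ℝ (Fin d) ≃ₗ[ℝ] EuclideanSpace ℝ (Fin d))).ne_zero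

theorem mdet_extChartAt_self (x : N) : mdet I (extChartAt I x) x = 1 := by
  unfold mdet
  rw [mfderiv_extChartAt_self]
  exact LinearMap.det_id

/-- The differential in the chart is injective, hence bounded below, which isolates `x` in its
fibre. A derivative within `range I` is enough for this, so boundary points are allowed. -/
theorem eventually_ne_of_mdet_ne_zero {F : N → EuclideanSpace ℝ (Fin d)} {x : N}
    (hF : MDifferentiableAt I 𝓘(ℝ, EuclideanSpace ℝ (Fin d)) F x) (hd : mdet I F x ≠ 0)
    (c : EuclideanSpace ℝ (Fin d)) : ∀ᶠ z in 𝓝[≠] x, F z ≠ c := by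
  obtain ⟨D, h1, h2⟩ := hasFDerivWithinAt_chart (mem_extChartAt_source x) hF
  have hD : D.det ≠ 0 := by
    have := mdet_eq_mul (mem_extChartAt_source x) hF
    have hu : UniqueDiffWithinAt ℝ (range I) (extChartAt I x x) :=
      I.uniqueDiffOn _ (extChartAt_target_subset_range x (mem_extChartAt_target x))
    rw [h1.fderivWithin hu, mdet_extChartAt_self, mul_one] at this
    rwa [← this]
  have hker : LinearMap.ker (D : EuclideanSpace ℝ (Fin d) →ₗ[ℝ] EuclideanSpace ℝ (Fin d)) = ⊥ :=
    LinearMap.ker_eq_bot.2 (LinearMap.equivOfDetNeZero _ hD).injective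
  obtain ⟨C, -, hC⟩ := LinearMap.exists_antilipschitzWith _ hker
  have h3 := h1.eventually_ne (c := c) ⟨C, hC⟩
  have h4 : Tendsto (extChartAt I x) (𝓝[≠] x) (𝓝[range I \ {extChartAt I x x}] (extChartAt I x x)) := by
    apply tendsto_nhdsWithin_of_tendsto_nhds_of_eventually_within
    · exact (continuousAt_extChartAt x).tendsto.mono_left nhdsWithin_le_nhds
    · filter_upwards [self_mem_nhdsWithin, mem_nhdsWithin_of_mem_nhds (extChartAt_source_mem_nhds (I := I) x)]
        with z hz hzs
      refine ⟨extChartAt_target_subset_range x ((extChartAt I x).map_source hzs), fun h => hz ?_⟩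
      exact (extChartAt I x).injOn hzs (mem_extChartAt_source x) h
  filter_upwards [h4.eventually h3, mem_nhdsWithin_of_mem_nhds (extChartAt_source_mem_nhds (I := I) x)]
    with z hz hzs
  simpa only [Function.comp_apply, (extChartAt I x).left_inv hzs] using hz

/-- The fibre over a regular value is finite in a compact set. -/
theorem finite_fibre [T2Space N] {F : N → EuclideanSpace ℝ (Fin d)} {K : Set N} (hK : IsCompact K)
    (hF : ∀ x ∈ K, MDifferentiableAt I 𝓘(ℝ, EuclideanSpace ℝ (Fin d)) F x)
    {a : EuclideanSpace ℝ (Fin d)} (hd : ∀ x ∈ K, F x = a → mdet I F x ≠ 0) :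
    {x ∈ K | F x = a}.Finite := by
  by_contra h
  obtain ⟨x, hxK, hx⟩ := Set.Infinite.exists_accPt_of_subset_isCompact h hK fun z hz => hz.1
  rw [accPt_iff_frequently_nhdsNE] at hx
  have hxa : F x = a := by
    by_contra hne
    have : ∀ᶠ z in 𝓝[≠] x, F z ≠ a :=
      ((hF x hxK).continuousAt.eventually_ne hne).filter_mono nhdsWithin_le_nhds
    exact hx (this.mono fun z hz h => hz h.2)
  exact hx ((eventually_ne_of_mdet_ne_zero (hF x hxK) (hd x hxK hxa) a).mono fun z hz h => hz h.2)

/-- Sard's theorem in equal dimensions. -/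
theorem ae_regular {F : N → EuclideanSpace ℝ (Fin d)} {K : Set N} (hK : IsCompact K)
    (hF : ∀ x ∈ K, MDifferentiableAt I 𝓘(ℝ, EuclideanSpace ℝ (Fin d)) F x) :
    ∀ᵐ a : EuclideanSpace ℝ (Fin d), ∀ x ∈ K, F x = a → mdet I F x ≠ 0 := by
  have key : volume (F '' {x ∈ K | mdet I F x = 0}) = 0 := by
    -- Finitely many chart domains cover `K`. In one chart the claim is that a set where the
    -- Jacobian determinant vanishes has a null image.
    suffices h : ∀ T ⊆ K, (∃ x₀, T ⊆ (extChartAt I x₀).source) → volume (F '' {x ∈ T | mdet I F x = 0}) = 0 by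
      have h' : volume (F '' {x ∈ K ∩ K | mdet I F x = 0}) = 0 := by
         refine hK.induction_on (p := fun T => volume (F '' {x ∈ K ∩ T | mdet I F x = 0}) = 0) ?_ ?_ ?_ ?_
         · simp
         · intro s t hst ht
           exact measure_mono_null (image_mono (fun x hx => ⟨⟨hx.1.1, hst hx.1.2⟩, hx.2⟩ : {x ∈ K ∩ s | mdet I F x = 0} ⊆ {x ∈ K ∩ t | mdet I F x = 0})) ht
         · intro s t hs ht
           refine measure_mono_null ?_ (measure_union_null hs ht)
           rintro _ ⟨x, ⟨⟨hxK, hx | hx⟩, hx0⟩, rfl⟩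
           · exact Or.inl ⟨x, ⟨⟨hxK, hx⟩, hx0⟩, rfl⟩
           · exact Or.inr ⟨x, ⟨⟨hxK, hx⟩, hx0⟩, rfl⟩
         · intro x _
           exact ⟨_, mem_nhdsWithin_of_mem_nhds (extChartAt_source_mem_nhds (I := I) x),
             h _ inter_subset_left ⟨x, inter_subset_right⟩⟩
      simpa only [inter_self] using h'
    rintro T hTK ⟨x₀, hT⟩
    let φ := extChartAt I x₀
    have hsub : F '' {x ∈ T | mdet I F x = 0} ⊆
        (F ∘ φ.symm) '' (φ '' {x ∈ T | mdet I F x = 0}) := by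
      rintro _ ⟨x, hx, rfl⟩
      exact ⟨φ x, ⟨x, hx, rfl⟩, by simp [φ.left_inv (hT hx.1)]⟩
    refine measure_mono_null hsub ?_
    apply addHaar_image_eq_zero_of_det_fderivWithin_eq_zero volume
      (f' := fun y => fderivWithin ℝ (F ∘ φ.symm) (range I) y)
    · rintro _ ⟨x, hx, rfl⟩
      obtain ⟨D, h1, -⟩ := hasFDerivWithinAt_chart (hT hx.1) (hF x (hTK hx.1))
      refine h1.differentiableWithinAt.hasFDerivWithinAt.mono ?_
      rintro _ ⟨z, hz, rfl⟩
      exact extChartAt_target_subset_range x₀ (φ.map_source (hT hz.1))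
    · rintro _ ⟨x, hx, rfl⟩
      have := mdet_eq_mul (hT hx.1) (hF x (hTK hx.1))
      rw [hx.2] at this
      exact (mul_eq_zero.1 this.symm).resolve_right (mdet_extChartAt_ne_zero (hT hx.1))
  filter_upwards [compl_mem_ae_iff.2 key] with a ha x hx hxa h0
  exact ha ⟨x, ⟨hx, h0⟩, hxa⟩

theorem contDiffOn_chart {F : N → EuclideanSpace ℝ (Fin d)} {W : Set N} {x₀ : N}
    (hF : ∀ x ∈ W, ContMDiffAt I 𝓘(ℝ, EuclideanSpace ℝ (Fin d)) 1 F x) :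
    ContDiffOn ℝ 1 (F ∘ (extChartAt I x₀).symm)
      ((extChartAt I x₀).target ∩ (extChartAt I x₀).symm ⁻¹' W) := by
  rw [← contMDiffOn_iff_contDiffOn]
  have h1 : ContMDiffOn I 𝓘(ℝ, EuclideanSpace ℝ (Fin d)) 1 F W := fun x hx => (hF x hx).contMDiffWithinAt
  exact h1.comp ((contMDiffOn_extChartAt_symm x₀).mono inter_subset_left) inter_subset_right

/-- At a point `x` of the fibre the chart at `x₀` has sign `σ x₀ * σ x` relative to the preferred
chart at `x`. Multiplied by the weight `σ x`, the factor `σ x` squares away and only `σ x₀` is left.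
-/
theorem finsum_localSign_chart {σ : N → SignType} {F : N → EuclideanSpace ℝ (Fin d)} {W : Set N} {x₀ : N}
    (hW : W ⊆ (extChartAt I x₀).source)
    (hσ : ∀ x ∈ W, σ x ≠ 0 ∧ SignType.sign (mdet I (extChartAt I x₀) x) = σ x₀ * σ x)
    (hF : ∀ x ∈ W, MDifferentiableAt I 𝓘(ℝ, EuclideanSpace ℝ (Fin d)) F x)
    {a : EuclideanSpace ℝ (Fin d)} {P : Finset (EuclideanSpace ℝ (Fin d))}
    (hP : ∀ y, y ∈ P ↔ (y ∈ (extChartAt I x₀).target ∩ (extChartAt I x₀).symm ⁻¹' W) ∧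
      (F ∘ (extChartAt I x₀).symm) y = a) :
    ∑ᶠ x ∈ {x ∈ W | F x = a}, localSign I σ F x =
      (σ x₀ : ℤ) * ∑ y ∈ P, ((SignType.sign (fderivWithin ℝ (F ∘ (extChartAt I x₀).symm) (range I) y).det :
        SignType) : ℤ) := by
  rw [Finset.mul_sum, ← finsum_mem_coe_finset]
  refine finsum_mem_eq_of_bijOn (extChartAt I x₀) ⟨?_, ?_, ?_⟩ ?_
  · rintro x ⟨hx, hxa⟩
    refine (hP _).2 ⟨⟨(extChartAt I x₀).map_source (hW hx), ?_⟩, ?_⟩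
    · simpa only [mem_preimage, (extChartAt I x₀).left_inv (hW hx)] using hx
    · simpa only [Function.comp_apply, (extChartAt I x₀).left_inv (hW hx)] using hxa
  · exact (extChartAt I x₀).injOn.mono fun x hx => hW hx.1
  · intro y hy
    obtain ⟨⟨hyt, hyW⟩, hya⟩ := (hP y).1 hy
    exact ⟨_, ⟨hyW, hya⟩, (extChartAt I x₀).right_inv hyt⟩
  · rintro x ⟨hx, -⟩
    obtain ⟨h0, h1⟩ := hσ x hx
    rw [localSign, mdet_eq_mul (hW hx) (hF x hx), sign_mul, h1, ← SignType.coe_mul]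
    congr 1
    generalize SignType.sign (fderivWithin ℝ (F ∘ (extChartAt I x₀).symm) (range I) (extChartAt I x₀ x)).det = s
    generalize σ x₀ = t at *
    generalize σ x = u at *
    clear h1 hσ
    revert s t u
    decide

end Count
end

/-! ### Homotopy invariance of the signed count in dimension three. -/

noncomputable section

open MeasureTheory

section Count

variable {d : ℕ} {H : Type*} [TopologicalSpace H]
  {I : ModelWithCorners ℝ (EuclideanSpace ℝ (Fin d)) H}
  {N : Type*} [TopologicalSpace N] [ChartedSpace H N]

theorem localSign_congr {σ : N → SignType} {F G : N → EuclideanSpace ℝ (Fin d)} {x : N}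
    (h : F =ᶠ[𝓝 x] G) : localSign I σ F x = localSign I σ G x := by
  rw [localSign, localSign, mdet_congr h]

theorem degCount_congr {σ : N → SignType} {A : Set N} {F G : N → EuclideanSpace ℝ (Fin d)}
    {a : EuclideanSpace ℝ (Fin d)} (h : ∀ x ∈ A, F x = a ∨ G x = a → F =ᶠ[𝓝 x] G) :
    degCount I σ A F a = degCount I σ A G a := by
  have hs : {x ∈ A | F x = a} = {x ∈ A | G x = a} := by
    ext x
    refine and_congr_right fun hx => ⟨fun hf => ?_, fun hg => ?_⟩
    · rw [← (h x hx (Or.inl hf)).eq_of_nhds]; exact hf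
    · rw [(h x hx (Or.inr hg)).eq_of_nhds]; exact hg
  rw [degCount, degCount, ← hs]
  exact finsum_mem_congr rfl fun x hx => localSign_congr (h x hx.1 (Or.inl hx.2))

theorem degCount_split {σ : N → SignType} {A W : Set N} (hW : W ⊆ A)
    {F : N → EuclideanSpace ℝ (Fin d)} {a : EuclideanSpace ℝ (Fin d)}
    (hf : {x ∈ A | F x = a}.Finite) :
    degCount I σ A F a = degCount I σ W F a + degCount I σ (A \ W) F a := by
  have hs : {x ∈ A | F x = a} = {x ∈ W | F x = a} ∪ {x ∈ A \ W | F x = a} := by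
    ext x
    constructor
    · rintro ⟨hx, hxa⟩
      by_cases hxW : x ∈ W
      exacts [Or.inl ⟨hxW, hxa⟩, Or.inr ⟨⟨hx, hxW⟩, hxa⟩]
    · rintro (⟨hx, hxa⟩ | ⟨hx, hxa⟩)
      exacts [⟨hW hx, hxa⟩, ⟨hx.1, hxa⟩]
  unfold degCount
  rw [hs, finsum_mem_union _ (hf.subset fun x hx => ⟨hW hx.1, hx.2⟩)
    (hf.subset fun x hx => ⟨hx.1.1, hx.2⟩)]
  exact disjoint_left.2 fun x hx hx' => hx'.1.2 hx.1

/-- If two maps agree locally off `W`, their counts over `A ⊇ W` differ by as much as their counts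
over `W`. -/
theorem degCount_sub_degCount {σ : N → SignType} {A W : Set N} (hW : W ⊆ A)
    {F G : N → EuclideanSpace ℝ (Fin d)} {a : EuclideanSpace ℝ (Fin d)}
    (hF : {x ∈ A | F x = a}.Finite) (hG : {x ∈ A | G x = a}.Finite)
    (h : ∀ x ∈ A \ W, F =ᶠ[𝓝 x] G) :
    degCount I σ A G a - degCount I σ A F a = degCount I σ W G a - degCount I σ W F a := by
  rw [degCount_split hW hF, degCount_split hW hG, degCount_congr fun x hx _ => h x hx]
  ring

end Count

section Homotopy

variable {M : Type*} [TopologicalSpace M] [T2Space M]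
  [ChartedSpace (EuclideanSpace ℝ (Fin 3)) M] [IsManifold (𝓡 3) ∞ M]

/-- A partial linear homotopy between `F₀` and `F₁`. -/
def interp {X E : Type*} [AddCommGroup E] [Module ℝ E] (F₀ F₁ : X → E) (s : X → ℝ) (x : X) : E :=
  F₀ x + s x • (F₁ x - F₀ x)

theorem contMDiffAt_interp {E' H' X : Type*} [NormedAddCommGroup E'] [NormedSpace ℝ E']
    [TopologicalSpace H'] {I : ModelWithCorners ℝ E' H'} [TopologicalSpace X] [ChartedSpace H' X]
    {E : Type*} [NormedAddCommGroup E] [NormedSpace ℝ E] {F₀ F₁ : X → E} {s : X → ℝ} {x : X}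
    (h₀ : ContMDiffAt I 𝓘(ℝ, E) 1 F₀ x) (h₁ : ContMDiffAt I 𝓘(ℝ, E) 1 F₁ x)
    (hs : ContMDiff I 𝓘(ℝ, ℝ) ∞ s) : ContMDiffAt I 𝓘(ℝ, E) 1 (interp F₀ F₁ s) x :=
  h₀.add (((hs x).of_le (by exact_mod_cast le_top)).smul (h₁.sub h₀))

/-- Off `T` the maps agree, so only the counts over `W` matter, and `sum_sign_det_eq_of_eqOn_compl`
compares these in the chart at `x₀`. The lower bound `m` off `K` confines the fibres over small
values to the compact set `K`, which makes them finite over regular values. -/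
theorem ae_degCount_eq_of_bump {A K : Set M} (hA : IsOpen A) (hK : IsCompact K) (hKA : K ⊆ A)
    {F₀ F₁ : M → EuclideanSpace ℝ (Fin 3)} {W T : Set M} {x₀ : M} (hWo : IsOpen W) (hWA : W ⊆ A)
    (hWs : W ⊆ (extChartAt (𝓡 3) x₀).source) (hT : IsCompact T) (hTW : T ⊆ W)
    (h₀ : ∀ x ∈ A, ContMDiffAt (𝓡 3) 𝓘(ℝ, EuclideanSpace ℝ (Fin 3)) 1 F₀ x)
    (h₁ : ∀ x ∈ A, ContMDiffAt (𝓡 3) 𝓘(ℝ, EuclideanSpace ℝ (Fin 3)) 1 F₁ x)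
    {σ : M → SignType}
    (hσ : ∀ x ∈ W, σ x ≠ 0 ∧ SignType.sign (mdet (𝓡 3) (extChartAt (𝓡 3) x₀) x) = σ x₀ * σ x)
    (heq : ∀ x ∉ T, F₀ x = F₁ x)
    {m : ℝ} (hm₀ : ∀ x ∈ A \ K, m ≤ ‖F₀ x‖) (hm₁ : ∀ x ∈ A \ K, m ≤ ‖F₁ x‖) :
    ∀ᵐ a : EuclideanSpace ℝ (Fin 3), ‖a‖ < m → degCount (𝓡 3) σ A F₀ a = degCount (𝓡 3) σ A F₁ a := by
  have mem : ∀ {F : M → EuclideanSpace ℝ (Fin 3)} (_ : ∀ x ∈ A \ K, m ≤ ‖F x‖)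
      {a : EuclideanSpace ℝ (Fin 3)} (_ : ‖a‖ < m), ∀ x ∈ A, F x = a → x ∈ K := by
    intro F hF a ha x hx hxa
    by_contra hxK
    exact absurd (hF x ⟨hx, hxK⟩) (by rw [hxa]; exact not_le.2 ha)
  have md : ∀ {F : M → EuclideanSpace ℝ (Fin 3)}
      (_ : ∀ x ∈ A, ContMDiffAt (𝓡 3) 𝓘(ℝ, EuclideanSpace ℝ (Fin 3)) 1 F x),
      ∀ x ∈ A, MDifferentiableAt (𝓡 3) 𝓘(ℝ, EuclideanSpace ℝ (Fin 3)) F x :=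
    fun h x hx => (h x hx).mdifferentiableAt one_ne_zero
  filter_upwards [ae_regular hK fun x hx => md h₀ x (hKA hx), ae_regular hK fun x hx => md h₁ x (hKA hx)]
    with a r₀ r₁ ha
  have fin : ∀ {F : M → EuclideanSpace ℝ (Fin 3)}
      (_ : ∀ x ∈ A, ContMDiffAt (𝓡 3) 𝓘(ℝ, EuclideanSpace ℝ (Fin 3)) 1 F x)
      (_ : ∀ x ∈ A \ K, m ≤ ‖F x‖) (_ : ∀ x ∈ K, F x = a → mdet (𝓡 3) F x ≠ 0),
      {x ∈ A | F x = a}.Finite := fun h hm r =>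
    (finite_fibre hK (fun x hx => md h x (hKA hx)) r).subset
      fun x hx => ⟨mem hm ha x hx.1 hx.2, hx.2⟩
  have f₀ := fin h₀ hm₀ r₀
  have f₁ := fin h₁ hm₁ r₁
  have hoff : ∀ x ∈ A \ W, F₀ =ᶠ[𝓝 x] F₁ := fun x hx => by
    filter_upwards [hT.isClosed.isOpen_compl.mem_nhds fun h => hx.2 (hTW h)] with z hz using heq z hz
  rw [← sub_eq_zero, ← neg_sub, degCount_sub_degCount hWA f₀ f₁ hoff, neg_eq_zero, sub_eq_zero]
  let φ := extChartAt (𝓡 3) x₀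
  let O := φ.target ∩ φ.symm ⁻¹' W
  have hO : IsOpen O := (continuousOn_extChartAt_symm x₀).isOpen_inter_preimage
    (isOpen_extChartAt_target x₀) hWo
  have hPf : ∀ {F : M → EuclideanSpace ℝ (Fin 3)} (_ : {x ∈ A | F x = a}.Finite),
      {y | y ∈ O ∧ (F ∘ φ.symm) y = a}.Finite := fun h =>
    (h.image φ).subset fun y hy => ⟨φ.symm y, ⟨hWA hy.1.2, hy.2⟩, φ.right_inv hy.1.1⟩
  have hreg : ∀ {F : M → EuclideanSpace ℝ (Fin 3)}
      (_ : ∀ x ∈ A, ContMDiffAt (𝓡 3) 𝓘(ℝ, EuclideanSpace ℝ (Fin 3)) 1 F x)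
      (_ : ∀ x ∈ A \ K, m ≤ ‖F x‖) (_ : ∀ x ∈ K, F x = a → mdet (𝓡 3) F x ≠ 0),
      ∀ y, y ∈ O → (F ∘ φ.symm) y = a → (fderiv ℝ (F ∘ φ.symm) y).det ≠ 0 := by
    intro F h hm r y hy hya h0
    have hs : φ.symm y ∈ φ.source := φ.map_target hy.1
    have := mdet_eq_mul (x₀ := x₀) hs (md h _ (hWA hy.2))
    rw [ModelWithCorners.Boundaryless.range_eq_univ, fderivWithin_univ] at this
    change mdet (𝓡 3) F (φ.symm y) = (fderiv ℝ (F ∘ φ.symm) (φ (φ.symm y))).det * _ at this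
    rw [φ.right_inv hy.1, h0, zero_mul] at this
    exact r _ (mem hm ha _ (hWA hy.2) hya) hya this
  have e : ∀ {F : M → EuclideanSpace ℝ (Fin 3)}
      (_ : ∀ x ∈ A, ContMDiffAt (𝓡 3) 𝓘(ℝ, EuclideanSpace ℝ (Fin 3)) 1 F x)
      (h : {x ∈ A | F x = a}.Finite), degCount (𝓡 3) σ W F a = (σ x₀ : ℤ) * ∑ y ∈ (hPf h).toFinset,
        ((SignType.sign (fderiv ℝ (F ∘ φ.symm) y).det : SignType) : ℤ) := by
    intro F h hf
    have := finsum_localSign_chart (I := 𝓡 3) (σ := σ) hWs hσ (fun x hx => md h x (hWA hx)) (a := a)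
      (P := (hPf hf).toFinset) (fun y => (hPf hf).mem_toFinset)
    rw [ModelWithCorners.Boundaryless.range_eq_univ] at this
    simp only [fderivWithin_univ] at this
    exact this
  rw [e h₀ f₀, e h₁ f₁]
  congr 1
  symm
  refine sum_sign_det_eq_of_eqOn_compl (V₀ := F₀ ∘ φ.symm) (V₁ := F₁ ∘ φ.symm) hO (T := φ '' T)
    (hT.image_of_continuousOn ((continuousOn_extChartAt x₀).mono (hTW.trans hWs))) ?_
    (contDiffOn_chart fun x hx => h₀ x (hWA hx)) (contDiffOn_chart fun x hx => h₁ x (hWA hx)) ?_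
    (fun y => (hPf f₀).mem_toFinset) (fun y => (hPf f₁).mem_toFinset) ?_ ?_
  · rintro _ ⟨x, hx, rfl⟩
    refine ⟨φ.map_source (hWs (hTW hx)), ?_⟩
    rw [mem_preimage, φ.left_inv (hWs (hTW hx))]
    exact hTW hx
  · rintro y ⟨hy, hyT⟩
    refine heq _ fun h => hyT ⟨_, h, φ.right_inv hy.1⟩
  · intro y hy
    have := (hPf f₀).mem_toFinset.1 hy
    exact hreg h₀ hm₀ r₀ y this.1 this.2
  · intro y hy
    have := (hPf f₁).mem_toFinset.1 hy
    exact hreg h₁ hm₁ r₁ y this.1 this.2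

/-- Homotopy invariance of the signed number of points of almost every fibre. -/
theorem ae_degCount_eq {A K : Set M} (hA : IsOpen A) (hK : IsCompact K) (hKA : K ⊆ A)
    {F₀ F₁ : M → EuclideanSpace ℝ (Fin 3)}
    (h₀ : ∀ x ∈ A, ContMDiffAt (𝓡 3) 𝓘(ℝ, EuclideanSpace ℝ (Fin 3)) 1 F₀ x)
    (h₁ : ∀ x ∈ A, ContMDiffAt (𝓡 3) 𝓘(ℝ, EuclideanSpace ℝ (Fin 3)) 1 F₁ x)
    {σ : M → SignType} (hσ : IsOrientationSign (𝓡 3) σ A) {m : ℝ}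
    (hm : ∀ x ∈ A \ K, ∀ s ∈ Icc (0 : ℝ) 1, m ≤ ‖F₀ x + s • (F₁ x - F₀ x)‖) :
    ∀ᵐ a : EuclideanSpace ℝ (Fin 3), ‖a‖ < m → degCount (𝓡 3) σ A F₀ a = degCount (𝓡 3) σ A F₁ a := by
  -- The homotopy parameter is a function on `M`, raised to `1` on one small set after another, so
  -- that each stage changes the map within one chart. Its values remain in `[0, 1]`, so the lower
  -- bound off `K` holds at every stage.
  have key : ∀ s₀ : M → ℝ, ContMDiff (𝓡 3) 𝓘(ℝ, ℝ) ∞ s₀ → (∀ x, s₀ x ∈ Icc (0 : ℝ) 1) →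
      ∃ s : M → ℝ, ContMDiff (𝓡 3) 𝓘(ℝ, ℝ) ∞ s ∧ (∀ x, s x ∈ Icc (0 : ℝ) 1) ∧
      (∀ x, s₀ x = 1 → s x = 1) ∧ (∀ᶠ x in 𝓝ˢ K, s x = 1) ∧
      ∀ᵐ a : EuclideanSpace ℝ (Fin 3), ‖a‖ < m →
        degCount (𝓡 3) σ A (interp F₀ F₁ s₀) a = degCount (𝓡 3) σ A (interp F₀ F₁ s) a := by
    refine hK.induction_on (p := fun K' => ∀ s₀ : M → ℝ, ContMDiff (𝓡 3) 𝓘(ℝ, ℝ) ∞ s₀ →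
      (∀ x, s₀ x ∈ Icc (0 : ℝ) 1) →
      ∃ s : M → ℝ, ContMDiff (𝓡 3) 𝓘(ℝ, ℝ) ∞ s ∧ (∀ x, s x ∈ Icc (0 : ℝ) 1) ∧
      (∀ x, s₀ x = 1 → s x = 1) ∧ (∀ᶠ x in 𝓝ˢ K', s x = 1) ∧
      ∀ᵐ a : EuclideanSpace ℝ (Fin 3), ‖a‖ < m →
        degCount (𝓡 3) σ A (interp F₀ F₁ s₀) a = degCount (𝓡 3) σ A (interp F₀ F₁ s) a) ?_ ?_ ?_ ?_
    · intro s₀ hs hr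
      exact ⟨s₀, hs, hr, fun _ h => h, by simp, by simp⟩
    · intro T₁ T₂ hT h s₀ hs hr
      obtain ⟨s, a1, a2, a3, a4, a5⟩ := h s₀ hs hr
      exact ⟨s, a1, a2, a3, a4.filter_mono (nhdsSet_mono hT), a5⟩
    · intro T₁ T₂ H₁ H₂ s₀ hs hr
      obtain ⟨s, a1, a2, a3, a4, a5⟩ := H₁ s₀ hs hr
      obtain ⟨s', b1, b2, b3, b4, b5⟩ := H₂ s a1 a2
      refine ⟨s', b1, b2, fun x h => b3 x (a3 x h), ?_, ?_⟩
      · rw [nhdsSet_union, eventually_sup]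
        exact ⟨a4.mono b3, b4⟩
      · filter_upwards [a5, b5] with a h5 h6 ha using (h5 ha).trans (h6 ha)
    · intro x₀ hx₀
      have hx₀A := hKA hx₀
      have hW : A ∩ (extChartAt (𝓡 3) x₀).source ∩
          {x | x ∈ A → SignType.sign (mdet (𝓡 3) (extChartAt (𝓡 3) x₀) x) = σ x₀ * σ x} ∈ 𝓝 x₀ :=
        inter_mem (inter_mem (hA.mem_nhds hx₀A) (extChartAt_source_mem_nhds x₀))
          (hσ.eventually_eq x₀ hx₀A)
      obtain ⟨W, hWs, hWo, hxW⟩ := mem_nhds_iff.1 hW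
      obtain ⟨χ, -, hχ⟩ := (SmoothBumpFunction.nhds_basis_tsupport (I := 𝓡 3) x₀).mem_iff.1
        (hWo.mem_nhds hxW)
      have hχs : ContMDiff (𝓡 3) 𝓘(ℝ, ℝ) ∞ χ := χ.contMDiff
      have hχr : ∀ x, χ x ∈ Icc (0 : ℝ) 1 := fun x => ⟨χ.nonneg, χ.le_one⟩
      refine ⟨{x | ∀ᶠ z in 𝓝 x, χ z = 1}, mem_nhdsWithin_of_mem_nhds
        (eventually_eventually_nhds.2 χ.eventuallyEq_one), fun s₀ hs hr => ?_⟩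
      have hs' : ContMDiff (𝓡 3) 𝓘(ℝ, ℝ) ∞ fun x => s₀ x + χ x * (1 - s₀ x) :=
        hs.add (hχs.mul (contMDiff_const.sub hs))
      have hr' : ∀ x, s₀ x + χ x * (1 - s₀ x) ∈ Icc (0 : ℝ) 1 := fun x => by
        obtain ⟨p, q⟩ := hr x
        obtain ⟨p', q'⟩ := hχr x
        constructor <;> nlinarith
      refine ⟨_, hs', hr', fun x hx => by simp [hx], ?_, ?_⟩
      · exact mem_nhdsSet_iff_forall.2 fun x hx => hx.mono fun z hz => by
          change s₀ z + χ z * (1 - s₀ z) = 1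
          rw [hz]; ring
      · refine ae_degCount_eq_of_bump (x₀ := x₀) (W := W) (T := tsupport χ) hA hK hKA hWo
          (fun x hx => (hWs hx).1.1) (fun x hx => (hWs hx).1.2) χ.hasCompactSupport hχ
          (fun x hx => contMDiffAt_interp (h₀ x hx) (h₁ x hx) hs)
          (fun x hx => contMDiffAt_interp (h₀ x hx) (h₁ x hx) hs')
          (fun x hx => ⟨hσ.ne_zero x (hWs hx).1.1, (hWs hx).2 (hWs hx).1.1⟩) ?_
          (fun x hx => hm x hx _ (hr x)) (fun x hx => hm x hx _ (hr' x))
        intro x hx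
        simp [interp, image_eq_zero_of_notMem_tsupport hx]
  obtain ⟨s, a1, a2, -, a4, a5⟩ := key (fun _ => 0) contMDiff_const (by simp)
  filter_upwards [a5] with a h5 ha
  have e0 : interp F₀ F₁ (fun _ => 0) = F₀ := by ext1 x; simp [interp]
  rw [e0] at h5
  rw [h5 ha]
  -- The final parameter is known to be `1` only near `K`, but the fibres to be compared lie in `K`.
  refine degCount_congr fun x hx h => ?_
  have hxK : x ∈ K := by
    by_contra hxK
    rcases h with h | h
    · exact absurd (hm x ⟨hx, hxK⟩ (s x) (a2 x)) (by
        change interp F₀ F₁ s x = a at h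
        rw [← h] at ha; exact not_le.2 ha)
    · have := hm x ⟨hx, hxK⟩ 1 (by simp)
      rw [one_smul, add_sub_cancel, h] at this
      exact absurd this (not_le.2 ha)
  filter_upwards [mem_nhdsSet_iff_forall.1 a4 x hxK] with z hz
  have hz' : s z = 1 := hz
  simp [interp, hz']

end Homotopy
end

/-! ### The degree of a Gauss map on a sphere as a signed count in the ball. -/

noncomputable section

open MeasureTheory

theorem mdet_eq_det_fderiv {d : ℕ} (F : EuclideanSpace ℝ (Fin d) → EuclideanSpace ℝ (Fin d))
    (x : EuclideanSpace ℝ (Fin d)) : mdet (𝓡 d) F x = (fderiv ℝ F x).det := by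
  unfold mdet
  rw [mfderiv_eq_fderiv]

theorem isOrientationSign_one {d : ℕ} (A : Set (EuclideanSpace ℝ (Fin d))) :
    IsOrientationSign (𝓡 d) (fun _ : EuclideanSpace ℝ (Fin d) => (1 : SignType)) A := by
  refine ⟨fun x _ => by decide, fun x₀ _ => Eventually.of_forall fun x _ => ?_⟩
  rw [mdet_eq_det_fderiv]
  have : (extChartAt (𝓡 d) x₀ : EuclideanSpace ℝ (Fin d) → EuclideanSpace ℝ (Fin d)) = id := by
    ext1 y; simp [chartAt_self_eq]
  rw [this, fderiv_id]
  have h : (ContinuousLinearMap.id ℝ (EuclideanSpace ℝ (Fin d))).det = 1 := LinearMap.det_id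
  rw [h]
  simp

/-- The radial extension of degree one of the direction of `V` on the sphere of centre `y₀` and
radius `ρ`. -/
def coneExt {d : ℕ} (V : EuclideanSpace ℝ (Fin d) → EuclideanSpace ℝ (Fin d))
    (y₀ : EuclideanSpace ℝ (Fin d)) (ρ : ℝ) (z : EuclideanSpace ℝ (Fin d)) :
    EuclideanSpace ℝ (Fin d) :=
  ‖z‖ • (‖V (y₀ + ρ • (‖z‖⁻¹ • z))‖⁻¹ • V (y₀ + ρ • (‖z‖⁻¹ • z)))

section Cone

variable {d : ℕ} {V : EuclideanSpace ℝ (Fin d) → EuclideanSpace ℝ (Fin d)}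
  {y₀ : EuclideanSpace ℝ (Fin d)} {ρ : ℝ}

theorem coneExt_smul {t : ℝ} (ht : 0 < t) (z : EuclideanSpace ℝ (Fin d)) :
    coneExt V y₀ ρ (t • z) = t • coneExt V y₀ ρ z := by
  have h : ‖t • z‖⁻¹ • (t • z) = ‖z‖⁻¹ • z := by
    rw [norm_smul, Real.norm_of_nonneg ht.le, smul_smul, mul_inv_rev, mul_assoc,
      inv_mul_cancel₀ ht.ne', mul_one]
  rw [coneExt, h, norm_smul, Real.norm_of_nonneg ht.le, mul_smul]
  rfl

theorem sphere_point_mem (hρ : 0 < ρ) {z : EuclideanSpace ℝ (Fin d)} (hz : z ≠ 0) :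
    y₀ + ρ • (‖z‖⁻¹ • z) ∈ Metric.sphere y₀ ρ := by
  rw [mem_sphere_iff_norm, add_sub_cancel_left, norm_smul, norm_smul, norm_inv, norm_norm,
    inv_mul_cancel₀ (norm_ne_zero_iff.2 hz), mul_one, Real.norm_of_nonneg hρ.le]

theorem norm_coneExt (hρ : 0 < ρ) (hV : ∀ y ∈ Metric.sphere y₀ ρ, V y ≠ 0)
    (z : EuclideanSpace ℝ (Fin d)) : ‖coneExt V y₀ ρ z‖ = ‖z‖ := by
  by_cases hz : z = 0
  · simp [coneExt, hz]
  · have := hV _ (sphere_point_mem hρ hz)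
    rw [coneExt, norm_smul, norm_smul, norm_inv, norm_norm, norm_norm,
      inv_mul_cancel₀ (norm_ne_zero_iff.2 this), mul_one]

theorem contDiffOn_coneExt (hρ : 0 < ρ) {O : Set (EuclideanSpace ℝ (Fin d))}
    (hVO : ContDiffOn ℝ 1 V O) (hO : Metric.sphere y₀ ρ ⊆ O)
    (hV : ∀ y ∈ Metric.sphere y₀ ρ, V y ≠ 0) : ContDiffOn ℝ 1 (coneExt V y₀ ρ) {0}ᶜ := by
  have hn : ContDiffOn ℝ 1 (fun z : EuclideanSpace ℝ (Fin d) => ‖z‖) {0}ᶜ :=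
    fun z hz => (contDiffAt_norm ℝ hz).contDiffWithinAt
  have hp : ContDiffOn ℝ 1 (fun z : EuclideanSpace ℝ (Fin d) => y₀ + ρ • (‖z‖⁻¹ • z)) {0}ᶜ :=
    contDiffOn_const.add (contDiffOn_const.fun_smul
      ((hn.fun_inv fun z hz => norm_ne_zero_iff.2 hz).fun_smul contDiffOn_id))
  have hVp : ContDiffOn ℝ 1 (fun z => V (y₀ + ρ • (‖z‖⁻¹ • z))) {0}ᶜ :=
    hVO.comp hp fun z hz => hO (sphere_point_mem hρ hz)
  have hne : ∀ z ∈ ({0}ᶜ : Set (EuclideanSpace ℝ (Fin d))), V (y₀ + ρ • (‖z‖⁻¹ • z)) ≠ 0 :=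
    fun z hz => hV _ (sphere_point_mem hρ hz)
  exact hn.fun_smul (((hVp.norm ℝ hne).fun_inv fun z hz => norm_ne_zero_iff.2 (hne z hz)).fun_smul hVp)

/-- Differentiating homogeneity of degree one gives homogeneity of degree zero for the differential,
so signs on any sphere can be read on the unit sphere. -/
theorem fderiv_coneExt_smul (hd : DifferentiableOn ℝ (coneExt V y₀ ρ) {0}ᶜ) {t : ℝ} (ht : 0 < t)
    {z : EuclideanSpace ℝ (Fin d)} (hz : z ≠ 0) :
    fderiv ℝ (coneExt V y₀ ρ) (t • z) = fderiv ℝ (coneExt V y₀ ρ) z := by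
  have hda : ∀ z : EuclideanSpace ℝ (Fin d), z ≠ 0 → HasFDerivAt (coneExt V y₀ ρ)
      (fderiv ℝ (coneExt V y₀ ρ) z) z := fun z hz =>
    ((hd z hz).differentiableAt (isOpen_compl_singleton.mem_nhds hz)).hasFDerivAt
  have htz : t • z ≠ 0 := smul_ne_zero ht.ne' hz
  have h1 : HasFDerivAt (fun z => coneExt V y₀ ρ (t • z))
      ((fderiv ℝ (coneExt V y₀ ρ) (t • z)).comp (t • ContinuousLinearMap.id ℝ _)) z :=
    (hda _ htz).comp z ((hasFDerivAt_id z).const_smul t)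
  have h2 : HasFDerivAt (fun z => coneExt V y₀ ρ (t • z)) (t • fderiv ℝ (coneExt V y₀ ρ) z) z := by
    simp only [coneExt_smul ht]
    exact (hda z hz).const_smul t
  have h3 := h1.unique h2
  ext1 v
  have h4 := congrArg (fun A : EuclideanSpace ℝ (Fin d) →L[ℝ] EuclideanSpace ℝ (Fin d) => A v) h3
  simp only [ContinuousLinearMap.comp_apply, smul_apply,
    ContinuousLinearMap.id_apply, map_smul] at h4
  exact smul_right_injective _ ht.ne' h4

end Cone

/-- On the sphere `F` makes an acute angle with `V`, so a straight homotopy, without zeros near the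
sphere, joins `F` to the homogeneous extension `G` of the direction of `V`. The fibre of `G` over `a
≠ 0` consists of points at distance `‖a‖` from the centre; it corresponds, with the same signs, to
the preimages of `a / ‖a‖` under the Gauss map. That map is therefore `C¹` enough to serve as its
own representative in `HasSphereDegree`. -/
theorem exists_forall_ae_hasSphereDegree {V F : EuclideanSpace ℝ (Fin 3) → EuclideanSpace ℝ (Fin 3)}
    {y₀ : EuclideanSpace ℝ (Fin 3)} {ρ : ℝ} (hρ : 0 < ρ) {O : Set (EuclideanSpace ℝ (Fin 3))}
    (hO : IsOpen O) (hbO : Metric.closedBall y₀ ρ ⊆ O) (hVO : ContDiffOn ℝ 1 V O)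
    (hFO : ContDiffOn ℝ 1 F O) (hV : ∀ y ∈ Metric.sphere y₀ ρ, V y ≠ 0)
    (hVF : ∀ y ∈ Metric.sphere y₀ ρ, 0 < inner ℝ (V y) (F y)) :
    ∃ m > 0, ∀ᵐ a : EuclideanSpace ℝ (Fin 3), ‖a‖ < m →
      ∀ f : C(UnitSphere 3, UnitSphere 3), (∀ u : UnitSphere 3, (f u : EuclideanSpace ℝ (Fin 3)) =
        ‖V (y₀ + ρ • (u : EuclideanSpace ℝ (Fin 3)))‖⁻¹ •
          V (y₀ + ρ • (u : EuclideanSpace ℝ (Fin 3)))) →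
      HasSphereDegree f (degCount (𝓡 3) (fun _ => 1) (Metric.ball y₀ ρ) F a) := by
  obtain ⟨G, hG⟩ : ∃ G, G = coneExt V y₀ ρ := ⟨_, rfl⟩
  have hGn : ∀ z, ‖G z‖ = ‖z‖ := hG ▸ norm_coneExt hρ hV
  have hsO : Metric.sphere y₀ ρ ⊆ O := Metric.sphere_subset_closedBall.trans hbO
  have hGd : ContDiffOn ℝ 1 G {0}ᶜ := hG ▸ contDiffOn_coneExt hρ hVO hsO hV
  have hGda : ∀ z, z ≠ 0 → ContDiffAt ℝ 1 G z := fun z hz =>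
    hGd.contDiffAt (isOpen_compl_singleton.mem_nhds hz)
  -- the angular function
  let ψ : EuclideanSpace ℝ (Fin 3) → ℝ := fun y => inner ℝ (G (y - y₀)) (F y)
  have hψc : ContinuousOn ψ (Metric.closedBall y₀ ρ \ Metric.ball y₀ (ρ / 2)) := by
    refine ContinuousOn.inner (𝕜 := ℝ) (hGd.continuousOn.comp
      (f := fun y : EuclideanSpace ℝ (Fin 3) => y - y₀) (by fun_prop) ?_)
      (hFO.continuousOn.mono fun y hy => hbO hy.1)
    rintro y hy (h : y - y₀ = 0)
    rw [sub_eq_zero] at h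
    exact hy.2 (by rw [h]; exact Metric.mem_ball_self (by positivity))
  have hGs : ∀ y ∈ Metric.sphere y₀ ρ, G (y - y₀) = ρ • (‖V y‖⁻¹ • V y) := by
    intro y hy
    rw [mem_sphere_iff_norm] at hy
    have : y₀ + ρ • (‖y - y₀‖⁻¹ • (y - y₀)) = y := by
      rw [hy, smul_smul, mul_inv_cancel₀ hρ.ne', one_smul, add_sub_cancel]
    rw [hG, coneExt, this, hy]
  have hψs : ∀ y ∈ Metric.sphere y₀ ρ, 0 < ψ y := by
    intro y hy
    change 0 < inner ℝ (G (y - y₀)) (F y)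
    rw [hGs y hy, real_inner_smul_left, real_inner_smul_left]
    have := norm_pos_iff.2 (hV y hy)
    exact mul_pos hρ (mul_pos (inv_pos.2 this) (hVF y hy))
  have hann : Metric.sphere y₀ ρ ⊆ Metric.closedBall y₀ ρ \ Metric.ball y₀ (ρ / 2) := fun y hy =>
    ⟨Metric.sphere_subset_closedBall hy, fun h => by
      rw [Metric.mem_ball, Metric.mem_sphere.1 hy] at h; linarith⟩
  obtain ⟨c, hc, hcψ⟩ : ∃ c > 0, ∀ y ∈ Metric.sphere y₀ ρ, c ≤ ψ y :=
    (isCompact_sphere y₀ ρ).exists_forall_le' (hψc.mono hann) hψs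
  let m₁ := c / 2
  have hm₁ : 0 < m₁ := by positivity
  -- What remains of the ball is a collar of the sphere on which `ψ > m₁`, so that `F` and `G` make
  -- an acute angle there.
  let K := Metric.closedBall y₀ (ρ / 2) ∪
    {y ∈ Metric.closedBall y₀ ρ \ Metric.ball y₀ (ρ / 2) | ψ y ∈ Iic m₁}
  have hK : IsCompact K := (isCompact_closedBall _ _).union
    (((isCompact_closedBall y₀ ρ).diff Metric.isOpen_ball).of_isClosed_subset
      (hψc.preimage_isClosed_of_isClosed
        (Metric.isClosed_closedBall.sdiff Metric.isOpen_ball) isClosed_Iic) fun y hy => hy.1)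
  have hKb : K ⊆ Metric.ball y₀ ρ := by
    rintro y (hy | ⟨hy, hyψ⟩)
    · exact Metric.closedBall_subset_ball (by linarith) hy
    · rcases (Metric.mem_closedBall.1 hy.1).lt_or_eq with h | h
      · exact h
      · have := hcψ y h
        have h2 : ψ y ≤ c / 2 := hyψ
        linarith
  -- Along the homotopy the inner product with `G (y - y₀)` is `(1 - s) ψ + s ‖y - y₀‖²`. On the
  -- collar both `ψ` and `‖y - y₀‖²` are at least `m ‖y - y₀‖`, and `‖G (y - y₀)‖ = ‖y - y₀‖`.
  let m := min (m₁ / ρ) (ρ / 2)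
  have hm : 0 < m := lt_min (by positivity) (by positivity)
  refine ⟨m, hm, ?_⟩
  -- `G` need not be differentiable at the origin and is cut off there. The cutoff acts within
  -- radius `m' / 2`, hence does not touch the fibres over values of larger norm. Letting `m'` run
  -- through the rationals covers all small nonzero values.
  have key : ∀ m' : ℝ, 0 < m' → m' < m → ∀ᵐ a : EuclideanSpace ℝ (Fin 3), m' / 2 < ‖a‖ → ‖a‖ < m' →
      ∀ f : C(UnitSphere 3, UnitSphere 3), (∀ u : UnitSphere 3, (f u : EuclideanSpace ℝ (Fin 3)) =
        ‖V (y₀ + ρ • (u : EuclideanSpace ℝ (Fin 3)))‖⁻¹ •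
          V (y₀ + ρ • (u : EuclideanSpace ℝ (Fin 3)))) →
      HasSphereDegree f (degCount (𝓡 3) (fun _ => 1) (Metric.ball y₀ ρ) F a) := by
    intro m' hm' hmm
    let χ : ContDiffBump (0 : EuclideanSpace ℝ (Fin 3)) :=
      ⟨m' / 4, m' / 2, by positivity, by linarith⟩
    let G' : EuclideanSpace ℝ (Fin 3) → EuclideanSpace ℝ (Fin 3) :=
      fun y => (1 - χ (y - y₀)) • G (y - y₀)
    have hG'1 : ∀ y, m' / 2 ≤ ‖y - y₀‖ → G' y = G (y - y₀) := by
      intro y hy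
      have : χ (y - y₀) = 0 := χ.zero_of_le_dist (by simpa [dist_zero_right] using hy)
      simp only [G', this, sub_zero, one_smul]
    have hG'n : ∀ y, ‖G' y‖ ≤ ‖y - y₀‖ := by
      intro y
      rw [norm_smul, hGn, Real.norm_of_nonneg (sub_nonneg.2 χ.le_one)]
      exact mul_le_of_le_one_left (norm_nonneg _) (by linarith [χ.nonneg (x := y - y₀)])
    have hG'd : ContDiff ℝ 1 G' := by
      rw [contDiff_iff_contDiffAt]
      intro y
      by_cases hy : y = y₀
      · have : G' =ᶠ[𝓝 y] fun _ => 0 := by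
          filter_upwards [Metric.ball_mem_nhds y (show 0 < m' / 4 by positivity)] with z hz
          have : χ (z - y₀) = 1 := χ.one_of_mem_closedBall (by
            rw [mem_closedBall_zero_iff, ← hy, ← dist_eq_norm]; exact hz.le)
          simp only [G', this, sub_self, zero_smul]
        exact contDiffAt_const.congr_of_eventuallyEq this
      · have hs : ContDiffAt ℝ 1 (fun y : EuclideanSpace ℝ (Fin 3) => y - y₀) y := by fun_prop
        exact (contDiffAt_const.sub ((χ.contDiff.contDiffAt).comp y hs)).smul
          ((hGda _ (sub_ne_zero.2 hy)).comp y hs)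
    have hhom : ∀ y ∈ Metric.ball y₀ ρ \ K, ∀ s ∈ Icc (0 : ℝ) 1, m ≤ ‖F y + s • (G' y - F y)‖ := by
      rintro y ⟨hy, hyK⟩ s ⟨hs0, hs1⟩
      have hy2 : ρ / 2 < ‖y - y₀‖ := by
        by_contra h
        exact hyK (Or.inl (mem_closedBall_iff_norm.2 (not_lt.1 h)))
      have hyρ : ‖y - y₀‖ < ρ := mem_ball_iff_norm.1 hy
      have hψ : m₁ < ψ y := by
        by_contra h
        refine hyK (Or.inr ⟨⟨Metric.ball_subset_closedBall hy, fun h' => ?_⟩, not_lt.1 h⟩)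
        rw [mem_ball_iff_norm] at h'; linarith
      have hmm' : m' / 2 ≤ ‖y - y₀‖ := by
        have : m ≤ ρ / 2 := min_le_right _ _
        linarith
      rw [hG'1 y hmm']
      have h1 : inner ℝ (G (y - y₀)) (F y + s • (G (y - y₀) - F y)) =
          (1 - s) * ψ y + s * ‖y - y₀‖ ^ 2 := by
        rw [inner_add_right, real_inner_smul_right, inner_sub_right, real_inner_self_eq_norm_sq, hGn]
        simp only [ψ]; ring
      have h2 := real_inner_le_norm (G (y - y₀)) (F y + s • (G (y - y₀) - F y))
      rw [h1, hGn] at h2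
      have hr : 0 < ‖y - y₀‖ := by linarith
      have h3 : m * ‖y - y₀‖ ≤ ψ y := by
        have e1 : m ≤ m₁ / ρ := min_le_left _ _
        calc m * ‖y - y₀‖ ≤ m₁ / ρ * ρ := by gcongr
          _ = m₁ := by field_simp
          _ ≤ ψ y := hψ.le
      have h4 : m * ‖y - y₀‖ ≤ ‖y - y₀‖ ^ 2 := by
        have : m ≤ ρ / 2 := min_le_right _ _
        nlinarith
      have h5 : m * ‖y - y₀‖ ≤ ‖y - y₀‖ * ‖F y + s • (G (y - y₀) - F y)‖ := by nlinarith
      nlinarith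
    have hmd : ∀ y, ContMDiffAt (𝓡 3) 𝓘(ℝ, EuclideanSpace ℝ (Fin 3)) 1 G' y := fun y =>
      hG'd.contMDiff.contMDiffAt
    filter_upwards [ae_degCount_eq Metric.isOpen_ball hK hKb (F₀ := F) (F₁ := G')
      (fun y hy => (hFO.contDiffAt (hO.mem_nhds (hbO (Metric.ball_subset_closedBall hy)))).contMDiffAt)
      (fun y _ => hmd y) (isOrientationSign_one _) hhom,
      ae_regular hK (I := 𝓡 3) (F := G') fun y _ => (hmd y).mdifferentiableAt one_ne_zero]
      with a h1 h2 ha1 ha2 f hf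
    rw [h1 (ha2.trans hmm)]
    have ha0 : 0 < ‖a‖ := by linarith
    have hmρ : m ≤ ρ / 2 := min_le_right _ _
    have hGf : ∀ (u : UnitSphere 3) (t : ℝ), 0 < t →
        G (t • (u : EuclideanSpace ℝ (Fin 3))) = t • (f u : EuclideanSpace ℝ (Fin 3)) := by
      intro u t ht
      rw [hG, coneExt_smul ht, coneExt]
      have hu : ‖(u : EuclideanSpace ℝ (Fin 3))‖ = 1 := by simpa using u.2
      rw [hu, hf u]
      simp
    let q : UnitSphere 3 := ⟨‖a‖⁻¹ • a, by simp [norm_smul, ha0.ne']⟩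
    -- preimages
    have hmem : ∀ u : UnitSphere 3, f u = q ↔
        y₀ + ‖a‖ • (u : EuclideanSpace ℝ (Fin 3)) ∈ {x ∈ Metric.ball y₀ ρ | G' x = a} := by
      intro u
      have hu : ‖(u : EuclideanSpace ℝ (Fin 3))‖ = 1 := by simpa using u.2
      have hn : ‖(y₀ + ‖a‖ • (u : EuclideanSpace ℝ (Fin 3))) - y₀‖ = ‖a‖ := by
        rw [add_sub_cancel_left, norm_smul, hu, norm_norm, mul_one]
      have hb : y₀ + ‖a‖ • (u : EuclideanSpace ℝ (Fin 3)) ∈ Metric.ball y₀ ρ := by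
        rw [mem_ball_iff_norm, hn]; linarith
      rw [mem_sep_iff, and_iff_right hb, hG'1 _ (by rw [hn]; exact ha1.le), add_sub_cancel_left,
        hGf u _ ha0]
      constructor
      · intro h
        rw [h]
        change ‖a‖ • (‖a‖⁻¹ • a) = a
        rw [smul_smul, mul_inv_cancel₀ ha0.ne', one_smul]
      · intro h
        ext1
        change (f u : EuclideanSpace ℝ (Fin 3)) = ‖a‖⁻¹ • a
        rw [← h, smul_smul, norm_smul]
        have : ‖(f u : EuclideanSpace ℝ (Fin 3))‖ = 1 := by simpa using (f u).2
        rw [this, norm_norm, mul_one, inv_mul_cancel₀ ha0.ne', one_smul]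
    have hsurj : ∀ x ∈ {x ∈ Metric.ball y₀ ρ | G' x = a}, ∃ u : UnitSphere 3,
        y₀ + ‖a‖ • (u : EuclideanSpace ℝ (Fin 3)) = x := by
      rintro x ⟨-, hxa⟩
      have e1 : m' / 2 ≤ ‖x - y₀‖ := by
        have := hG'n x
        rw [hxa] at this; linarith
      have e2 : ‖x - y₀‖ = ‖a‖ := by rw [← hxa, hG'1 x e1, hGn]
      refine ⟨⟨‖a‖⁻¹ • (x - y₀), by simp [norm_smul, e2, ha0.ne']⟩, ?_⟩
      change y₀ + ‖a‖ • (‖a‖⁻¹ • (x - y₀)) = x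
      rw [smul_smul, mul_inv_cancel₀ ha0.ne', one_smul, add_sub_cancel]
    have hfd : ∀ u : UnitSphere 3, fderiv ℝ G' (y₀ + ‖a‖ • (u : EuclideanSpace ℝ (Fin 3))) =
        fderiv ℝ G u := by
      intro u
      have hu : ‖(u : EuclideanSpace ℝ (Fin 3))‖ = 1 := by simpa using u.2
      have hu0 : (u : EuclideanSpace ℝ (Fin 3)) ≠ 0 := by rw [← norm_ne_zero_iff, hu]; exact one_ne_zero
      have hn : ‖(y₀ + ‖a‖ • (u : EuclideanSpace ℝ (Fin 3))) - y₀‖ = ‖a‖ := by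
        rw [add_sub_cancel_left, norm_smul, hu, norm_norm, mul_one]
      have : G' =ᶠ[𝓝 (y₀ + ‖a‖ • (u : EuclideanSpace ℝ (Fin 3)))] fun y => G (y - y₀) := by
        have hc : ContinuousAt (fun y : EuclideanSpace ℝ (Fin 3) => ‖y - y₀‖)
          (y₀ + ‖a‖ • (u : EuclideanSpace ℝ (Fin 3))) := by fun_prop
        filter_upwards [hc.eventually (lt_mem_nhds (hn.symm ▸ ha1))] with z hz
        exact hG'1 z hz.le
      rw [this.fderiv_eq, fderiv_comp_sub, add_sub_cancel_left]
      subst hG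
      exact fderiv_coneExt_smul (hGd.differentiableOn one_ne_zero) ha0 hu0
    have hKm : ∀ x ∈ {x ∈ Metric.ball y₀ ρ | G' x = a}, x ∈ K := by
      rintro x hx
      obtain ⟨u, rfl⟩ := hsurj x hx
      have hu : ‖(u : EuclideanSpace ℝ (Fin 3))‖ = 1 := by simpa using u.2
      refine Or.inl (mem_closedBall_iff_norm.2 ?_)
      rw [add_sub_cancel_left, norm_smul, hu, norm_norm, mul_one]; linarith
    have hfin : {x ∈ Metric.ball y₀ ρ | G' x = a}.Finite :=
      (finite_fibre hK (fun y _ => (hmd y).mdifferentiableAt one_ne_zero) h2).subset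
        fun x hx => ⟨hKm x hx, hx.2⟩
    have hinj : Function.Injective fun u : UnitSphere 3 => y₀ + ‖a‖ • (u : EuclideanSpace ℝ (Fin 3)) :=
      fun u v huv => Subtype.ext (smul_right_injective _ ha0.ne' (add_left_cancel huv))
    have hfinq : (f ⁻¹' {q}).Finite :=
      (hfin.preimage hinj.injOn).subset fun u hu => (hmem u).1 hu
    refine ⟨f, G, q, ContinuousMap.Homotopic.refl f, hGf, hGd, ?_, hfinq, ?_⟩
    · intro u hu
      have := (hmem u).1 hu
      have h3 := h2 _ (hKm _ this) this.2
      rwa [mdet_eq_det_fderiv, hfd u] at h3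
    · rw [degCount, ← finsum_mem_coe_finset]
      refine finsum_mem_eq_of_bijOn (fun u : UnitSphere 3 => y₀ + ‖a‖ • (u : EuclideanSpace ℝ (Fin 3)))
        ⟨?_, hinj.injOn, ?_⟩ ?_
      · intro u hu
        rw [hfinq.coe_toFinset] at hu
        exact (hmem u).1 hu
      · intro x hx
        obtain ⟨u, rfl⟩ := hsurj x hx
        refine ⟨u, ?_, rfl⟩
        rw [hfinq.coe_toFinset]
        exact (hmem u).2 hx
      · intro u _
        rw [localSign, mdet_eq_det_fderiv, hfd u, one_mul]
  have key' : ∀ᵐ a : EuclideanSpace ℝ (Fin 3), ∀ m' : ℚ, 0 < (m' : ℝ) → (m' : ℝ) < m →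
      (m' : ℝ) / 2 < ‖a‖ → ‖a‖ < m' →
      ∀ f : C(UnitSphere 3, UnitSphere 3), (∀ u : UnitSphere 3, (f u : EuclideanSpace ℝ (Fin 3)) =
        ‖V (y₀ + ρ • (u : EuclideanSpace ℝ (Fin 3)))‖⁻¹ •
          V (y₀ + ρ • (u : EuclideanSpace ℝ (Fin 3)))) →
      HasSphereDegree f (degCount (𝓡 3) (fun _ => 1) (Metric.ball y₀ ρ) F a) := by
    rw [ae_all_iff]
    intro m'
    by_cases h : 0 < (m' : ℝ) ∧ (m' : ℝ) < m
    · filter_upwards [key m' h.1 h.2] with a ha _ _ using ha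
    · exact Eventually.of_forall fun a h1 h2 => absurd ⟨h1, h2⟩ h
  have hne : ∀ᵐ a : EuclideanSpace ℝ (Fin 3), a ≠ 0 := by
    simp [ae_iff]
  filter_upwards [key', hne] with a h1 h2 h3
  have ha0 : 0 < ‖a‖ := norm_pos_iff.2 h2
  obtain ⟨m', e1, e2⟩ := exists_rat_btwn (lt_min h3 (show ‖a‖ < 2 * ‖a‖ by linarith))
  exact h1 m' (ha0.trans e1) (e2.trans_le (min_le_left _ _))
    (by linarith [e2.trans_le (min_le_right _ _)]) e1

end

/-! ### Degrees of closed curves in the plane. -/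

noncomputable section

open MeasureTheory

/-- A nonvanishing `C¹` closed curve has a degree, given by the integral of the angular form. -/
theorem exists_hasCircleDegree {b : ℝ → ℂ} (hb : ContDiff ℝ 1 b) (hb0 : ∀ t, b t ≠ 0)
    (hp : Function.Periodic b 1) :
    ∃ n : ℤ, HasCircleDegree (fun t => b t / ‖b t‖) n ∧
      ∫ t in (0 : ℝ)..1, (deriv b t / b t).im = 2 * Real.pi * n := by
  have hd : ∀ t, HasDerivAt b (deriv b t) t := fun t => (hb.differentiable one_ne_zero t).hasDerivAt
  have hcd : Continuous (deriv b) := hb.continuous_deriv le_rfl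
  have hc : Continuous fun t => deriv b t / b t := hcd.div hb.continuous hb0
  -- A logarithm of `b / b 0`, since `b * exp (-L)` has zero derivative; its imaginary part gives
  -- the continuous angle.
  let L : ℝ → ℂ := fun t => ∫ s in (0 : ℝ)..t, deriv b s / b s
  have hL : ∀ t, HasDerivAt L (deriv b t / b t) t := fun t =>
    intervalIntegral.integral_hasDerivAt_right (hc.intervalIntegrable _ _)
      (hc.stronglyMeasurableAtFilter _ _) hc.continuousAt
  have hconst : ∀ t, b t = b 0 * Complex.exp (L t) := by
    have h1 : ∀ t, HasDerivAt (fun t => b t * Complex.exp (-L t)) 0 t := by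
      intro t
      have := (hd t).mul (hL t).neg.cexp
      have h0 : b t * (deriv b t / b t) = deriv b t := mul_div_cancel₀ _ (hb0 t)
      have e : deriv b t * Complex.exp (-L t) + b t * (Complex.exp (-L t) * -(deriv b t / b t)) = 0 := by
        linear_combination -(Complex.exp (-L t)) * h0
      exact e ▸ this
    intro t
    have h2 := is_const_of_deriv_eq_zero (fun t => (h1 t).differentiableAt) (fun t => (h1 t).deriv) t 0
    simp only [L, intervalIntegral.integral_same, neg_zero, Complex.exp_zero, mul_one] at h2
    rw [← h2, mul_assoc, ← Complex.exp_add]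
    simp [L]
  have hLc : Continuous L := continuous_iff_continuousAt.2 fun t => (hL t).continuousAt
  let θ : ℝ → ℝ := fun t => (b 0).arg + (L t).im
  have hbθ : ∀ t, b t / ‖b t‖ = Complex.exp ((θ t : ℂ) * Complex.I) := by
    intro t
    have h1 : b t = (‖b t‖ : ℂ) * Complex.exp ((θ t : ℂ) * Complex.I) := by
      have h2 : ‖b t‖ = ‖b 0‖ * Real.exp (L t).re := by
        conv_lhs => rw [hconst t]
        rw [norm_mul, Complex.norm_exp]
      rw [h2, hconst t]
      conv_lhs => rw [← Complex.norm_mul_exp_arg_mul_I (b 0), ← Complex.re_add_im (L t)]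
      push_cast
      rw [Complex.exp_add]
      simp only [θ]
      push_cast
      rw [add_mul, Complex.exp_add]
      ring
    have h3 : (‖b t‖ : ℂ) ≠ 0 := by simpa using hb0 t
    rw [div_eq_iff h3]
    rw [mul_comm]; exact h1
  have hθ1 : ∀ t, θ (t + 1) = θ t + (L 1).im := by
    intro t
    have hper : Function.Periodic (fun t => deriv b t / b t) 1 := by
      intro t
      have h1 : deriv b (t + 1) = deriv b t := by
        rw [← deriv_comp_add_const]
        congr 1
        ext1 s
        exact hp s
      simp only [h1, hp t]
    have h2 : L (t + 1) = L t + L 1 := by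
      have := hper.intervalIntegral_add_eq t 0
      simp only [zero_add] at this
      simp only [L]
      rw [← this]
      exact (intervalIntegral.integral_add_adjacent_intervals (hc.intervalIntegrable _ _)
        (hc.intervalIntegrable _ _)).symm
    simp only [θ, h2, Complex.add_im]
    ring
  have h01 : Complex.exp (((L 1).im : ℂ) * Complex.I) = 1 := by
    have h1 := hbθ (0 + 1)
    rw [hθ1, hp 0, hbθ 0] at h1
    push_cast at h1
    rw [add_mul, Complex.exp_add] at h1
    exact (mul_eq_left₀ (Complex.exp_ne_zero _)).1 h1.symm
  obtain ⟨n, hn⟩ := Complex.exp_eq_one_iff.1 h01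
  have hn' : (L 1).im = 2 * Real.pi * n := by
    have h2 : ((L 1).im : ℂ) = ((2 * Real.pi * n : ℝ) : ℂ) := by
      have h3 := mul_right_cancel₀ Complex.I_ne_zero (hn.trans (show (n : ℂ) * (2 * Real.pi * Complex.I) =
        (n * (2 * Real.pi)) * Complex.I by ring))
      rw [h3]; push_cast; ring
    exact_mod_cast h2
  refine ⟨n, ⟨θ, by fun_prop, hbθ, fun t => by rw [hθ1, hn']⟩, ?_⟩
  rw [← hn']
  exact (Complex.imCLM.intervalIntegral_comp_comm (hc.intervalIntegrable 0 1))

/-- Two closed curves on the circle which are nowhere at a right angle or more have the same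
degree. -/
theorem HasCircleDegree.congr {f h : ℝ → ℂ} {n : ℤ} (hf : HasCircleDegree f n)
    (hfp : Function.Periodic f 1) (hp : Function.Periodic h 1) (hc : Continuous h)
    (h1 : ∀ t, ‖h t‖ = 1) (hfh : ∀ t, 0 < (h t * (starRingEnd ℂ) (f t)).re) : HasCircleDegree h n := by
  obtain ⟨θ, hθ, hfθ, hθ1⟩ := hf
  have hfc : Continuous f := by
    have : f = fun t => Complex.exp ((θ t : ℂ) * Complex.I) := funext hfθ
    rw [this]; fun_prop
  have hfn : ∀ t, ‖f t‖ = 1 := fun t => by rw [hfθ t, Complex.norm_exp_ofReal_mul_I]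
  have hcc : Continuous fun t => h t * (starRingEnd ℂ) (f t) := hc.mul (Complex.continuous_conj.comp hfc)
  -- The angle from `f` to `h` is less than a right angle, so its principal determination is
  -- continuous; being periodic, it does not alter the total variation.
  refine ⟨fun t => θ t + (h t * (starRingEnd ℂ) (f t)).arg, hθ.add ?_, fun t => ?_, fun t => ?_⟩
  · exact continuous_iff_continuousAt.2 fun t =>
      ContinuousAt.comp (f := fun t => h t * (starRingEnd ℂ) (f t))
        (Complex.continuousAt_arg (Or.inl (hfh t))) hcc.continuousAt
  · have h2 := Complex.norm_mul_exp_arg_mul_I (h t * (starRingEnd ℂ) (f t))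
    rw [norm_mul, h1, RCLike.norm_conj, hfn, mul_one, Complex.ofReal_one, one_mul] at h2
    push_cast
    rw [add_mul, Complex.exp_add, h2, ← hfθ t, mul_comm (h t), ← mul_assoc, Complex.mul_conj',
      hfn]
    simp
  · simp only [hp t, hfp t, hθ1 t]
    ring

end

/-! ### Charts at the boundary of a surface. -/

noncomputable section

open MeasureTheory

theorem clm_det_two (A : EuclideanSpace ℝ (Fin 2) →L[ℝ] EuclideanSpace ℝ (Fin 2)) :
    A.det = A (stdVec 0) 0 * A (stdVec 1) 1 - A (stdVec 1) 0 * A (stdVec 0) 1 := by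
  rw [clm_det_eq_matrix_det, Matrix.det_fin_two]
  rfl

theorem add_smul_stdVec_zero (y : EuclideanSpace ℝ (Fin 2)) (s : ℝ) :
    (y + s • stdVec 0 : EuclideanSpace ℝ (Fin 2)) 0 = y 0 + s := by
  simp [stdVec]

theorem range_modelHalfPlane : range (𝓡∂ 2) = halfPlane := by
  rw [range_modelWithCornersEuclideanHalfSpace]; rfl

section Surface

variable {S : Type*} [TopologicalSpace S] [ChartedSpace (EuclideanHalfSpace 2) S]

theorem extChartAt_mem_halfPlane {x₀ x : S} (hx : x ∈ (extChartAt (𝓡∂ 2) x₀).source) :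
    extChartAt (𝓡∂ 2) x₀ x ∈ halfPlane := by
  rw [← range_modelHalfPlane]
  exact extChartAt_target_subset_range x₀ ((extChartAt (𝓡∂ 2) x₀).map_source hx)

/-- Chart images are only relatively open in the half plane; `O` is an open set of the plane cutting
out such an image, as the half-plane statements require. -/
theorem exists_isOpen_chart {W : Set S} (hW : IsOpen W) (x₀ : S) :
    ∃ O : Set (EuclideanSpace ℝ (Fin 2)), IsOpen O ∧
      O ∩ halfPlane = (extChartAt (𝓡∂ 2) x₀).target ∩ (extChartAt (𝓡∂ 2) x₀).symm ⁻¹' W := by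
  refine ⟨(𝓡∂ 2).symm ⁻¹' ((chartAt _ x₀).target ∩ (chartAt _ x₀).symm ⁻¹' W),
    ((chartAt _ x₀).isOpen_inter_preimage_symm hW).preimage (𝓡∂ 2).continuous_symm, ?_⟩
  rw [← range_modelHalfPlane]
  ext y
  simp only [mem_inter_iff, mem_preimage, extChartAt_target, extChartAt_coe_symm, Function.comp_apply]
  tauto

variable [IsManifold (𝓡∂ 2) ∞ S]

/-- Being an interior point can be tested in any chart of the atlas. A point of first coordinate
zero is not interior to a subset of the half plane, as moving along `-stdVec 0` shows. -/
theorem mem_boundary_iff_chart {x₀ x : S} (hx : x ∈ (extChartAt (𝓡∂ 2) x₀).source) :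
    x ∈ (𝓡∂ 2).boundary S ↔ extChartAt (𝓡∂ 2) x₀ x 0 = 0 := by
  have hx' : x ∈ (chartAt (EuclideanHalfSpace 2) x₀).source := by rwa [extChartAt_source] at hx
  have h0 : (0 : ℝ) ≤ extChartAt (𝓡∂ 2) x₀ x 0 := extChartAt_mem_halfPlane hx
  have h1 := (𝓡∂ 2).isInteriorPoint_iff_of_mem_atlas (n := ∞) (by simp)
    (chart_mem_atlas _ x₀) hx'
  change (𝓡∂ 2).IsBoundaryPoint x ↔ _
  rw [← not_iff_not, ← (𝓡∂ 2).isInteriorPoint_iff_not_isBoundaryPoint, h1]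
  change extChartAt (𝓡∂ 2) x₀ x ∈ interior (extChartAt (𝓡∂ 2) x₀).target ↔ _
  constructor
  · intro h hz
    have h2 : halfPlane ∈ 𝓝 (extChartAt (𝓡∂ 2) x₀ x) :=
      mem_of_superset (mem_interior_iff_mem_nhds.1 h) (by
        rw [← range_modelHalfPlane]; exact extChartAt_target_subset_range x₀)
    have hc : ContinuousAt (fun s : ℝ => extChartAt (𝓡∂ 2) x₀ x + s • stdVec 0) 0 := by fun_prop
    have h3 : ∀ᶠ s in 𝓝 (0 : ℝ), extChartAt (𝓡∂ 2) x₀ x + s • stdVec 0 ∈ halfPlane :=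
      hc.eventually (by simpa using h2)
    obtain ⟨s, hs, hs0⟩ := ((h3.filter_mono nhdsWithin_le_nhds).and
      (self_mem_nhdsWithin (s := Iio (0 : ℝ)))).exists
    have : (0 : ℝ) ≤ extChartAt (𝓡∂ 2) x₀ x 0 + s := by
      rw [← add_smul_stdVec_zero]; exact hs
    rw [hz, zero_add] at this
    exact absurd this (not_le.2 hs0)
  · intro h
    obtain ⟨O, hO, hOe⟩ := exists_isOpen_chart (S := S) isOpen_univ x₀
    simp only [preimage_univ, inter_univ] at hOe
    rw [← hOe, mem_interior_iff_mem_nhds]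
    refine inter_mem (hO.mem_nhds ?_) (mem_interior_halfPlane (lt_of_le_of_ne h0 (Ne.symm h)))
    have := (extChartAt (𝓡∂ 2) x₀).map_source hx
    rw [← hOe] at this
    exact this.1

/-- `γ` is a `C¹` curve in the boundary of `S`. -/
structure IsBoundaryCurve (γ : ℝ → S) : Prop where
  contMDiff : ContMDiff 𝓘(ℝ, ℝ) (𝓡∂ 2) 1 γ
  mem_boundary : ∀ t, γ t ∈ (𝓡∂ 2).boundary S

namespace IsBoundaryCurve

variable {γ : ℝ → S}

theorem preimage_source_mem (hγ : IsBoundaryCurve γ) {x₀ : S} {t : ℝ} (ht : γ t ∈ (extChartAt (𝓡∂ 2) x₀).source) :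
    ∀ᶠ s in 𝓝 t, γ s ∈ (extChartAt (𝓡∂ 2) x₀).source :=
  hγ.contMDiff.continuous.continuousAt.eventually ((isOpen_extChartAt_source x₀).mem_nhds ht)

/-- In a chart, a boundary curve moves along the boundary of the half-plane. -/
theorem hasDerivAt_chart (hγ : IsBoundaryCurve γ) {x₀ : S} {t : ℝ} (ht : γ t ∈ (extChartAt (𝓡∂ 2) x₀).source) :
    HasDerivAt (fun s => extChartAt (𝓡∂ 2) x₀ (γ s))
      (deriv (fun s => extChartAt (𝓡∂ 2) x₀ (γ s) 1) t • stdVec 1) t ∧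
    HasDerivAt (fun s => extChartAt (𝓡∂ 2) x₀ (γ s) 1)
      (deriv (fun s => extChartAt (𝓡∂ 2) x₀ (γ s) 1) t) t ∧
    (mfderiv (𝓡∂ 2) 𝓘(ℝ, EuclideanSpace ℝ (Fin 2)) (extChartAt (𝓡∂ 2) x₀) (γ t)
      (mfderiv 𝓘(ℝ, ℝ) (𝓡∂ 2) γ t (1 : ℝ)) : EuclideanSpace ℝ (Fin 2)) =
      deriv (fun s => extChartAt (𝓡∂ 2) x₀ (γ s) 1) t • stdVec 1 := by
  have h1 : HasMFDerivAt 𝓘(ℝ, ℝ) (𝓡∂ 2) γ t _ :=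
    (hγ.contMDiff.contMDiffAt.mdifferentiableAt one_ne_zero).hasMFDerivAt
  have h2 : HasMFDerivAt (𝓡∂ 2) 𝓘(ℝ, EuclideanSpace ℝ (Fin 2)) (extChartAt (𝓡∂ 2) x₀) (γ t) _ :=
    (mdifferentiableAt_extChartAt (by rwa [extChartAt_source] at ht)).hasMFDerivAt
  obtain ⟨L, hL⟩ : ∃ L : ℝ →L[ℝ] EuclideanSpace ℝ (Fin 2), L =
      ((mfderiv (𝓡∂ 2) 𝓘(ℝ, EuclideanSpace ℝ (Fin 2)) (extChartAt (𝓡∂ 2) x₀) (γ t) :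
        EuclideanSpace ℝ (Fin 2) →L[ℝ] EuclideanSpace ℝ (Fin 2)).comp
        (mfderiv 𝓘(ℝ, ℝ) (𝓡∂ 2) γ t : ℝ →L[ℝ] EuclideanSpace ℝ (Fin 2))) := ⟨_, rfl⟩
  have h3 : HasFDerivAt (fun s => extChartAt (𝓡∂ 2) x₀ (γ s)) L t := by
    rw [hL]; exact (h2.comp t h1).hasFDerivAt
  obtain ⟨w, hw⟩ : ∃ w : EuclideanSpace ℝ (Fin 2),
    (mfderiv (𝓡∂ 2) 𝓘(ℝ, EuclideanSpace ℝ (Fin 2)) (extChartAt (𝓡∂ 2) x₀) (γ t)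
      (mfderiv 𝓘(ℝ, ℝ) (𝓡∂ 2) γ t (1 : ℝ)) : EuclideanSpace ℝ (Fin 2)) = w := ⟨_, rfl⟩
  have h4 : HasDerivAt (fun s => extChartAt (𝓡∂ 2) x₀ (γ s)) w t := by
    have : w = L 1 := by rw [← hw, hL]; rfl
    rw [this]; exact h3.hasDerivAt
  have h5 : ∀ i, HasDerivAt (fun s => extChartAt (𝓡∂ 2) x₀ (γ s) i) (w i) t := fun i =>
    (EuclideanSpace.proj (𝕜 := ℝ) i : EuclideanSpace ℝ (Fin 2) →L[ℝ] ℝ).hasFDerivAt.comp_hasDerivAt t h4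
  have h6 : w 0 = 0 := by
    have : (fun s => extChartAt (𝓡∂ 2) x₀ (γ s) 0) =ᶠ[𝓝 t] fun _ => 0 := by
      filter_upwards [hγ.preimage_source_mem ht] with s hs
      exact (mem_boundary_iff_chart hs).1 (hγ.mem_boundary s)
    exact (h5 0).unique ((hasDerivAt_const t (0 : ℝ)).congr_of_eventuallyEq this)
  have h7 : w = w 1 • stdVec 1 := by
    conv_lhs => rw [← planePt_eta w, h6]
    simp [planePt]
  rw [hw, (h5 1).deriv, ← h7]
  exact ⟨h4, h5 1, rfl⟩

/-- The velocity in any chart, in terms of the sign of the chart. -/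
theorem sign_deriv_chart (hγ : IsBoundaryCurve γ) {x₀ : S} {t : ℝ} (ht : γ t ∈ (extChartAt (𝓡∂ 2) x₀).source)
    {s s₀ : SignType} (hs : s ≠ 0)
    (hv : SignType.sign ((show EuclideanSpace ℝ (Fin 2) from mfderiv 𝓘(ℝ, ℝ) (𝓡∂ 2) γ t (1 : ℝ)) 1) = -s)
    (hx : SignType.sign (mdet (𝓡∂ 2) (extChartAt (𝓡∂ 2) x₀) (γ t)) = s₀ * s) :
    SignType.sign (deriv (fun s => extChartAt (𝓡∂ 2) x₀ (γ s) 1) t) = -s₀ := by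
  obtain ⟨-, -, h1⟩ := hγ.hasDerivAt_chart ht
  obtain ⟨-, -, h2⟩ := hγ.hasDerivAt_chart (mem_extChartAt_source (I := 𝓡∂ 2) (γ t))
  have h3 : (mfderiv 𝓘(ℝ, ℝ) (𝓡∂ 2) γ t (1 : ℝ) : EuclideanSpace ℝ (Fin 2)) =
      deriv (fun s => extChartAt (𝓡∂ 2) (γ t) (γ s) 1) t • stdVec 1 := by
    rw [← h2, mfderiv_extChartAt_self]; rfl
  have h0 := mdet_extChartAt_ne_zero ht
  unfold mdet at h0 hx
  -- positivity of the derivative along the inward normal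
  have hxx := mem_extChartAt_source (I := 𝓡∂ 2) (γ t)
  obtain ⟨D, hD1, hD2⟩ := hasFDerivWithinAt_chart (I := 𝓡∂ 2) (x₀ := γ t) (x := γ t) hxx
    (F := extChartAt (𝓡∂ 2) x₀) (mdifferentiableAt_extChartAt (by rwa [extChartAt_source] at ht))
  have hDA : (mfderiv (𝓡∂ 2) 𝓘(ℝ, EuclideanSpace ℝ (Fin 2)) (extChartAt (𝓡∂ 2) x₀) (γ t) :
      EuclideanSpace ℝ (Fin 2) →L[ℝ] EuclideanSpace ℝ (Fin 2)) = D := by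
    rw [hD2, mfderiv_extChartAt_self]; rfl
  obtain ⟨A, hA⟩ : ∃ A : EuclideanSpace ℝ (Fin 2) →L[ℝ] EuclideanSpace ℝ (Fin 2), A = D := ⟨_, rfl⟩
  obtain ⟨v, hvv⟩ : ∃ v : EuclideanSpace ℝ (Fin 2),
    v = (mfderiv 𝓘(ℝ, ℝ) (𝓡∂ 2) γ t (1 : ℝ) : EuclideanSpace ℝ (Fin 2)) := ⟨_, rfl⟩
  -- The first coordinate of the chart at `x₀` is nonnegative and vanishes at `γ t`. It has a local
  -- minimum there on the half plane, so its derivative in the inward direction is nonnegative.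
  have hnn : 0 ≤ A (stdVec 0) 0 := by
    have hc : HasFDerivWithinAt (fun y => (extChartAt (𝓡∂ 2) x₀ ((extChartAt (𝓡∂ 2) (γ t)).symm y)) 0)
        ((EuclideanSpace.proj (𝕜 := ℝ) 0 : EuclideanSpace ℝ (Fin 2) →L[ℝ] ℝ).comp D) (range (𝓡∂ 2))
        (extChartAt (𝓡∂ 2) (γ t) (γ t)) :=
      (EuclideanSpace.proj (𝕜 := ℝ) 0 : EuclideanSpace ℝ (Fin 2) →L[ℝ] ℝ).hasFDerivAt.comp_hasFDerivWithinAt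
        _ hD1
    have hmin : IsLocalMinOn
        (fun y => (extChartAt (𝓡∂ 2) x₀ ((extChartAt (𝓡∂ 2) (γ t)).symm y)) 0) (range (𝓡∂ 2))
        (extChartAt (𝓡∂ 2) (γ t) (γ t)) := by
      have hcs : ContinuousWithinAt (extChartAt (𝓡∂ 2) (γ t)).symm (range (𝓡∂ 2))
          (extChartAt (𝓡∂ 2) (γ t) (γ t)) := (continuousAt_extChartAt_symm (γ t)).continuousWithinAt
      have : ∀ᶠ y in 𝓝[range (𝓡∂ 2)] (extChartAt (𝓡∂ 2) (γ t) (γ t)),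
          (extChartAt (𝓡∂ 2) (γ t)).symm y ∈ (extChartAt (𝓡∂ 2) x₀).source := by
        refine hcs.eventually ((isOpen_extChartAt_source x₀).mem_nhds ?_)
        rwa [extChartAt_to_inv]
      filter_upwards [this] with y hy
      rw [extChartAt_to_inv, (mem_boundary_iff_chart ht).1 (hγ.mem_boundary t)]
      exact extChartAt_mem_halfPlane hy
    have := hmin.hasFDerivWithinAt_nonneg hc (y := stdVec 0) (by
      apply mem_posTangentConeAt_of_segment_subset
      rw [range_modelHalfPlane]
      refine convex_halfPlane.segment_subset (extChartAt_mem_halfPlane hxx) ?_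
      have h : (0 : ℝ) ≤ extChartAt (𝓡∂ 2) (γ t) (γ t) 0 := extChartAt_mem_halfPlane hxx
      have h' : (0 : ℝ) ≤ extChartAt (𝓡∂ 2) (γ t) (γ t) 0 + 1 := by linarith
      rw [← add_smul_stdVec_zero, one_smul] at h'
      exact h')
    rw [hA]; exact this
  rw [← hvv] at hv h3
  set τ := deriv (fun s => extChartAt (𝓡∂ 2) x₀ (γ s) 1) t
  have hAv : A v = τ • stdVec 1 := by
    rw [← h1, hA, ← hDA, hvv]; rfl
  have hv1 : v = v 1 • stdVec 1 := by
    rw [h3]; simp [stdVec]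
  have hv0 : v 1 ≠ 0 := by
    intro h
    rw [h, sign_zero] at hv
    revert hv hs
    clear * -
    revert s
    decide
  have hA1 : v 1 • A (stdVec 1) = τ • stdVec 1 := by rw [← map_smul, ← hv1, hAv]
  have hA10 : A (stdVec 1) 0 = 0 := by
    have := congrArg (fun y : EuclideanSpace ℝ (Fin 2) => y 0) hA1
    simpa [stdVec, hv0] using this
  have hA11 : v 1 * A (stdVec 1) 1 = τ := by
    have := congrArg (fun y : EuclideanSpace ℝ (Fin 2) => y 1) hA1
    simpa [stdVec] using this
  -- The change of charts preserves the tangent line of the boundary, so its matrix is triangular.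
  -- As the normal entry is positive, the tangential entry has the sign of the determinant.
  have hdet : A.det = A (stdVec 0) 0 * A (stdVec 1) 1 := by
    rw [clm_det_two, hA10]; ring
  have hx' : SignType.sign A.det = s₀ * s := by rw [← hx, hA, ← hDA]
  have h0' : A.det ≠ 0 := by rw [hA, ← hDA]; exact h0
  rw [hdet] at hx' h0'
  have hpos : 0 < A (stdVec 0) 0 := lt_of_le_of_ne hnn fun h => h0' (by rw [← h, zero_mul])
  rw [sign_mul, sign_pos hpos, one_mul] at hx'
  rw [← hA11, sign_mul, hv, hx']
  revert hs
  clear * -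
  revert s s₀
  decide

end IsBoundaryCurve

end Surface
end

/-! ### A local argument principle on surfaces with boundary. -/

noncomputable section

open MeasureTheory

theorem angularForm_smul (p w : EuclideanSpace ℝ (Fin 2)) (c : ℝ) :
    angularForm p (c • w) = c * angularForm p w := by
  simp only [angularForm, PiLp.smul_apply, smul_eq_mul]; ring

theorem continuous_angularForm {X : Type*} [TopologicalSpace X] {p w : X → EuclideanSpace ℝ (Fin 2)}
    (hp : Continuous p) (hw : Continuous w) (h0 : ∀ x, p x ≠ 0) :
    Continuous fun x => angularForm (p x) (w x) := by
  unfold angularForm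
  refine Continuous.div (by fun_prop) (by fun_prop) fun x => ?_
  have := norm_pos_iff.2 (h0 x)
  positivity

/-- A `C¹` curve in the plane has measure zero. -/
theorem volume_range_curve {β : ℝ → EuclideanSpace ℝ (Fin 2)} (hβ : Differentiable ℝ β) :
    volume (range β) = 0 := by
  -- The curve is extended to a map of the plane that ignores the second variable, whose Jacobian
  -- determinant vanishes identically.
  have h1 : range β ⊆ (fun y : EuclideanSpace ℝ (Fin 2) => β (y 0)) '' univ := by
    rintro _ ⟨t, rfl⟩
    exact ⟨planePt t 0, mem_univ _, by simp⟩
  have h2 : ∀ y : EuclideanSpace ℝ (Fin 2), HasFDerivAt (fun y : EuclideanSpace ℝ (Fin 2) => β (y 0))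
      ((fderiv ℝ β (y 0)).comp (EuclideanSpace.proj (𝕜 := ℝ) 0 : EuclideanSpace ℝ (Fin 2) →L[ℝ] ℝ)) y :=
    fun y => HasFDerivAt.comp y (hβ (y 0)).hasFDerivAt
      (EuclideanSpace.proj (𝕜 := ℝ) 0 : EuclideanSpace ℝ (Fin 2) →L[ℝ] ℝ).hasFDerivAt
  refine measure_mono_null h1 (addHaar_image_eq_zero_of_det_fderivWithin_eq_zero volume
    (fun y _ => (h2 y).hasFDerivWithinAt) fun y _ => ?_)
  rw [clm_det_two]
  have : (EuclideanSpace.proj (𝕜 := ℝ) 0 : EuclideanSpace ℝ (Fin 2) →L[ℝ] ℝ) (stdVec 1) = 0 := by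
    simp [stdVec]
  simp [this]

section Surface

variable {S : Type*} [TopologicalSpace S] [ChartedSpace (EuclideanHalfSpace 2) S]
  [IsManifold (𝓡∂ 2) ∞ S]

/-- `γ` parametrizes the boundary of `S`, oriented according to the chart signs `σ`. -/
structure IsOrientedBoundary (σ : S → SignType) {k : ℕ} (γ : Fin k → ℝ → S) : Prop where
  curve : ∀ i, IsBoundaryCurve (γ i)
  periodic : ∀ i, Function.Periodic (γ i) 1
  injOn : ∀ i, InjOn (γ i) (Ico 0 1)
  disjoint : Pairwise fun i j => Disjoint (range (γ i)) (range (γ j))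
  iUnion_range : ⋃ i, range (γ i) = (𝓡∂ 2).boundary S
  -- In a positive chart the outward vector is `-stdVec 0`, and it forms a positive basis with a
  -- velocity along `-stdVec 1`; hence the minus sign.
  sign_velocity : ∀ i t, SignType.sign
    ((show EuclideanSpace ℝ (Fin 2) from mfderiv 𝓘(ℝ, ℝ) (𝓡∂ 2) (γ i) t (1 : ℝ)) 1) = -σ (γ i t)

/-- The integral over the boundary of the angular form around `a`. -/
def boundaryWinding {k : ℕ} (γ : Fin k → ℝ → S) (α : S → EuclideanSpace ℝ (Fin 2))
    (a : EuclideanSpace ℝ (Fin 2)) : ℝ :=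
  ∑ i, ∫ t in (0 : ℝ)..1, angularForm (α (γ i t) - a) (deriv (fun s => α (γ i s)) t)

theorem IsBoundaryCurve.contDiff_comp {γ : ℝ → S} (hγ : IsBoundaryCurve γ)
    {F : S → EuclideanSpace ℝ (Fin 2)} (hF : ContMDiff (𝓡∂ 2) 𝓘(ℝ, EuclideanSpace ℝ (Fin 2)) 1 F) :
    ContDiff ℝ 1 fun t => F (γ t) :=
  (hF.comp hγ.contMDiff).contDiff

theorem IsBoundaryCurve.continuous_angularForm {γ : ℝ → S} (hγ : IsBoundaryCurve γ)
    {F : S → EuclideanSpace ℝ (Fin 2)} (hF : ContMDiff (𝓡∂ 2) 𝓘(ℝ, EuclideanSpace ℝ (Fin 2)) 1 F)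
    {a : EuclideanSpace ℝ (Fin 2)} (ha : ∀ t, F (γ t) ≠ a) :
    Continuous fun t => angularForm (F (γ t) - a) (deriv (fun s => F (γ s)) t) :=
  _root_.continuous_angularForm ((hγ.contDiff_comp hF).continuous.sub continuous_const)
    ((hγ.contDiff_comp hF).continuous_deriv le_rfl) fun t => sub_ne_zero.2 (ha t)

theorem IsBoundaryCurve.chart_eq_planePt {γ : ℝ → S} (hγ : IsBoundaryCurve γ) {x₀ : S} {t : ℝ}
    (ht : γ t ∈ (extChartAt (𝓡∂ 2) x₀).source) :
    extChartAt (𝓡∂ 2) x₀ (γ t) = planePt 0 (extChartAt (𝓡∂ 2) x₀ (γ t) 1) := by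
  conv_lhs => rw [← planePt_eta (extChartAt (𝓡∂ 2) x₀ (γ t)),
    (mem_boundary_iff_chart ht).1 (hγ.mem_boundary t)]

theorem IsBoundaryCurve.deriv_comp {γ : ℝ → S} (hγ : IsBoundaryCurve γ) {x₀ : S} {t : ℝ}
    (ht : γ t ∈ (extChartAt (𝓡∂ 2) x₀).source)
    {F : S → EuclideanSpace ℝ (Fin 2)} (hF : ContMDiff (𝓡∂ 2) 𝓘(ℝ, EuclideanSpace ℝ (Fin 2)) 1 F) :
    deriv (fun s => F (γ s)) t = deriv (fun s => extChartAt (𝓡∂ 2) x₀ (γ s) 1) t •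
      fderivWithin ℝ (F ∘ (extChartAt (𝓡∂ 2) x₀).symm) halfPlane
        (planePt 0 (extChartAt (𝓡∂ 2) x₀ (γ t) 1)) (stdVec 1) := by
  obtain ⟨D, hD, -⟩ := hasFDerivWithinAt_chart ht (hF.mdifferentiableAt one_ne_zero)
  rw [range_modelHalfPlane] at hD
  obtain ⟨h1, -, -⟩ := hγ.hasDerivAt_chart ht
  rw [← hγ.chart_eq_planePt ht, hD.fderivWithin (uniqueDiffOn_halfPlane _ (extChartAt_mem_halfPlane ht))]
  have hev : ∀ᶠ s in 𝓝 t, extChartAt (𝓡∂ 2) x₀ (γ s) ∈ halfPlane :=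
    (hγ.preimage_source_mem ht).mono fun s hs => extChartAt_mem_halfPlane hs
  have h2 := HasFDerivWithinAt.comp_hasDerivAt_of_eq t hD h1 hev rfl
  rw [map_smul] at h2
  refine HasDerivAt.deriv (h2.congr_of_eventuallyEq ?_)
  filter_upwards [hγ.preimage_source_mem ht] with s hs
  simp only [Function.comp_apply, (extChartAt (𝓡∂ 2) x₀).left_inv hs]

/-- Off `W` the counts agree, and in the chart at `x₀` their difference is given by
`sum_sign_det_sub_eq_boundary`. The substitution `t ↦ φ (γ i t) 1` turns the line integral found
there into integrals over the curves. The sign in that formula, the sign of the boundary velocity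
and the sign `σ x₀` of the chart combine to `+1`. -/
theorem degCount_sub_eq_boundaryWinding_sub [T2Space S] [CompactSpace S] {σ : S → SignType} {k : ℕ}
    {γ : Fin k → ℝ → S} (hγ : IsOrientedBoundary σ γ) {W T : Set S} {x₀ : S} (hWo : IsOpen W)
    (hWs : W ⊆ (extChartAt (𝓡∂ 2) x₀).source) (hT : IsCompact T) (hTW : T ⊆ W)
    {F₀ F₁ : S → EuclideanSpace ℝ (Fin 2)}
    (h₀ : ContMDiff (𝓡∂ 2) 𝓘(ℝ, EuclideanSpace ℝ (Fin 2)) 1 F₀)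
    (h₁ : ContMDiff (𝓡∂ 2) 𝓘(ℝ, EuclideanSpace ℝ (Fin 2)) 1 F₁)
    (hσ : ∀ x ∈ W, σ x ≠ 0 ∧ SignType.sign (mdet (𝓡∂ 2) (extChartAt (𝓡∂ 2) x₀) x) = σ x₀ * σ x)
    (heq : ∀ x ∉ T, F₀ x = F₁ x) {a : EuclideanSpace ℝ (Fin 2)}
    (r₀ : ∀ x, F₀ x = a → mdet (𝓡∂ 2) F₀ x ≠ 0) (r₁ : ∀ x, F₁ x = a → mdet (𝓡∂ 2) F₁ x ≠ 0)
    (b₀ : ∀ x ∈ (𝓡∂ 2).boundary S, F₀ x ≠ a) (b₁ : ∀ x ∈ (𝓡∂ 2).boundary S, F₁ x ≠ a) :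
    2 * Real.pi * ((degCount (𝓡∂ 2) σ univ F₁ a : ℝ) - degCount (𝓡∂ 2) σ univ F₀ a) =
      boundaryWinding γ F₁ a - boundaryWinding γ F₀ a := by
  have md : ∀ {F : S → EuclideanSpace ℝ (Fin 2)}
      (_ : ContMDiff (𝓡∂ 2) 𝓘(ℝ, EuclideanSpace ℝ (Fin 2)) 1 F) (x : S),
      MDifferentiableAt (𝓡∂ 2) 𝓘(ℝ, EuclideanSpace ℝ (Fin 2)) F x :=
    fun h x => h.mdifferentiableAt one_ne_zero
  have fin : ∀ {F : S → EuclideanSpace ℝ (Fin 2)}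
      (_ : ContMDiff (𝓡∂ 2) 𝓘(ℝ, EuclideanSpace ℝ (Fin 2)) 1 F)
      (_ : ∀ x, F x = a → mdet (𝓡∂ 2) F x ≠ 0), {x ∈ univ | F x = a}.Finite := fun h r =>
    finite_fibre isCompact_univ (fun x _ => md h x) fun x _ => r x
  have f₀ := fin h₀ r₀
  have f₁ := fin h₁ r₁
  have hoff : ∀ x ∈ univ \ W, F₀ =ᶠ[𝓝 x] F₁ := fun x hx => by
    filter_upwards [hT.isClosed.isOpen_compl.mem_nhds fun h => hx.2 (hTW h)] with z hz using heq z hz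
  have hdeg := degCount_sub_degCount (I := 𝓡∂ 2) (σ := σ) (subset_univ W) f₀ f₁ hoff
  let φ := extChartAt (𝓡∂ 2) x₀
  obtain ⟨O, hO, hOe⟩ := exists_isOpen_chart hWo x₀
  change O ∩ halfPlane = φ.target ∩ φ.symm ⁻¹' W at hOe
  have hPf : ∀ {F : S → EuclideanSpace ℝ (Fin 2)} (_ : {x ∈ univ | F x = a}.Finite),
      {y | y ∈ O ∩ halfPlane ∧ (F ∘ φ.symm) y = a}.Finite := fun h =>
    (h.image φ).subset fun y hy => ⟨φ.symm y, ⟨mem_univ _, hy.2⟩, φ.right_inv (hOe ▸ hy.1).1⟩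
  have hpos : ∀ {F : S → EuclideanSpace ℝ (Fin 2)} (_ : ∀ x ∈ (𝓡∂ 2).boundary S, F x ≠ a),
      ∀ y, y ∈ O ∩ halfPlane → (F ∘ φ.symm) y = a → 0 < y 0 := by
    intro F b y hy hya
    have hy' := hOe ▸ hy
    have hs : φ.symm y ∈ φ.source := φ.map_target hy'.1
    refine lt_of_le_of_ne hy.2 fun h => b (φ.symm y) ((mem_boundary_iff_chart hs).2 ?_) hya
    change φ (φ.symm y) 0 = 0
    rw [φ.right_inv hy'.1, h]
  have hfd : ∀ {F : S → EuclideanSpace ℝ (Fin 2)} {y : EuclideanSpace ℝ (Fin 2)} (_ : 0 < y 0),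
      fderivWithin ℝ (F ∘ φ.symm) (range (𝓡∂ 2)) y = fderiv ℝ (F ∘ φ.symm) y := fun hy => by
    rw [range_modelHalfPlane]; exact fderivWithin_of_mem_nhds (mem_interior_halfPlane hy)
  have hreg : ∀ {F : S → EuclideanSpace ℝ (Fin 2)}
      (_ : ContMDiff (𝓡∂ 2) 𝓘(ℝ, EuclideanSpace ℝ (Fin 2)) 1 F)
      (_ : ∀ x ∈ (𝓡∂ 2).boundary S, F x ≠ a) (_ : ∀ x, F x = a → mdet (𝓡∂ 2) F x ≠ 0),
      ∀ y, y ∈ O ∩ halfPlane → (F ∘ φ.symm) y = a → (fderiv ℝ (F ∘ φ.symm) y).det ≠ 0 := by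
    intro F h b r y hy hya h0
    have hy' := hOe ▸ hy
    have hs : φ.symm y ∈ φ.source := φ.map_target hy'.1
    have := mdet_eq_mul (x₀ := x₀) hs (md h _)
    change mdet (𝓡∂ 2) F (φ.symm y) =
      (fderivWithin ℝ (F ∘ φ.symm) (range (𝓡∂ 2)) (φ (φ.symm y))).det * _ at this
    rw [φ.right_inv hy'.1, hfd (hpos b y hy hya), h0, zero_mul] at this
    exact r _ hya this
  have e : ∀ {F : S → EuclideanSpace ℝ (Fin 2)}
      (_ : ContMDiff (𝓡∂ 2) 𝓘(ℝ, EuclideanSpace ℝ (Fin 2)) 1 F)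
      (_ : ∀ x ∈ (𝓡∂ 2).boundary S, F x ≠ a)
      (h : {x ∈ univ | F x = a}.Finite), (degCount (𝓡∂ 2) σ W F a : ℝ) =
        ((σ x₀ : SignType) : ℝ) * ∑ y ∈ (hPf h).toFinset,
        ((SignType.sign (fderiv ℝ (F ∘ φ.symm) y).det : SignType) : ℝ) := by
    intro F h b hf
    have h1 := finsum_localSign_chart (I := 𝓡∂ 2) (σ := σ) hWs hσ (fun x _ => md h x) (a := a)
      (P := (hPf hf).toFinset) (fun y => by
        rw [(hPf hf).mem_toFinset, mem_ofPred_eq, hOe])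
    have h2 : (degCount (𝓡∂ 2) σ W F a : ℝ) = _ := congrArg (fun z : ℤ => (z : ℝ)) h1
    rw [h2]
    push_cast
    congr 1
    refine Finset.sum_congr rfl fun y hy => ?_
    have hy' := (hPf hf).mem_toFinset.1 hy
    rw [← hfd (hpos b y hy'.1 hy'.2)]
  have hT' : IsCompact (φ '' T) :=
    hT.image_of_continuousOn ((continuousOn_extChartAt x₀).mono (hTW.trans hWs))
  have hT'O : φ '' T ⊆ O ∩ halfPlane := by
    rw [hOe]
    rintro _ ⟨x, hx, rfl⟩
    refine ⟨φ.map_source (hWs (hTW hx)), ?_⟩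
    rw [mem_preimage, φ.left_inv (hWs (hTW hx))]
    exact hTW hx
  have main := sum_sign_det_sub_eq_boundary (V₀ := F₀ ∘ φ.symm) (V₁ := F₁ ∘ φ.symm) (a := a) hO
    hT' (hT'O.trans inter_subset_left)
    (by rw [hOe]; exact contDiffOn_chart fun x _ => h₀ x)
    (by rw [hOe]; exact contDiffOn_chart fun x _ => h₁ x) (by
      intro y hy hyT
      refine heq _ fun h => hyT ⟨_, h, φ.right_inv (hOe ▸ hy).1⟩)
    (P₀ := (hPf f₀).toFinset) (P₁ := (hPf f₁).toFinset)
    (fun y => (hPf f₀).mem_toFinset) (fun y => (hPf f₁).mem_toFinset)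
    (fun y hy => hpos b₀ y ((hPf f₀).mem_toFinset.1 hy).1 ((hPf f₀).mem_toFinset.1 hy).2)
    (fun y hy => hpos b₁ y ((hPf f₁).mem_toFinset.1 hy).1 ((hPf f₁).mem_toFinset.1 hy).2)
    (fun y hy => hreg h₀ b₀ r₀ y ((hPf f₀).mem_toFinset.1 hy).1 ((hPf f₀).mem_toFinset.1 hy).2)
    (fun y hy => hreg h₁ b₁ r₁ y ((hPf f₁).mem_toFinset.1 hy).1 ((hPf f₁).mem_toFinset.1 hy).2)
  obtain ⟨h, hh⟩ : ∃ h : ℝ → ℝ, h = fun t =>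
      angularForm ((F₁ ∘ φ.symm) (planePt 0 t) - a)
        (fderivWithin ℝ (F₁ ∘ φ.symm) halfPlane (planePt 0 t) (stdVec 1)) -
      angularForm ((F₀ ∘ φ.symm) (planePt 0 t) - a)
        (fderivWithin ℝ (F₀ ∘ φ.symm) halfPlane (planePt 0 t) (stdVec 1)) := ⟨_, rfl⟩
  change _ = - ∫ t in {t : ℝ | planePt 0 t ∈ φ '' T}, _ at main
  rw [← hh] at main
  -- the boundary terms
  let τ : Fin k → ℝ → ℝ := fun i t => φ (γ i t) 1
  -- Parameters in one period at which the curve lies in `T`. At the others both maps agree near the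
  -- curve, so the integrands cancel.
  let B : Fin k → Set ℝ := fun i => Ico 0 1 ∩ γ i ⁻¹' T
  let Δ : Fin k → ℝ → ℝ := fun i t => angularForm (F₁ (γ i t) - a) (deriv (fun s => F₁ (γ i s)) t) -
    angularForm (F₀ (γ i t) - a) (deriv (fun s => F₀ (γ i s)) t)
  have hγc : ∀ i, Continuous (γ i) := fun i => (hγ.curve i).contMDiff.continuous
  have hΔc : ∀ i, Continuous (Δ i) := fun i =>
    ((hγ.curve i).continuous_angularForm h₁ fun t => b₁ _ ((hγ.curve i).mem_boundary t)).sub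
      ((hγ.curve i).continuous_angularForm h₀ fun t => b₀ _ ((hγ.curve i).mem_boundary t))
  have hBm : ∀ i, MeasurableSet (B i) := fun i =>
    measurableSet_Ico.inter (hT.isClosed.preimage (hγc i)).measurableSet
  have hBs : ∀ i, ∀ t ∈ B i, γ i t ∈ φ.source := fun i t ht => hWs (hTW ht.2)
  have hτd : ∀ i, ∀ t ∈ B i, HasDerivAt (τ i) (deriv (τ i) t) t := fun i t ht =>
    ((hγ.curve i).hasDerivAt_chart (hBs i t ht)).2.1
  have hγτ : ∀ i, ∀ t ∈ B i, φ (γ i t) = planePt 0 (τ i t) := fun i t ht =>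
    (hγ.curve i).chart_eq_planePt (hBs i t ht)
  have hτinj : ∀ i, InjOn (τ i) (B i) := by
    intro i t ht s hs hts
    refine hγ.injOn i ht.1 hs.1 (φ.injOn (hBs i t ht) (hBs i s hs) ?_)
    rw [hγτ i t ht, hγτ i s hs, hts]
  have hΔ : ∀ i, ∀ t ∈ B i, Δ i t = -((σ x₀ : SignType) : ℝ) * (|deriv (τ i) t| • h (τ i t)) := by
    intro i t ht
    have hsrc := hBs i t ht
    have hx := hσ _ (hTW ht.2)
    have hsgn := (hγ.curve i).sign_deriv_chart hsrc hx.1 (hγ.sign_velocity i t) hx.2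
    have e1 : deriv (τ i) t = -((σ x₀ : SignType) : ℝ) * |deriv (τ i) t| := by
      have h2 := sign_mul_abs (deriv (τ i) t)
      have h3 : SignType.sign (deriv (τ i) t) = -σ x₀ := hsgn
      rw [h3] at h2
      have hcast : ∀ s : SignType, ((-s : SignType) : ℝ) = -(s : ℝ) := by intro s; cases s <;> simp
      rw [hcast] at h2
      exact h2.symm
    have e2 : ∀ {F : S → EuclideanSpace ℝ (Fin 2)}
      (_ : ContMDiff (𝓡∂ 2) 𝓘(ℝ, EuclideanSpace ℝ (Fin 2)) 1 F),
        angularForm (F (γ i t) - a) (deriv (fun s => F (γ i s)) t) = deriv (τ i) t *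
          angularForm ((F ∘ φ.symm) (planePt 0 (τ i t)) - a)
            (fderivWithin ℝ (F ∘ φ.symm) halfPlane (planePt 0 (τ i t)) (stdVec 1)) := by
      intro F hF
      rw [(hγ.curve i).deriv_comp hsrc hF, angularForm_smul]
      congr 2
      rw [← hγτ i t ht, Function.comp_apply, φ.left_inv hsrc]
    calc Δ i t = deriv (τ i) t * h (τ i t) := by
          simp only [Δ]
          rw [e2 h₁, e2 h₀, hh]; ring
      _ = _ := by
        conv_lhs => rw [e1]
        rw [smul_eq_mul]; ring
  -- The point `x₀` is not assumed to lie in `W`; that `σ x₀ ≠ 0` is deduced from any point of `W`.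
  have hsig : ((σ x₀ : SignType) : ℝ) * ((σ x₀ : SignType) : ℝ) = 1 ∨ W = ∅ := by
    by_cases hW : W = ∅
    · exact Or.inr hW
    · obtain ⟨x, hx⟩ := nonempty_iff_ne_empty.2 hW
      left
      have h1 := hσ x hx
      have h2 := mdet_extChartAt_ne_zero (hWs hx)
      have : σ x₀ ≠ 0 := by
        intro h3
        rw [h3, zero_mul] at h1
        exact h2 (sign_eq_zero_iff.1 h1.2)
      revert this
      generalize σ x₀ = s
      cases s <;> simp
  have hint : ∀ i, ∫ t in (0 : ℝ)..1, Δ i t = -((σ x₀ : SignType) : ℝ) * ∫ t in τ i '' B i, h t := by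
    intro i
    rw [intervalIntegral.integral_of_le zero_le_one, ← integral_Ico_eq_integral_Ioc]
    have h1 : ∫ t in Ico (0 : ℝ) 1, Δ i t = ∫ t in B i, Δ i t := by
      refine (setIntegral_eq_of_subset_of_forall_sdiff_eq_zero measurableSet_Ico inter_subset_left ?_)
      intro t ht
      have htT : γ i t ∉ T := fun h => ht.2 ⟨ht.1, h⟩
      have hev : (fun s => F₁ (γ i s)) =ᶠ[𝓝 t] fun s => F₀ (γ i s) := by
        filter_upwards [(hγc i).continuousAt.eventually (hT.isClosed.isOpen_compl.mem_nhds htT)]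
          with s hs using (heq _ hs).symm
      simp only [Δ]
      rw [hev.deriv_eq, heq _ htT, sub_self]
    rw [h1, setIntegral_congr_fun (hBm i) (hΔ i), integral_const_mul,
      integral_image_eq_integral_abs_deriv_smul (hBm i)
        (fun t ht => (hτd i t ht).hasDerivWithinAt) (hτinj i)]
  -- The curves exhaust the boundary, so in the chart they cover the part of the boundary line lying
  -- in the image of `T`. Each point is covered once, by injectivity over a period and disjointness.
  have hunion : {t : ℝ | planePt 0 t ∈ φ '' T} = ⋃ i, τ i '' B i := by
    ext t
    simp only [mem_ofPred_eq, mem_iUnion]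
    constructor
    · rintro ⟨x, hx, hxt⟩
      have hxs := hWs (hTW hx)
      have hxb : x ∈ (𝓡∂ 2).boundary S := by
        refine (mem_boundary_iff_chart hxs).2 ?_
        change φ x 0 = 0
        rw [hxt, planePt_zero]
      rw [← hγ.iUnion_range] at hxb
      obtain ⟨i, s, hs⟩ := mem_iUnion.1 hxb
      obtain ⟨s', hs', hss⟩ := (hγ.periodic i).exists_mem_Ico₀ zero_lt_one s
      have e1 : γ i s' = x := by rw [← hss, hs]
      refine ⟨i, s', ⟨hs', by rw [mem_preimage, e1]; exact hx⟩, ?_⟩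
      simp only [τ]
      rw [e1, hxt, planePt_one]
    · rintro ⟨i, s, hs, rfl⟩
      exact ⟨γ i s, hs.2, hγτ i s hs⟩
  have hdisj : Pairwise (Function.onFun Disjoint fun i => τ i '' B i) := by
    intro i j hij
    refine disjoint_left.2 ?_
    rintro _ ⟨s, hs, rfl⟩ ⟨t, ht, hst⟩
    have : γ i s = γ j t := φ.injOn (hBs i s hs) (hBs j t ht) (by
      rw [hγτ i s hs, hγτ j t ht, hst])
    exact disjoint_left.1 (hγ.disjoint hij) ⟨s, rfl⟩ (this ▸ ⟨t, rfl⟩)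
  have hwind : boundaryWinding γ F₁ a - boundaryWinding γ F₀ a = ∑ i, ∫ t in (0 : ℝ)..1, Δ i t := by
    rw [boundaryWinding, boundaryWinding, ← Finset.sum_sub_distrib]
    refine Finset.sum_congr rfl fun i _ => (intervalIntegral.integral_sub ?_ ?_).symm
    · exact ((hγ.curve i).continuous_angularForm h₁ fun t =>
        b₁ _ ((hγ.curve i).mem_boundary t)).intervalIntegrable _ _
    · exact ((hγ.curve i).continuous_angularForm h₀ fun t =>
        b₀ _ ((hγ.curve i).mem_boundary t)).intervalIntegrable _ _
  have hdeg' : (degCount (𝓡∂ 2) σ univ F₁ a : ℝ) - degCount (𝓡∂ 2) σ univ F₀ a =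
      degCount (𝓡∂ 2) σ W F₁ a - degCount (𝓡∂ 2) σ W F₀ a := by exact_mod_cast hdeg
  rw [hdeg', e h₁ b₁ f₁, e h₀ b₀ f₀, ← mul_sub, mul_left_comm, main, hwind,
    Finset.sum_congr rfl fun i _ => hint i, ← Finset.mul_sum, hunion]
  rw [integral_iUnion_fintype (fun i => (hBm i).image_of_continuousOn_injOn
    (fun t ht => (hτd i t ht).continuousAt.continuousWithinAt) (hτinj i)) hdisj]
  · ring
  · intro i
    rw [integrableOn_image_iff_integrableOn_abs_deriv_smul (hBm i)
        (fun t ht => (hτd i t ht).hasDerivWithinAt) (hτinj i)]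
    rcases hsig with hsig | hW
    · have h1 : IntegrableOn (fun t => -((σ x₀ : SignType) : ℝ) * Δ i t) (B i) :=
        (((hΔc i).const_mul _).integrableOn_Icc (a := 0) (b := 1)).mono_set
          fun t ht => Ico_subset_Icc_self ht.1
      refine h1.congr_fun (fun t ht => ?_) (hBm i)
      change -((σ x₀ : SignType) : ℝ) * Δ i t = _
      rw [hΔ i t ht, ← mul_assoc, neg_mul_neg, hsig, one_mul]
    · have : B i = ∅ := by
        ext t
        simp only [mem_empty_iff_false, iff_false]
        intro ht
        have := hTW ht.2
        rw [hW] at this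
        exact this
      rw [this]; exact integrableOn_empty

end Surface
end

/-! ### The argument principle on a compact surface. -/

noncomputable section

open MeasureTheory

section Surface

variable {S : Type*} [TopologicalSpace S] [ChartedSpace (EuclideanHalfSpace 2) S]
  [IsManifold (𝓡∂ 2) ∞ S]

theorem IsOrientedBoundary.ae_forall_ne {σ : S → SignType} {k : ℕ} {γ : Fin k → ℝ → S}
    (hγ : IsOrientedBoundary σ γ) {F : S → EuclideanSpace ℝ (Fin 2)}
    (hF : ContMDiff (𝓡∂ 2) 𝓘(ℝ, EuclideanSpace ℝ (Fin 2)) 1 F) :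
    ∀ᵐ a : EuclideanSpace ℝ (Fin 2), ∀ x ∈ (𝓡∂ 2).boundary S, F x ≠ a := by
  have h : ∀ i, ∀ᵐ a : EuclideanSpace ℝ (Fin 2), a ∉ range fun t => F (γ i t) := fun i =>
    compl_mem_ae_iff.2 (volume_range_curve (((hγ.curve i).contDiff_comp hF).differentiable one_ne_zero))
  filter_upwards [ae_all_iff.2 h] with a ha x hx hxa
  rw [← hγ.iUnion_range] at hx
  obtain ⟨i, t, rfl⟩ := mem_iUnion.1 hx
  exact ha i ⟨t, hxa⟩

variable [T2Space S] [CompactSpace S]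

/-- Deform `α` to the constant map `0`, one chart at a time. The deformation may cross the value
`a`, since count and boundary integral change together; both vanish for the constant map when `a ≠
0`. Each stage excludes only a null set of values: the critical values and the image of the
boundary. -/
theorem ae_degCount_eq_boundaryWinding {σ : S → SignType} (hσ : IsOrientationSign (𝓡∂ 2) σ univ)
    {k : ℕ} {γ : Fin k → ℝ → S} (hγ : IsOrientedBoundary σ γ) {α : S → EuclideanSpace ℝ (Fin 2)}
    (hα : ContMDiff (𝓡∂ 2) 𝓘(ℝ, EuclideanSpace ℝ (Fin 2)) 1 α) :
    ∀ᵐ a : EuclideanSpace ℝ (Fin 2),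
      2 * Real.pi * (degCount (𝓡∂ 2) σ univ α a : ℝ) = boundaryWinding γ α a := by
  let F₁ : S → EuclideanSpace ℝ (Fin 2) := fun _ => 0
  have h₁ : ContMDiff (𝓡∂ 2) 𝓘(ℝ, EuclideanSpace ℝ (Fin 2)) 1 F₁ := contMDiff_const
  have key : ∀ s₀ : S → ℝ, ContMDiff (𝓡∂ 2) 𝓘(ℝ, ℝ) ∞ s₀ →
      ∃ s : S → ℝ, ContMDiff (𝓡∂ 2) 𝓘(ℝ, ℝ) ∞ s ∧
      (∀ x, s₀ x = 1 → s x = 1) ∧ (∀ x ∈ (univ : Set S), s x = 1) ∧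
      ∀ᵐ a : EuclideanSpace ℝ (Fin 2),
        2 * Real.pi * (degCount (𝓡∂ 2) σ univ (interp α F₁ s) a : ℝ) -
          2 * Real.pi * (degCount (𝓡∂ 2) σ univ (interp α F₁ s₀) a : ℝ) =
        boundaryWinding γ (interp α F₁ s) a - boundaryWinding γ (interp α F₁ s₀) a := by
    refine isCompact_univ.induction_on (p := fun K' => ∀ s₀ : S → ℝ, ContMDiff (𝓡∂ 2) 𝓘(ℝ, ℝ) ∞ s₀ →
      ∃ s : S → ℝ, ContMDiff (𝓡∂ 2) 𝓘(ℝ, ℝ) ∞ s ∧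
      (∀ x, s₀ x = 1 → s x = 1) ∧ (∀ x ∈ K', s x = 1) ∧
      ∀ᵐ a : EuclideanSpace ℝ (Fin 2),
        2 * Real.pi * (degCount (𝓡∂ 2) σ univ (interp α F₁ s) a : ℝ) -
          2 * Real.pi * (degCount (𝓡∂ 2) σ univ (interp α F₁ s₀) a : ℝ) =
        boundaryWinding γ (interp α F₁ s) a - boundaryWinding γ (interp α F₁ s₀) a) ?_ ?_ ?_ ?_
    · intro s₀ hs
      exact ⟨s₀, hs, fun _ h => h, by simp, by simp⟩
    · intro T₁ T₂ hT h s₀ hs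
      obtain ⟨s, a1, a3, a4, a5⟩ := h s₀ hs
      exact ⟨s, a1, a3, fun x hx => a4 x (hT hx), a5⟩
    · intro T₁ T₂ H₁ H₂ s₀ hs
      obtain ⟨s, a1, a3, a4, a5⟩ := H₁ s₀ hs
      obtain ⟨s', b1, b3, b4, b5⟩ := H₂ s a1
      refine ⟨s', b1, fun x h => b3 x (a3 x h), ?_, ?_⟩
      · rintro x (hx | hx)
        exacts [b3 x (a4 x hx), b4 x hx]
      · filter_upwards [a5, b5] with a h5 h6
        linarith
    · intro x₀ _
      have hW : (extChartAt (𝓡∂ 2) x₀).source ∩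
          {x | x ∈ univ → SignType.sign (mdet (𝓡∂ 2) (extChartAt (𝓡∂ 2) x₀) x) = σ x₀ * σ x} ∈ 𝓝 x₀ :=
        inter_mem (extChartAt_source_mem_nhds x₀) (hσ.eventually_eq x₀ (mem_univ _))
      obtain ⟨W, hWs, hWo, hxW⟩ := mem_nhds_iff.1 hW
      obtain ⟨χ, -, hχ⟩ := (SmoothBumpFunction.nhds_basis_tsupport (I := 𝓡∂ 2) x₀).mem_iff.1
        (hWo.mem_nhds hxW)
      have hχs : ContMDiff (𝓡∂ 2) 𝓘(ℝ, ℝ) ∞ χ := χ.contMDiff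
      refine ⟨{x | χ x = 1}, mem_nhdsWithin_of_mem_nhds χ.eventuallyEq_one, fun s₀ hs => ?_⟩
      have hs' : ContMDiff (𝓡∂ 2) 𝓘(ℝ, ℝ) ∞ fun x => s₀ x + χ x * (1 - s₀ x) :=
        hs.add (hχs.mul (contMDiff_const.sub hs))
      refine ⟨_, hs', fun x hx => by simp [hx], ?_, ?_⟩
      · intro x hx
        have hx' : χ x = 1 := hx
        change s₀ x + χ x * (1 - s₀ x) = 1
        rw [hx']; ring
      · have c₀ : ContMDiff (𝓡∂ 2) 𝓘(ℝ, EuclideanSpace ℝ (Fin 2)) 1 (interp α F₁ s₀) := fun x =>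
          contMDiffAt_interp (hα x) (h₁ x) hs
        have c₁ : ContMDiff (𝓡∂ 2) 𝓘(ℝ, EuclideanSpace ℝ (Fin 2)) 1
            (interp α F₁ fun x => s₀ x + χ x * (1 - s₀ x)) := fun x =>
          contMDiffAt_interp (hα x) (h₁ x) hs'
        filter_upwards [hγ.ae_forall_ne c₀, hγ.ae_forall_ne c₁,
          ae_regular isCompact_univ fun x _ => c₀.mdifferentiableAt one_ne_zero,
          ae_regular isCompact_univ fun x _ => c₁.mdifferentiableAt one_ne_zero] with a b₀ b₁ r₀ r₁
        rw [← mul_sub]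
        refine degCount_sub_eq_boundaryWinding_sub (x₀ := x₀) hγ hWo (fun x hx => (hWs hx).1)
          χ.hasCompactSupport hχ c₀ c₁
          (fun x hx => ⟨hσ.ne_zero x (mem_univ _), (hWs hx).2 (mem_univ _)⟩) ?_
          (fun x => r₀ x (mem_univ _)) (fun x => r₁ x (mem_univ _)) b₀ b₁
        intro x hx
        simp [interp, image_eq_zero_of_notMem_tsupport hx]
  obtain ⟨s, -, -, a4, a5⟩ := key (fun _ => 0) contMDiff_const
  have hne : ∀ᵐ a : EuclideanSpace ℝ (Fin 2), a ≠ 0 := by simp [ae_iff]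
  filter_upwards [a5, hne] with a h5 ha
  have e0 : interp α F₁ (fun _ => 0) = α := by ext1 x; simp [interp]
  have e1 : interp α F₁ s = fun _ => 0 := by
    ext1 x; simp [interp, F₁, a4 x (mem_univ x)]
  have d1 : degCount (𝓡∂ 2) σ univ (fun _ : S => (0 : EuclideanSpace ℝ (Fin 2))) a = 0 := by
    have : {x ∈ (univ : Set S) | (0 : EuclideanSpace ℝ (Fin 2)) = a} = ∅ := by
      ext x; simp [ha.symm]
    rw [degCount, this, finsum_mem_empty]
  have w1 : boundaryWinding γ (fun _ : S => (0 : EuclideanSpace ℝ (Fin 2))) a = 0 := by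
    simp [boundaryWinding, angularForm]
  rw [e0, e1, d1, w1] at h5
  push_cast at h5
  linarith

end Surface
end

/-! ### Coordinates on the tangent bundle given by a frame. -/

noncomputable section

open MeasureTheory

/-- The determinant of three vectors of `ℝ³`. -/
def det3 (u v w : EuclideanSpace ℝ (Fin 3)) : ℝ :=
  (EuclideanSpace.basisFun (Fin 3) ℝ).toBasis.det ![u, v, w]

theorem det3_eq (u v w : EuclideanSpace ℝ (Fin 3)) :
    det3 u v w = u 0 * (v 1 * w 2 - v 2 * w 1) - v 0 * (u 1 * w 2 - u 2 * w 1) +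
      w 0 * (u 1 * v 2 - u 2 * v 1) := by
  rw [det3, Module.Basis.det_apply, Matrix.det_fin_three]
  simp [Module.Basis.toMatrix_apply]
  ring

theorem det3_map (A : EuclideanSpace ℝ (Fin 3) →L[ℝ] EuclideanSpace ℝ (Fin 3))
    (u v w : EuclideanSpace ℝ (Fin 3)) : det3 (A u) (A v) (A w) = A.det * det3 u v w := by
  have h := (EuclideanSpace.basisFun (Fin 3) ℝ).toBasis.det_comp
    (A : EuclideanSpace ℝ (Fin 3) →ₗ[ℝ] EuclideanSpace ℝ (Fin 3)) ![u, v, w]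
  rw [det3, det3, ContinuousLinearMap.det, ← h]
  congr 1
  ext i
  fin_cases i <;> rfl

theorem det3_eq_mul_basis_det (b : Module.Basis (Fin 3) ℝ (EuclideanSpace ℝ (Fin 3)))
    (u v w : EuclideanSpace ℝ (Fin 3)) :
    det3 u v w = det3 (b 0) (b 1) (b 2) * b.det ![u, v, w] := by
  have h1 := AlternatingMap.eq_smul_basis_det b (EuclideanSpace.basisFun (Fin 3) ℝ).toBasis.det
  have h2 : ⇑b = ![b 0, b 1, b 2] := by ext1 i; fin_cases i <;> rfl
  have h3 := congrArg (fun f : EuclideanSpace ℝ (Fin 3) [⋀^Fin 3]→ₗ[ℝ] ℝ => f ![u, v, w]) h1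
  rw [det3, det3, ← h2]
  exact h3

section Frame

variable {M : Type*} [TopologicalSpace M] [ChartedSpace (EuclideanSpace ℝ (Fin 3)) M]
  [IsManifold (𝓡 3) ∞ M] {o : ∀ p : M, Orientation ℝ (TangentSpace (𝓡 3) p) (Fin 3)}

theorem isPositive_iff {p : M} {b : Module.Basis (Fin 3) ℝ (TangentSpace (𝓡 3) p)}
    (hb : b.orientation = o p) (u v w : TangentSpace (𝓡 3) p) :
    IsPositive o p u v w ↔ 0 < b.det ![u, v, w] := by
  constructor
  · rintro ⟨b', hb', ho⟩
    rw [← hb', ← b.orientation_eq_iff_det_pos, hb, ho]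
  · intro h
    obtain ⟨h1, h2⟩ := (Module.Basis.is_basis_iff_det b).2 (IsUnit.mk0 _ h.ne')
    let b' := Module.Basis.mk h1 h2.ge
    have hb' : ⇑b' = ![u, v, w] := Module.Basis.coe_mk _ _
    exact ⟨b', hb', by rw [← hb, eq_comm, b.orientation_eq_iff_det_pos, hb']; exact h⟩

/-- A linear map to `ℝ³` takes positive bases to bases of the same sign. -/
theorem IsPositive.det3_mul {p : M} {u v w u' v' w' : TangentSpace (𝓡 3) p}
    (h : IsPositive o p u v w) (h' : IsPositive o p u' v' w')
    (A : EuclideanSpace ℝ (Fin 3) →L[ℝ] EuclideanSpace ℝ (Fin 3)) :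
    ∃ c > 0, det3 (A u') (A v') (A w') = c * det3 (A u) (A v) (A w) := by
  obtain ⟨b, hb, ho⟩ := h
  refine ⟨b.det ![u', v', w'], (isPositive_iff ho _ _ _).1 h', ?_⟩
  have h1 := det3_eq_mul_basis_det b u' v' w'
  have e0 : b 0 = u := congrFun hb 0
  have e1 : b 1 = v := congrFun hb 1
  have e2 : b 2 = w := congrFun hb 2
  have h2 : det3 u' v' w' = det3 u v w * b.det ![u', v', w'] := by
    rw [← e0, ← e1, ← e2]; exact h1
  have h3 := det3_map A u v w
  have h4 := det3_map A u' v' w'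
  exact h4.trans (by rw [h2]; rw [mul_comm (b.det _)]; exact (mul_assoc _ _ _).symm.trans (by rw [← h3]))

variable [RiemannianBundle (fun p : M => TangentSpace (𝓡 3) p)]

/-- The coordinates of a tangent vector given by its inner products with `E₁`, `E₂` and
`Y / ‖Y‖ ^ 2`; the source is the tangent space at `p`. -/
def frameCoord (E₁ E₂ Y : ∀ p : M, TangentSpace (𝓡 3) p) (p : M) :
    EuclideanSpace ℝ (Fin 3) →L[ℝ] EuclideanSpace ℝ (Fin 3) :=
  LinearMap.toContinuousLinearMap
    { toFun := fun v => !₂[inner ℝ (show TangentSpace (𝓡 3) p from v) (E₁ p),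
        inner ℝ (show TangentSpace (𝓡 3) p from v) (E₂ p),
        inner ℝ (show TangentSpace (𝓡 3) p from v) (Y p) / inner ℝ (Y p) (Y p)]
      map_add' := fun u v => by
        ext i
        fin_cases i
        · exact inner_add_left (𝕜 := ℝ) (E := TangentSpace (𝓡 3) p) u v (E₁ p)
        · exact inner_add_left (𝕜 := ℝ) (E := TangentSpace (𝓡 3) p) u v (E₂ p)
        · exact (congrArg (· / inner ℝ (Y p) (Y p))
            (inner_add_left (𝕜 := ℝ) (E := TangentSpace (𝓡 3) p) u v (Y p))).trans (add_div _ _ _)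
      map_smul' := fun c v => by
        ext i
        fin_cases i
        · exact real_inner_smul_left (F := TangentSpace (𝓡 3) p) v (E₁ p) c
        · exact real_inner_smul_left (F := TangentSpace (𝓡 3) p) v (E₂ p) c
        · exact (congrArg (· / inner ℝ (Y p) (Y p))
            (real_inner_smul_left (F := TangentSpace (𝓡 3) p) v (Y p) c)).trans (mul_div_assoc _ _ _) }

variable {E₁ E₂ Y : ∀ p : M, TangentSpace (𝓡 3) p}

theorem frameCoord_zero (p : M) (v : TangentSpace (𝓡 3) p) :
    frameCoord E₁ E₂ Y p v 0 = inner ℝ v (E₁ p) := rfl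

theorem frameCoord_one (p : M) (v : TangentSpace (𝓡 3) p) :
    frameCoord E₁ E₂ Y p v 1 = inner ℝ v (E₂ p) := rfl

variable [IsContMDiffRiemannianBundle (𝓡 3) ∞ (EuclideanSpace ℝ (Fin 3))
      (fun p : M => TangentSpace (𝓡 3) p)]

/-- A section of the tangent bundle is `C¹` at `p`. -/
abbrev IsC1At (s : ∀ p : M, TangentSpace (𝓡 3) p) (p : M) : Prop :=
  ContMDiffAt (𝓡 3) (𝓡 3).tangent 1 (fun p => (⟨p, s p⟩ : TangentBundle (𝓡 3) M)) p

theorem contMDiffAt_inner {s t : ∀ p : M, TangentSpace (𝓡 3) p} {p : M} (hs : IsC1At s p)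
    (ht : IsC1At t p) : ContMDiffAt (𝓡 3) 𝓘(ℝ, ℝ) 1 (fun p => inner ℝ (s p) (t p)) p :=
  haveI : IsContMDiffRiemannianBundle (𝓡 3) 1 (EuclideanSpace ℝ (Fin 3))
    (fun p : M => TangentSpace (𝓡 3) p) :=
    IsContMDiffRiemannianBundle.of_le (n := ∞) (by exact_mod_cast le_top)
  ContMDiffAt.inner_bundle (n := 1) (F := EuclideanSpace ℝ (Fin 3))
    (E := fun p : M => TangentSpace (𝓡 3) p) (b := fun p => p) hs ht

theorem contMDiffAt_frameCoord {s : ∀ p : M, TangentSpace (𝓡 3) p} {p : M} (h₁ : IsC1At E₁ p)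
    (h₂ : IsC1At E₂ p) (hY : IsC1At Y p) (hY0 : Y p ≠ 0) (hs : IsC1At s p) :
    ContMDiffAt (𝓡 3) 𝓘(ℝ, EuclideanSpace ℝ (Fin 3)) 1 (fun p => frameCoord E₁ E₂ Y p (s p)) p := by
  have h : ContMDiffAt (𝓡 3) 𝓘(ℝ, Fin 3 → ℝ) 1
      (fun p => (frameCoord E₁ E₂ Y p (s p)).ofLp) p := by
    rw [contMDiffAt_pi_space]
    intro i
    fin_cases i
    · exact contMDiffAt_inner hs h₁
    · exact contMDiffAt_inner hs h₂
    · exact (contMDiffAt_inner hs hY).div₀ (contMDiffAt_inner hY hY) (inner_self_ne_zero.2 hY0)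
  exact ((EuclideanSpace.equiv (Fin 3) ℝ).symm.contDiff.contMDiff.contMDiffAt).comp p h

/-- `frameCoord`, read in the chart at `z`. -/
def frameCoordIn (E₁ E₂ Y : ∀ p : M, TangentSpace (𝓡 3) p) (z p : M) :
    EuclideanSpace ℝ (Fin 3) →L[ℝ] EuclideanSpace ℝ (Fin 3) :=
  (frameCoord E₁ E₂ Y p).comp
    ((trivializationAt (EuclideanSpace ℝ (Fin 3)) (TangentSpace (𝓡 3)) z).symmL ℝ p)

theorem frameCoordIn_comp {z p : M} (hp : p ∈ (extChartAt (𝓡 3) z).source) :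
    (frameCoordIn E₁ E₂ Y z p).comp
      (show EuclideanSpace ℝ (Fin 3) →L[ℝ] EuclideanSpace ℝ (Fin 3) from
        mfderiv (𝓡 3) 𝓘(ℝ, EuclideanSpace ℝ (Fin 3)) (extChartAt (𝓡 3) z) p) =
      frameCoord E₁ E₂ Y p := by
  have hp' : p ∈ (chartAt (EuclideanSpace ℝ (Fin 3)) z).source := by rwa [extChartAt_source] at hp
  rw [← TangentBundle.continuousLinearMapAt_trivializationAt hp']
  ext1 v
  have := (trivializationAt (EuclideanSpace ℝ (Fin 3)) (TangentSpace (𝓡 3)) z).symmL_continuousLinearMapAt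
    (R := ℝ) (b := p) (by simpa using hp') v
  exact congrArg (frameCoord E₁ E₂ Y p) this

theorem frameCoordIn_self (z : M) : frameCoordIn E₁ E₂ Y z z = frameCoord E₁ E₂ Y z := by
  have h := frameCoordIn_comp (E₁ := E₁) (E₂ := E₂) (Y := Y) (mem_extChartAt_source (I := 𝓡 3) z)
  rw [mfderiv_extChartAt_self] at h
  exact h

/-- `frameCoord` uses the preferred chart at the moving point and may jump with the choice of that
chart. Read in the fixed trivialisation at `z` it is continuous. -/
theorem continuousAt_frameCoordIn {z p : M} (hp : p ∈ (extChartAt (𝓡 3) z).source)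
    (h₁ : IsC1At E₁ p) (h₂ : IsC1At E₂ p) (hY : IsC1At Y p) (hY0 : Y p ≠ 0) :
    ContinuousAt (frameCoordIn E₁ E₂ Y z) p := by
  have hp' : p ∈ (chartAt (EuclideanSpace ℝ (Fin 3)) z).source := by rwa [extChartAt_source] at hp
  have hb : p ∈ (trivializationAt (EuclideanSpace ℝ (Fin 3)) (TangentSpace (𝓡 3)) z :
      Trivialization (EuclideanSpace ℝ (Fin 3)) (π (EuclideanSpace ℝ (Fin 3))
        (TangentSpace (𝓡 3) : M → Type _))).baseSet := by simpa using hp'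
  rw [continuousAt_clm_apply]
  intro w
  refine ContMDiffAt.continuousAt (n := 1) (I := 𝓡 3) (I' := 𝓘(ℝ, EuclideanSpace ℝ (Fin 3)))
    (contMDiffAt_frameCoord h₁ h₂ hY hY0 ?_)
  refine ((trivializationAt (EuclideanSpace ℝ (Fin 3)) (TangentSpace (𝓡 3))
    z).contMDiffAt_section_iff hb).2 ?_
  refine (contMDiffAt_const (c := w)).congr_of_eventuallyEq ?_
  filter_upwards [(trivializationAt (EuclideanSpace ℝ (Fin 3)) (TangentSpace (𝓡 3))
    z).open_baseSet.mem_nhds hb] with q hq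
  have h3 := (trivializationAt (EuclideanSpace ℝ (Fin 3)) (TangentSpace (𝓡 3)) z).symmL_apply
    (R := ℝ) hq w
  have h4 := (trivializationAt (EuclideanSpace ℝ (Fin 3)) (TangentSpace (𝓡 3)) z).apply_mk_symm hq w
  exact (congrArg (fun v => ((trivializationAt (EuclideanSpace ℝ (Fin 3)) (TangentSpace (𝓡 3)) z)
    (⟨q, v⟩ : TangentBundle (𝓡 3) M)).2) h3).trans (congrArg Prod.snd h4)

/-- The sign of the preferred chart at `p` with respect to the frame. -/
def frameSign (E₁ E₂ Y : ∀ p : M, TangentSpace (𝓡 3) p) (p : M) : SignType :=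
  SignType.sign (frameCoord E₁ E₂ Y p).det

/-- `(E₁, E₂, Y)` gives `C¹` coordinates on the tangent space at `p`. -/
structure IsC1FrameAt (E₁ E₂ Y : ∀ p : M, TangentSpace (𝓡 3) p) (p : M) : Prop where
  fst : IsC1At E₁ p
  snd : IsC1At E₂ p
  thd : IsC1At Y p
  thd_ne_zero : Y p ≠ 0
  det_ne_zero : (frameCoord E₁ E₂ Y p).det ≠ 0

/-- The determinant of `frameCoord` at `q` is that of `frameCoordIn`, which is continuous and
nonzero at `p`, times the Jacobian determinant at `q` of the chart at `p`. -/
theorem IsC1FrameAt.eventually_sign {p : M} (h : IsC1FrameAt E₁ E₂ Y p) :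
    ∀ᶠ q in 𝓝 p, SignType.sign (mdet (𝓡 3) (extChartAt (𝓡 3) p) q) =
      frameSign E₁ E₂ Y p * frameSign E₁ E₂ Y q := by
  have hc := continuousAt_frameCoordIn (mem_extChartAt_source (I := 𝓡 3) p) h.fst h.snd h.thd
    h.thd_ne_zero
  have hd : ContinuousAt (fun q => (frameCoordIn E₁ E₂ Y p q).det) p :=
    continuous_clm_det.continuousAt.comp hc
  have h0 : (frameCoordIn E₁ E₂ Y p p).det ≠ 0 := by rw [frameCoordIn_self]; exact h.det_ne_zero
  have hs : ∀ᶠ q in 𝓝 p, SignType.sign (frameCoordIn E₁ E₂ Y p q).det = frameSign E₁ E₂ Y p := by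
    rw [frameSign, ← frameCoordIn_self]
    rcases lt_or_gt_of_ne h0 with h1 | h1
    · filter_upwards [hd.eventually (gt_mem_nhds h1)] with q hq
      rw [sign_neg h1, sign_neg hq]
    · filter_upwards [hd.eventually (lt_mem_nhds h1)] with q hq
      rw [sign_pos h1, sign_pos hq]
  filter_upwards [hs, extChartAt_source_mem_nhds (I := 𝓡 3) p] with q hq hqs
  have h2 : (frameCoord E₁ E₂ Y q).det =
      (frameCoordIn E₁ E₂ Y p q).det * mdet (𝓡 3) (extChartAt (𝓡 3) p) q := by
    rw [← frameCoordIn_comp hqs]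
    exact LinearMap.det_comp _ _
  have h3 : frameSign E₁ E₂ Y p ≠ 0 := sign_ne_zero.2 h.det_ne_zero
  have h4 : frameSign E₁ E₂ Y q = SignType.sign (frameCoord E₁ E₂ Y q).det := rfl
  rw [h4, h2, sign_mul, hq]
  revert h3
  generalize frameSign E₁ E₂ Y p = s
  generalize SignType.sign (mdet (𝓡 3) (extChartAt (𝓡 3) p) q) = t
  revert s t
  decide

theorem isOrientationSign_frameSign {A : Set M} (h : ∀ p ∈ A, IsC1FrameAt E₁ E₂ Y p) :
    IsOrientationSign (𝓡 3) (frameSign E₁ E₂ Y) A :=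
  ⟨fun p hp => sign_ne_zero.2 (h p hp).det_ne_zero,
    fun p hp => (h p hp).eventually_sign.mono fun _ hq _ => hq⟩

/-- The differential of the chart at `z` is the trivialisation of the tangent bundle at `z`, so this
is the regularity of `X` as a section. -/
theorem contDiffOn_coordField {X : ∀ p : M, TangentSpace (𝓡 3) p} (hX : ∀ p, IsC1At X p) (z : M) :
    ContDiffOn ℝ 1 (coordField X z) (extChartAt (𝓡 3) z).target := by
  have h : ContMDiffOn (𝓡 3) 𝓘(ℝ, EuclideanSpace ℝ (Fin 3)) 1
      (fun p => ((trivializationAt (EuclideanSpace ℝ (Fin 3)) (TangentSpace (𝓡 3)) z)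
        (⟨p, X p⟩ : TangentBundle (𝓡 3) M)).2) (extChartAt (𝓡 3) z).source := by
    intro p hp
    have hp' : p ∈ (chartAt (EuclideanSpace ℝ (Fin 3)) z).source := by rwa [extChartAt_source] at hp
    exact (((trivializationAt (EuclideanSpace ℝ (Fin 3)) (TangentSpace (𝓡 3))
      z).contMDiffAt_section_iff (by simpa using hp')).1 (hX p)).contMDiffWithinAt
  rw [← contMDiffOn_iff_contDiffOn]
  refine (h.comp (contMDiffOn_extChartAt_symm z)
    (extChartAt (𝓡 3) z).mapsTo_symm).congr fun y hy => ?_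
  have hs := (extChartAt (𝓡 3) z).map_target hy
  have hp' : (extChartAt (𝓡 3) z).symm y ∈ (chartAt (EuclideanSpace ℝ (Fin 3)) z).source := by
    rwa [extChartAt_source] at hs
  unfold coordField
  rw [← TangentBundle.continuousLinearMapAt_trivializationAt hp']
  exact (trivializationAt (EuclideanSpace ℝ (Fin 3)) (TangentSpace (𝓡 3))
    z).continuousLinearMapAt_apply_of_mem (R := ℝ) (by simpa using hp') _

theorem frameCoordIn_coordField {X : ∀ p : M, TangentSpace (𝓡 3) p} {z : M}
    {y : EuclideanSpace ℝ (Fin 3)} (hy : y ∈ (extChartAt (𝓡 3) z).target) :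
    frameCoordIn E₁ E₂ Y z ((extChartAt (𝓡 3) z).symm y) (coordField X z y) =
      frameCoord E₁ E₂ Y ((extChartAt (𝓡 3) z).symm y) (X ((extChartAt (𝓡 3) z).symm y)) := by
  rw [← frameCoordIn_comp ((extChartAt (𝓡 3) z).map_target hy)]
  rfl

end Frame
end

/-! ### The index at an isolated zero as a signed count. -/

noncomputable section

open MeasureTheory

theorem ae_comp_of_det_ne_zero {A : EuclideanSpace ℝ (Fin 3) →L[ℝ] EuclideanSpace ℝ (Fin 3)}
    (hA : A.det ≠ 0) {p : EuclideanSpace ℝ (Fin 3) → Prop} (h : ∀ᵐ a, p a) : ∀ᵐ a, p (A a) := by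
  rw [ae_iff] at h ⊢
  have := Measure.addHaar_preimage_continuousLinearMap volume hA {a | ¬p a}
  rw [h, mul_zero] at this
  exact this

section Index

variable {M : Type*} [TopologicalSpace M] [ChartedSpace (EuclideanSpace ℝ (Fin 3)) M]
  [IsManifold (𝓡 3) ∞ M] [RiemannianBundle (fun p : M => TangentSpace (𝓡 3) p)]
  [IsContMDiffRiemannianBundle (𝓡 3) ∞ (EuclideanSpace ℝ (Fin 3))
      (fun p : M => TangentSpace (𝓡 3) p)]
  {E₁ E₂ Y : ∀ p : M, TangentSpace (𝓡 3) p}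

/-- Near an isolated zero, the index counts the points of almost every fibre of the coordinates
of the field in a frame. -/
theorem exists_forall_ae_hasIndexAt {X : ∀ p : M, TangentSpace (𝓡 3) p} (hX : ∀ p, IsC1At X p)
    {z : M} (hz : X z = 0) {N : Set M} (hN : N ∈ 𝓝 z) (hXN : ∀ p ∈ N, X p = 0 → p = z)
    (hfr : ∀ p ∈ N, IsC1FrameAt E₁ E₂ Y p) :
    ∃ B : Set M, IsOpen B ∧ z ∈ B ∧ B ⊆ N ∧ ∃ m > 0, ∀ᵐ a : EuclideanSpace ℝ (Fin 3), ‖a‖ < m →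
      HasIndexAt X z (degCount (𝓡 3) (frameSign E₁ E₂ Y) B (fun p => frameCoord E₁ E₂ Y p (X p)) a) := by
  let φ := extChartAt (𝓡 3) z
  let y₀ := φ z
  have hzN := mem_of_mem_nhds hN
  have hfz := hfr z hzN
  let L₀ := frameCoord E₁ E₂ Y z
  let e := L₀.toContinuousLinearEquivOfDetNeZero hfz.det_ne_zero
  -- Composition with the inverse of the frame coordinates at `z` makes the coordinates of `X` near
  -- `z` a perturbation of `coordField X z` of relative size less than `1 / 2`, so the two make an
  -- acute angle.
  let Li : EuclideanSpace ℝ (Fin 3) →L[ℝ] EuclideanSpace ℝ (Fin 3) := e.symm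
  have hLi : ∀ v, Li (L₀ v) = v := fun v => e.symm_apply_apply v
  have hLL : Li.comp L₀ = ContinuousLinearMap.id ℝ _ := by ext1 v; exact hLi v
  have hdet : Li.det * L₀.det = 1 := by
    have h1 : (Li.comp L₀).det = Li.det * L₀.det := LinearMap.det_comp _ _
    rw [← h1, hLL]; exact LinearMap.det_id
  have hLi0 : Li.det ≠ 0 := left_ne_zero_of_mul (hdet ▸ one_ne_zero)
  have hsLi : SignType.sign Li.det = frameSign E₁ E₂ Y z := by
    have h1 : SignType.sign Li.det * frameSign E₁ E₂ Y z = 1 := by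
      rw [frameSign, ← sign_mul]
      change SignType.sign (Li.det * L₀.det) = 1
      rw [hdet]; simp
    revert h1
    generalize SignType.sign Li.det = s
    generalize frameSign E₁ E₂ Y z = t
    revert s t
    decide
  -- a neighbourhood on which everything is under control
  have hP : ∀ᶠ p in 𝓝 z, p ∈ N ∧ ‖Li.comp (frameCoordIn E₁ E₂ Y z p) - ContinuousLinearMap.id ℝ _‖ < 1 / 2 ∧
      SignType.sign (mdet (𝓡 3) φ p) = frameSign E₁ E₂ Y z * frameSign E₁ E₂ Y p := by
    refine Filter.Eventually.and hN (Filter.Eventually.and ?_ hfz.eventually_sign)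
    have hc : ContinuousAt (fun p => Li.comp (frameCoordIn E₁ E₂ Y z p) - ContinuousLinearMap.id ℝ _) z := by
      have h1 := continuousAt_frameCoordIn (mem_extChartAt_source (I := 𝓡 3) z) hfz.fst hfz.snd hfz.thd
        hfz.thd_ne_zero
      exact (ContinuousAt.comp (g := fun A : EuclideanSpace ℝ (Fin 3) →L[ℝ] EuclideanSpace ℝ (Fin 3) =>
        Li.comp A) (by fun_prop) h1).sub continuousAt_const
    refine hc.norm.tendsto.eventually_lt_const ?_
    rw [frameCoordIn_self]
    change ‖Li.comp L₀ - _‖ < _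
    rw [hLL, sub_self, norm_zero]; norm_num
  obtain ⟨N', hN', hN'o, hzN'⟩ := mem_nhds_iff.1 hP
  let O := φ.target ∩ φ.symm ⁻¹' N'
  have hO : IsOpen O := (continuousOn_extChartAt_symm z).isOpen_inter_preimage
    (isOpen_extChartAt_target z) hN'o
  have hy₀ : y₀ ∈ O := ⟨mem_extChartAt_target z, by
    rw [mem_preimage, extChartAt_to_inv]; exact hzN'⟩
  obtain ⟨ρ', hρ', hbO'⟩ := Metric.isOpen_iff.1 hO y₀ hy₀
  let ρ := ρ' / 2
  have hρ : 0 < ρ := by positivity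
  have hbO : Metric.closedBall y₀ ρ ⊆ O :=
    (Metric.closedBall_subset_ball (by simp only [ρ]; linarith)).trans hbO'
  let V := coordField X z
  let G : M → EuclideanSpace ℝ (Fin 3) := fun p => frameCoord E₁ E₂ Y p (X p)
  let F : EuclideanSpace ℝ (Fin 3) → EuclideanSpace ℝ (Fin 3) := fun y => Li (G (φ.symm y))
  have hGc : ∀ p ∈ N', ContMDiffAt (𝓡 3) 𝓘(ℝ, EuclideanSpace ℝ (Fin 3)) 1 G p := fun p hp =>
    have h := hfr p (hN' hp).1
    contMDiffAt_frameCoord h.fst h.snd h.thd h.thd_ne_zero (hX p)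
  have hGO : ContDiffOn ℝ 1 (G ∘ φ.symm) O := contDiffOn_chart hGc
  have hFO : ContDiffOn ℝ 1 F O := Li.contDiff.comp_contDiffOn hGO
  have hVO : ContDiffOn ℝ 1 V O := (contDiffOn_coordField hX z).mono inter_subset_left
  have hGV : ∀ y ∈ O, frameCoordIn E₁ E₂ Y z (φ.symm y) (V y) = G (φ.symm y) := fun y hy =>
    frameCoordIn_coordField hy.1
  have hzero : ∀ y ∈ O, X (φ.symm y) = 0 ↔ y = y₀ := by
    intro y hy
    constructor
    · intro h
      rw [← φ.right_inv hy.1, hXN _ (hN' hy.2).1 h]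
    · rintro rfl
      rw [extChartAt_to_inv]; exact hz
  have hV0 : ∀ y ∈ O, y ≠ y₀ → V y ≠ 0 := by
    intro y hy hne h0
    have h1 := hGV y hy
    rw [h0, map_zero] at h1
    have h2 := (hfr _ (hN' hy.2).1).det_ne_zero
    have h3 : X (φ.symm y) = 0 :=
      (ContinuousLinearMap.toContinuousLinearEquivOfDetNeZero _ h2).injective
        (h1.symm.trans (map_zero _).symm)
    exact hne ((hzero y hy).1 h3)
  have hVs : ∀ y ∈ Metric.sphere y₀ ρ, V y ≠ 0 := fun y hy =>
    hV0 y (hbO (Metric.sphere_subset_closedBall hy)) (Metric.ne_of_mem_sphere hy hρ.ne')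
  have hVF : ∀ y ∈ Metric.sphere y₀ ρ, 0 < inner ℝ (V y) (F y) := by
    intro y hy
    have hyO := hbO (Metric.sphere_subset_closedBall hy)
    have h1 := (hN' hyO.2).2.1
    set D := Li.comp (frameCoordIn E₁ E₂ Y z (φ.symm y)) - ContinuousLinearMap.id ℝ _ with hD
    have h2 : F y = V y + D (V y) := by
      simp only [F]
      rw [← hGV y hyO, hD]
      simp
    have h3 := norm_pos_iff.2 (hVs y hy)
    have h4 : ‖D (V y)‖ ≤ 1 / 2 * ‖V y‖ := (D.le_opNorm _).trans (by gcongr)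
    have h5 := abs_le.1 (abs_real_inner_le_norm (V y) (D (V y)))
    rw [h2, inner_add_right, real_inner_self_eq_norm_sq]
    nlinarith
  obtain ⟨m, hm, hae⟩ := exists_forall_ae_hasSphereDegree hρ hO hbO hVO hFO hVs hVF
  let B := φ.source ∩ φ ⁻¹' Metric.ball y₀ ρ
  have hB : IsOpen B := (continuousOn_extChartAt z).isOpen_inter_preimage (isOpen_extChartAt_source z)
    Metric.isOpen_ball
  have hBN' : B ⊆ N' := by
    intro p hp
    have := (hbO (Metric.ball_subset_closedBall hp.2)).2
    rwa [mem_preimage, φ.left_inv hp.1] at this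
  -- At `p` the chart at `z` has sign `frameSign z * frameSign p`, and `Li` contributes another
  -- `frameSign z`. Hence the counts weighted by `frameSign` become ordinary counts for `F`.
  have hdeg : ∀ a, degCount (𝓡 3) (frameSign E₁ E₂ Y) B G a =
      degCount (𝓡 3) (fun _ => 1) (Metric.ball y₀ ρ) F (Li a) := by
    intro a
    refine finsum_mem_eq_of_bijOn φ ⟨?_, ?_, ?_⟩ ?_
    · rintro p ⟨hp, hpa⟩
      refine ⟨hp.2, ?_⟩
      simp only [F]
      rw [φ.left_inv hp.1, hpa]
    · exact φ.injOn.mono fun p hp => hp.1.1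
    · rintro y ⟨hy, hya⟩
      have hyO := hbO (Metric.ball_subset_closedBall hy)
      refine ⟨φ.symm y, ⟨⟨φ.map_target hyO.1, ?_⟩, ?_⟩, φ.right_inv hyO.1⟩
      · rw [mem_preimage, φ.right_inv hyO.1]; exact hy
      · exact e.symm.injective hya
    · rintro p ⟨hp, -⟩
      have hpN := hBN' hp
      have h1 := mdet_eq_mul (x₀ := z) hp.1 ((hGc p hpN).mdifferentiableAt one_ne_zero)
      rw [ModelWithCorners.Boundaryless.range_eq_univ, fderivWithin_univ] at h1
      have hpO : φ p ∈ O := ⟨φ.map_source hp.1, by rwa [mem_preimage, φ.left_inv hp.1]⟩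
      have h2 : fderiv ℝ F (φ p) = Li.comp (fderiv ℝ (G ∘ φ.symm) (φ p)) :=
        (Li.hasFDerivAt.comp (φ p)
          ((hGO.differentiableOn one_ne_zero).differentiableAt (hO.mem_nhds hpO)).hasFDerivAt).fderiv
      have h3 : (fderiv ℝ F (φ p)).det = Li.det * (fderiv ℝ (G ∘ φ.symm) (φ p)).det := by
        rw [h2]; exact LinearMap.det_comp _ _
      have h4 := (hN' hpN).2.2
      have h5 : frameSign E₁ E₂ Y p ≠ 0 := sign_ne_zero.2 (hfr p (hN' hpN).1).det_ne_zero
      rw [localSign, localSign, mdet_eq_det_fderiv, h3, h1, sign_mul, sign_mul, hsLi]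
      change ((_ * (SignType.sign (fderiv ℝ (G ∘ φ.symm) (φ p)).det *
        SignType.sign (mdet (𝓡 3) φ p)) : SignType) : ℤ) = _
      rw [h4]
      congr 1
      revert h5
      generalize frameSign E₁ E₂ Y z = s
      generalize frameSign E₁ E₂ Y p = t
      generalize SignType.sign (fderiv ℝ (G ∘ φ.symm) (φ p)).det = u
      revert s t u
      decide
  have hsph : ∀ u : UnitSphere 3, y₀ + ρ • (u : EuclideanSpace ℝ (Fin 3)) ∈ Metric.sphere y₀ ρ := by
    intro u
    have hu : ‖(u : EuclideanSpace ℝ (Fin 3))‖ = 1 := by simpa using u.2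
    rw [mem_sphere_iff_norm, add_sub_cancel_left, norm_smul, hu, mul_one, Real.norm_of_nonneg hρ.le]
  have hVc : Continuous fun u : UnitSphere 3 => V (y₀ + ρ • (u : EuclideanSpace ℝ (Fin 3))) :=
    hVO.continuousOn.comp_continuous (by fun_prop)
      fun u => hbO (Metric.sphere_subset_closedBall (hsph u))
  have hfc : Continuous fun u : UnitSphere 3 => ‖V (y₀ + ρ • (u : EuclideanSpace ℝ (Fin 3)))‖⁻¹ •
      V (y₀ + ρ • (u : EuclideanSpace ℝ (Fin 3))) :=
    (hVc.norm.inv₀ fun u => norm_ne_zero_iff.2 (hVs _ (hsph u))).smul hVc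
  have hfm : ∀ u : UnitSphere 3, ‖V (y₀ + ρ • (u : EuclideanSpace ℝ (Fin 3)))‖⁻¹ •
      V (y₀ + ρ • (u : EuclideanSpace ℝ (Fin 3))) ∈ Metric.sphere (0 : EuclideanSpace ℝ (Fin 3)) 1 :=
    fun u => by
      rw [mem_sphere_zero_iff_norm, norm_smul, norm_inv, norm_norm,
        inv_mul_cancel₀ (norm_ne_zero_iff.2 (hVs _ (hsph u)))]
  let f : C(UnitSphere 3, UnitSphere 3) := ⟨fun u => ⟨_, hfm u⟩, hfc.subtype_mk hfm⟩
  refine ⟨B, hB, ⟨mem_extChartAt_source z, Metric.mem_ball_self hρ⟩,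
    fun p hp => (hN' (hBN' hp)).1, m / (‖Li‖ + 1), by positivity, ?_⟩
  filter_upwards [ae_comp_of_det_ne_zero hLi0 hae] with a ha ham
  rw [lt_div_iff₀ (by positivity)] at ham
  have ham' : ‖Li a‖ < m := (Li.le_opNorm a).trans_lt (by nlinarith [norm_nonneg a, norm_nonneg Li])
  change HasIndexAt X z (degCount (𝓡 3) (frameSign E₁ E₂ Y) B G a)
  rw [hdeg a]
  exact ⟨ρ, hρ, hbO.trans inter_subset_left, fun y hy => hzero y (hbO hy), f, fun u => rfl,
    ha ham' f fun u => rfl⟩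

end Index
end

/-! ### Approximation of an adapted frame by `C¹` fields. -/

noncomputable section

open MeasureTheory

section Approximation

variable {M : Type*} [TopologicalSpace M] [ChartedSpace (EuclideanSpace ℝ (Fin 3)) M]
  [IsManifold (𝓡 3) ∞ M]

theorem exists_section_through (z : M) (v : TangentSpace (𝓡 3) z) :
    ∃ U ∈ 𝓝 z, ∃ s : ∀ p : M, TangentSpace (𝓡 3) p,
      ContMDiffOn (𝓡 3) (𝓡 3).tangent ∞ (fun p => (⟨p, s p⟩ : TangentBundle (𝓡 3) M)) U ∧
      s z = v := by
  let e := trivializationAt (EuclideanSpace ℝ (Fin 3)) (TangentSpace (𝓡 3) : M → Type _) z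
  have hz : z ∈ e.baseSet := mem_baseSet_trivializationAt _ _ z
  let w : EuclideanSpace ℝ (Fin 3) := e.continuousLinearMapAt ℝ z v
  refine ⟨e.baseSet, e.open_baseSet.mem_nhds hz, fun p => e.symmL ℝ p w, ?_,
    e.symmL_continuousLinearMapAt (R := ℝ) hz v⟩
  intro p hp
  refine ContMDiffAt.contMDiffWithinAt ((e.contMDiffAt_section_iff hp).2 ?_)
  refine (contMDiffAt_const (c := w)).congr_of_eventuallyEq ?_
  filter_upwards [e.open_baseSet.mem_nhds hp] with q hq
  have h3 := e.symmL_apply (R := ℝ) hq w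
  have h4 := e.apply_mk_symm hq w
  exact (congrArg (fun v => (e (⟨q, v⟩ : TangentBundle (𝓡 3) M)).2) h3).trans
    (congrArg Prod.snd h4)

variable [RiemannianBundle (fun p : M => TangentSpace (𝓡 3) p)]
  [IsContMDiffRiemannianBundle (𝓡 3) ∞ (EuclideanSpace ℝ (Fin 3))
      (fun p : M => TangentSpace (𝓡 3) p)]

theorem continuousOn_inner {C : Set M} {s t : ∀ p : M, TangentSpace (𝓡 3) p}
    (hs : ContinuousOn (fun p => (⟨p, s p⟩ : TangentBundle (𝓡 3) M)) C)
    (ht : ContinuousOn (fun p => (⟨p, t p⟩ : TangentBundle (𝓡 3) M)) C) :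
    ContinuousOn (fun p => inner ℝ (s p) (t p)) C :=
  haveI : IsContMDiffRiemannianBundle (𝓡 3) 0 (EuclideanSpace ℝ (Fin 3))
    (fun p : M => TangentSpace (𝓡 3) p) :=
    IsContMDiffRiemannianBundle.of_le (n := ∞) (by exact_mod_cast le_top)
  contMDiffOn_zero_iff.1 (ContMDiffOn.inner_bundle (n := 0) (IM := 𝓡 3) (IB := 𝓡 3)
    (F := EuclideanSpace ℝ (Fin 3))
    (E := fun p : M => TangentSpace (𝓡 3) p) (b := fun p => p)
    (contMDiffOn_zero_iff.2 hs) (contMDiffOn_zero_iff.2 ht))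

/-- A section along a closed set whose inner products with finitely many continuous sections are
continuous can be replaced by a global `C¹` section with almost the same inner products. -/
theorem exists_contMDiff_inner_approx [T2Space M] [SecondCountableTopology M] {C : Set M} (hC : IsClosed C) {ι : Type*} [Finite ι]
    {f : ι → ∀ p : M, TangentSpace (𝓡 3) p}
    (hf : ∀ j, ContinuousOn (fun p => (⟨p, f j p⟩ : TangentBundle (𝓡 3) M)) C)
    {w : ∀ p : M, TangentSpace (𝓡 3) p}
    (hw : ∀ j, ContinuousOn (fun p => inner ℝ (f j p) (w p)) C) {η : ℝ} (hη : 0 < η) :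
    ∃ E : ∀ p : M, TangentSpace (𝓡 3) p, (∀ p, IsC1At E p) ∧
      ∀ p ∈ C, ∀ j, |inner ℝ (f j p) (E p) - inner ℝ (f j p) (w p)| < η := by
  haveI : LocallyCompactSpace M := ChartedSpace.locallyCompactSpace (EuclideanSpace ℝ (Fin 3)) M
  -- The requirement is a convex condition on the value at each point, void off `C`, so local
  -- solutions can be patched by a partition of unity.
  let t : ∀ p : M, Set (TangentSpace (𝓡 3) p) := fun p =>
    {v | p ∈ C → ∀ j, |inner ℝ (f j p) v - inner ℝ (f j p) (w p)| < η}
  have ht : ∀ p, Convex ℝ (t p) := by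
    intro p u hu v hv a b ha hb hab hp j
    have h1 := hu hp j
    have h2 := hv hp j
    have h3 : inner ℝ (f j p) (a • u + b • v) - inner ℝ (f j p) (w p) =
        a * (inner ℝ (f j p) u - inner ℝ (f j p) (w p)) +
        b * (inner ℝ (f j p) v - inner ℝ (f j p) (w p)) := by
      have h3 : inner ℝ (f j p) (a • u + b • v) = a * inner ℝ (f j p) u + b * inner ℝ (f j p) v := by
        rw [inner_add_right, real_inner_smul_right, real_inner_smul_right]
      rw [h3]
      linear_combination (inner ℝ (f j p) (w p)) * hab
    rw [h3]
    have := convex_ball (0 : ℝ) η (mem_ball_zero_iff.2 h1) (mem_ball_zero_iff.2 h2) ha hb hab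
    exact mem_ball_zero_iff.1 this
  obtain ⟨s, hs⟩ := exists_contMDiffSection_forall_mem_convex_of_local (𝓡 3) (n := 1)
    (F_fiber := EuclideanSpace ℝ (Fin 3)) (fun p : M => TangentSpace (𝓡 3) p) t ht (by
    intro z
    obtain ⟨U, hU, s, hs, hsz⟩ := exists_section_through z (w z)
    by_cases hz : z ∈ C
    · have h1 : ∀ᶠ p in 𝓝[C] z, ∀ j, |inner ℝ (f j p) (s p) - inner ℝ (f j p) (w p)| < η := by
        rw [eventually_all]
        intro j
        have h2 : ContinuousWithinAt (fun p => inner ℝ (f j p) (s p)) (C ∩ U) z :=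
          continuousOn_inner ((hf j).mono inter_subset_left)
            (hs.continuousOn.mono inter_subset_right) z ⟨hz, mem_of_mem_nhds hU⟩
        have h2' : ContinuousWithinAt (fun p => inner ℝ (f j p) (s p)) C z :=
          h2.mono_of_mem_nhdsWithin (inter_mem self_mem_nhdsWithin (mem_nhdsWithin_of_mem_nhds hU))
        have h3 := ((h2'.sub (hw j z hz)).norm).tendsto.eventually_lt_const (u := η) (by
          change |inner ℝ (f j z) (s z) - inner ℝ (f j z) (w z)| < η
          rw [hsz]; simpa using hη)
        exact h3
      rw [eventually_nhdsWithin_iff] at h1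
      exact ⟨_, inter_mem hU h1, s, (hs.of_le (by exact_mod_cast le_top)).mono inter_subset_left,
        fun p hp => hp.2⟩
    · exact ⟨_, inter_mem hU (hC.isOpen_compl.mem_nhds hz), s,
        (hs.of_le (by exact_mod_cast le_top)).mono inter_subset_left,
        fun p hp h => absurd h hp.2⟩)
  exact ⟨s, fun p => s.contMDiff.contMDiffAt, fun p hp => hs p hp⟩

variable {o : ∀ p : M, Orientation ℝ (TangentSpace (𝓡 3) p) (Fin 3)} {U : Set M}
  {X Y e₁ e₂ : ∀ p : M, TangentSpace (𝓡 3) p}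

theorem IsAdaptedFrame.fst_ne_zero (h : IsAdaptedFrame o U X Y e₁ e₂) {p : M}
    (hp : p ∈ closure U) : e₁ p ≠ 0 := by
  obtain ⟨b, hb, -⟩ := h.positive p hp
  have := b.ne_zero 0
  rwa [hb] at this

theorem IsAdaptedFrame.snd_ne_zero (h : IsAdaptedFrame o U X Y e₁ e₂) {p : M}
    (hp : p ∈ closure U) : e₂ p ≠ 0 := by
  obtain ⟨b, hb, -⟩ := h.positive p hp
  have := b.ne_zero 1
  rwa [hb] at this

theorem IsAdaptedFrame.thd_ne_zero (h : IsAdaptedFrame o U X Y e₁ e₂) {p : M}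
    (hp : p ∈ closure U) : Y p ≠ 0 := by
  obtain ⟨b, hb, -⟩ := h.positive p hp
  have := b.ne_zero 2
  rwa [hb] at this

/-- The coordinates of the normal component in an adapted frame. -/
def normalCoord (X Y e₁ e₂ : ∀ p : M, TangentSpace (𝓡 3) p) (p : M) : ℂ :=
  ⟨inner ℝ (normalComponent X Y p) (e₁ p) / inner ℝ (e₁ p) (e₁ p),
    inner ℝ (normalComponent X Y p) (e₂ p) / inner ℝ (e₂ p) (e₂ p)⟩

theorem normalGaussMap_eq (p : M) :
    normalGaussMap X Y e₁ e₂ p =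
      (‖normalCoord X Y e₁ e₂ p‖⁻¹ : ℝ) • normalCoord X Y e₁ e₂ p := by
  have h : ‖normalCoord X Y e₁ e₂ p‖ = Real.sqrt ((normalCoord X Y e₁ e₂ p).re ^ 2 +
      (normalCoord X Y e₁ e₂ p).im ^ 2) := by
    rw [Complex.norm_def, Complex.normSq_apply]
    congr 1
    ring
  rw [h]
  apply Complex.ext
  · simp only [normalGaussMap, normalCoord, Complex.smul_re, smul_eq_mul]
    rw [div_eq_inv_mul]
  · simp only [normalGaussMap, normalCoord, Complex.smul_im, smul_eq_mul]
    rw [div_eq_inv_mul]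

theorem IsAdaptedFrame.inner_normalComponent_fst (h : IsAdaptedFrame o U X Y e₁ e₂) {p : M}
    (hp : p ∈ closure U) : inner ℝ (normalComponent X Y p) (e₁ p) = inner ℝ (X p) (e₁ p) := by
  rw [normalComponent, inner_sub_left, real_inner_smul_left, real_inner_comm (e₁ p) (Y p), h.inner_fst p hp,
    mul_zero, sub_zero]

theorem IsAdaptedFrame.inner_normalComponent_snd (h : IsAdaptedFrame o U X Y e₁ e₂) {p : M}
    (hp : p ∈ closure U) : inner ℝ (normalComponent X Y p) (e₂ p) = inner ℝ (X p) (e₂ p) := by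
  rw [normalComponent, inner_sub_left, real_inner_smul_left, real_inner_comm (e₂ p) (Y p),
    h.inner_snd p hp, mul_zero, sub_zero]

/-- In an adapted frame, the vanishing of the normal coordinates means that `X` is a multiple
of `Y`. -/
theorem IsAdaptedFrame.normalComponent_eq_zero (h : IsAdaptedFrame o U X Y e₁ e₂) {p : M}
    (hp : p ∈ closure U) (h0 : normalCoord X Y e₁ e₂ p = 0) : normalComponent X Y p = 0 := by
  have hn1 := inner_self_ne_zero (𝕜 := ℝ).2 (h.fst_ne_zero hp)
  have hn2 := inner_self_ne_zero (𝕜 := ℝ).2 (h.snd_ne_zero hp)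
  have hn3 := inner_self_ne_zero (𝕜 := ℝ).2 (h.thd_ne_zero hp)
  have h1 : inner ℝ (normalComponent X Y p) (e₁ p) = 0 := by
    have := congrArg Complex.re h0
    simpa [normalCoord, h.fst_ne_zero hp] using this
  have h2 : inner ℝ (normalComponent X Y p) (e₂ p) = 0 := by
    have := congrArg Complex.im h0
    simpa [normalCoord, h.snd_ne_zero hp] using this
  have h3 : inner ℝ (normalComponent X Y p) (Y p) = 0 := by
    rw [normalComponent, inner_sub_left, real_inner_smul_left, quotientFunction,
      div_mul_cancel₀ _ hn3, sub_self]
  obtain ⟨b, hb, -⟩ := h.positive p hp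
  have hb' : ∀ i, inner ℝ (normalComponent X Y p) (b i) = 0 := by
    rw [hb]
    intro i
    fin_cases i
    exacts [h1, h2, h3]
  have h4 : ∀ v, inner ℝ (normalComponent X Y p) v = 0 := by
    intro v
    rw [← b.sum_repr v, inner_sum]
    refine Finset.sum_eq_zero fun i _ => ?_
    rw [real_inner_smul_right, hb', mul_zero]
  exact inner_self_eq_zero.1 (h4 _)

/-- An orthogonal frame has dual vectors `eᵢ / ⟨eᵢ, eᵢ⟩`. Approximating them by `C¹` fields gives
`C¹` coordinates that are close to the normal coordinates on `X` and close to the first two basis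
vectors on `e₁`, `e₂`. The field `Y` is kept, so the third coordinate of `X` is exactly the quotient
function. -/
theorem exists_isC1FrameAt [T2Space M] [SecondCountableTopology M]
    (hr : ∀ p, IsC1At Y p) (hXc : ∀ p, IsC1At X p)
    (h : IsAdaptedFrame o U X Y e₁ e₂) {m : ℝ} (hm : 0 < m) :
    ∃ E₁ E₂ : ∀ p : M, TangentSpace (𝓡 3) p, (∀ p, IsC1At E₁ p) ∧ (∀ p, IsC1At E₂ p) ∧
      ∀ p ∈ closure U, IsC1FrameAt E₁ E₂ Y p ∧
        0 < det3 (frameCoord E₁ E₂ Y p (e₁ p)) (frameCoord E₁ E₂ Y p (e₂ p))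
          (frameCoord E₁ E₂ Y p (Y p)) ∧
        |frameCoord E₁ E₂ Y p (X p) 0 - (normalCoord X Y e₁ e₂ p).re| < m ∧
        |frameCoord E₁ E₂ Y p (X p) 1 - (normalCoord X Y e₁ e₂ p).im| < m := by
  have key : ∀ e : ∀ p : M, TangentSpace (𝓡 3) p,
      ContinuousOn (fun p => (⟨p, e p⟩ : TangentBundle (𝓡 3) M)) (closure U) →
      (∀ p ∈ closure U, e p ≠ 0) → ∃ E : ∀ p : M, TangentSpace (𝓡 3) p, (∀ p, IsC1At E p) ∧
      ∀ p ∈ closure U, ∀ j : Fin 3,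
        |inner ℝ ((![e₁, e₂, X] : Fin 3 → ∀ p : M, TangentSpace (𝓡 3) p) j p) (E p) -
        inner ℝ ((![e₁, e₂, X] : Fin 3 → ∀ p : M, TangentSpace (𝓡 3) p) j p) (e p) /
          inner ℝ (e p) (e p)| < min m (1 / 4) := by
    intro e he he0
    have hf : ∀ j : Fin 3, ContinuousOn (fun p => (⟨p,
        (![e₁, e₂, X] : Fin 3 → ∀ p : M, TangentSpace (𝓡 3) p) j p⟩ : TangentBundle (𝓡 3) M))
        (closure U) := by
      intro j
      fin_cases j
      · exact h.continuousOn_fst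
      · exact h.continuousOn_snd
      · exact fun p _ => (hXc p).continuousAt.continuousWithinAt
    have hin : ∀ {f g : ∀ p : M, TangentSpace (𝓡 3) p},
        ContinuousOn (fun p => (⟨p, f p⟩ : TangentBundle (𝓡 3) M)) (closure U) →
        ContinuousOn (fun p => (⟨p, g p⟩ : TangentBundle (𝓡 3) M)) (closure U) →
        ContinuousOn (fun p => inner ℝ (f p) (g p)) (closure U) := fun hf hg =>
      continuousOn_inner hf hg
    obtain ⟨E, hE, hE'⟩ := exists_contMDiff_inner_approx isClosed_closure hf
      (w := fun p => (inner ℝ (e p) (e p))⁻¹ • e p) (fun j => by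
        refine ((hin (hf j) he).div (hin he he) fun p hp =>
          inner_self_ne_zero (𝕜 := ℝ).2 (he0 p hp)).congr fun p hp => ?_
        simp only [real_inner_smul_right, div_eq_inv_mul, Pi.div_apply])
      (η := min m (1 / 4)) (by positivity)
    refine ⟨E, hE, fun p hp j => ?_⟩
    have := hE' p hp j
    rwa [real_inner_smul_right, ← div_eq_inv_mul] at this
  obtain ⟨E₁, hE₁, h₁⟩ := key e₁ h.continuousOn_fst fun p hp => h.fst_ne_zero hp
  obtain ⟨E₂, hE₂, h₂⟩ := key e₂ h.continuousOn_snd fun p hp => h.snd_ne_zero hp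
  refine ⟨E₁, E₂, hE₁, hE₂, fun p hp => ?_⟩
  have hn1 := inner_self_ne_zero (𝕜 := ℝ).2 (h.fst_ne_zero hp)
  have hn2 := inner_self_ne_zero (𝕜 := ℝ).2 (h.snd_ne_zero hp)
  have hn3 := inner_self_ne_zero (𝕜 := ℝ).2 (h.thd_ne_zero hp)
  have h11 := (h₁ p hp 0).trans_le (min_le_right _ _)
  have h12 := (h₁ p hp 1).trans_le (min_le_right _ _)
  have h21 := (h₂ p hp 0).trans_le (min_le_right _ _)
  have h22 := (h₂ p hp 1).trans_le (min_le_right _ _)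
  have h13 := (h₁ p hp 2).trans_le (min_le_left _ _)
  have h23 := (h₂ p hp 2).trans_le (min_le_left _ _)
  simp only [Matrix.cons_val_zero, Matrix.cons_val_one, Matrix.cons_val] at h11 h12 h21 h22 h13 h23
  have horth := h.inner_fst_snd p hp
  rw [div_self hn1] at h11
  rw [div_self hn2] at h22
  rw [real_inner_comm (e₁ p) (e₂ p), horth, zero_div, sub_zero] at h12
  rw [horth, zero_div, sub_zero] at h21
  have hdet : 0 < det3 (frameCoord E₁ E₂ Y p (e₁ p)) (frameCoord E₁ E₂ Y p (e₂ p))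
      (frameCoord E₁ E₂ Y p (Y p)) := by
    have a1 : frameCoord E₁ E₂ Y p (e₁ p) 2 = 0 := by
      exact (congrArg (· / _) (h.inner_fst p hp)).trans (zero_div _)
    have a2 : frameCoord E₁ E₂ Y p (e₂ p) 2 = 0 := by
      exact (congrArg (· / _) (h.inner_snd p hp)).trans (zero_div _)
    have a3 : frameCoord E₁ E₂ Y p (Y p) 2 = 1 := by
      exact div_self hn3
    -- Only the 2 × 2 block of `e₁`, `e₂` remains. Its entries are within `1 / 4` of the identity,
    -- so its determinant exceeds `9 / 16 - 1 / 16`.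
    rw [det3_eq, a1, a2, a3]
    simp only [frameCoord_zero, frameCoord_one]
    rw [abs_lt] at h11 h12 h21 h22
    nlinarith
  refine ⟨⟨hE₁ p, hE₂ p, hr p, h.thd_ne_zero hp, fun h0 => ?_⟩, hdet, ?_, ?_⟩
  · have h1 := det3_map (frameCoord E₁ E₂ Y p) (e₁ p) (e₂ p) (Y p)
    rw [h0, zero_mul] at h1
    exact hdet.ne' h1
  · rw [frameCoord_zero]
    simp only [normalCoord]
    rw [h.inner_normalComponent_fst hp]
    exact h13
  · rw [frameCoord_one]
    simp only [normalCoord]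
    rw [h.inner_normalComponent_snd hp]
    exact h23

end Approximation
end

/-! ### Cross products of functionals and existence of adapted frames. -/

noncomputable section

open MeasureTheory

section CrossProduct

variable {V : Type*} [AddCommGroup V] [Module ℝ V]

/-- The cross product of two functionals, relative to a frame `b`. -/
def crossVec (f g : V → ℝ) (b : Fin 3 → V) : V :=
  (f (b 1) * g (b 2) - f (b 2) * g (b 1)) • b 0 + (f (b 2) * g (b 0) - f (b 0) * g (b 2)) • b 1 +
    (f (b 0) * g (b 1) - f (b 1) * g (b 0)) • b 2

/-- The dependence on the frame is through its determinant alone, so an orientation determines the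
direction of the cross product. This allows local constructions to be glued. -/
theorem crossVec_eq_det_smul (f g : V →ₗ[ℝ] ℝ) (b : Module.Basis (Fin 3) ℝ V) (b' : Fin 3 → V) :
    crossVec f g b' = b.det b' • crossVec f g b := by
  have h : ∀ j, b' j = b.toMatrix b' 0 j • b 0 + b.toMatrix b' 1 j • b 1 + b.toMatrix b' 2 j • b 2 := by
    intro j
    conv_lhs => rw [← b.sum_repr (b' j), Fin.sum_univ_three]
    rfl
  rw [b.det_apply, Matrix.det_fin_three]
  simp only [crossVec, h, map_add, map_smul, smul_eq_mul]
  module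

theorem map_crossVec_fst (f g : V →ₗ[ℝ] ℝ) (b : Fin 3 → V) : f (crossVec f g b) = 0 := by
  simp only [crossVec, map_add, map_smul, smul_eq_mul]
  ring

theorem map_crossVec_snd (f g : V →ₗ[ℝ] ℝ) (b : Fin 3 → V) : g (crossVec f g b) = 0 := by
  simp only [crossVec, map_add, map_smul, smul_eq_mul]
  ring

/-- The three coefficients are the coordinates of `f ∧ g`. If they all vanished, then so would `f u
* g v - f v * g u`. -/
theorem crossVec_ne_zero {f g : V →ₗ[ℝ] ℝ} (b : Module.Basis (Fin 3) ℝ V) {u v : V}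
    (hu : f u ≠ 0) (hv : f v = 0) (hgv : g v ≠ 0) : crossVec f g b ≠ 0 := by
  intro h
  have hl := b.linearIndependent
  rw [Fintype.linearIndependent_iff] at hl
  have h0 := hl ![f (b 1) * g (b 2) - f (b 2) * g (b 1), f (b 2) * g (b 0) - f (b 0) * g (b 2),
    f (b 0) * g (b 1) - f (b 1) * g (b 0)] (by
      rw [Fin.sum_univ_three]
      exact h)
  have h1 : f (b 1) * g (b 2) - f (b 2) * g (b 1) = 0 := h0 0
  have h2 : f (b 2) * g (b 0) - f (b 0) * g (b 2) = 0 := h0 1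
  have h3 : f (b 0) * g (b 1) - f (b 1) * g (b 0) = 0 := h0 2
  have hk : f u * g v - f v * g u = 0 := by
    rw [← b.sum_repr u, ← b.sum_repr v, Fin.sum_univ_three, Fin.sum_univ_three]
    simp only [map_add, map_smul, smul_eq_mul]
    linear_combination (b.repr u 1 * b.repr v 2 - b.repr u 2 * b.repr v 1) * h1 +
      (b.repr u 2 * b.repr v 0 - b.repr u 0 * b.repr v 2) * h2 +
      (b.repr u 0 * b.repr v 1 - b.repr u 1 * b.repr v 0) * h3
  rw [hv, zero_mul, sub_zero] at hk
  exact mul_ne_zero hu hgv hk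

end CrossProduct

section AdaptedFrame

variable {M : Type*} [TopologicalSpace M] [ChartedSpace (EuclideanSpace ℝ (Fin 3)) M]
  [IsManifold (𝓡 3) ∞ M]

theorem continuousOn_smul_section {C : Set M} {φ : M → ℝ} {s : ∀ p : M, TangentSpace (𝓡 3) p}
    (hφ : ContinuousOn φ C)
    (hs : ContinuousOn (fun p => (⟨p, s p⟩ : TangentBundle (𝓡 3) M)) C) :
    ContinuousOn (fun p => (⟨p, φ p • s p⟩ : TangentBundle (𝓡 3) M)) C :=
  contMDiffOn_zero_iff.1 (ContMDiffOn.smul_section (I := 𝓡 3) (n := 0)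
    (V := fun p : M => TangentSpace (𝓡 3) p) (contMDiffOn_zero_iff.2 hφ) (contMDiffOn_zero_iff.2 hs))

theorem continuousOn_add_section {C : Set M} {s t : ∀ p : M, TangentSpace (𝓡 3) p}
    (hs : ContinuousOn (fun p => (⟨p, s p⟩ : TangentBundle (𝓡 3) M)) C)
    (ht : ContinuousOn (fun p => (⟨p, t p⟩ : TangentBundle (𝓡 3) M)) C) :
    ContinuousOn (fun p => (⟨p, s p + t p⟩ : TangentBundle (𝓡 3) M)) C :=
  contMDiffOn_zero_iff.1 (ContMDiffOn.add_section (I := 𝓡 3) (n := 0)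
    (V := fun p : M => TangentSpace (𝓡 3) p) (contMDiffOn_zero_iff.2 hs) (contMDiffOn_zero_iff.2 ht))

variable [RiemannianBundle (fun p : M => TangentSpace (𝓡 3) p)]
  [IsContMDiffRiemannianBundle (𝓡 3) ∞ (EuclideanSpace ℝ (Fin 3))
      (fun p : M => TangentSpace (𝓡 3) p)]
  {o : ∀ p : M, Orientation ℝ (TangentSpace (𝓡 3) p) (Fin 3)} {U : Set M}
  {X Y : ∀ p : M, TangentSpace (𝓡 3) p}

/-- All positive bases give the same direction, so after normalisation the arbitrary choice of a
basis at each point disappears. Continuity is then checked with the local continuous positive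
frames. -/
theorem exists_continuousOn_crossVec {C : Set M} (ho : IsContinuousOrientationOn o C)
    {f g : ∀ p : M, TangentSpace (𝓡 3) p →ₗ[ℝ] ℝ}
    (hf : ∀ V ⊆ C, ∀ s : ∀ p : M, TangentSpace (𝓡 3) p,
      ContinuousOn (fun p => (⟨p, s p⟩ : TangentBundle (𝓡 3) M)) V →
      ContinuousOn (fun p => f p (s p)) V)
    (hg : ∀ V ⊆ C, ∀ s : ∀ p : M, TangentSpace (𝓡 3) p,
      ContinuousOn (fun p => (⟨p, s p⟩ : TangentBundle (𝓡 3) M)) V →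
      ContinuousOn (fun p => g p (s p)) V)
    (hfg : ∀ p ∈ C, ∃ u v, f p u ≠ 0 ∧ f p v = 0 ∧ g p v ≠ 0) :
    ∃ e : ∀ p : M, TangentSpace (𝓡 3) p,
      ContinuousOn (fun p => (⟨p, e p⟩ : TangentBundle (𝓡 3) M)) C ∧
      ∀ p ∈ C, f p (e p) = 0 ∧ g p (e p) = 0 ∧ ‖e p‖ = 1 ∧
        ∃ b : Module.Basis (Fin 3) ℝ (TangentSpace (𝓡 3) p), b.orientation = o p ∧
          ∃ c > (0 : ℝ), e p = c • crossVec (f p) (g p) b := by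
  have hb : ∀ p ∈ C, ∃ b : Module.Basis (Fin 3) ℝ (TangentSpace (𝓡 3) p), b.orientation = o p := by
    intro p hp
    obtain ⟨V, hV, e, -, he⟩ := ho p hp
    obtain ⟨b, -, hb⟩ := he p (mem_of_mem_nhdsWithin hp hV)
    exact ⟨b, hb⟩
  -- Provides a default value for `choose!` at points outside `C`.
  haveI : ∀ p : M, Nonempty (Module.Basis (Fin 3) ℝ (TangentSpace (𝓡 3) p)) :=
    fun p => ⟨(EuclideanSpace.basisFun (Fin 3) ℝ).toBasis⟩
  choose! b hb using hb
  have hc0 : ∀ p ∈ C, crossVec (f p) (g p) (b p) ≠ 0 := by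
    intro p hp
    obtain ⟨u, v, hu, hv, hgv⟩ := hfg p hp
    exact crossVec_ne_zero (b p) hu hv hgv
  refine ⟨fun p => ‖crossVec (f p) (g p) (b p)‖⁻¹ • crossVec (f p) (g p) (b p), ?_, ?_⟩
  · intro p₀ hp₀
    obtain ⟨V, hV, e, hec, he⟩ := ho p₀ hp₀
    have hVC : V ∩ C ∈ 𝓝[C] p₀ := inter_mem hV self_mem_nhdsWithin
    have hec' : ∀ i, ContinuousOn (fun p => (⟨p, e i p⟩ : TangentBundle (𝓡 3) M)) (V ∩ C) :=
      fun i => (hec i).mono inter_subset_left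
    have hf' := fun i => hf (V ∩ C) inter_subset_right (e i) (hec' i)
    have hg' := fun i => hg (V ∩ C) inter_subset_right (e i) (hec' i)
    let w : ∀ p : M, TangentSpace (𝓡 3) p := fun p =>
      crossVec (f p) (g p) ![e 0 p, e 1 p, e 2 p]
    have hw : ContinuousOn (fun p => (⟨p, w p⟩ : TangentBundle (𝓡 3) M)) (V ∩ C) := by
      have h0 := continuousOn_smul_section (((hf' 1).mul (hg' 2)).sub ((hf' 2).mul (hg' 1))) (hec' 0)
      have h1 := continuousOn_smul_section (((hf' 2).mul (hg' 0)).sub ((hf' 0).mul (hg' 2))) (hec' 1)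
      have h2 := continuousOn_smul_section (((hf' 0).mul (hg' 1)).sub ((hf' 1).mul (hg' 0))) (hec' 2)
      exact continuousOn_add_section (continuousOn_add_section h0 h1) h2
    have hwb : ∀ p ∈ V ∩ C, ∃ c > (0 : ℝ), w p = c • crossVec (f p) (g p) (b p) := by
      intro p hp
      exact ⟨_, (isPositive_iff (hb p hp.2) _ _ _).1 (he p hp.1), crossVec_eq_det_smul _ _ _ _⟩
    have hw0 : ∀ p ∈ V ∩ C, w p ≠ 0 := by
      intro p hp
      obtain ⟨c, hc, h⟩ := hwb p hp
      rw [h]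
      exact smul_ne_zero hc.ne' (hc0 p hp.2)
    have hn : ContinuousOn (fun p => ‖w p‖⁻¹) (V ∩ C) := by
      have h1 := (continuousOn_inner hw hw).sqrt
      refine (h1.congr fun p _ => ?_).inv₀ fun p hp => norm_ne_zero_iff.2 (hw0 p hp)
      exact norm_eq_sqrt_real_inner _
    have h := continuousOn_smul_section hn hw
    refine ((h.congr fun p hp => ?_) p₀ ⟨mem_of_mem_nhdsWithin hp₀ hV, hp₀⟩).mono_of_mem_nhdsWithin hVC
    obtain ⟨c, hc, h⟩ := hwb p hp
    congr 1
    rw [h, norm_smul, Real.norm_of_nonneg hc.le, smul_smul]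
    congr 1
    field_simp
  · intro p hp
    have hn := norm_ne_zero_iff.2 (hc0 p hp)
    refine ⟨?_, ?_, ?_, b p, hb p hp, _, inv_pos.2 (norm_pos_iff.2 (hc0 p hp)), rfl⟩
    · rw [map_smul, map_crossVec_fst, smul_zero]
    · rw [map_smul, map_crossVec_snd, smul_zero]
    · rw [norm_smul, norm_inv, norm_norm, inv_mul_cancel₀ hn]

theorem contMDiffAt_quotientFunction {p : M} (hX : IsC1At X p) (hY : IsC1At Y p) (h0 : Y p ≠ 0) :
    ContMDiffAt (𝓡 3) 𝓘(ℝ, ℝ) 1 (quotientFunction X Y) p :=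
  (contMDiffAt_inner hX hY).div₀ (contMDiffAt_inner hY hY) (inner_self_ne_zero.2 h0)

/-- The quotient function is `C¹` on the open set where `Y` does not vanish, so its tangent map is
continuous there. This set contains `C`, which may have no interior. -/
theorem continuousOn_dQuotient (hX : ∀ p, IsC1At X p) (hY : ∀ p, IsC1At Y p) {C : Set M}
    (h0 : ∀ p ∈ C, Y p ≠ 0) {s : ∀ p : M, TangentSpace (𝓡 3) p}
    (hs : ContinuousOn (fun p => (⟨p, s p⟩ : TangentBundle (𝓡 3) M)) C) :
    ContinuousOn (fun p => dQuotient X Y p (s p)) C := by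
  let O : Set M := {p | Y p ≠ 0}
  have hO : IsOpen O := by
    have h1 : Continuous fun p => inner ℝ (Y p) (Y p) :=
      continuous_iff_continuousAt.2 fun p => (contMDiffAt_inner (hY p) (hY p)).continuousAt
    have h2 : O = {p | inner ℝ (Y p) (Y p) ≠ (0 : ℝ)} := by
      ext p
      exact (inner_self_ne_zero (𝕜 := ℝ)).symm
    rw [h2]
    exact isOpen_ne_fun h1 continuous_const
  have h1 : ContMDiffOn (𝓡 3) 𝓘(ℝ, ℝ) 1 (quotientFunction X Y) O := fun p hp =>
    (contMDiffAt_quotientFunction (hX p) (hY p) hp).contMDiffWithinAt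
  have h2 := h1.continuousOn_tangentMapWithin le_rfl hO.uniqueMDiffOn
  have h3 := (tangentBundleModelSpaceHomeomorph 𝓘(ℝ, ℝ)).continuous.comp_continuousOn
    (h2.comp hs fun p hp => h0 p hp)
  refine (continuous_snd.comp_continuousOn h3).congr fun p hp => ?_
  simp only [dQuotient, tangentBundleModelSpaceHomeomorph, tangentMapWithin, Function.comp_apply,
    mfderivWithin_of_isOpen hO (h0 p hp)]
  rfl

/-- The line of `e₂` is the common kernel of `dμ` and `⟨Y, ·⟩`, which are independent because `Y` is
not orthogonal to the level sets; that of `e₁` is the common kernel of `⟨e₂, ·⟩` and `⟨Y, ·⟩`. Both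
are cross products of functionals, and `e₁` is finally scaled by `‖Y‖`. -/
theorem exists_isAdaptedFrame (hX : ∀ p, IsC1At X p) (hY : ∀ p, IsC1At Y p)
    (ho : IsTransverseOrientation o Y (closure U))
    (hμ : ∀ p ∈ closure U, ∃ v, dQuotient X Y p v = 0 ∧ inner ℝ (Y p) v ≠ 0)
    (hμ0 : ∀ p ∈ closure U, ∃ u, dQuotient X Y p u ≠ 0) :
    ∃ e₁ e₂ : ∀ p : M, TangentSpace (𝓡 3) p, IsAdaptedFrame o U X Y e₁ e₂ := by
  have hYc : ContinuousOn (fun p => (⟨p, Y p⟩ : TangentBundle (𝓡 3) M)) (closure U) :=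
    fun p _ => (hY p).continuousAt.continuousWithinAt
  let D : ∀ p : M, TangentSpace (𝓡 3) p →ₗ[ℝ] ℝ := fun p =>
    (mfderiv (𝓡 3) 𝓘(ℝ, ℝ) (quotientFunction X Y) p).toLinearMap
  obtain ⟨e₂, he₂, h₂⟩ := exists_continuousOn_crossVec ho.continuousOn (f := D)
    (g := fun p => (innerSL ℝ (Y p)).toLinearMap)
    (fun V hV s hs => continuousOn_dQuotient hX hY (fun p hp => ho.ne_zero p (hV hp)) hs)
    (fun V hV s hs => continuousOn_inner (hYc.mono hV) hs)
    (fun p hp => by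
      obtain ⟨v, hv, hv'⟩ := hμ p hp
      obtain ⟨u, hu⟩ := hμ0 p hp
      exact ⟨u, v, hu, hv, hv'⟩)
  obtain ⟨e₁, he₁, h₁⟩ := exists_continuousOn_crossVec ho.continuousOn
    (f := fun p => (innerSL ℝ (e₂ p)).toLinearMap) (g := fun p => (innerSL ℝ (Y p)).toLinearMap)
    (fun V hV s hs => continuousOn_inner (he₂.mono hV) hs)
    (fun V hV s hs => continuousOn_inner (hYc.mono hV) hs)
    (fun p hp => by
      obtain ⟨-, h, h1, -⟩ := h₂ p hp
      refine ⟨e₂ p, Y p, ?_, ?_, inner_self_ne_zero (𝕜 := ℝ).2 (ho.ne_zero p hp)⟩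
      · change inner ℝ (e₂ p) (e₂ p) ≠ 0
        refine inner_self_ne_zero (𝕜 := ℝ).2 fun h0 => ?_
        rw [h0, norm_zero] at h1
        exact zero_ne_one h1
      · change inner ℝ (e₂ p) (Y p) = 0
        rw [real_inner_comm]
        exact h)
  have hYn : ContinuousOn (fun p => ‖Y p‖) (closure U) :=
    (continuousOn_inner hYc hYc).sqrt.congr fun p _ => norm_eq_sqrt_real_inner _
  refine ⟨fun p => ‖Y p‖ • e₁ p, e₂, continuousOn_smul_section hYn he₁, he₂,
    fun p hp => (h₂ p hp).1, fun p hp => (real_inner_comm _ _).trans (h₂ p hp).2.1, ?_, ?_, ?_, ?_⟩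
  · intro p hp
    rw [real_inner_smul_left, real_inner_comm]
    exact mul_eq_zero_of_right _ (h₁ p hp).1
  · intro p hp
    rw [real_inner_smul_left, real_inner_comm]
    exact mul_eq_zero_of_right _ (h₁ p hp).2.1
  · intro p hp
    rw [norm_smul, norm_norm, (h₁ p hp).2.2.1, (h₂ p hp).2.2.1, mul_one, one_mul]
  · intro p hp
    obtain ⟨hf, hg, hn, b, hb, c, hc, h⟩ := h₁ p hp
    rw [isPositive_iff hb]
    have hY0 := norm_pos_iff.2 (ho.ne_zero p hp)
    have h3 := crossVec_eq_det_smul (innerSL ℝ (e₂ p)).toLinearMap (innerSL ℝ (Y p)).toLinearMap b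
      ![‖Y p‖ • e₁ p, e₂ p, Y p]
    have hw : crossVec (innerSL ℝ (e₂ p)).toLinearMap (innerSL ℝ (Y p)).toLinearMap b =
        c⁻¹ • e₁ p := by
      rw [h, smul_smul, inv_mul_cancel₀ hc.ne', one_smul]
    have hf' : inner ℝ (e₂ p) (e₁ p) = 0 := hf
    have hg' : inner ℝ (Y p) (e₁ p) = 0 := hg
    have h22 : inner ℝ (e₂ p) (e₂ p) = (1 : ℝ) := by
      rw [real_inner_self_eq_norm_sq, (h₂ p hp).2.2.1, one_pow]
    have h2Y : inner ℝ (Y p) (e₂ p) = 0 := (h₂ p hp).2.1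
    -- Computed in the frame `(‖Y‖ e₁, e₂, Y)` instead of `b`, the cross product is again a positive
    -- multiple of `e₁`, so this frame has positive determinant with respect to `b`.
    have h4 : crossVec (innerSL ℝ (e₂ p)).toLinearMap (innerSL ℝ (Y p)).toLinearMap
        ![‖Y p‖ • e₁ p, e₂ p, Y p] = (‖Y p‖ ^ 2 * ‖Y p‖) • e₁ p := by
      simp only [crossVec, Matrix.cons_val_zero, Matrix.cons_val_one, Matrix.cons_val,
        ContinuousLinearMap.coe_coe, innerSL_apply_apply, real_inner_smul_right, hf', hg', h22, h2Y,
        real_inner_comm (e₂ p) (Y p), real_inner_self_eq_norm_sq (Y p)]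
      simp [smul_smul]
    rw [hw, h4, smul_smul] at h3
    have he0 : e₁ p ≠ 0 := fun h0 => by rw [h0, norm_zero] at hn; exact zero_ne_one hn
    have h5 := smul_left_injective ℝ he0 h3
    have h6 : 0 < b.det ![‖Y p‖ • e₁ p, e₂ p, Y p] * c⁻¹ := by
      have : 0 < ‖Y p‖ ^ 2 * ‖Y p‖ := by positivity
      exact this.trans_eq h5
    exact pos_of_mul_pos_left h6 (inv_pos.2 hc).le

end AdaptedFrame
end

/-! ### Orientation of the level surfaces through `S × ℝ`. -/

noncomputable section

open MeasureTheory

/-- `ℝ² × ℝ` as a copy of `ℝ³`. -/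
def joinEquiv : (EuclideanSpace ℝ (Fin 2) × ℝ) ≃L[ℝ] EuclideanSpace ℝ (Fin 3) :=
  LinearEquiv.toContinuousLinearEquiv
    { toFun := fun z => !₂[z.1 0, z.1 1, z.2]
      invFun := fun v => (!₂[v 0, v 1], v 2)
      map_add' := fun z w => by ext i; fin_cases i <;> rfl
      map_smul' := fun c z => by ext i; fin_cases i <;> rfl
      left_inv := fun z => by
        refine Prod.ext ?_ rfl
        ext i; fin_cases i <;> rfl
      right_inv := fun v => by ext i; fin_cases i <;> rfl }

@[simp] theorem joinEquiv_zero (z : EuclideanSpace ℝ (Fin 2) × ℝ) : joinEquiv z 0 = z.1 0 := rfl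
@[simp] theorem joinEquiv_one (z : EuclideanSpace ℝ (Fin 2) × ℝ) : joinEquiv z 1 = z.1 1 := rfl
@[simp] theorem joinEquiv_two (z : EuclideanSpace ℝ (Fin 2) × ℝ) : joinEquiv z 2 = z.2 := rfl

/-- The determinant of a linear map from `ℝ² × ℝ` to `ℝ³`. -/
def jac (T : EuclideanSpace ℝ (Fin 2) × ℝ →L[ℝ] EuclideanSpace ℝ (Fin 3)) : ℝ :=
  det3 (T (stdVec 0, 0)) (T (stdVec 1, 0)) (T (0, 1))

theorem continuous_jac : Continuous jac := by
  have h : ∀ v, Continuous fun T : EuclideanSpace ℝ (Fin 2) × ℝ →L[ℝ] EuclideanSpace ℝ (Fin 3) => T v :=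
    fun v => continuous_eval_const v
  have hi : ∀ v (i : Fin 3), Continuous fun T : EuclideanSpace ℝ (Fin 2) × ℝ →L[ℝ]
      EuclideanSpace ℝ (Fin 3) => T v i := fun v i =>
    (EuclideanSpace.proj (𝕜 := ℝ) i).continuous.comp (h v)
  have h0 := hi (stdVec 0, 0)
  have h1 := hi (stdVec 1, 0)
  have h2 := hi (0, 1)
  have hj : jac = fun T => T (stdVec 0, 0) 0 * (T (stdVec 1, 0) 1 * T (0, 1) 2 -
      T (stdVec 1, 0) 2 * T (0, 1) 1) - T (stdVec 1, 0) 0 * (T (stdVec 0, 0) 1 * T (0, 1) 2 -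
      T (stdVec 0, 0) 2 * T (0, 1) 1) + T (0, 1) 0 * (T (stdVec 0, 0) 1 * T (stdVec 1, 0) 2 -
      T (stdVec 0, 0) 2 * T (stdVec 1, 0) 1) := by
    ext1 T
    exact det3_eq _ _ _
  rw [hj]
  exact (((h0 0).mul (((h1 1).mul (h2 2)).sub ((h1 2).mul (h2 1)))).sub
    ((h1 0).mul (((h0 1).mul (h2 2)).sub ((h0 2).mul (h2 1))))).add
    ((h2 0).mul (((h0 1).mul (h1 2)).sub ((h0 2).mul (h1 1))))

theorem jac_comp_left (A : EuclideanSpace ℝ (Fin 3) →L[ℝ] EuclideanSpace ℝ (Fin 3))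
    (T : EuclideanSpace ℝ (Fin 2) × ℝ →L[ℝ] EuclideanSpace ℝ (Fin 3)) :
    jac (A.comp T) = A.det * jac T := det3_map A _ _ _

theorem clm_apply_stdVec (B : EuclideanSpace ℝ (Fin 2) →L[ℝ] EuclideanSpace ℝ (Fin 2)) (i : Fin 2) :
    B (stdVec i) = B (stdVec i) 0 • stdVec 0 + B (stdVec i) 1 • stdVec 1 := by
  ext j
  fin_cases j <;> simp [stdVec]

theorem jac_comp_prodMap (T : EuclideanSpace ℝ (Fin 2) × ℝ →L[ℝ] EuclideanSpace ℝ (Fin 3))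
    (B : EuclideanSpace ℝ (Fin 2) →L[ℝ] EuclideanSpace ℝ (Fin 2)) :
    jac (T.comp (B.prodMap (ContinuousLinearMap.id ℝ ℝ))) = B.det * jac T := by
  have h : ∀ i, T (B (stdVec i), 0) =
      B (stdVec i) 0 • T (stdVec 0, 0) + B (stdVec i) 1 • T (stdVec 1, 0) := by
    intro i
    conv_lhs => rw [clm_apply_stdVec B i]
    rw [← map_smul, ← map_smul, ← map_add]
    simp
  have h1 : jac (T.comp (B.prodMap (ContinuousLinearMap.id ℝ ℝ))) =
      det3 (T (B (stdVec 0), 0)) (T (B (stdVec 1), 0)) (T (B 0, 1)) := rfl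
  rw [h1, h, h, map_zero, jac, clm_det_two]
  simp only [det3_eq, PiLp.add_apply, PiLp.smul_apply, smul_eq_mul]
  ring

theorem jac_joinEquiv : jac joinEquiv = 1 := by
  simp [jac, det3_eq, stdVec]

theorem jac_ne_zero {T : EuclideanSpace ℝ (Fin 2) × ℝ →L[ℝ] EuclideanSpace ℝ (Fin 3)}
    (hT : Function.Injective T) : jac T ≠ 0 := by
  have h : T = (T.comp (joinEquiv.symm : EuclideanSpace ℝ (Fin 3) →L[ℝ] _)).comp
      (joinEquiv : _ →L[ℝ] EuclideanSpace ℝ (Fin 3)) := by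
    refine ContinuousLinearMap.ext fun v => ?_
    simp
  rw [h, jac_comp_left, jac_joinEquiv, mul_one]
  have hi : Function.Injective (T.comp (joinEquiv.symm : EuclideanSpace ℝ (Fin 3) →L[ℝ] _)) :=
    hT.comp joinEquiv.symm.injective
  intro h0
  have h1 := LinearMap.bot_lt_ker_of_det_eq_zero h0
  rw [LinearMap.ker_eq_bot.2 hi] at h1
  exact lt_irrefl _ h1

section Sheet

variable {M : Type*} [TopologicalSpace M] [ChartedSpace (EuclideanSpace ℝ (Fin 3)) M]
  [IsManifold (𝓡 3) ∞ M] [RiemannianBundle (fun p : M => TangentSpace (𝓡 3) p)]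
  [IsContMDiffRiemannianBundle (𝓡 3) ∞ (EuclideanSpace ℝ (Fin 3))
      (fun p : M => TangentSpace (𝓡 3) p)]
  {S : Type*} [TopologicalSpace S] [ChartedSpace (EuclideanHalfSpace 2) S]
  [IsManifold (𝓡∂ 2) ∞ S]
  {E₁ E₂ Y : ∀ p : M, TangentSpace (𝓡 3) p} {Φ : S × ℝ → M}

/-- The differential of `Φ : S × ℝ → M`, in the preferred charts. -/
def sheetDeriv (Φ : S × ℝ → M) (z : S × ℝ) :
    EuclideanSpace ℝ (Fin 2) × ℝ →L[ℝ] EuclideanSpace ℝ (Fin 3) :=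
  mfderiv ((𝓡∂ 2).prod 𝓘(ℝ, ℝ)) (𝓡 3) Φ z

/-- The sign of the preferred chart of `S` with respect to the orientation which, followed by the
second factor of `S × ℝ`, corresponds to the frame `(E₁, E₂, Y)`. -/
def sheetSign (E₁ E₂ Y : ∀ p : M, TangentSpace (𝓡 3) p) (Φ : S × ℝ → M) (z : S × ℝ) : SignType :=
  SignType.sign (jac ((frameCoord E₁ E₂ Y (Φ z)).comp (sheetDeriv Φ z)))

theorem sheetSign_eq (z : S × ℝ) : sheetSign E₁ E₂ Y Φ z =
    frameSign E₁ E₂ Y (Φ z) * SignType.sign (jac (sheetDeriv Φ z)) := by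
  rw [sheetSign, jac_comp_left, sign_mul]
  rfl

/-- `Φ` is a local `C¹` immersion at `z`, and the frame is `C¹` at `Φ z`. -/
structure IsC1SheetAt (E₁ E₂ Y : ∀ p : M, TangentSpace (𝓡 3) p) (Φ : S × ℝ → M) (z : S × ℝ) :
    Prop where
  contMDiffAt : ContMDiffAt ((𝓡∂ 2).prod 𝓘(ℝ, ℝ)) (𝓡 3) 1 Φ z
  injective : Function.Injective (sheetDeriv Φ z)
  frame : IsC1FrameAt E₁ E₂ Y (Φ z)

theorem IsC1SheetAt.jac_ne_zero {z : S × ℝ} (h : IsC1SheetAt E₁ E₂ Y Φ z) :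
    jac (sheetDeriv Φ z) ≠ 0 := _root_.jac_ne_zero h.injective

theorem IsC1SheetAt.sheetSign_ne_zero {z : S × ℝ} (h : IsC1SheetAt E₁ E₂ Y Φ z) :
    sheetSign E₁ E₂ Y Φ z ≠ 0 := by
  rw [sheetSign, jac_comp_left]
  exact sign_ne_zero.2 (mul_ne_zero h.frame.det_ne_zero h.jac_ne_zero)

theorem sheetDeriv_extChartAt {z₀ z : S × ℝ} (hz : z.1 ∈ (extChartAt (𝓡∂ 2) z₀.1).source) :
    (show EuclideanSpace ℝ (Fin 2) × ℝ →L[ℝ] EuclideanSpace ℝ (Fin 2) × ℝ from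
      mfderiv ((𝓡∂ 2).prod 𝓘(ℝ, ℝ)) 𝓘(ℝ, EuclideanSpace ℝ (Fin 2) × ℝ)
        (extChartAt ((𝓡∂ 2).prod 𝓘(ℝ, ℝ)) z₀) z) =
      (show EuclideanSpace ℝ (Fin 2) →L[ℝ] EuclideanSpace ℝ (Fin 2) from
        mfderiv (𝓡∂ 2) 𝓘(ℝ, EuclideanSpace ℝ (Fin 2)) (extChartAt (𝓡∂ 2) z₀.1) z.1).prodMap
        (ContinuousLinearMap.id ℝ ℝ) := by
  have hz' : z.1 ∈ (chartAt (EuclideanHalfSpace 2) z₀.1).source := by rwa [extChartAt_source] at hz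
  have h1 : ⇑(extChartAt ((𝓡∂ 2).prod 𝓘(ℝ, ℝ)) z₀) = Prod.map (extChartAt (𝓡∂ 2) z₀.1) id := by
    rw [extChartAt_prod]
    ext1 w
    rfl
  rw [h1]
  have h2 := mfderiv_prodMap (p := z) (f := extChartAt (𝓡∂ 2) z₀.1) (g := (id : ℝ → ℝ))
    (I' := 𝓘(ℝ, ℝ)) (J' := 𝓘(ℝ, ℝ)) (mdifferentiableAt_extChartAt (I := 𝓡∂ 2) hz') mdifferentiableAt_id
  rw [mfderiv_id] at h2
  rw [modelWithCornersSelf_prod, ← chartedSpaceSelf_prod]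
  exact h2

/-- As for `frameSign`: in fixed charts at `z₀` the determinant is continuous and nonzero. Returning
to the preferred charts at `z` multiplies it by the Jacobian determinant of the change of charts of
`S`, the factor `ℝ` contributing `1`. -/
theorem IsC1SheetAt.eventually_sign {z₀ : S × ℝ} (h : IsC1SheetAt E₁ E₂ Y Φ z₀) :
    ∀ᶠ z in 𝓝 z₀, SignType.sign (mdet (𝓡∂ 2) (extChartAt (𝓡∂ 2) z₀.1) z.1) =
      sheetSign E₁ E₂ Y Φ z₀ * sheetSign E₁ E₂ Y Φ z := by
  let P : S × ℝ → EuclideanSpace ℝ (Fin 2) × ℝ →L[ℝ] EuclideanSpace ℝ (Fin 3) :=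
    inTangentCoordinates ((𝓡∂ 2).prod 𝓘(ℝ, ℝ)) (𝓡 3) id Φ
      (mfderiv ((𝓡∂ 2).prod 𝓘(ℝ, ℝ)) (𝓡 3) Φ) z₀
  have hP : ContinuousAt P z₀ :=
    (h.contMDiffAt.mfderiv_const (m := 0) (by norm_num)).continuousAt
  let Q : S × ℝ → EuclideanSpace ℝ (Fin 2) × ℝ →L[ℝ] EuclideanSpace ℝ (Fin 3) := fun z =>
    (frameCoordIn E₁ E₂ Y (Φ z₀) (Φ z)).comp (P z)
  have hΦ := h.contMDiffAt.continuousAt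
  have hQ : ContinuousAt Q z₀ := by
    have h1 := continuousAt_frameCoordIn (mem_extChartAt_source (I := 𝓡 3) (Φ z₀)) h.frame.fst
      h.frame.snd h.frame.thd h.frame.thd_ne_zero
    exact (ContinuousAt.comp (f := Φ) h1 hΦ).clm_comp hP
  have hs : ∀ᶠ z in 𝓝 z₀, z.1 ∈ (extChartAt (𝓡∂ 2) z₀.1).source :=
    continuous_fst.continuousAt.eventually (extChartAt_source_mem_nhds (I := 𝓡∂ 2) z₀.1)
  have ht : ∀ᶠ z in 𝓝 z₀, Φ z ∈ (extChartAt (𝓡 3) (Φ z₀)).source :=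
    hΦ.eventually (extChartAt_source_mem_nhds (I := 𝓡 3) (Φ z₀))
  have key : ∀ᶠ z in 𝓝 z₀, jac ((frameCoord E₁ E₂ Y (Φ z)).comp (sheetDeriv Φ z)) =
      mdet (𝓡∂ 2) (extChartAt (𝓡∂ 2) z₀.1) z.1 * jac (Q z) := by
    filter_upwards [hs, ht, extChartAt_source_mem_nhds (I := (𝓡∂ 2).prod 𝓘(ℝ, ℝ)) z₀] with z hz1 hz2 hz3
    have h1 : P z = (mfderiv (𝓡 3) 𝓘(ℝ, EuclideanSpace ℝ (Fin 3)) (extChartAt (𝓡 3) (Φ z₀)) (Φ z)) ∘L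
        (mfderiv ((𝓡∂ 2).prod 𝓘(ℝ, ℝ)) (𝓡 3) Φ z) ∘L
        (mfderivWithin 𝓘(ℝ, EuclideanSpace ℝ (Fin 2) × ℝ) ((𝓡∂ 2).prod 𝓘(ℝ, ℝ))
          (extChartAt ((𝓡∂ 2).prod 𝓘(ℝ, ℝ)) z₀).symm (range ((𝓡∂ 2).prod 𝓘(ℝ, ℝ)))
          (extChartAt ((𝓡∂ 2).prod 𝓘(ℝ, ℝ)) z₀ z)) :=
      inTangentCoordinates_eq_mfderiv_comp (f := id) (g := Φ) (x₀ := z₀) (x := z)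
        (by rwa [extChartAt_source] at hz3) (by rwa [extChartAt_source] at hz2)
    have h2 := mfderivWithin_extChartAt_symm_comp_mfderiv_extChartAt' hz3
    have h3 : (Q z).comp (show EuclideanSpace ℝ (Fin 2) × ℝ →L[ℝ] EuclideanSpace ℝ (Fin 2) × ℝ from
      mfderiv ((𝓡∂ 2).prod 𝓘(ℝ, ℝ)) 𝓘(ℝ, EuclideanSpace ℝ (Fin 2) × ℝ)
        (extChartAt ((𝓡∂ 2).prod 𝓘(ℝ, ℝ)) z₀) z) =
        (frameCoord E₁ E₂ Y (Φ z)).comp (sheetDeriv Φ z) := by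
      have h4 := frameCoordIn_comp (E₁ := E₁) (E₂ := E₂) (Y := Y) hz2
      refine ContinuousLinearMap.ext fun v => ?_
      have h5 := congrArg (fun T => T v) h2
      have h6 := congrArg (fun T => T (sheetDeriv Φ z v)) h4
      refine Eq.trans ?_ h6
      change frameCoordIn E₁ E₂ Y (Φ z₀) (Φ z) (P z _) = _
      rw [h1]
      refine congrArg (fun u => frameCoordIn E₁ E₂ Y (Φ z₀) (Φ z) (mfderiv (𝓡 3)
        𝓘(ℝ, EuclideanSpace ℝ (Fin 3)) (extChartAt (𝓡 3) (Φ z₀)) (Φ z) (sheetDeriv Φ z u))) h5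
    rw [← h3, sheetDeriv_extChartAt hz1, jac_comp_prodMap]
    rfl
  have h0 : jac (Q z₀) = jac ((frameCoord E₁ E₂ Y (Φ z₀)).comp (sheetDeriv Φ z₀)) := by
    have := key.self_of_nhds
    rw [mdet_extChartAt_self, one_mul] at this
    exact this.symm
  have hs0 := h.sheetSign_ne_zero
  have hQ0 : jac (Q z₀) ≠ 0 := by
    rw [h0]
    exact sign_ne_zero.1 hs0
  have hJ : ContinuousAt (fun z => jac (Q z)) z₀ := continuous_jac.continuousAt.comp hQ
  have hsgn : ∀ᶠ z in 𝓝 z₀, SignType.sign (jac (Q z)) = sheetSign E₁ E₂ Y Φ z₀ := by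
    rw [sheetSign, ← h0]
    rcases lt_or_gt_of_ne hQ0 with h1 | h1
    · filter_upwards [hJ.eventually (gt_mem_nhds h1)] with q hq
      rw [sign_neg h1, sign_neg hq]
    · filter_upwards [hJ.eventually (lt_mem_nhds h1)] with q hq
      rw [sign_pos h1, sign_pos hq]
  filter_upwards [key, hsgn] with z hz hz'
  have h1 : sheetSign E₁ E₂ Y Φ z = SignType.sign (mdet (𝓡∂ 2) (extChartAt (𝓡∂ 2) z₀.1) z.1) *
      sheetSign E₁ E₂ Y Φ z₀ := by
    rw [← hz', ← sign_mul, ← hz]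
    rfl
  rw [h1]
  revert hs0
  generalize sheetSign E₁ E₂ Y Φ z₀ = s
  generalize SignType.sign (mdet (𝓡∂ 2) (extChartAt (𝓡∂ 2) z₀.1) z.1) = t
  revert s t
  decide

theorem isOrientationSign_sheetSign {c : ℝ} (h : ∀ x, IsC1SheetAt E₁ E₂ Y Φ (x, c)) :
    IsOrientationSign (𝓡∂ 2) (fun x => sheetSign E₁ E₂ Y Φ (x, c)) univ where
  ne_zero x _ := (h x).sheetSign_ne_zero
  eventually_eq x₀ _ := by
    have hc : ContinuousAt (fun x : S => (x, c)) x₀ := by fun_prop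
    exact (hc.eventually (h x₀).eventually_sign).mono fun x hx _ => hx

/-- The preferred chart of `S` at `x` is the same for every `c`, so the sign is locally constant in
`c`. -/
theorem sheetSign_eq_of_mem {x : S} {J : Set ℝ} (hJ : IsPreconnected J)
    (h : ∀ c ∈ J, IsC1SheetAt E₁ E₂ Y Φ (x, c)) {c c' : ℝ} (hc : c ∈ J) (hc' : c' ∈ J) :
    sheetSign E₁ E₂ Y Φ (x, c) = sheetSign E₁ E₂ Y Φ (x, c') := by
  refine hJ.constant (f := fun c => sheetSign E₁ E₂ Y Φ (x, c)) (fun c hc => ?_) hc hc'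
  have hf : ContinuousAt (fun c : ℝ => (x, c)) c := by fun_prop
  have h1 := hf.eventually (h c hc).eventually_sign
  have h2 := (h c hc).sheetSign_ne_zero
  refine ContinuousAt.continuousWithinAt (continuousAt_const (y := sheetSign E₁ E₂ Y Φ (x, c)) |>.congr ?_)
  filter_upwards [h1] with c' hc'
  rw [mdet_extChartAt_self, sign_one] at hc'
  revert hc'
  generalize sheetSign E₁ E₂ Y Φ (x, c) = s
  generalize sheetSign E₁ E₂ Y Φ (x, c') = t
  revert s t
  decide

end Sheet
end

/-! ### Reduction of the count in `U` to a level surface; consequences of preparedness. -/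

noncomputable section

open MeasureTheory

/-- The first two coordinates of a vector of `ℝ³`. -/
def projTwo : EuclideanSpace ℝ (Fin 3) →L[ℝ] EuclideanSpace ℝ (Fin 2) :=
  (ContinuousLinearMap.fst ℝ (EuclideanSpace ℝ (Fin 2)) ℝ).comp
    (joinEquiv.symm : EuclideanSpace ℝ (Fin 3) →L[ℝ] EuclideanSpace ℝ (Fin 2) × ℝ)

theorem joinEquiv_projTwo (v : EuclideanSpace ℝ (Fin 3)) : joinEquiv (projTwo v, v 2) = v :=
  joinEquiv.apply_symm_apply v

theorem projTwo_joinEquiv (a : EuclideanSpace ℝ (Fin 2)) (c : ℝ) :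
    projTwo (joinEquiv (a, c)) = a :=
  congrArg Prod.fst (joinEquiv.symm_apply_apply (a, c))

theorem projTwo_zero (v : EuclideanSpace ℝ (Fin 3)) : projTwo v 0 = v 0 := rfl

theorem projTwo_one (v : EuclideanSpace ℝ (Fin 3)) : projTwo v 1 = v 1 := rfl

theorem jac_eq_det {T : EuclideanSpace ℝ (Fin 2) × ℝ →L[ℝ] EuclideanSpace ℝ (Fin 3)}
    (hT : ∀ v, T v 2 = v.2) : jac T =
      ((projTwo.comp T).comp (ContinuousLinearMap.inl ℝ (EuclideanSpace ℝ (Fin 2)) ℝ)).det := by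
  rw [clm_det_two]
  change _ = projTwo (T (stdVec 0, 0)) 0 * projTwo (T (stdVec 1, 0)) 1 -
    projTwo (T (stdVec 1, 0)) 0 * projTwo (T (stdVec 0, 0)) 1
  simp only [projTwo_zero, projTwo_one]
  rw [jac, det3_eq, hT, hT, hT]
  ring

section Sheet

variable {M : Type*} [TopologicalSpace M] [ChartedSpace (EuclideanSpace ℝ (Fin 3)) M]
  [IsManifold (𝓡 3) ∞ M] [RiemannianBundle (fun p : M => TangentSpace (𝓡 3) p)]
  [IsContMDiffRiemannianBundle (𝓡 3) ∞ (EuclideanSpace ℝ (Fin 3))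
      (fun p : M => TangentSpace (𝓡 3) p)]
  {S : Type*} [TopologicalSpace S] [ChartedSpace (EuclideanHalfSpace 2) S]
  [IsManifold (𝓡∂ 2) ∞ S]
  {E₁ E₂ Y : ∀ p : M, TangentSpace (𝓡 3) p} {Φ : S × ℝ → M}

/-- In the coordinates `(x, c)` the differential of `F` is block triangular, since its third
component is the parameter; its determinant is therefore that of the planar map. The sign of the
Jacobian of `Φ` occurs once in `sheetSign` and once through the chain rule, and cancels. -/
theorem localSign_sheet {F : M → EuclideanSpace ℝ (Fin 3)} {x : S} {c : ℝ}
    (h : IsC1SheetAt E₁ E₂ Y Φ (x, c))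
    (hF : MDifferentiableAt (𝓡 3) 𝓘(ℝ, EuclideanSpace ℝ (Fin 3)) F (Φ (x, c)))
    (h2 : ∀ᶠ z in 𝓝 (x, c), F (Φ z) 2 = z.2) :
    localSign (𝓡∂ 2) (fun x => sheetSign E₁ E₂ Y Φ (x, c)) (fun x => projTwo (F (Φ (x, c)))) x =
      localSign (𝓡 3) (frameSign E₁ E₂ Y) F (Φ (x, c)) := by
  obtain ⟨D, hD⟩ : ∃ D : EuclideanSpace ℝ (Fin 3) →L[ℝ] EuclideanSpace ℝ (Fin 3),
    D = mfderiv (𝓡 3) 𝓘(ℝ, EuclideanSpace ℝ (Fin 3)) F (Φ (x, c)) := ⟨_, rfl⟩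
  let T : EuclideanSpace ℝ (Fin 2) × ℝ →L[ℝ] EuclideanSpace ℝ (Fin 3) :=
    D.comp (sheetDeriv Φ (x, c))
  have hT : HasMFDerivAt ((𝓡∂ 2).prod 𝓘(ℝ, ℝ)) 𝓘(ℝ, EuclideanSpace ℝ (Fin 3)) (fun z => F (Φ z))
      (x, c) T := by
    have h1 := hF.hasMFDerivAt
    rw [← hD] at h1
    exact h1.comp (x, c) (h.contMDiffAt.mdifferentiableAt one_ne_zero).hasMFDerivAt
  have hT2 : ∀ v, T v 2 = v.2 := by
    have h3 : HasMFDerivAt ((𝓡∂ 2).prod 𝓘(ℝ, ℝ)) 𝓘(ℝ, ℝ) (fun z => F (Φ z) 2) (x, c)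
        ((EuclideanSpace.proj (𝕜 := ℝ) (2 : Fin 3)).comp T) :=
      HasMFDerivAt.comp (x, c) (EuclideanSpace.proj (𝕜 := ℝ) (2 : Fin 3)).hasMFDerivAt hT
    have h4 : HasMFDerivAt ((𝓡∂ 2).prod 𝓘(ℝ, ℝ)) 𝓘(ℝ, ℝ) (fun z => F (Φ z) 2) (x, c)
        (ContinuousLinearMap.snd ℝ (EuclideanSpace ℝ (Fin 2)) ℝ) :=
      HasMFDerivAt.congr_of_eventuallyEq (hasMFDerivAt_snd (x, c)) h2
    exact fun v => congrArg (fun L : EuclideanSpace ℝ (Fin 2) × ℝ →L[ℝ] ℝ => L v)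
      (hasMFDerivAt_unique h3 h4)
  have hα : HasMFDerivAt (𝓡∂ 2) 𝓘(ℝ, EuclideanSpace ℝ (Fin 2)) (fun x => projTwo (F (Φ (x, c)))) x
      ((projTwo.comp T).comp (ContinuousLinearMap.inl ℝ (EuclideanSpace ℝ (Fin 2)) ℝ)) := by
    have h3 : HasMFDerivAt ((𝓡∂ 2).prod 𝓘(ℝ, ℝ)) 𝓘(ℝ, EuclideanSpace ℝ (Fin 2))
        (fun z => projTwo (F (Φ z))) (x, c) (projTwo.comp T) :=
      HasMFDerivAt.comp (x, c) projTwo.hasMFDerivAt hT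
    have h4 : HasMFDerivAt (𝓡∂ 2) ((𝓡∂ 2).prod 𝓘(ℝ, ℝ)) (fun x : S => (x, c)) x
        (ContinuousLinearMap.inl ℝ (EuclideanSpace ℝ (Fin 2)) ℝ) := by
      have h5 : MDifferentiableAt (𝓡∂ 2) ((𝓡∂ 2).prod 𝓘(ℝ, ℝ)) (fun x : S => (x, c)) x :=
        mdifferentiableAt_id.prodMk mdifferentiableAt_const
      have h6 := h5.hasMFDerivAt
      rw [mfderiv_prod_left] at h6
      exact h6
    exact HasMFDerivAt.comp (f := fun x : S => (x, c)) (g := fun z => projTwo (F (Φ z))) x h3 h4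
  have hdα : mdet (𝓡∂ 2) (fun x => projTwo (F (Φ (x, c)))) x = jac T := by
    rw [jac_eq_det hT2, mdet]
    exact congrArg ContinuousLinearMap.det hα.mfderiv
  have hdF : mdet (𝓡 3) F (Φ (x, c)) = D.det := by
    rw [hD]; rfl
  have hs : SignType.sign (jac (sheetDeriv Φ (x, c))) ≠ 0 := sign_ne_zero.2 h.jac_ne_zero
  rw [localSign, localSign, hdα, hdF, sheetSign_eq, jac_comp_left, sign_mul]
  congr 1
  revert hs
  generalize SignType.sign (jac (sheetDeriv Φ (x, c))) = s
  generalize frameSign E₁ E₂ Y (Φ (x, c)) = t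
  generalize SignType.sign D.det = u
  revert s t u
  decide

theorem degCount_sheet {F : M → EuclideanSpace ℝ (Fin 3)} {U : Set M} {c : ℝ}
    (h : ∀ x, IsC1SheetAt E₁ E₂ Y Φ (x, c))
    (hF : ∀ x, MDifferentiableAt (𝓡 3) 𝓘(ℝ, EuclideanSpace ℝ (Fin 3)) F (Φ (x, c)))
    (h2 : ∀ x, ∀ᶠ z in 𝓝 (x, c), F (Φ z) 2 = z.2) (hinj : ∀ x y, Φ (x, c) = Φ (y, c) → x = y)
    {a : EuclideanSpace ℝ (Fin 2)} (hU : ∀ x, F (Φ (x, c)) = joinEquiv (a, c) → Φ (x, c) ∈ U)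
    (hsurj : ∀ p ∈ U, F p = joinEquiv (a, c) → ∃ x, Φ (x, c) = p) :
    degCount (𝓡 3) (frameSign E₁ E₂ Y) U F (joinEquiv (a, c)) =
      degCount (𝓡∂ 2) (fun x => sheetSign E₁ E₂ Y Φ (x, c)) univ
        (fun x => projTwo (F (Φ (x, c)))) a := by
  have hiff : ∀ x, projTwo (F (Φ (x, c))) = a ↔ F (Φ (x, c)) = joinEquiv (a, c) := by
    intro x
    constructor
    · intro hx
      have h3 : F (Φ (x, c)) 2 = c := (h2 x).self_of_nhds
      rw [← joinEquiv_projTwo (F (Φ (x, c))), hx, h3]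
    · intro hx
      rw [hx, projTwo_joinEquiv]
  symm
  refine finsum_mem_eq_of_bijOn (fun x => Φ (x, c)) ⟨?_, ?_, ?_⟩ fun x _ =>
    localSign_sheet (h x) (hF x) (h2 x)
  · rintro x ⟨-, hx⟩
    exact ⟨hU x ((hiff x).1 hx), (hiff x).1 hx⟩
  · intro x _ y _ hxy
    exact hinj x y hxy
  · rintro p ⟨hp, hpa⟩
    obtain ⟨x, rfl⟩ := hsurj p hp hpa
    exact ⟨x, ⟨mem_univ _, (hiff x).2 hpa⟩, rfl⟩

variable {X : ∀ p : M, TangentSpace (𝓡 3) p} {U : Set M} {ε : ℝ} {r : ℕ∞}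
  {o : ∀ p : M, Orientation ℝ (TangentSpace (𝓡 3) p) (Fin 3)}

theorem IsPreparedTriple.contMDiffAt_injective (hp : IsPreparedTriple r U X Y ε Φ) (hr : 1 ≤ r) {x : S} {c : ℝ}
    (hc : c ∈ Ioo (-ε) ε) : ContMDiffAt ((𝓡∂ 2).prod 𝓘(ℝ, ℝ)) (𝓡 3) 1 Φ (x, c) ∧
      Function.Injective (sheetDeriv Φ (x, c)) := by
  have hn : (univ : Set S) ×ˢ Icc (-ε) ε ∈ 𝓝 (x, c) :=
    prod_mem_nhds univ_mem (Icc_mem_nhds hc.1 hc.2)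
  have h1 : ContMDiffAt ((𝓡∂ 2).prod 𝓘(ℝ, ℝ)) (𝓡 3) 1 Φ (x, c) :=
    (hp.contMDiffOn.of_le (by exact_mod_cast hr)).contMDiffAt hn
  refine ⟨h1, ?_⟩
  have h2 := hp.injective_mfderiv (x, c) ⟨mem_univ _, Ioo_subset_Icc_self hc⟩
  rw [mfderivWithin_of_mem_nhds hn] at h2
  exact h2

theorem IsPreparedTriple.mem_closure (hp : IsPreparedTriple r U X Y ε Φ) (x : S) {c : ℝ}
    (hc : c ∈ Icc (-ε) ε) : Φ (x, c) ∈ closure U :=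
  hp.image_eq ▸ mem_image_of_mem Φ (show (x, c) ∈ (univ : Set S) ×ˢ Icc (-ε) ε from ⟨mem_univ _, hc⟩)

theorem IsPreparedTriple.right_ne_zero_closure (hp : IsPreparedTriple r U X Y ε Φ) {p : M}
    (h : p ∈ closure U) : Y p ≠ 0 := by
  obtain ⟨v, -, hv⟩ := hp.not_orthogonal p h
  intro h0
  rw [h0, inner_zero_left] at hv
  exact hv rfl

theorem IsPreparedTriple.isC1At_left (hp : IsPreparedTriple r U X Y ε Φ) (hr : 1 ≤ r) (p : M) :
    IsC1At X p := (hp.contMDiff_left.of_le (by exact_mod_cast hr)).contMDiffAt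

theorem IsPreparedTriple.isC1At_right (hp : IsPreparedTriple r U X Y ε Φ) (hr : 1 ≤ r) (p : M) :
    IsC1At Y p := (hp.contMDiff_right.of_le (by exact_mod_cast hr)).contMDiffAt

/-- Differentiate `μ (Φ (x, c)) = c` with respect to `c`, within `[-ε, ε]` so as to include the
extreme levels. This shows that `dμ` does not vanish on the closure of `U`, and it provides a
transverse vector for orienting the levels. -/
theorem IsPreparedTriple.exists_dQuotient_eq_one (hp : IsPreparedTriple r U X Y ε Φ) (hr : 1 ≤ r)
    {x : S} {c : ℝ} (hc : c ∈ Icc (-ε) ε) :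
    dQuotient X Y (Φ (x, c)) (mfderivWithin ((𝓡∂ 2).prod 𝓘(ℝ, ℝ)) (𝓡 3) Φ (univ ×ˢ Icc (-ε) ε) (x, c)
      ((0, 1) : EuclideanSpace ℝ (Fin 2) × ℝ)) = 1 := by
  have hq := ((contMDiffAt_quotientFunction (hp.isC1At_left hr _) (hp.isC1At_right hr _)
    (hp.right_ne_zero_closure (hp.mem_closure x hc))).mdifferentiableAt one_ne_zero).hasMFDerivAt
  have hΦ := ((hp.contMDiffOn.of_le (n := r) (m := 1) (by exact_mod_cast hr)).mdifferentiableOn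
    one_ne_zero (x, c) ⟨mem_univ _, hc⟩).hasMFDerivWithinAt
  have hi : HasMFDerivAt 𝓘(ℝ, ℝ) ((𝓡∂ 2).prod 𝓘(ℝ, ℝ)) (fun c : ℝ => (x, c)) c
      (ContinuousLinearMap.inr ℝ (EuclideanSpace ℝ (Fin 2)) ℝ) := by
    have h5 : MDifferentiableAt 𝓘(ℝ, ℝ) ((𝓡∂ 2).prod 𝓘(ℝ, ℝ)) (fun c : ℝ => (x, c)) c :=
      mdifferentiableAt_const.prodMk mdifferentiableAt_id
    have h6 := h5.hasMFDerivAt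
    rw [mfderiv_prod_right] at h6
    exact h6
  have h1 := hq.comp_hasMFDerivWithinAt (x, c) hΦ
  have h2 := HasMFDerivWithinAt.comp c h1 (hi.hasMFDerivWithinAt (s := Icc (-ε) ε))
    (fun c' hc' => ⟨mem_univ _, hc'⟩)
  have h3 := hasMFDerivWithinAt_iff_hasFDerivWithinAt.1 h2
  obtain ⟨L, hL⟩ : ∃ L : ℝ →L[ℝ] ℝ, L = ((mfderiv (𝓡 3) 𝓘(ℝ, ℝ) (quotientFunction X Y)
    (Φ (x, c))).comp (mfderivWithin ((𝓡∂ 2).prod 𝓘(ℝ, ℝ)) (𝓡 3) Φ (univ ×ˢ Icc (-ε) ε) (x, c))).comp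
      (ContinuousLinearMap.inr ℝ (EuclideanSpace ℝ (Fin 2)) ℝ) := ⟨_, rfl⟩
  have h4 : HasFDerivWithinAt (fun c : ℝ => c) L (Icc (-ε) ε) c := by
    rw [hL]
    exact h3.congr (fun c' hc' => (hp.quotientFunction_eq x c' hc').symm)
      (hp.quotientFunction_eq x c hc).symm
  have hU : UniqueDiffWithinAt ℝ (Icc (-ε) ε) c :=
    uniqueDiffOn_Icc (by linarith [hp.eps_pos]) c hc
  have h5 := hU.eq h4 (hasFDerivWithinAt_id c _)
  have h6 : L 1 = 1 := by rw [h5]; rfl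
  rw [hL] at h6
  exact h6

/-- Test the boundary orientation on the outward vector `-stdVec 0` and the transverse vector
`∂Φ/∂c`, on which `dμ` is `1`. Together with the velocity `v` they form a positive triple, as `(e₁,
e₂, Y)` does. In frame coordinates this says that `v 1 * jac` is negative. -/
theorem IsBoundaryParametrization.isOrientedBoundary (hp : IsPreparedTriple r U X Y ε Φ) (hr : 1 ≤ r)
    {e₁ e₂ : ∀ p : M, TangentSpace (𝓡 3) p} (he : IsAdaptedFrame o U X Y e₁ e₂)
    (hfr : ∀ p ∈ closure U, 0 < det3 (frameCoord E₁ E₂ Y p (e₁ p)) (frameCoord E₁ E₂ Y p (e₂ p))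
          (frameCoord E₁ E₂ Y p (Y p)))
    {k : ℕ} {γ : Fin k → ℝ → S} (hγ : IsBoundaryParametrization o X Y Φ γ) :
    IsOrientedBoundary (fun x => sheetSign E₁ E₂ Y Φ (x, 0)) γ where
  curve i := ⟨hγ.contMDiff i, fun t => hγ.iUnion_range ▸ mem_iUnion.2 ⟨i, t, rfl⟩⟩
  periodic := hγ.periodic
  injOn := hγ.injOn
  disjoint := hγ.disjoint
  iUnion_range := hγ.iUnion_range
  sign_velocity i t := by
    have h0 : (0 : ℝ) ∈ Ioo (-ε) ε := ⟨by linarith [hp.eps_pos], hp.eps_pos⟩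
    obtain ⟨hΦ, -⟩ := hp.contMDiffAt_injective hr (x := γ i t) h0
    have hn : (univ : Set S) ×ˢ Icc (-ε) ε ∈ 𝓝 (γ i t, (0 : ℝ)) :=
      prod_mem_nhds univ_mem (Icc_mem_nhds h0.1 h0.2)
    have hone := hp.exists_dQuotient_eq_one hr (x := γ i t) (Ioo_subset_Icc_self h0)
    rw [mfderivWithin_of_mem_nhds hn] at hone
    have hpos := hγ.positive i t
    obtain ⟨v, hv⟩ : ∃ v : EuclideanSpace ℝ (Fin 2),
      v = mfderiv 𝓘(ℝ, ℝ) (𝓡∂ 2) (γ i) t (1 : ℝ) := ⟨_, rfl⟩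
    have hD : ∀ w : EuclideanSpace ℝ (Fin 2), mfderiv (𝓡∂ 2) (𝓡 3) (fun x => Φ (x, 0)) (γ i t) w =
        sheetDeriv Φ (γ i t, 0) (w, 0) := by
      intro w
      have h5 : MDifferentiableAt (𝓡∂ 2) ((𝓡∂ 2).prod 𝓘(ℝ, ℝ)) (fun x : S => (x, (0 : ℝ))) (γ i t) :=
        mdifferentiableAt_id.prodMk mdifferentiableAt_const
      have h6 := h5.hasMFDerivAt
      rw [mfderiv_prod_left] at h6
      have h7 := HasMFDerivAt.comp (γ i t) (hΦ.mdifferentiableAt one_ne_zero).hasMFDerivAt h6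
      exact congrArg (fun L : EuclideanSpace ℝ (Fin 2) →L[ℝ] EuclideanSpace ℝ (Fin 3) => L w) h7.mfderiv
    have h1 := (hpos (-stdVec 0 : EuclideanSpace ℝ (Fin 2)) (by simp [IsOutward, stdVec])).2.2 _
      (hone.symm ▸ one_pos)
    rw [← hv] at h1 ⊢
    have hcl := hp.mem_closure (γ i t) (Ioo_subset_Icc_self h0)
    obtain ⟨c, hc, h2⟩ := IsPositive.det3_mul (he.positive _ hcl) h1 (frameCoord E₁ E₂ Y (Φ (γ i t, 0)))
    have h3 := mul_pos hc (hfr _ hcl)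
    have h4 := h3.trans_eq h2.symm
    have hT : 0 < det3
        ((frameCoord E₁ E₂ Y (Φ (γ i t, 0))).comp (sheetDeriv Φ (γ i t, 0)) (-stdVec 0, 0))
        ((frameCoord E₁ E₂ Y (Φ (γ i t, 0))).comp (sheetDeriv Φ (γ i t, 0)) (v, 0))
        ((frameCoord E₁ E₂ Y (Φ (γ i t, 0))).comp (sheetDeriv Φ (γ i t, 0)) (0, 1)) := by
      have e1 := hD (-stdVec 0)
      have e2 := hD v
      simp only [ContinuousLinearMap.comp_apply]
      rw [← e1, ← e2]
      exact h4
    change SignType.sign (v 1) = -sheetSign E₁ E₂ Y Φ (γ i t, 0)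
    rw [sheetSign]
    generalize (frameCoord E₁ E₂ Y (Φ (γ i t, 0))).comp (sheetDeriv Φ (γ i t, 0)) = T at hT ⊢
    have e1 : T (-stdVec 0, 0) = -T (stdVec 0, 0) := by
      rw [← map_neg]; simp
    have e2 : T (v, 0) = v 0 • T (stdVec 0, 0) + v 1 • T (stdVec 1, 0) := by
      rw [← map_smul, ← map_smul, ← map_add]
      congr 1
      refine Prod.ext ?_ (by simp)
      ext j
      fin_cases j <;> simp [stdVec]
    have e3 : det3 (T (-stdVec 0, 0)) (T (v, 0)) (T (0, 1)) = -(v 1 * jac T) := by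
      rw [e1, e2, jac]
      simp only [det3_eq, PiLp.add_apply, PiLp.smul_apply, PiLp.neg_apply, smul_eq_mul]
      ring
    rw [e3] at hT
    have h5 : SignType.sign (v 1) * SignType.sign (jac T) = -1 := by
      rw [← sign_mul]
      exact sign_neg (by linarith)
    revert h5
    generalize SignType.sign (v 1) = s
    generalize SignType.sign (jac T) = t
    revert s t
    decide

end Sheet
end

/-! ### Uniqueness of circle degrees, angular integrals, generic horizontal planes. -/

noncomputable section

open MeasureTheory

/-- Two determinations of the angle differ by a continuous function with values in `2πℤ`, hence by a
constant. -/
theorem HasCircleDegree.unique {f : ℝ → ℂ} {m n : ℤ} (hm : HasCircleDegree f m)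
    (hn : HasCircleDegree f n) : m = n := by
  obtain ⟨θ, hθ, hfθ, hθ1⟩ := hm
  obtain ⟨η, hη, hfη, hη1⟩ := hn
  have hpi : (2 * Real.pi : ℝ) ≠ 0 := by positivity
  have h : ∀ t, ∃ k : ℤ, (k : ℝ) = (θ t - η t) / (2 * Real.pi) := by
    intro t
    obtain ⟨k, hk⟩ := Complex.exp_eq_exp_iff_exists_int.1 ((hfθ t).symm.trans (hfη t))
    refine ⟨k, ?_⟩
    have h1 : ((θ t : ℂ)) = η t + k * (2 * Real.pi) := by
      have h2 : (θ t : ℂ) * Complex.I = (η t + k * (2 * Real.pi)) * Complex.I := by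
        rw [hk]; ring
      exact mul_right_cancel₀ Complex.I_ne_zero h2
    have h2 : θ t = η t + k * (2 * Real.pi) := by exact_mod_cast h1
    rw [h2, add_sub_cancel_left, mul_div_assoc, div_self hpi, mul_one]
  choose k hk using h
  have hkc : Continuous k := by
    rw [Int.isClosedEmbedding_coe_real.isEmbedding.continuous_iff]
    have : (fun k : ℤ => (k : ℝ)) ∘ k = fun t => (θ t - η t) / (2 * Real.pi) := funext hk
    rw [this]
    fun_prop
  have h01 : k 1 = k 0 := PreconnectedSpace.constant inferInstance hkc
  have h2 := hk 1
  have h3 := hk 0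
  have h4 := hθ1 0
  have h5 := hη1 0
  rw [zero_add] at h4 h5
  rw [h01, h3, h4, h5, div_left_inj' hpi] at h2
  have h6 : 2 * Real.pi * (m : ℝ) = 2 * Real.pi * n := by linarith
  exact_mod_cast mul_left_cancel₀ hpi h6

/-- The plane as the complex line. -/
def toComplex : EuclideanSpace ℝ (Fin 2) →L[ℝ] ℂ :=
  LinearMap.toContinuousLinearMap
    { toFun := fun p => ⟨p 0, p 1⟩
      map_add' := fun p q => by apply Complex.ext <;> simp
      map_smul' := fun c p => by apply Complex.ext <;> simp }

theorem toComplex_re (p : EuclideanSpace ℝ (Fin 2)) : (toComplex p).re = p 0 := rfl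

theorem toComplex_im (p : EuclideanSpace ℝ (Fin 2)) : (toComplex p).im = p 1 := rfl

theorem angularForm_eq (p w : EuclideanSpace ℝ (Fin 2)) :
    angularForm p w = (toComplex w / toComplex p).im := by
  rw [angularForm, Complex.div_im, toComplex_re, toComplex_re, toComplex_im, toComplex_im,
    EuclideanSpace.norm_sq_eq, Fin.sum_univ_two, Complex.normSq_apply, toComplex_re, toComplex_im]
  simp only [Real.norm_eq_abs, sq_abs]
  rw [← sub_div]
  congr 1 <;> ring

/-- The angular integral of `β` gives the degree of its direction, and `h` stays at an acute angle
with `β`. -/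
theorem exists_hasCircleDegree_of_plane {β : ℝ → EuclideanSpace ℝ (Fin 2)} (hβ : ContDiff ℝ 1 β)
    (hβp : Function.Periodic β 1) {h : ℝ → ℂ} (hp : Function.Periodic h 1) (hc : Continuous h)
    (h1 : ∀ t, ‖h t‖ = 1) (hh : ∀ t, 0 < (h t * (starRingEnd ℂ) (toComplex (β t))).re) :
    ∃ n : ℤ, HasCircleDegree h n ∧
      ∫ t in (0 : ℝ)..1, angularForm (β t) (deriv β t) = 2 * Real.pi * n := by
  let b : ℝ → ℂ := fun t => toComplex (β t)
  have hb : ContDiff ℝ 1 b := toComplex.contDiff.comp hβ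
  have hb0 : ∀ t, b t ≠ 0 := by
    intro t h0
    have := hh t
    rw [show toComplex (β t) = 0 from h0, map_zero, mul_zero] at this
    exact lt_irrefl _ this
  have hbp : Function.Periodic b 1 := fun t => congrArg toComplex (hβp t)
  obtain ⟨n, hn, hi⟩ := exists_hasCircleDegree hb hb0 hbp
  refine ⟨n, hn.congr (fun t => by simp only [hbp t]) hp hc h1 fun t => ?_, ?_⟩
  · have h2 : h t * (starRingEnd ℂ) (b t / ‖b t‖) =
        ((‖b t‖⁻¹ : ℝ) : ℂ) * (h t * (starRingEnd ℂ) (b t)) := by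
      rw [map_div₀, Complex.conj_ofReal, Complex.ofReal_inv]
      ring
    rw [h2, Complex.re_ofReal_mul]
    exact mul_pos (inv_pos.2 (norm_pos_iff.2 (hb0 t))) (hh t)
  · rw [← hi]
    refine intervalIntegral.integral_congr fun t _ => ?_
    have h2 : deriv b t = toComplex (deriv β t) :=
      (toComplex.hasFDerivAt.comp_hasDerivAt t (hβ.differentiable one_ne_zero t).hasDerivAt).deriv
    change _ = (deriv b t / b t).im
    rw [h2, angularForm_eq]

/-- A property of almost every point of `ℝ³` holds at almost every point of almost every
horizontal plane. -/
theorem ae_ae_joinEquiv {P : EuclideanSpace ℝ (Fin 3) → Prop} (h : ∀ᵐ a, P a) :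
    ∀ᵐ c : ℝ, ∀ᵐ a : EuclideanSpace ℝ (Fin 2), P (joinEquiv (a, c)) := by
  let L : (ℝ × EuclideanSpace ℝ (Fin 2)) ≃L[ℝ] EuclideanSpace ℝ (Fin 3) :=
    (ContinuousLinearEquiv.prodComm ℝ ℝ (EuclideanSpace ℝ (Fin 2))).trans joinEquiv
  let ν : Measure (EuclideanSpace ℝ (Fin 3)) := Measure.map L (volume.prod volume)
  haveI : ν.IsAddHaarMeasure := L.isAddHaarMeasure_map _
  have h1 : ∀ᵐ a ∂ν, P a := (Measure.absolutelyContinuous_isAddHaarMeasure ν volume).ae_le h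
  have h2 := ae_of_ae_map L.continuous.aemeasurable h1
  exact Measure.ae_ae_of_ae_prod h2

/-- `P` is generic in `ℝ³`, while `Q` is generic in each horizontal plane near the origin and is not
known to be measurable. Fubini is therefore applied to `P` alone, and the two properties are
compared within one plane. -/
theorem exists_small_of_ae_joinEquiv {P Q : EuclideanSpace ℝ (Fin 3) → Prop} (hP : ∀ᵐ a, P a)
    {δ₀ : ℝ} (hδ₀ : 0 < δ₀) (hQ : ∀ c : ℝ, |c| < δ₀ → ∀ᵐ a : EuclideanSpace ℝ (Fin 2), ‖a‖ < δ₀ →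
      Q (joinEquiv (a, c))) {δ : ℝ} (hδ : 0 < δ) : ∃ a, ‖a‖ < δ ∧ P a ∧ Q a := by
  have hn : ∀ᶠ z in 𝓝 (0 : EuclideanSpace ℝ (Fin 2) × ℝ), ‖joinEquiv z‖ < δ := by
    have h1 : ContinuousAt (fun z => ‖joinEquiv z‖) (0 : EuclideanSpace ℝ (Fin 2) × ℝ) :=
      joinEquiv.continuous.norm.continuousAt
    exact h1.eventually_lt_const (by simpa using hδ)
  obtain ⟨δ₁, hδ₁, h1⟩ := Metric.eventually_nhds_iff.1 hn
  let ρ := min δ₀ δ₁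
  have hρ : 0 < ρ := lt_min hδ₀ hδ₁
  have hc : ∃ᶠ c : ℝ in ae volume, c ∈ Metric.ball (0 : ℝ) ρ :=
    frequently_ae_mem_iff.2 (Metric.measure_ball_pos volume 0 hρ).ne'
  obtain ⟨c, hc, hcP⟩ := (hc.and_eventually (ae_ae_joinEquiv hP)).exists
  have hc' : |c| < ρ := by simpa using hc
  have ha : ∃ᶠ a : EuclideanSpace ℝ (Fin 2) in ae volume, a ∈ Metric.ball (0 : EuclideanSpace ℝ (Fin 2)) ρ :=
    frequently_ae_mem_iff.2 (Metric.measure_ball_pos volume 0 hρ).ne'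
  obtain ⟨a, ha, haP, haQ⟩ :=
    (ha.and_eventually (hcP.and (hQ c (hc'.trans_le (min_le_left _ _))))).exists
  have ha' : ‖a‖ < ρ := by simpa using ha
  refine ⟨joinEquiv (a, c), h1 ?_, haP, haQ (ha'.trans_le (min_le_left _ _))⟩
  rw [dist_zero_right, Prod.norm_def, max_lt_iff]
  exact ⟨ha'.trans_le (min_le_right _ _), hc'.trans_le (min_le_right _ _)⟩
end

/-! ### Linking numbers and the signed count in `U`. -/

noncomputable section

open MeasureTheory

section Linking

variable {M : Type*} [TopologicalSpace M] [ChartedSpace (EuclideanSpace ℝ (Fin 3)) M]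
  [IsManifold (𝓡 3) ∞ M] [RiemannianBundle (fun p : M => TangentSpace (𝓡 3) p)]
  [IsContMDiffRiemannianBundle (𝓡 3) ∞ (EuclideanSpace ℝ (Fin 3))
      (fun p : M => TangentSpace (𝓡 3) p)]
  {X Y E₁ E₂ e₁ e₂ : ∀ p : M, TangentSpace (𝓡 3) p} {U : Set M}
  {o : ∀ p : M, Orientation ℝ (TangentSpace (𝓡 3) p) (Fin 3)}

theorem IsC1FrameAt.eq_zero {p : M} (h : IsC1FrameAt E₁ E₂ Y p) {v : TangentSpace (𝓡 3) p}
    (hv : frameCoord E₁ E₂ Y p v = 0) : v = 0 := by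
  let e := (frameCoord E₁ E₂ Y p).toContinuousLinearEquivOfDetNeZero h.det_ne_zero
  exact e.map_eq_zero_iff.1 hv

theorem IsC1FrameAt.contMDiffAt {p : M} (h : IsC1FrameAt E₁ E₂ Y p) (hX : IsC1At X p) :
    ContMDiffAt (𝓡 3) 𝓘(ℝ, EuclideanSpace ℝ (Fin 3)) 1 (fun p => frameCoord E₁ E₂ Y p (X p)) p :=
  contMDiffAt_frameCoord h.fst h.snd h.thd h.thd_ne_zero hX

/-- A field without zeros on a compact set has coordinates bounded away from zero. -/
theorem exists_le_norm_frameCoord {K : Set M} (hK : IsCompact K) (hfr : ∀ p ∈ K, IsC1FrameAt E₁ E₂ Y p)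
    (hX : ∀ p, IsC1At X p) (h0 : ∀ p ∈ K, X p ≠ 0) :
    ∃ m > 0, ∀ p ∈ K, m ≤ ‖frameCoord E₁ E₂ Y p (X p)‖ := by
  refine hK.exists_forall_le' (f := fun p => ‖frameCoord E₁ E₂ Y p (X p)‖) (fun p hp => ?_)
    fun p hp => norm_pos_iff.2 fun h => h0 p hp ((hfr p hp).eq_zero h)
  exact ((hfr p hp).contMDiffAt (hX p)).continuousAt.norm.continuousWithinAt

theorem IsAdaptedFrame.continuousOn_normalCoord (h : IsAdaptedFrame o U X Y e₁ e₂)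
    (hX : ∀ p, IsC1At X p) : ContinuousOn (normalCoord X Y e₁ e₂) (closure U) := by
  have hXc : ContinuousOn (fun p => (⟨p, X p⟩ : TangentBundle (𝓡 3) M)) (closure U) :=
    fun p _ => (hX p).continuousAt.continuousWithinAt
  have h1 := (continuousOn_inner hXc h.continuousOn_fst).div
    (continuousOn_inner h.continuousOn_fst h.continuousOn_fst)
    fun p hp => inner_self_ne_zero (𝕜 := ℝ).2 (h.fst_ne_zero hp)
  have h2 := (continuousOn_inner hXc h.continuousOn_snd).div
    (continuousOn_inner h.continuousOn_snd h.continuousOn_snd)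
    fun p hp => inner_self_ne_zero (𝕜 := ℝ).2 (h.snd_ne_zero hp)
  refine (Complex.equivRealProdCLM.symm.continuous.comp_continuousOn (h1.prodMk h2)).congr
    fun p hp => ?_
  apply Complex.ext
  · simp only [normalCoord, h.inner_normalComponent_fst hp]
    rfl
  · simp only [normalCoord, h.inner_normalComponent_snd hp]
    rfl

variable {S : Type*} [TopologicalSpace S] [ChartedSpace (EuclideanHalfSpace 2) S]
  [IsManifold (𝓡∂ 2) ∞ S] {Φ : S × ℝ → M} {ε : ℝ} {r : ℕ∞}

/-- On the zero level the normal component is `X` itself, and a zero of `X` on the boundary would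
belong to `K_0`. -/
theorem IsPreparedTriple.normalCoord_ne_zero (hp : IsPreparedTriple r U X Y ε Φ)
    (h : IsAdaptedFrame o U X Y e₁ e₂) {x : S} (hx : x ∈ (𝓡∂ 2).boundary S) :
    normalCoord X Y e₁ e₂ (Φ (x, 0)) ≠ 0 := by
  have h0 : (0 : ℝ) ∈ Icc (-ε) ε := ⟨by linarith [hp.eps_pos], hp.eps_pos.le⟩
  have hcl := hp.mem_closure x h0
  intro hn
  have h1 := h.normalComponent_eq_zero hcl hn
  rw [normalComponent, hp.quotientFunction_eq x 0 h0] at h1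
  exact hp.boundary_disjoint 0 h0 x hx ⟨hcl, h1⟩

theorem re_mul_conj_pos {w v : ℂ} {m : ℝ} (hm : 0 < m) (hw : m ≤ ‖w‖) (h1 : |v.re - w.re| < m / 4)
    (h2 : |v.im - w.im| < m / 4) : 0 < (w * (starRingEnd ℂ) v).re := by
  have h3 : ‖v - w‖ ≤ m / 2 := by
    refine (Complex.norm_le_abs_re_add_abs_im _).trans ?_
    rw [Complex.sub_re, Complex.sub_im]
    linarith
  have h4 : w * (starRingEnd ℂ) v = w * (starRingEnd ℂ) w + w * (starRingEnd ℂ) (v - w) := by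
    rw [map_sub]; ring
  have h5 : ‖w * (starRingEnd ℂ) (v - w)‖ ≤ ‖w‖ * (m / 2) := by
    rw [norm_mul, Complex.norm_conj]
    gcongr
  have h6 := (abs_le.1 ((Complex.abs_re_le_norm _).trans h5)).1
  have h7 : (w * (starRingEnd ℂ) w).re = ‖w‖ * ‖w‖ := by
    rw [Complex.mul_conj, Complex.ofReal_re, Complex.normSq_eq_norm_sq, sq]
  rw [h4, Complex.add_re, h7]
  nlinarith

variable [T2Space M] [SecondCountableTopology M] [T2Space S] [CompactSpace S]

/-- Along the boundary of `S × {0}` the normal coordinates are bounded below by some `m`. With a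
frame precise to within `m / 4`, and `a`, `c` small, the first two coordinates of `X`, shifted by
`a`, stay at an acute angle with them, so every boundary integral is `2π` times the same integer.
The argument principle on `S × {c}` then evaluates the count in `U`. -/
theorem exists_isLinkingNumber (hp : IsPreparedTriple r U X Y ε Φ) (hr : 1 ≤ r)
    (he : IsAdaptedFrame o U X Y e₁ e₂) {k : ℕ} {γ : Fin k → ℝ → S}
    (hγ : IsBoundaryParametrization o X Y Φ γ) :
    ∃ E₁ E₂ : ∀ p : M, TangentSpace (𝓡 3) p, (∀ p, IsC1At E₁ p) ∧ (∀ p, IsC1At E₂ p) ∧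
      (∀ p ∈ closure U, IsC1FrameAt E₁ E₂ Y p) ∧
      ∃ l : Fin k → ℤ, (∀ i, IsLinkingNumber X Y e₁ e₂ Φ (γ i) (l i)) ∧
      ∃ δ > 0, ∀ c : ℝ, |c| < δ → ∀ᵐ a : EuclideanSpace ℝ (Fin 2), ‖a‖ < δ →
        degCount (𝓡 3) (frameSign E₁ E₂ Y) U (fun p => frameCoord E₁ E₂ Y p (X p))
          (joinEquiv (a, c)) = ∑ i, l i := by
  have hX := hp.isC1At_left hr
  have hY := hp.isC1At_right hr
  have h0 : (0 : ℝ) ∈ Ioo (-ε) ε := ⟨by linarith [hp.eps_pos], hp.eps_pos⟩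
  have h0' := Ioo_subset_Icc_self h0
  have hΦ : ∀ x : S, ∀ c ∈ Ioo (-ε) ε, ContMDiffAt ((𝓡∂ 2).prod 𝓘(ℝ, ℝ)) (𝓡 3) 1 Φ (x, c) :=
    fun x c hc => (hp.contMDiffAt_injective hr hc).1
  let w : S → ℂ := fun x => normalCoord X Y e₁ e₂ (Φ (x, 0))
  have hw : Continuous w := by
    refine (he.continuousOn_normalCoord hX).comp_continuous ?_ fun x => hp.mem_closure x h0'
    refine continuous_iff_continuousAt.2 fun x => ?_
    exact ContinuousAt.comp (f := fun x : S => (x, (0 : ℝ))) (hΦ x 0 h0).continuousAt (by fun_prop)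
  have hbd : IsCompact ((𝓡∂ 2).boundary S) :=
    ((𝓡∂ 2).isClosed_boundary (M := S) (n := ∞) (by simp)).isCompact
  obtain ⟨m, hm, hwm⟩ := hbd.exists_forall_le' (f := fun x => ‖w x‖) hw.norm.continuousOn
    (a := 0) fun x hx => norm_pos_iff.2 (hp.normalCoord_ne_zero he hx)
  obtain ⟨E₁, E₂, hE₁, hE₂, hE⟩ := exists_isC1FrameAt hY hX he (m := m / 4) (by linarith)
  have hfr : ∀ p ∈ closure U, IsC1FrameAt E₁ E₂ Y p := fun p hp => (hE p hp).1
  let F : M → EuclideanSpace ℝ (Fin 3) := fun p => frameCoord E₁ E₂ Y p (X p)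
  have hF : ∀ p ∈ closure U, ContMDiffAt (𝓡 3) 𝓘(ℝ, EuclideanSpace ℝ (Fin 3)) 1 F p :=
    fun p hp => (hfr p hp).contMDiffAt (hX p)
  -- The third frame coordinate of `X` is the quotient function by definition.
  have hF2 : ∀ x : S, ∀ c ∈ Icc (-ε) ε, F (Φ (x, c)) 2 = c := fun x c hc =>
    hp.quotientFunction_eq x c hc
  have hF2' : ∀ x : S, ∀ c ∈ Ioo (-ε) ε, ∀ᶠ z in 𝓝 (x, c), F (Φ z) 2 = z.2 := by
    intro x c hc
    filter_upwards [continuous_snd.continuousAt.preimage_mem_nhds (Icc_mem_nhds hc.1 hc.2)] with z hz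
    exact hF2 z.1 z.2 hz
  have hsh : ∀ x : S, ∀ c ∈ Ioo (-ε) ε, IsC1SheetAt E₁ E₂ Y Φ (x, c) := fun x c hc =>
    ⟨hΦ x c hc, (hp.contMDiffAt_injective hr hc).2, hfr _ (hp.mem_closure x (Ioo_subset_Icc_self hc))⟩
  have hFΦ : ∀ x : S, ∀ c ∈ Ioo (-ε) ε, ContMDiffAt ((𝓡∂ 2).prod 𝓘(ℝ, ℝ))
      𝓘(ℝ, EuclideanSpace ℝ (Fin 2)) 1 (fun z => projTwo (F (Φ z))) (x, c) := by
    intro x c hc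
    have h1 := ContMDiffAt.comp (x, c) (hF _ (hp.mem_closure x (Ioo_subset_Icc_self hc))) (hΦ x c hc)
    exact (projTwo.contMDiff.contMDiffAt).comp (x, c) h1
  have hα : ∀ c ∈ Ioo (-ε) ε, ContMDiff (𝓡∂ 2) 𝓘(ℝ, EuclideanSpace ℝ (Fin 2)) 1
      fun x => projTwo (F (Φ (x, c))) := by
    intro c hc x
    exact ContMDiffAt.comp (f := fun x : S => (x, c)) x (hFΦ x c hc)
      (contMDiffAt_id.prodMk contMDiffAt_const)
  have hob := IsBoundaryParametrization.isOrientedBoundary hp hr he (fun p hp => (hE p hp).2.1) hγ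
  -- the comparison with the Gauss map along the boundary
  have hsmall : ∀ᶠ z in 𝓝 (0 : EuclideanSpace ℝ (Fin 2) × ℝ), ∀ x ∈ (𝓡∂ 2).boundary S,
      0 < (w x * (starRingEnd ℂ) (toComplex (projTwo (F (Φ (x, z.2))) - z.1))).re := by
    refine hbd.eventually_forall_of_forall_eventually fun x hx => ?_
    have hc1 : ContinuousAt (fun q : (EuclideanSpace ℝ (Fin 2) × ℝ) × S =>
        projTwo (F (Φ (q.2, q.1.2)))) (0, x) :=
      ContinuousAt.comp (f := fun q : (EuclideanSpace ℝ (Fin 2) × ℝ) × S => (q.2, q.1.2))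
        (g := fun z => projTwo (F (Φ z))) (hFΦ x 0 h0).continuousAt (by fun_prop)
    have hc2 : ContinuousAt (fun q : (EuclideanSpace ℝ (Fin 2) × ℝ) × S => (w q.2 * (starRingEnd ℂ)
        (toComplex (projTwo (F (Φ (q.2, q.1.2))) - q.1.1))).re) (0, x) := by
      have h1 : ContinuousAt (fun q : (EuclideanSpace ℝ (Fin 2) × ℝ) × S => w q.2) (0, x) :=
        (hw.comp continuous_snd).continuousAt
      have h2 : ContinuousAt (fun q : (EuclideanSpace ℝ (Fin 2) × ℝ) × S => q.1.1) (0, x) := by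
        fun_prop
      exact Complex.continuous_re.continuousAt.comp (h1.mul (Complex.continuous_conj.continuousAt.comp
        (toComplex.continuous.continuousAt.comp (hc1.sub h2))))
    refine hc2.eventually_const_lt ?_
    have hcl := hE _ (hp.mem_closure x h0')
    change 0 < (w x * (starRingEnd ℂ) (toComplex (projTwo (F (Φ (x, 0))) - 0))).re
    rw [sub_zero]
    exact re_mul_conj_pos hm (hwm x hx) hcl.2.2.1 hcl.2.2.2
  have hcurve : ∀ i t, γ i t ∈ (𝓡∂ 2).boundary S := fun i t => (hob.curve i).mem_boundary t
  have key : ∀ z : EuclideanSpace ℝ (Fin 2) × ℝ, z.2 ∈ Ioo (-ε) ε → (∀ x ∈ (𝓡∂ 2).boundary S,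
      0 < (w x * (starRingEnd ℂ) (toComplex (projTwo (F (Φ (x, z.2))) - z.1))).re) →
      ∀ i, ∃ n : ℤ, HasCircleDegree (fun t => normalGaussMap X Y e₁ e₂ (Φ (γ i t, 0))) n ∧
      ∫ t in (0 : ℝ)..1, angularForm (projTwo (F (Φ (γ i t, z.2))) - z.1)
        (deriv (fun s => projTwo (F (Φ (γ i s, z.2)))) t) = 2 * Real.pi * n := by
    intro z hz hpos i
    have hβ : ContDiff ℝ 1 fun t => projTwo (F (Φ (γ i t, z.2))) - z.1 :=
      ((hob.curve i).contDiff_comp (hα z.2 hz)).sub contDiff_const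
    have hwγ : Continuous fun t => w (γ i t) := hw.comp (hob.curve i).contMDiff.continuous
    have hw0 : ∀ t, 0 < ‖w (γ i t)‖ := fun t => hm.trans_le (hwm _ (hcurve i t))
    have hg : (fun t => normalGaussMap X Y e₁ e₂ (Φ (γ i t, 0))) =
        fun t => (‖w (γ i t)‖⁻¹ : ℝ) • w (γ i t) := funext fun t => normalGaussMap_eq _
    obtain ⟨n, hn, hi⟩ := exists_hasCircleDegree_of_plane hβ
      (fun t => by simp only [hob.periodic i t])
      (h := fun t => (‖w (γ i t)‖⁻¹ : ℝ) • w (γ i t))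
      (fun t => by simp only [hob.periodic i t])
      ((hwγ.norm.inv₀ fun t => (hw0 t).ne').smul hwγ)
      (fun t => by rw [norm_smul, norm_inv, norm_norm, inv_mul_cancel₀ (hw0 t).ne'])
      (fun t => by
        rw [smul_mul_assoc, Complex.smul_re]
        exact mul_pos (inv_pos.2 (hw0 t)) (hpos _ (hcurve i t)))
    refine ⟨n, hg ▸ hn, ?_⟩
    rw [← hi]
    simp only [deriv_sub_const]
  -- The integers are fixed with `a = 0`, `c = 0`. For other small values `key` still speaks of the
  -- Gauss map at level `0`, so uniqueness of the degree gives the same integers.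
  have hl := key 0 h0 (hsmall.self_of_nhds)
  choose l hl _ using hl
  refine ⟨E₁, E₂, hE₁, hE₂, hfr, l, hl, ?_⟩
  have hfc : IsCompact (frontier U) :=
    hp.isCompact_closure.of_isClosed_subset isClosed_frontier frontier_subset_closure
  -- A value of norm less than `m'` is not taken on the frontier, so its fibre in the closure lies
  -- in `U`.
  obtain ⟨m', hm', hFm⟩ := exists_le_norm_frameCoord hfc (fun p hp => hfr p (frontier_subset_closure hp))
    hX hp.left_ne_zero
  have hjoin : ∀ᶠ z in 𝓝 (0 : EuclideanSpace ℝ (Fin 2) × ℝ), ‖joinEquiv z‖ < m' := by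
    have h1 : ContinuousAt (fun z => ‖joinEquiv z‖) (0 : EuclideanSpace ℝ (Fin 2) × ℝ) :=
      joinEquiv.continuous.norm.continuousAt
    exact h1.eventually_lt_const (by simpa using hm')
  have heps : ∀ᶠ z in 𝓝 (0 : EuclideanSpace ℝ (Fin 2) × ℝ), z.2 ∈ Ioo (-ε) ε :=
    continuous_snd.continuousAt.preimage_mem_nhds (Ioo_mem_nhds h0.1 h0.2)
  obtain ⟨δ, hδ, hall⟩ := Metric.eventually_nhds_iff.1 (hsmall.and (hjoin.and heps))
  refine ⟨δ, hδ, fun c hc => ?_⟩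
  have hcε : c ∈ Ioo (-ε) ε := by
    have h1 : dist ((0 : EuclideanSpace ℝ (Fin 2)), c) 0 < δ := by
      rw [dist_zero_right, Prod.norm_def, norm_zero]
      exact max_lt hδ hc
    exact (hall h1).2.2
  have hsc : (fun x => sheetSign E₁ E₂ Y Φ (x, c)) = fun x => sheetSign E₁ E₂ Y Φ (x, 0) :=
    funext fun x => sheetSign_eq_of_mem isPreconnected_Ioo (fun c hc => hsh x c hc) hcε h0
  have hob' : IsOrientedBoundary (fun x => sheetSign E₁ E₂ Y Φ (x, c)) γ := by rw [hsc]; exact hob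
  filter_upwards [ae_degCount_eq_boundaryWinding
    (isOrientationSign_sheetSign fun x => hsh x c hcε) hob' (hα c hcε)] with a ha haδ
  have h1 : dist ((a, c) : EuclideanSpace ℝ (Fin 2) × ℝ) 0 < δ := by
    rw [dist_zero_right, Prod.norm_def]
    exact max_lt haδ hc
  obtain ⟨hs1, hs2, -⟩ := hall h1
  have hcI := Ioo_subset_Icc_self hcε
  rw [degCount_sheet (F := F) (fun x => hsh x c hcε)
    (fun x => (hF _ (hp.mem_closure x hcI)).mdifferentiableAt one_ne_zero)
    (fun x => hF2' x c hcε) (fun x y hxy => ?_) (fun x hx => ?_) (fun p hpU hpa => ?_)]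
  · have h2 : boundaryWinding γ (fun x => projTwo (F (Φ (x, c)))) a = 2 * Real.pi * ∑ i, (l i : ℝ) := by
      rw [boundaryWinding, Finset.mul_sum]
      refine Finset.sum_congr rfl fun i _ => ?_
      obtain ⟨n, hn, hi⟩ := key (a, c) hcε hs1 i
      rw [(hl i).unique hn]
      exact hi
    rw [h2] at ha
    have h3 := mul_left_cancel₀ (by positivity) ha
    exact_mod_cast h3
  · exact congrArg Prod.fst (hp.injOn (show (x, c) ∈ (univ : Set S) ×ˢ Icc (-ε) ε from ⟨mem_univ _, hcI⟩)
      (show (y, c) ∈ (univ : Set S) ×ˢ Icc (-ε) ε from ⟨mem_univ _, hcI⟩) hxy)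
  · by_contra hU
    have h4 : Φ (x, c) ∈ frontier U := by
      rw [hp.isOpen.frontier_eq]
      exact ⟨hp.mem_closure x hcI, hU⟩
    have h5 := hFm _ h4
    change m' ≤ ‖F (Φ (x, c))‖ at h5
    rw [hx] at h5
    exact absurd hs2 (not_lt.2 h5)
  · have h4 : p ∈ Φ '' (univ ×ˢ Icc (-ε) ε) := hp.image_eq.symm ▸ subset_closure hpU
    obtain ⟨⟨x, c'⟩, ⟨-, hc'⟩, rfl⟩ := h4
    have h5 := hF2 x c' hc'
    rw [hpa] at h5
    have h6 : c = c' := h5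
    exact ⟨x, by rw [h6]⟩

end Linking
end

/-! ### From the signed count to the Poincaré–Hopf index. -/

noncomputable section

open MeasureTheory

section Count

variable {d : ℕ} {H : Type*} [TopologicalSpace H]
  {I : ModelWithCorners ℝ (EuclideanSpace ℝ (Fin d)) H}
  {N : Type*} [TopologicalSpace N] [ChartedSpace H N]

theorem degCount_eq_sum {σ : N → SignType} {A : Set N} {F : N → EuclideanSpace ℝ (Fin d)}
    {a : EuclideanSpace ℝ (Fin d)} {Z : Finset N} {B : N → Set N} (hB : ∀ z ∈ Z, B z ⊆ A)
    (hd : (Z : Set N).PairwiseDisjoint B) (hc : ∀ x ∈ A, F x = a → ∃ z ∈ Z, x ∈ B z)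
    (hf : {x ∈ A | F x = a}.Finite) :
    degCount I σ A F a = ∑ z ∈ Z, degCount I σ (B z) F a := by
  have hs : {x ∈ A | F x = a} = ⋃ z ∈ (Z : Set N), {x ∈ B z | F x = a} := by
    ext x
    simp only [mem_iUnion]
    constructor
    · rintro ⟨hx, hxa⟩
      obtain ⟨z, hz, hxz⟩ := hc x hx hxa
      exact ⟨z, hz, hxz, hxa⟩
    · rintro ⟨z, hz, hxz, hxa⟩
      exact ⟨hB z hz hxz, hxa⟩
  have h1 : (Z : Set N).PairwiseDisjoint fun z => {x ∈ B z | F x = a} := fun z hz z' hz' hne =>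
    (hd hz hz' hne).mono (fun x hx => hx.1) fun x hx => hx.1
  have h2 : ∀ z ∈ (Z : Set N), {x ∈ B z | F x = a}.Finite := fun z hz =>
    hf.subset fun x hx => ⟨hB z hz hx.1, hx.2⟩
  rw [degCount, hs, finsum_mem_biUnion h1 Z.finite_toSet h2, finsum_mem_coe_finset]
  rfl

end Count

theorem norm_le_sum_three (v : EuclideanSpace ℝ (Fin 3)) : ‖v‖ ≤ |v 0| + |v 1| + |v 2| := by
  rw [EuclideanSpace.norm_eq, Fin.sum_univ_three]
  refine Real.sqrt_le_iff.2 ⟨by positivity, ?_⟩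
  simp only [Real.norm_eq_abs]
  nlinarith [abs_nonneg (v 0), abs_nonneg (v 1), abs_nonneg (v 2),
    mul_nonneg (abs_nonneg (v 0)) (abs_nonneg (v 1)), mul_nonneg (abs_nonneg (v 0)) (abs_nonneg (v 2)),
    mul_nonneg (abs_nonneg (v 1)) (abs_nonneg (v 2))]

section Index

variable {M : Type*} [TopologicalSpace M] [ChartedSpace (EuclideanSpace ℝ (Fin 3)) M]
  [IsManifold (𝓡 3) ∞ M] [RiemannianBundle (fun p : M => TangentSpace (𝓡 3) p)]
  [IsContMDiffRiemannianBundle (𝓡 3) ∞ (EuclideanSpace ℝ (Fin 3))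
      (fun p : M => TangentSpace (𝓡 3) p)]
  {X Y E₁ E₂ : ∀ p : M, TangentSpace (𝓡 3) p} {U : Set M}

theorem IsC1At.exists_norm_le {s : ∀ p : M, TangentSpace (𝓡 3) p} {K : Set M} (hK : IsCompact K)
    (hs : ∀ p ∈ K, IsC1At s p) : ∃ C ≥ 0, ∀ p ∈ K, ‖s p‖ ≤ C := by
  have h1 : ContinuousOn (fun p => ‖s p‖) K := by
    have h2 : ContinuousOn (fun p => inner ℝ (s p) (s p)) K := fun p hp =>
      (contMDiffAt_inner (hs p hp) (hs p hp)).continuousAt.continuousWithinAt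
    exact h2.sqrt.congr fun p _ => norm_eq_sqrt_real_inner _
  obtain ⟨C, hC⟩ := hK.exists_bound_of_continuousOn h1
  exact ⟨max C 0, le_max_right _ _, fun p hp =>
    ((Real.norm_of_nonneg (norm_nonneg _)).symm.le.trans (hC p hp)).trans (le_max_left _ _)⟩

theorem exists_norm_frameCoord_le {K : Set M} (hK : IsCompact K)
    (hfr : ∀ p ∈ K, IsC1FrameAt E₁ E₂ Y p) :
    ∃ C > 0, ∀ p ∈ K, ∀ v : TangentSpace (𝓡 3) p, ‖frameCoord E₁ E₂ Y p v‖ ≤ C * ‖v‖ := by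
  obtain ⟨C₁, hC₁, h₁⟩ := IsC1At.exists_norm_le hK fun p hp => (hfr p hp).fst
  obtain ⟨C₂, hC₂, h₂⟩ := IsC1At.exists_norm_le hK fun p hp => (hfr p hp).snd
  have h3 : ContinuousOn (fun p => ‖Y p‖ / inner ℝ (Y p) (Y p)) K := by
    have h2 : ContinuousOn (fun p => inner ℝ (Y p) (Y p)) K := fun p hp =>
      (contMDiffAt_inner (hfr p hp).thd (hfr p hp).thd).continuousAt.continuousWithinAt
    exact (h2.sqrt.congr fun p _ => norm_eq_sqrt_real_inner _).div h2 fun p hp =>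
      inner_self_ne_zero (𝕜 := ℝ).2 (hfr p hp).thd_ne_zero
  obtain ⟨C₃, h₃⟩ := hK.exists_bound_of_continuousOn h3
  refine ⟨C₁ + C₂ + |C₃| + 1, by positivity, fun p hp v => ?_⟩
  refine (norm_le_sum_three _).trans ?_
  have a1 : |frameCoord E₁ E₂ Y p v 0| ≤ C₁ * ‖v‖ := by
    rw [frameCoord_zero]
    refine (abs_real_inner_le_norm _ _).trans ?_
    rw [mul_comm]
    exact mul_le_mul_of_nonneg_right (h₁ p hp) (norm_nonneg _)
  have a2 : |frameCoord E₁ E₂ Y p v 1| ≤ C₂ * ‖v‖ := by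
    rw [frameCoord_one]
    refine (abs_real_inner_le_norm _ _).trans ?_
    rw [mul_comm]
    exact mul_le_mul_of_nonneg_right (h₂ p hp) (norm_nonneg _)
  have a3 : |frameCoord E₁ E₂ Y p v 2| ≤ |C₃| * ‖v‖ := by
    change |inner ℝ v (Y p) / inner ℝ (Y p) (Y p)| ≤ _
    rw [abs_div, abs_of_nonneg (real_inner_self_nonneg (x := Y p))]
    refine (div_le_div_of_nonneg_right (abs_real_inner_le_norm _ _) real_inner_self_nonneg).trans ?_
    rw [mul_div_assoc, mul_comm]
    refine mul_le_mul_of_nonneg_right ?_ (norm_nonneg _)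
    exact (le_abs_self _).trans ((h₃ p hp).trans (le_abs_self _))
  nlinarith [norm_nonneg v]

/-- The combination of the frame `(E₁, E₂, Y)` with coefficients `a`. -/
def frameComb (E₁ E₂ Y : ∀ p : M, TangentSpace (𝓡 3) p) (a : EuclideanSpace ℝ (Fin 3)) (p : M) :
    TangentSpace (𝓡 3) p :=
  a 0 • E₁ p + a 1 • E₂ p + a 2 • Y p

theorem isC1At_sub_frameComb {p : M} (hX : IsC1At X p) (h₁ : IsC1At E₁ p) (h₂ : IsC1At E₂ p)
    (hY : IsC1At Y p) (a : EuclideanSpace ℝ (Fin 3)) :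
    IsC1At (fun p => X p - frameComb E₁ E₂ Y a p) p :=
  ContMDiffAt.sub_section (I := 𝓡 3) (n := 1) (V := fun p : M => TangentSpace (𝓡 3) p) hX
    (((ContMDiffAt.const_smul_section (I := 𝓡 3) (V := fun p : M => TangentSpace (𝓡 3) p) h₁).add_section
      (ContMDiffAt.const_smul_section (I := 𝓡 3) (V := fun p : M => TangentSpace (𝓡 3) p) h₂)).add_section
      (ContMDiffAt.const_smul_section (I := 𝓡 3) (V := fun p : M => TangentSpace (𝓡 3) p) hY))

/-- Pairing the combination with the vector whose frame coordinates are `a` gives `a 0 ^ 2 + a 1 ^ 2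
+ a 2 ^ 2 * ⟨Y, Y⟩`, which must vanish. -/
theorem IsC1FrameAt.eq_zero_of_frameComb {p : M} (h : IsC1FrameAt E₁ E₂ Y p)
    {a : EuclideanSpace ℝ (Fin 3)} (ha : frameComb E₁ E₂ Y a p = 0) : a = 0 := by
  let e := (frameCoord E₁ E₂ Y p).toContinuousLinearEquivOfDetNeZero h.det_ne_zero
  obtain ⟨v, hv⟩ : ∃ v : TangentSpace (𝓡 3) p, frameCoord E₁ E₂ Y p v = a :=
    ⟨e.symm a, e.apply_symm_apply a⟩
  have hY := real_inner_self_pos.2 h.thd_ne_zero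
  have h0 : inner ℝ v (E₁ p) = a 0 := congrArg (fun w : EuclideanSpace ℝ (Fin 3) => w 0) hv
  have h1 : inner ℝ v (E₂ p) = a 1 := congrArg (fun w : EuclideanSpace ℝ (Fin 3) => w 1) hv
  have h2 : inner ℝ v (Y p) / inner ℝ (Y p) (Y p) = a 2 :=
    congrArg (fun w : EuclideanSpace ℝ (Fin 3) => w 2) hv
  rw [div_eq_iff hY.ne'] at h2
  have h3 : inner ℝ v (frameComb E₁ E₂ Y a p) = 0 := by rw [ha, inner_zero_right]
  rw [frameComb, inner_add_right, inner_add_right, real_inner_smul_right, real_inner_smul_right,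
    real_inner_smul_right, h0, h1, h2] at h3
  have h5 : 0 ≤ a 2 * a 2 * inner ℝ (Y p) (Y p) := mul_nonneg (mul_self_nonneg _) hY.le
  have e0 : a 0 = 0 := by nlinarith [mul_self_nonneg (a 0), mul_self_nonneg (a 1)]
  have e1 : a 1 = 0 := by nlinarith [mul_self_nonneg (a 0), mul_self_nonneg (a 1)]
  have e2 : a 2 = 0 := by
    rw [e0, e1] at h3
    have h6 : a 2 * a 2 * inner ℝ (Y p) (Y p) = 0 := by linarith
    rcases mul_eq_zero.1 h6 with h7 | h7
    · exact mul_self_eq_zero.1 h7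
    · exact absurd h7 hY.ne'
  ext i
  fin_cases i
  exacts [e0, e1, e2]

/-- The frame `(E₁, E₂, Y)` in the coordinates `frameCoord`. -/
def frameGram (E₁ E₂ Y : ∀ p : M, TangentSpace (𝓡 3) p) (p : M) :
    EuclideanSpace ℝ (Fin 3) →L[ℝ] EuclideanSpace ℝ (Fin 3) :=
  (EuclideanSpace.proj (𝕜 := ℝ) (0 : Fin 3)).smulRight (frameCoord E₁ E₂ Y p (E₁ p)) +
    (EuclideanSpace.proj (𝕜 := ℝ) (1 : Fin 3)).smulRight (frameCoord E₁ E₂ Y p (E₂ p)) +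
    (EuclideanSpace.proj (𝕜 := ℝ) (2 : Fin 3)).smulRight (frameCoord E₁ E₂ Y p (Y p))

theorem frameGram_apply (a : EuclideanSpace ℝ (Fin 3)) (p : M) :
    frameGram E₁ E₂ Y p a = frameCoord E₁ E₂ Y p (frameComb E₁ E₂ Y a p) := by
  have h1 := (frameCoord E₁ E₂ Y p).map_add (a 0 • E₁ p + a 1 • E₂ p : TangentSpace (𝓡 3) p)
    (a 2 • Y p : TangentSpace (𝓡 3) p)
  have h2 := (frameCoord E₁ E₂ Y p).map_add (a 0 • E₁ p : TangentSpace (𝓡 3) p)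
    (a 1 • E₂ p : TangentSpace (𝓡 3) p)
  have h3 := (frameCoord E₁ E₂ Y p).map_smul (a 0) (E₁ p)
  have h4 := (frameCoord E₁ E₂ Y p).map_smul (a 1) (E₂ p)
  have h5 := (frameCoord E₁ E₂ Y p).map_smul (a 2) (Y p)
  refine Eq.trans ?_ h1.symm
  change a 0 • frameCoord E₁ E₂ Y p (E₁ p) + a 1 • frameCoord E₁ E₂ Y p (E₂ p) +
    a 2 • frameCoord E₁ E₂ Y p (Y p) = _
  rw [← h3, ← h4, ← h5]
  exact congrArg (· + _) h2.symm

theorem IsC1FrameAt.exists_frameGram_equiv {p : M} (h : IsC1FrameAt E₁ E₂ Y p) :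
    ∃ e : EuclideanSpace ℝ (Fin 3) ≃L[ℝ] EuclideanSpace ℝ (Fin 3),
      (e : EuclideanSpace ℝ (Fin 3) →L[ℝ] EuclideanSpace ℝ (Fin 3)) = frameGram E₁ E₂ Y p := by
  have hd : (frameGram E₁ E₂ Y p).det ≠ 0 := by
    intro h0
    have h1 := LinearMap.bot_lt_ker_of_det_eq_zero h0
    have h2 : LinearMap.ker (frameGram E₁ E₂ Y p).toLinearMap = ⊥ := by
      refine LinearMap.ker_eq_bot'.2 fun a ha => ?_
      exact h.eq_zero_of_frameComb (h.eq_zero ((frameGram_apply a p).symm.trans ha))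
    exact absurd h1 (by rw [h2]; exact lt_irrefl _)
  exact ⟨_, ContinuousLinearMap.coe_toContinuousLinearEquivOfDetNeZero _ hd⟩

theorem contMDiffAt_frameGram {p : M} (h : IsC1FrameAt E₁ E₂ Y p) :
    ContMDiffAt (𝓡 3) 𝓘(ℝ, EuclideanSpace ℝ (Fin 3) →L[ℝ] EuclideanSpace ℝ (Fin 3)) 1
      (frameGram E₁ E₂ Y) p := by
  have hs : ∀ (i : Fin 3) (s : ∀ p : M, TangentSpace (𝓡 3) p), IsC1At s p →
      ContMDiffAt (𝓡 3) 𝓘(ℝ, EuclideanSpace ℝ (Fin 3) →L[ℝ] EuclideanSpace ℝ (Fin 3)) 1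
      (fun p => (EuclideanSpace.proj (𝕜 := ℝ) i).smulRight (frameCoord E₁ E₂ Y p (s p))) p := by
    intro i s hs
    have h1 := h.contMDiffAt hs
    exact ((ContinuousLinearMap.smulRightL ℝ (EuclideanSpace ℝ (Fin 3)) (EuclideanSpace ℝ (Fin 3))
      (EuclideanSpace.proj (𝕜 := ℝ) i)).contMDiff.contMDiffAt).comp p h1
  exact ((hs 0 E₁ h.fst).add (hs 1 E₂ h.snd)).add (hs 2 Y h.thd)

variable [T2Space M]

/-- Subtracting from `X` the combination of `E₁`, `E₂`, `Y` with constant coefficients `a` creates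
zeros exactly where the coefficients of `X` in this frame are `a`. For a regular value there are
finitely many. Since `frameCoord` yields inner products rather than coefficients, the inverse of
`frameGram` intervenes. -/
theorem exists_isIndexPerturbation (hUc : IsCompact (closure U)) (hX : ∀ p, IsC1At X p)
    (hE₁ : ∀ p, IsC1At E₁ p) (hE₂ : ∀ p, IsC1At E₂ p) (hY : ∀ p, IsC1At Y p)
    (hfr : ∀ p ∈ closure U, IsC1FrameAt E₁ E₂ Y p) {δ : ℝ} (hδ : 0 < δ) :
    ∃ X' : ∀ p : M, TangentSpace (𝓡 3) p, IsIndexPerturbation X U δ X' := by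
  let f : M → EuclideanSpace ℝ (Fin 3) := fun p =>
    (frameGram E₁ E₂ Y p).inverse (frameCoord E₁ E₂ Y p (X p))
  have hf : ∀ p ∈ closure U, MDifferentiableAt (𝓡 3) 𝓘(ℝ, EuclideanSpace ℝ (Fin 3)) f p := by
    intro p hp
    obtain ⟨e, he⟩ := (hfr p hp).exists_frameGram_equiv
    have h1 : ContMDiffAt (𝓡 3) 𝓘(ℝ, EuclideanSpace ℝ (Fin 3) →L[ℝ] EuclideanSpace ℝ (Fin 3)) 1
        (fun p => (frameGram E₁ E₂ Y p).inverse) p := by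
      refine ContMDiffAt.comp (g := ContinuousLinearMap.inverse) p ?_ (contMDiffAt_frameGram (hfr p hp))
      rw [← he]
      exact (contDiffAt_map_inverse e).contMDiffAt
    exact (h1.clm_apply ((hfr p hp).contMDiffAt (hX p))).mdifferentiableAt one_ne_zero
  obtain ⟨C₁, hC₁, h₁⟩ := IsC1At.exists_norm_le hUc fun p hp => hE₁ p
  obtain ⟨C₂, hC₂, h₂⟩ := IsC1At.exists_norm_le hUc fun p hp => hE₂ p
  obtain ⟨C₃, hC₃, h₃⟩ := IsC1At.exists_norm_le hUc fun p hp => hY p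
  let C := C₁ + C₂ + C₃ + 1
  have hC : 0 < C := by positivity
  have hb : ∃ᶠ a : EuclideanSpace ℝ (Fin 3) in ae volume, a ∈ Metric.ball (0 : EuclideanSpace ℝ (Fin 3)) (δ / C) :=
    frequently_ae_mem_iff.2 (Metric.measure_ball_pos volume 0 (by positivity)).ne'
  obtain ⟨a, ha, hreg⟩ := (hb.and_eventually (ae_regular hUc hf)).exists
  have ha' : ‖a‖ * C < δ := by
    rw [mem_ball_zero_iff, lt_div_iff₀ hC] at ha
    exact ha
  refine ⟨fun p => X p - frameComb E₁ E₂ Y a p,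
    ⟨fun p => isC1At_sub_frameComb (hX p) (hE₁ p) (hE₂ p) (hY p) a, fun p hp => ?_, ?_⟩⟩
  · have h4 : X p - frameComb E₁ E₂ Y a p - X p = -frameComb E₁ E₂ Y a p := by abel
    rw [h4, norm_neg, frameComb]
    have h5 : ∀ i, |a i| ≤ ‖a‖ := fun i => by
      simpa using PiLp.norm_apply_le a i
    have h6 : ∀ (i : Fin 3) (v : TangentSpace (𝓡 3) p) (c : ℝ), ‖v‖ ≤ c → ‖a i • v‖ ≤ ‖a‖ * c := by
      intro i v c hv
      rw [norm_smul, Real.norm_eq_abs]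
      exact mul_le_mul (h5 i) hv (norm_nonneg _) (norm_nonneg _)
    have h7 := norm_add₃_le (a := a 0 • E₁ p) (b := a 1 • E₂ p) (c := a 2 • Y p)
    have h8 := h6 0 _ _ (h₁ p hp)
    have h9 := h6 1 _ _ (h₂ p hp)
    have h10 := h6 2 _ _ (h₃ p hp)
    have h11 : ‖a‖ * C = ‖a‖ * C₁ + ‖a‖ * C₂ + ‖a‖ * C₃ + ‖a‖ := by
      simp only [C]; ring
    linarith [norm_nonneg a]
  · refine (finite_fibre hUc hf hreg).subset ?_
    rintro p ⟨hp, hp0⟩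
    refine ⟨subset_closure hp, ?_⟩
    obtain ⟨e, he⟩ := (hfr p (subset_closure hp)).exists_frameGram_equiv
    have h4 : X p = frameComb E₁ E₂ Y a p := sub_eq_zero.1 hp0
    change (frameGram E₁ E₂ Y p).inverse (frameCoord E₁ E₂ Y p (X p)) = a
    rw [h4]
    have h5 := frameGram_apply (E₁ := E₁) (E₂ := E₂) (Y := Y) a p
    refine (congrArg (frameGram E₁ E₂ Y p).inverse h5.symm).trans ?_
    rw [← he, ContinuousLinearMap.inverse_equiv]
    exact e.symm_apply_apply a

/-- The coordinates of a perturbation `X'` are linearly homotopic to those of `X` without small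
values near the frontier, so the counts in `U` agree. Near each zero of `X'` the count is its index.
Away from the zeros the coordinates of `X'` are bounded below, so small values are not taken there.
-/
theorem isPoincareHopfIndex_of_degCount (hUo : IsOpen U) (hUc : IsCompact (closure U))
    (hX : ∀ p, IsC1At X p) (hX0 : ∀ p ∈ frontier U, X p ≠ 0)
    (hE₁ : ∀ p, IsC1At E₁ p) (hE₂ : ∀ p, IsC1At E₂ p) (hY : ∀ p, IsC1At Y p)
    (hfr : ∀ p ∈ closure U, IsC1FrameAt E₁ E₂ Y p) {n : ℤ} {δ₀ : ℝ} (hδ₀ : 0 < δ₀)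
    (hdeg : ∀ c : ℝ, |c| < δ₀ → ∀ᵐ a : EuclideanSpace ℝ (Fin 2), ‖a‖ < δ₀ →
        degCount (𝓡 3) (frameSign E₁ E₂ Y) U (fun p => frameCoord E₁ E₂ Y p (X p))
          (joinEquiv (a, c)) = n) :
    IsPoincareHopfIndex X U n := by
  refine ⟨?_, fun δ hδ => exists_isIndexPerturbation hUc hX hE₁ hE₂ hY hfr hδ⟩
  have hfc : IsCompact (frontier U) := hUc.of_isClosed_subset isClosed_frontier frontier_subset_closure
  obtain ⟨m₀, hm₀, hFm⟩ := exists_le_norm_frameCoord hfc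
    (fun p hp => hfr p (frontier_subset_closure hp)) hX hX0
  obtain ⟨C, hC, hCb⟩ := exists_norm_frameCoord_le hUc hfr
  -- On the frontier `‖F‖ ≥ 3 m`, and the perturbation moves `F` by at most `m`. Off the compact set
  -- where `‖F‖ ≤ 2 m` the whole homotopy has norm at least `m`.
  let m := m₀ / 3
  have hm : 0 < m := by positivity
  refine ⟨m / C, by positivity, fun X' h => ?_⟩
  have hX' : ∀ p, IsC1At X' p := fun p => h.contMDiff p
  let F : M → EuclideanSpace ℝ (Fin 3) := fun p => frameCoord E₁ E₂ Y p (X p)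
  let F' : M → EuclideanSpace ℝ (Fin 3) := fun p => frameCoord E₁ E₂ Y p (X' p)
  have hF : ∀ p ∈ closure U, ContMDiffAt (𝓡 3) 𝓘(ℝ, EuclideanSpace ℝ (Fin 3)) 1 F p :=
    fun p hp => (hfr p hp).contMDiffAt (hX p)
  have hF' : ∀ p ∈ closure U, ContMDiffAt (𝓡 3) 𝓘(ℝ, EuclideanSpace ℝ (Fin 3)) 1 F' p :=
    fun p hp => (hfr p hp).contMDiffAt (hX' p)
  have hFF : ∀ p ∈ closure U, ‖F' p - F p‖ ≤ m := by
    intro p hp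
    have h1 := (frameCoord E₁ E₂ Y p).map_sub (X' p) (X p)
    have h2 := hCb p hp (X' p - X p)
    have h3 : ‖F' p - F p‖ ≤ C * ‖X' p - X p‖ := (congrArg norm h1).symm.le.trans h2
    have h4 := h.close p hp
    rw [lt_div_iff₀ hC] at h4
    linarith
  -- the zeros of the perturbation
  have hzero : ∀ p, X' p = 0 → F' p = 0 := by
    intro p hp
    change frameCoord E₁ E₂ Y p (X' p) = 0
    rw [hp]
    exact (frameCoord E₁ E₂ Y p).map_zero
  have hX'0 : ∀ p ∈ frontier U, X' p ≠ 0 := by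
    intro p hp h0
    have h1 := hFm p hp
    have h2 := hFF p (frontier_subset_closure hp)
    rw [hzero p h0, zero_sub, norm_neg] at h2
    change m₀ ≤ ‖F p‖ at h1
    simp only [m] at h2
    linarith
  have hmemU : ∀ p ∈ closure U, p ∉ frontier U → p ∈ U := by
    intro p hp hpf
    by_contra hpU
    exact hpf (hUo.frontier_eq ▸ ⟨hp, hpU⟩)
  let Z := h.finite_zeros.toFinset
  have hZ : ∀ p, p ∈ Z ↔ p ∈ U ∧ X' p = 0 := fun p => h.finite_zeros.mem_toFinset
  obtain ⟨V, hV, hVd⟩ := h.finite_zeros.t2_separation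
  have hloc : ∀ z, ∃ (B : Set M) (m' : ℝ), z ∈ Z → IsOpen B ∧ z ∈ B ∧ B ⊆ V z ∩ U ∧ 0 < m' ∧
      ∀ᵐ a : EuclideanSpace ℝ (Fin 3), ‖a‖ < m' →
        HasIndexAt X' z (degCount (𝓡 3) (frameSign E₁ E₂ Y) B F' a) := by
    intro z
    by_cases hz : z ∈ Z
    · obtain ⟨hzU, hz0⟩ := (hZ z).1 hz
      obtain ⟨B, hB, hzB, hBV, m', hm', hi⟩ := exists_forall_ae_hasIndexAt hX' hz0
        (N := V z ∩ U) (inter_mem ((hV z).2.mem_nhds (hV z).1) (hUo.mem_nhds hzU))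
        (fun p hp hp0 => by
          by_contra hne
          exact disjoint_left.1 (hVd ⟨hp.2, hp0⟩ ⟨hzU, hz0⟩ hne) (hV p).1 hp.1)
        (fun p hp => hfr p (subset_closure hp.2))
      exact ⟨B, m', fun _ => ⟨hB, hzB, hBV, hm', hi⟩⟩
    · exact ⟨∅, 0, fun h => absurd h hz⟩
  choose B m' hBm using hloc
  have hL : IsCompact (closure U \ ⋃ z ∈ Z, B z) :=
    hUc.diff (isOpen_biUnion fun z hz => (hBm z hz).1)
  obtain ⟨m₁, hm₁, hF'm⟩ := exists_le_norm_frameCoord hL (fun p hp => hfr p hp.1) hX' (by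
    rintro p ⟨hp, hpB⟩ hp0
    have hpU := hmemU p hp fun hf => hX'0 p hf hp0
    have hpZ := (hZ p).2 ⟨hpU, hp0⟩
    exact hpB (mem_biUnion hpZ (hBm p hpZ).2.1))
  -- the two counts agree
  have hKc : IsCompact {p ∈ closure U | ‖F p‖ ≤ 2 * m} := by
    refine hUc.of_isClosed_subset ?_ fun p hp => hp.1
    have h1 : ContinuousOn (fun p => ‖F p‖) (closure U) := fun p hp =>
      (hF p hp).continuousAt.norm.continuousWithinAt
    exact h1.preimage_isClosed_of_isClosed isClosed_closure isClosed_Iic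
  have hKU : {p ∈ closure U | ‖F p‖ ≤ 2 * m} ⊆ U := by
    rintro p ⟨hp, hpm⟩
    refine hmemU p hp fun hf => ?_
    have h1 : m₀ ≤ ‖F p‖ := hFm p hf
    simp only [m] at hpm
    linarith
  have hA := ae_degCount_eq (m := m) hUo hKc hKU (fun p hp => hF p (subset_closure hp))
    (fun p hp => hF' p (subset_closure hp))
    (isOrientationSign_frameSign fun p hp => hfr p (subset_closure hp)) (by
      rintro p ⟨hp, hpK⟩ s ⟨hs0, hs1⟩
      have h1 : 2 * m < ‖F p‖ := by
        by_contra hle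
        exact hpK ⟨subset_closure hp, not_lt.1 hle⟩
      have h2 := hFF p (subset_closure hp)
      have h3 : ‖s • (F' p - F p)‖ ≤ m := by
        rw [norm_smul, Real.norm_of_nonneg hs0]
        nlinarith [norm_nonneg (F' p - F p)]
      have h4 := norm_sub_le (F p + s • (F' p - F p)) (s • (F' p - F p))
      rw [add_sub_cancel_right] at h4
      linarith)
  have hreg := ae_regular hUc fun p hp => (hF' p hp).mdifferentiableAt one_ne_zero
  have hind : ∀ᵐ a : EuclideanSpace ℝ (Fin 3), ∀ z ∈ Z, ‖a‖ < m' z →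
      HasIndexAt X' z (degCount (𝓡 3) (frameSign E₁ E₂ Y) (B z) F' a) :=
    (Finset.eventually_all Z).2 fun z hz => (hBm z hz).2.2.2.2
  obtain ⟨δ, hδZ, hδ⟩ : ∃ δ : ℝ, (∀ z ∈ Z, δ < m' z) ∧ 0 < δ := by
    have h1 : ∀ᶠ δ : ℝ in 𝓝[>] 0, ∀ z ∈ Z, δ < m' z := (Finset.eventually_all Z).2 fun z hz =>
      mem_nhdsWithin_of_mem_nhds (Iio_mem_nhds (hBm z hz).2.2.2.1)
    exact (h1.and self_mem_nhdsWithin).exists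
  -- A single value serves all purposes: the homotopy invariance, regularity for `F'`, the indices
  -- at all zeros and the known count of `F`. It is also below every threshold found so far.
  obtain ⟨a, ha, ⟨haA, har, hai⟩, han⟩ := exists_small_of_ae_joinEquiv
    (Q := fun a => degCount (𝓡 3) (frameSign E₁ E₂ Y) U F a = n) (hA.and (hreg.and hind)) hδ₀ hdeg
    (δ := min δ (min m m₁)) (lt_min hδ (lt_min hm hm₁))
  rw [lt_min_iff, lt_min_iff] at ha
  refine ⟨fun z => degCount (𝓡 3) (frameSign E₁ E₂ Y) (B z) F' a, fun p hp hp0 => ?_, ?_⟩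
  · have hpZ := (hZ p).2 ⟨hp, hp0⟩
    exact hai p hpZ (ha.1.trans (hδZ p hpZ))
  · rw [← han, haA ha.2.1]
    symm
    refine degCount_eq_sum (fun z hz => (hBm z hz).2.2.1.trans inter_subset_right) ?_ ?_ ?_
    · intro z hz z' hz' hne
      exact (hVd ((hZ z).1 hz) ((hZ z').1 hz') hne).mono
        ((hBm z hz).2.2.1.trans inter_subset_left) ((hBm z' hz').2.2.1.trans inter_subset_left)
    · intro p hp hpa
      by_contra hne
      have h1 : m₁ ≤ ‖F' p‖ := hF'm p ⟨subset_closure hp, fun hB => hne (by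
        obtain ⟨z, hz, hpz⟩ := mem_iUnion₂.1 hB
        exact ⟨z, hz, hpz⟩)⟩
      rw [hpa] at h1
      exact absurd ha.2.2 (not_lt.2 h1)
    · exact (finite_fibre hUc (fun p hp => (hF' p hp).mdifferentiableAt one_ne_zero) har).subset
        fun p hp => ⟨subset_closure hp.1, hp.2⟩

end Index
end

theorem mainTheorem6
    {M : Type*} [TopologicalSpace M] [T2Space M] [SecondCountableTopology M]
    [ChartedSpace (EuclideanSpace ℝ (Fin 3)) M] [IsManifold (𝓡 3) ∞ M]
    [RiemannianBundle (fun p : M => TangentSpace (𝓡 3) p)]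
    [IsContMDiffRiemannianBundle (𝓡 3) ∞ (EuclideanSpace ℝ (Fin 3))
      (fun p : M => TangentSpace (𝓡 3) p)]
    {S : Type*} [TopologicalSpace S] [T2Space S] [CompactSpace S] [ConnectedSpace S]
    [ChartedSpace (EuclideanHalfSpace 2) S] [IsManifold (𝓡∂ 2) ∞ S]
    (r : ℕ∞) (hr : 1 ≤ r) (U : Set M) (X Y : ∀ p : M, TangentSpace (𝓡 3) p)
    (ε : ℝ) (Φ : S × ℝ → M) (hprep : IsPreparedTriple r U X Y ε Φ)
    (o : ∀ p : M, Orientation ℝ (TangentSpace (𝓡 3) p) (Fin 3))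
    (ho : IsTransverseOrientation o Y (closure U)) :
    (∃ e₁ e₂ : ∀ p : M, TangentSpace (𝓡 3) p, IsAdaptedFrame o U X Y e₁ e₂) ∧
    (∀ e₁ e₂ : ∀ p : M, TangentSpace (𝓡 3) p, IsAdaptedFrame o U X Y e₁ e₂ →
      ∀ (k : ℕ) (γ : Fin k → ℝ → S), IsBoundaryParametrization o X Y Φ γ →
        ∃ l : Fin k → ℤ, (∀ i, IsLinkingNumber X Y e₁ e₂ Φ (γ i) (l i)) ∧
          IsPoincareHopfIndex X U (∑ i, l i)) ∧
    ((𝓡∂ 2).boundary S = ∅ → IsPoincareHopfIndex X U 0) := by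
  have hX := hprep.isC1At_left hr
  have hY := hprep.isC1At_right hr
  have hmain : ∀ e₁ e₂ : ∀ p : M, TangentSpace (𝓡 3) p, IsAdaptedFrame o U X Y e₁ e₂ →
      ∀ (k : ℕ) (γ : Fin k → ℝ → S), IsBoundaryParametrization o X Y Φ γ →
        ∃ l : Fin k → ℤ, (∀ i, IsLinkingNumber X Y e₁ e₂ Φ (γ i) (l i)) ∧
          IsPoincareHopfIndex X U (∑ i, l i) := by
    intro e₁ e₂ he k γ hγ
    obtain ⟨E₁, E₂, hE₁, hE₂, hfr, l, hl, δ, hδ, hdeg⟩ := exists_isLinkingNumber hprep hr he hγ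
    exact ⟨l, hl, isPoincareHopfIndex_of_degCount hprep.isOpen hprep.isCompact_closure hX
      hprep.left_ne_zero hE₁ hE₂ hY hfr hδ hdeg⟩
  have hframe : ∃ e₁ e₂ : ∀ p : M, TangentSpace (𝓡 3) p, IsAdaptedFrame o U X Y e₁ e₂ := by
    refine exists_isAdaptedFrame hX hY ho hprep.not_orthogonal fun p hp => ?_
    have h1 : p ∈ Φ '' (univ ×ˢ Icc (-ε) ε) := hprep.image_eq.symm ▸ hp
    obtain ⟨⟨x, c⟩, ⟨-, hc⟩, rfl⟩ := h1
    exact ⟨_, (hprep.exists_dQuotient_eq_one hr (x := x) hc).trans_ne one_ne_zero⟩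
  refine ⟨hframe, hmain, fun hS => ?_⟩
  obtain ⟨e₁, e₂, he⟩ := hframe
  -- When the boundary is empty, the empty family of curves parametrises it and the sum is empty.
  obtain ⟨l, -, hi⟩ := hmain e₁ e₂ he 0 (fun i => i.elim0)
    ⟨fun i => i.elim0, fun i => i.elim0, fun i => i.elim0, fun i => i.elim0, fun i => i.elim0,
      by rw [hS]; exact iUnion_of_empty _, fun i => i.elim0⟩
  simpa using hi
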